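/- **Setting.** Let $d\ge 2$, $k,\ell\ge 0$ with $k+\ell\ge 2$, and $X=\mathbf P(\mathbb R^d)$. Let $T_1,\dots,T_k\in \mathrm{PGL}(d,\mathbb R)$ be biproximal, and write $T_i^{\pm}$ and $H_{T_i}^{\pm}$ for the attracting line and the repelling hyperplane of $T_i^{\pm1}$. Let $S_1,\dots,S_\ell\in\mathrm{PGL}(d,\mathbb R)$ be unipotent, each with a unique largest Jordan block; if $1+N$ is the unipotent lift of $S_j$ and $N^{m+1}=0\ne N^m$, write $S_j^+=\operatorname{im}N^m$ (a line, the attracting line) and $H_{S_j}=\ker N^m$ (the repelling hyperplane). Suppose that, after replacing each $T_i$ and $S_j$ by some positive power, they play *weak ping-pong* on $X$: there are open sets $A_i^\pm\ni T_i^\pm$, $B_i^\pm\supset H_{T_i}^\pm$, $C_j^\pm$ with $S_j^+\in\overline{C_j^\pm}$ and $D_j^\pm$ with $H_{S_j}\subset\overline{D_j^\pm}$, such that $$T_i^{\pm1}(X\smallsetminus B_i^\pm)\subset A_i^\pm,\qquad S_j^{\pm1}\bigl(X\smallsetminus \overline{D_j^\pm}\bigr)\subset C_j^\pm ,$$ the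 $2k$ sets $A_i^\pm$ are pairwise disjoint, the $2\ell$ sets $C_j^\pm$ are pairwise disjoint, $A_i^\varepsilon\cap B_{i'}^{\varepsilon'}=\varnothing$ unless $(i',\varepsilon')=(i,-\varepsilon)$, $C_j^\varepsilon\cap D_j^\varepsilon=\varnothing$, $\overline{C_j^\varepsilon}\cap\overline{D_{j'}^{\varepsilon'}}=\varnothing$ for $j\ne j'$, and the closures of the $C_j^\pm$ are disjoint from those of all $A_i^\pm,B_i^\pm$ and the closures of the $D_j^\pm$ are disjoint from those of all $A_i^\pm$. (For example $D_j^\pm=C_j^\mp$ if $d=2$.) **Claim.** There is $N$ such that for all exponents $n_1,\dots,n_k,m_1,\dots,m_\ell\ge N$, the group $\Gamma'\subset\mathrm{PGL}(d,\mathbb R)$ generated by the $T_i^{n_i}$ and the $S_j^{m_j}$ is free on these $k+\ell$ generators, $\langle S_j^{m_j}\rangle=\mathrm{Stab}_{\Gamma'}(S_j^+)$ for each $j$, and, with $\mathcal P$ the set of all conjugates in $\Gamma'$ of the groups $P_j=\langle S_j^{m_j}\rangle$, the inclusion $\rho\colon\Gamma'\hookrightarrow \mathrm{PGL}(d,\mathbb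 R)$ is $P_1$-dominated relative to $\mathcal P$. **Definition of the conclusion.** A finite generating set $G$ of a group $\Gamma$ is compatible if $G\cap P_j$ generates $P_j$ for each $j$. The cusped space $X(\Gamma,\mathcal P,G)$ is the Cayley graph with a combinatorial horoball glued to each left coset $gP_j$: vertices $(v,r)$, $v\in gP_j$, $r\ge0$ (with $(v,0)=v$), edges $(v,r)-(v,r+1)$, and $(v,r)-(w,r)$ when $0<d_{gP_j}(v,w)\le 2^r$, where $d_{gP_j}$ is the distance in the full subgraph of the Cayley graph on $gP_j$. Its metric is $d_c$, and $|\gamma|_c=d_c(1,\gamma)$. $\Gamma$ is hyperbolic relative to $\mathcal P$ if compatible generating sets exist and the cusped space is Gromov hyperbolic for every one. $\sigma_1\ge\dots\ge\sigma_d$ are singular values, and $U_p(g)$ is the span of the $p$ largest axes of the image under $g$ of the unit sphere. A homomorphism $\rho\colon\Gamma\to \mathrm{PGL}(d,\mathbb R)$ is $P_1$-dominated relative to $\mathcal P$ if $\Gamma$ is finitely generated, torsion-free and hyperbolic relative to $\mathcal P$, the subgroups in $\mathcal P$ are proper and infinite, and, for every compatible $G$: * (D$-$) there are $\underline C,\underline\mu>0$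 with $\frac{\sigma_1}{\sigma_2}(\rho(\gamma))\ge \underline C e^{\underline\mu|\gamma|_c}$ for all $\gamma\in\Gamma$; * (D$+$) there are $\overline C,\overline\mu>0$ with $\frac{\sigma_1}{\sigma_d}(\rho(\gamma))\le \overline C e^{\overline\mu|\gamma|_c}$ for all $\gamma\in\Gamma$; * (unique limits) for each $P\in\mathcal P$ there are a line $\xi(P)$ and a hyperplane $\xi^*(P)$, independent of $G$, such that $U_1(\rho(\eta_n))\to\xi(P)$ and $U_{d-1}(\rho(\eta_n))\to\xi^*(P)$ for every sequence $\eta_n\to\infty$ in $P$; * (uniform transversality) $\xi(P)\neq\xi(P')$ for $P\ne P'$ in $\mathcal P$; and for all $\underline\upsilon,\overline\upsilon>0$ there is $\delta_0>0$ such that $\sin\angle\bigl(\rho(g)^{-1}\xi(P_i),\rho(h)\xi^*(P_j)\bigr)>\delta_0$ for all $i,j$ and $g,h\in\Gamma$ for which there is a bi-infinite $(\underline\upsilon,\overline\upsilon)$-metric quasigeodesic path $\alpha=\eta gh\eta'$ ($\alpha(0)=1$; $\alpha$ passes through $g^{-1}$ at some time $-a\le0$, before which it stays in $g^{-1}P_i$,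 and through $h$ at some time $b\ge0$, after which it stays in $hP_j$) that is the projection of a $(\underline\upsilon,\overline\upsilon)$-quasigeodesic $c\colon\mathbb Z\to X(\Gamma,\mathcal P,G)$ with $c(0)=1$. Here a path $\alpha\colon\mathbb Z\to\Gamma$ has depth $\delta(n)$ at $n$, the least $e\ge0$ such that no coset $\alpha(n)P_j$ contains both $\alpha(n-e)$ and $\alpha(n+e)$, and is a $(\underline\upsilon,\overline\upsilon)$-metric quasigeodesic path if all depths are finite and, for all $m,n$, $\underline\upsilon^{-1}|m-n|-\underline\upsilon\le|\alpha(n)^{-1}\alpha(m)|_c\le\overline\upsilon(|m-n|+\min\{\delta(m),\delta(n)\})+\overline\upsilon$, and, whenever $\alpha(n)^{-1}\alpha(n+1)\in P_j$, the length $L$ of this element in the generators $G\cap P_j$ of $P_j$ satisfies $2^{\delta(n)-1}\le L\le 2^{\delta(n)+1}$. A $(\underline\upsilon,\overline\upsilon)$-quasigeodesic is a map $c$ to the vertices with $\underline\upsilon^{-1}|m-n|-\underline\upsilon\le d_c(c(n),c(m))\le\overline\upsilon|m-n|+\overline\upsilon$. -/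

import Mathlib

open scoped LinearAlgebra.Projectivization
open Filter Topology

noncomputable section

namespace RelDom

/-! ### Projective space, proximal and unipotent projective transformations -/

/-- The group `PGL(d, ℝ)`, that is `GL(d, ℝ)` modulo its centre. -/
abbrev PGLR (d : ℕ) : Type := Matrix.ProjGenLinGroup (Fin d) ℝ

/-- The real projective space of lines in `ℝ^d`. -/
abbrev Proj (d : ℕ) : Type := ℙ ℝ (Fin d → ℝ)

/-- The usual (quotient) topology of real projective space. -/
instance projTopology (d : ℕ) : TopologicalSpace (Proj d) :=
  TopologicalSpace.coinduced
    (fun v : {v : Fin d → ℝ // v ≠ 0} => Projectivization.mk' ℝ v) inferInstance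

/-- The set of points of projective space that lie in a linear subspace. -/
def projSet {d : ℕ} (H : Submodule ℝ (Fin d → ℝ)) : Set (Proj d) :=
  {x | x.submodule ≤ H}

/-- `r` is a simple eigenvalue of `M`, and every other complex eigenvalue of `M` has strictly
smaller modulus. -/
def IsDominantEigenvalue {d : ℕ} (M : Matrix (Fin d) (Fin d) ℝ) (r : ℝ) : Prop :=
  (M.charpoly.map (algebraMap ℝ ℂ)).roots.count (r : ℂ) = 1 ∧
    ∀ z ∈ (M.charpoly.map (algebraMap ℝ ℂ)).roots, z ≠ (r : ℂ) → ‖z‖ < |r|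

/-- `g` is proximal with attracting line `x` and repelling hyperplane `H`: for a representing
matrix `M` with dominant eigenvalue `r`, the line is the `r`-eigenspace and the hyperplane is its
`M`-invariant complement, which is the range of `M - r`. -/
def IsProximalWith {d : ℕ} (g : PGLR d) (x : Proj d) (H : Submodule ℝ (Fin d → ℝ)) : Prop :=
  ∃ (M : GL (Fin d) ℝ) (r : ℝ), Matrix.ProjGenLinGroup.mk M = g ∧
    IsDominantEigenvalue (M : Matrix (Fin d) (Fin d) ℝ) r ∧
    x.submodule = Module.End.eigenspace (Matrix.toLin' (M : Matrix (Fin d) (Fin d) ℝ)) r ∧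
    H = LinearMap.range
      (Matrix.toLin' ((M : Matrix (Fin d) (Fin d) ℝ) - r • (1 : Matrix (Fin d) (Fin d) ℝ)))

/-- `g` is unipotent with a well-defined (unique) largest Jordan block, with attracting line `x`
and repelling hyperplane `H`: for a unipotent representative `1 + N` with `N ^ (m + 1) = 0`, the
map `N ^ m` has rank one (its rank is the number of Jordan blocks of the maximal size `m + 1`);
the line is the range of `N ^ m` and the hyperplane is its kernel.
As `n → ± ∞`, the powers of `g` push every point off `H` to `x`. -/
def IsUnipotentWith {d : ℕ} (g : PGLR d) (x : Proj d) (H : Submodule ℝ (Fin d → ℝ)) : Prop :=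
  ∃ (M : GL (Fin d) ℝ) (m : ℕ), Matrix.ProjGenLinGroup.mk M = g ∧
    ((M : Matrix (Fin d) (Fin d) ℝ) - 1) ^ (m + 1) = 0 ∧
    x.submodule = LinearMap.range
      (Matrix.toLin' (((M : Matrix (Fin d) (Fin d) ℝ) - 1) ^ m)) ∧
    H = LinearMap.ker (Matrix.toLin' (((M : Matrix (Fin d) (Fin d) ℝ) - 1) ^ m))

/-- Weak ping-pong on projective space. Signs are elements `ε` of `ℤˣ = {1, -1}`.
`a i ε`, `H i ε` are the attracting line and repelling hyperplane of `(T i) ^ ε`;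
`s j`, `K j` are the attracting line and repelling hyperplane of `S j`.
`A i ε`, `B i ε` are the attracting and repelling sets of `(T i) ^ ε`, and
`C j ε`, `D j ε` those of `(S j) ^ ε`. The ping-pong of the `S j` is weak: the fixed point `s j`
is only required to be in the closures. The case `D j ε = C j (-ε)` is the one where
`(S j) ^ ε` sends everything off `closure (C j (-ε))` into `C j ε`. -/
structure WeakPingPong {d k l : ℕ} (T : Fin k → PGLR d) (S : Fin l → PGLR d)
    (a : Fin k → ℤˣ → Proj d) (H : Fin k → ℤˣ → Submodule ℝ (Fin d → ℝ))
    (s : Fin l → Proj d) (K : Fin l → Submodule ℝ (Fin d → ℝ))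
    (A B : Fin k → ℤˣ → Set (Proj d)) (C D : Fin l → ℤˣ → Set (Proj d)) : Prop where
  isOpen_A : ∀ i ε, IsOpen (A i ε)
  isOpen_B : ∀ i ε, IsOpen (B i ε)
  isOpen_C : ∀ j ε, IsOpen (C j ε)
  isOpen_D : ∀ j ε, IsOpen (D j ε)
  mem_A : ∀ i ε, a i ε ∈ A i ε
  subset_B : ∀ i ε, projSet (H i ε) ⊆ B i ε
  mem_closure_C : ∀ j ε, s j ∈ closure (C j ε)
  subset_closure_D : ∀ j ε, projSet (K j) ⊆ closure (D j ε)
  maps_T : ∀ i (ε : ℤˣ), ∀ x ∉ B i ε, (T i ^ (ε : ℤ)) • x ∈ A i ε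
  maps_S : ∀ j (ε : ℤˣ), ∀ x ∉ closure (D j ε), (S j ^ (ε : ℤ)) • x ∈ C j ε
  disjoint_A_A : ∀ i ε i' ε', (i, ε) ≠ (i', ε') → Disjoint (A i ε) (A i' ε')
  disjoint_A_B : ∀ i ε i' ε', (i', ε') ≠ (i, -ε) → Disjoint (A i ε) (B i' ε')
  disjoint_C_C : ∀ j ε j' ε', (j, ε) ≠ (j', ε') → Disjoint (C j ε) (C j' ε')
  disjoint_C_D : ∀ j ε, Disjoint (C j ε) (D j ε)
  disjoint_closure_C_D : ∀ j ε j' ε', j ≠ j' →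
    Disjoint (closure (C j ε)) (closure (D j' ε'))
  disjoint_closure_A_C : ∀ i ε j ε', Disjoint (closure (A i ε)) (closure (C j ε'))
  disjoint_closure_A_D : ∀ i ε j ε', Disjoint (closure (A i ε)) (closure (D j ε'))
  disjoint_closure_B_C : ∀ i ε j ε', Disjoint (closure (B i ε)) (closure (C j ε'))

/-! ### Singular values in `PGL(d, ℝ)` -/

/-- A representing matrix of `g`, as a linear map of Euclidean space. The notions below do not
depend on the representative. -/
def repLin {d : ℕ} (g : PGLR d) :
    EuclideanSpace ℝ (Fin d) →ₗ[ℝ] EuclideanSpace ℝ (Fin d) :=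
  Matrix.toEuclideanLin
    ((Function.surjInv Matrix.ProjGenLinGroup.mk_surjective g : GL (Fin d) ℝ) :
      Matrix (Fin d) (Fin d) ℝ)

/-- The quotient `σ_p / σ_q` of singular values of `g`, with `1 ≤ p, q ≤ d`
(Mathlib numbers singular values from `0`). -/
def svRatio {d : ℕ} (p q : ℕ) (g : PGLR d) : ℝ :=
  (repLin g).singularValues (p - 1) / (repLin g).singularValues (q - 1)

/-- `U_p(g)`, the span of the `p` largest axes of the image under `g` of the unit sphere
(`p ≥ 1`): the axes are the eigenvectors of `g g^*`, with eigenvalues the squares of the singular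
values. This is the usual `p`-dimensional space when `σ_p > σ_(p+1)`. -/
def axesSpan {d : ℕ} (p : ℕ) (g : PGLR d) : Submodule ℝ (EuclideanSpace ℝ (Fin d)) :=
  ⨆ (r : ℝ) (_ : (repLin g).singularValues (p - 1) ^ 2 ≤ r),
    Module.End.eigenspace (repLin g ∘ₗ LinearMap.adjoint (repLin g)) r

/-- Convergence of subspaces in the Grassmannian, as convergence of orthogonal projections. -/
def SubspaceTendsto {d : ℕ} (V : ℕ → Submodule ℝ (EuclideanSpace ℝ (Fin d)))
    (W : Submodule ℝ (EuclideanSpace ℝ (Fin d))) : Prop :=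
  Tendsto (fun n => (V n).starProjection) atTop (𝓝 W.starProjection)

/-! ### The cusped space

`P : Fin l → Subgroup Γ` lists representatives of the conjugacy classes of peripheral subgroups. -/

section Cusped

variable {Γ : Type*} [Group Γ] {l : ℕ}

/-- The peripheral subgroups: all conjugates of the `P j`. -/
def peripherals (P : Fin l → Subgroup Γ) : Set (Subgroup Γ) :=
  {Q | ∃ (j : Fin l) (g : Γ), Q = (P j).map (MulAut.conj g).toMonoidHom}

/-- Compatible finite generating sets. -/
def IsCompatible (P : Fin l → Subgroup Γ) (G : Set Γ) : Prop :=
  G.Finite ∧ Subgroup.closure G = ⊤ ∧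
    ∀ j, Subgroup.closure (G ∩ (P j : Set Γ)) = P j

/-- Vertices of the cusped space: `base g` is the vertex `g` of the Cayley graph, and
`horo j g n` is the vertex at height `n + 1` above `g` in the combinatorial horoball based on the
coset `g P_j`. -/
inductive CuspedVertex (Γ : Type*) (l : ℕ) : Type _
  | base (g : Γ) : CuspedVertex Γ l
  | horo (j : Fin l) (g : Γ) (n : ℕ) : CuspedVertex Γ l

/-- The element of the group below a vertex of the cusped space. -/
def CuspedVertex.proj : CuspedVertex Γ l → Γ
  | .base g => g
  | .horo _ g _ => g

/-- The length of a shortest path from `v` to `w` in the Cayley graph that only uses edges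
labelled by peripheral generators of `P j`; for `v`, `w` in one left coset of `P j`, this is the
distance in the full subgraph of the Cayley graph on this coset. -/
def periphDist (P : Fin l → Subgroup Γ) (G : Set Γ) (j : Fin l) (v w : Γ) : ℕ :=
  (SimpleGraph.mulCayley (G ∩ (P j : Set Γ))).dist v w

/-- The edges of the cusped space (up to orientation; loops are discarded below). -/
inductive CuspedRel (P : Fin l → Subgroup Γ) (G : Set Γ) :
    CuspedVertex Γ l → CuspedVertex Γ l → Prop
  | cayley (g h : Γ) (hgh : (SimpleGraph.mulCayley G).Adj g h) :
      CuspedRel P G (.base g) (.base h)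
  | vertical_base (j : Fin l) (g : Γ) : CuspedRel P G (.base g) (.horo j g 0)
  | vertical (j : Fin l) (g : Γ) (n : ℕ) : CuspedRel P G (.horo j g n) (.horo j g (n + 1))
  | horizontal (j : Fin l) (g h : Γ) (n : ℕ) (hgh : g⁻¹ * h ∈ P j)
      (hd : periphDist P G j g h ≤ 2 ^ (n + 1)) : CuspedRel P G (.horo j g n) (.horo j h n)

/-- The cusped space `X(Γ, P, G)`, as a graph. -/
def cuspedGraph (P : Fin l → Subgroup Γ) (G : Set Γ) : SimpleGraph (CuspedVertex Γ l) :=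
  SimpleGraph.fromRel (CuspedRel P G)

/-- Distance in the cusped space. -/
def cuspedDist (P : Fin l → Subgroup Γ) (G : Set Γ) (x y : CuspedVertex Γ l) : ℕ :=
  (cuspedGraph P G).dist x y

/-- The cusped word length `|g|_c`. -/
def cuspedLength (P : Fin l → Subgroup Γ) (G : Set Γ) (g : Γ) : ℕ :=
  cuspedDist P G (.base 1) (.base g)

/-- Gromov hyperbolicity of a connected graph with edges of length one, by the four-point
condition on its vertices (equivalent, up to the constant, to the one on the metric graph). -/
def IsHyperbolicGraph {V : Type*} (X : SimpleGraph V) : Prop :=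
  X.Connected ∧ ∃ δ : ℕ, ∀ x y z w : V,
    X.dist x z + X.dist y w ≤
      max (X.dist x y + X.dist z w) (X.dist x w + X.dist y z) + 2 * δ

/-- `Γ` is hyperbolic relative to (the conjugates of) the `P j`: a compatible generating set
exists, and the cusped space is hyperbolic for all of them. -/
def IsRelHyperbolic (P : Fin l → Subgroup Γ) : Prop :=
  (∃ G : Set Γ, IsCompatible P G) ∧
    ∀ G : Set Γ, IsCompatible P G → IsHyperbolicGraph (cuspedGraph P G)

/-! ### Metric quasigeodesic paths -/

/-- The numbers `e` for which the path `γ`, followed from time `n` for time `e` in both directions,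
is not at both ends in one and the same peripheral coset of `γ n`. -/
def exitTimes (P : Fin l → Subgroup Γ) (γ : ℤ → Γ) (n : ℤ) : Set ℕ :=
  {e | ∀ j, (γ n)⁻¹ * γ (n - e) ∉ P j ∨ (γ n)⁻¹ * γ (n + e) ∉ P j}

/-- The depth of `γ n` along the bi-infinite path `γ`. -/
def depth (P : Fin l → Subgroup Γ) (γ : ℤ → Γ) (n : ℤ) : ℕ :=
  sInf (exitTimes P γ n)

/-- Bi-infinite `(u, U)`-metric quasigeodesic paths. (If a depth were infinite, the path would
stay in one peripheral coset and could not satisfy `peripheral_step`; so depths are finite.) -/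
structure IsMetricQuasigeodesic (P : Fin l → Subgroup Γ) (G : Set Γ) (u U : ℝ) (γ : ℤ → Γ) :
    Prop where
  depth_finite : ∀ n, (exitTimes P γ n).Nonempty
  lower : ∀ m n : ℤ,
    u⁻¹ * |(m : ℝ) - n| - u ≤ (cuspedLength P G ((γ n)⁻¹ * γ m) : ℝ)
  upper : ∀ m n : ℤ, (cuspedLength P G ((γ n)⁻¹ * γ m) : ℝ) ≤
    U * (|(m : ℝ) - n| + min (depth P γ m : ℝ) (depth P γ n : ℝ)) + U
  peripheral_step : ∀ (n : ℤ) (j : Fin l), (γ n)⁻¹ * γ (n + 1) ∈ P j →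
    2 ^ depth P γ n ≤ 2 * periphDist P G j (γ n) (γ (n + 1)) ∧
    periphDist P G j (γ n) (γ (n + 1)) ≤ 2 ^ (depth P γ n + 1)

/-- `c` is a `(u, U)`-quasigeodesic of the cusped space that projects to `γ` and passes
through the identity vertex of the Cayley graph at time `0`. -/
structure IsQuasigeodesicLift (P : Fin l → Subgroup Γ) (G : Set Γ) (u U : ℝ) (γ : ℤ → Γ)
    (c : ℤ → CuspedVertex Γ l) : Prop where
  proj_eq : ∀ n, (c n).proj = γ n
  zero_eq : c 0 = .base 1
  lower : ∀ m n : ℤ, u⁻¹ * |(m : ℝ) - n| - u ≤ (cuspedDist P G (c n) (c m) : ℝ)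
  upper : ∀ m n : ℤ, (cuspedDist P G (c n) (c m) : ℝ) ≤ U * |(m : ℝ) - n| + U

/-- The path `γ` has the form `η g h η'`, read from the vertex `1` between `g` and `h`: up to the
vertex `g⁻¹` it runs in `g⁻¹ P_i`, and from the vertex `h` on it runs in `h P_j`. -/
def HasForm (P : Fin l → Subgroup Γ) (γ : ℤ → Γ) (i j : Fin l) (g h : Γ) : Prop :=
  γ 0 = 1 ∧ ∃ a b : ℕ, γ (-(a : ℤ)) = g⁻¹ ∧ γ b = h ∧
    (∀ n : ℤ, n ≤ -(a : ℤ) → g * γ n ∈ P i) ∧ (∀ n : ℤ, (b : ℤ) ≤ n → h⁻¹ * γ n ∈ P j)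

/-! ### Relatively dominated representations -/

variable {d : ℕ}

/-- Condition (D-). -/
def DMinus (P : Fin l → Subgroup Γ) (G : Set Γ) (ρ : Γ →* PGLR d) : Prop :=
  ∃ c > 0, ∃ μ > 0, ∀ γ : Γ,
    c * Real.exp (μ * cuspedLength P G γ) ≤ svRatio 1 2 (ρ γ)

/-- Condition (D+). -/
def DPlus (P : Fin l → Subgroup Γ) (G : Set Γ) (ρ : Γ →* PGLR d) : Prop :=
  ∃ c > 0, ∃ μ > 0, ∀ γ : Γ,
    svRatio 1 d (ρ γ) ≤ c * Real.exp (μ * cuspedLength P G γ)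

/-- Unique limits: `ξ Q` is a line, `ξd Q` a hyperplane, and they are the limits of `U_1` and
`U_(d-1)` along every sequence that goes to infinity in the peripheral subgroup `Q`. -/
def UniqueLimits (P : Fin l → Subgroup Γ) (ρ : Γ →* PGLR d)
    (ξ ξd : Subgroup Γ → Submodule ℝ (EuclideanSpace ℝ (Fin d))) : Prop :=
  ∀ Q ∈ peripherals P,
    Module.finrank ℝ (ξ Q) = 1 ∧ Module.finrank ℝ (ξd Q) = d - 1 ∧
    ∀ η : ℕ → Γ, (∀ n, η n ∈ Q) → Tendsto η atTop cofinite →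
      SubspaceTendsto (fun n => axesSpan 1 (ρ (η n))) (ξ Q) ∧
      SubspaceTendsto (fun n => axesSpan (d - 1) (ρ (η n))) (ξd Q)

/-- The limit lines of distinct peripheral subgroups are distinct. -/
def DistinctLimits (P : Fin l → Subgroup Γ)
    (ξ : Subgroup Γ → Submodule ℝ (EuclideanSpace ℝ (Fin d))) : Prop :=
  ∀ Q ∈ peripherals P, ∀ Q' ∈ peripherals P, Q ≠ Q' → ξ Q ≠ ξ Q'

/-- Uniform transversality: the sine of the angle between the line `g⁻¹ ξ(P_i)` and the
hyperplane `h ξd(P_j)` is bounded below when there is a metric quasigeodesic path `η g h η'`,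
projected from a quasigeodesic of the cusped space through the identity vertex. -/
def UniformTransversality (P : Fin l → Subgroup Γ) (G : Set Γ) (ρ : Γ →* PGLR d)
    (ξ ξd : Subgroup Γ → Submodule ℝ (EuclideanSpace ℝ (Fin d))) : Prop :=
  ∀ u > 0, ∀ U > 0, ∃ δ₀ > 0, ∀ (i j : Fin l) (g h : Γ),
    (∃ (γ : ℤ → Γ) (c : ℤ → CuspedVertex Γ l), IsMetricQuasigeodesic P G u U γ ∧
      IsQuasigeodesicLift P G u U γ c ∧ HasForm P γ i j g h) →
    ∀ v ∈ (ξ (P i)).map (repLin (ρ g⁻¹)), v ≠ 0 →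
      δ₀ < Metric.infDist v
        ((ξd (P j)).map (repLin (ρ h)) : Set (EuclideanSpace ℝ (Fin d))) / ‖v‖

/-- `ρ` is `P₁`-dominated relative to the conjugates of the `P j`: the group is finitely
generated, torsion-free, hyperbolic relative to these proper infinite subgroups, and (D-), (D+),
unique limits and uniform transversality hold. -/
def IsP1DominatedRel (P : Fin l → Subgroup Γ) (ρ : Γ →* PGLR d) : Prop :=
  Group.FG Γ ∧ (∀ g : Γ, g ≠ 1 → ¬ IsOfFinOrder g) ∧
  (∀ j, P j ≠ ⊤ ∧ Infinite (P j)) ∧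
  IsRelHyperbolic P ∧
  (∀ G : Set Γ, IsCompatible P G → DMinus P G ρ ∧ DPlus P G ρ) ∧
  ∃ ξ ξd : Subgroup Γ → Submodule ℝ (EuclideanSpace ℝ (Fin d)),
    UniqueLimits P ρ ξ ξd ∧ DistinctLimits P ξ ∧
    ∀ G : Set Γ, IsCompatible P G → UniformTransversality P G ρ ξ ξd

end Cusped

/-! ### The groups generated by powers -/

/-- The generators `T_i ^ (n_i)` and `S_j ^ (m_j)`. -/
def powerGens {d k l : ℕ} (T : Fin k → PGLR d) (S : Fin l → PGLR d)
    (n : Fin k → ℕ) (m : Fin l → ℕ) : Fin k ⊕ Fin l → PGLR d :=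
  Sum.elim (fun i => T i ^ n i) (fun j => S j ^ m j)

/-- The subgroup of `PGL(d, ℝ)` generated by the `T_i ^ (n_i)` and `S_j ^ (m_j)`. -/
def powerGroup {d k l : ℕ} (T : Fin k → PGLR d) (S : Fin l → PGLR d)
    (n : Fin k → ℕ) (m : Fin l → ℕ) : Subgroup (PGLR d) :=
  Subgroup.closure (Set.range (powerGens T S n m))

/-- The cyclic group generated by `S_j ^ (m_j)`, as a subgroup of `powerGroup T S n m`. -/
def cuspGroup {d k l : ℕ} (T : Fin k → PGLR d) (S : Fin l → PGLR d)
    (n : Fin k → ℕ) (m : Fin l → ℕ) (j : Fin l) : Subgroup (powerGroup T S n m) :=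
  (Subgroup.zpowers (S j ^ m j)).subgroupOf (powerGroup T S n m)

end RelDom

end

noncomputable section

namespace RelDom

/-! ### Hyperbolic kernels and quasigeodesics -/

/-! Everything rests on one estimate: every non-trivial reduced word in the generators has a lift
that is a map of rank one plus an error, and the error is exponentially small in a weighted word
length comparable with the cusped length.

A syllable T_i^p has weight |p|, and a syllable S_j^p has weight 2 log₂(1 + |p|), which is up to
constants the length of the shortcut through the horoball (`wt`). Rescaled powers of T_i converge
exponentially fast to a map φ ⊗ v of rank one, whose image is the attracting line and whose kernel
is the repelling hyperplane; powers of S_j converge at rate 1/|p| (`IsProximalWith.exists_approx`,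
`IsUnipotentWith.exists_approx`). Both rates are exponential in the weight, and large exponents make
the initial error as small as desired. Ping-pong supplies transversality: attracting lines of one
generator lie off the repelling hyperplanes of the others (`WeakPingPong.notMem_projSet`). When
φ₁(v₂) is bounded away from 0, a product of two perturbed rank-one maps is again one, and its error
is bounded by a constant times the product of the two errors (`rankOne_mul`, `rankOne_step`).
Induction on syllables gives `exists_isWordApprox`, and the outcome is recorded in `GoodRep`.

The estimate forbids scalar words, which gives freeness (`GoodRep.injective`); it gives the singular
value gap (`GoodRep.le_svRatio`); and it shows that only cusp powers can send the fixed line of a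
cusp into the fixed hyperplane of a cusp (`GoodRep.eq_syl_of_apply_eq_zero`), which gives the
stabilisers and the distinctness of limit lines. Limits of singular subspaces follow from
convergence to rank one (`tendsto_axesSpan_one`, `tendsto_axesSpan_pred`).

On the geometric side, the weighted distance on words satisfies the four-point inequality
(`wdist_four`). A vertex of a horoball is modelled as the midpoint of two group elements of its
coset, far apart on either side; this extends the distance to a hyperbolic kernel on the cusped
space (`cuspKernel`). The kernel is comparable with the graph distance for every compatible
generating set (`cuspKernel_le`, `cuspedDist_le`). Since a kernel has no geodesics, stability of
quasigeodesics is proved with virtual points between two vertices (`IsHypKernel.exists_near`,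
`IsHypKernel.morse`), and hyperbolicity is then transferred to the graph
(`IsHypKernel.isHyperbolicGraph`).

For uniform transversality, stability bounds the Gromov product at 1 of the two sides of the
quasigeodesic (`exists_ends_of_lift`). Words with bounded Gromov product have a short common prefix
followed by transverse remainders (`exists_prefix`), so the angle between the image of a generic
vector and the corresponding hyperplane is bounded below (`GoodRep.exists_transverse`). Passing to
the limit along the two peripheral rays gives the bound for the limit line and hyperplane. -/

/-- A symmetric nonnegative kernel with the four-point inequality, almost vanishing on the
diagonal. -/
structure IsHypKernel {V : Type*} (m : V → V → ℝ) (δ C : ℝ) : Prop where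
  delta_nonneg : 0 ≤ δ
  symm : ∀ x y, m x y = m y x
  nonneg : ∀ x y, 0 ≤ m x y
  self_le : ∀ x, m x x ≤ C
  four : ∀ x y z w, m x z + m y w ≤ max (m x y + m z w) (m x w + m y z) + δ

/-- The distance from `z` to the virtual point at distance `s` from `x` between `x` and `y`. -/
def virtualDist {V : Type*} (m : V → V → ℝ) (x y : V) (s : ℝ) (z : V) : ℝ :=
  max (m x z - s) (m y z - (m x y - s))

section Kernel

variable {V : Type*} {m : V → V → ℝ} {δ C : ℝ}

theorem IsHypKernel.triangle (h : IsHypKernel m δ C) (a b c : V) :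
    m a c ≤ m a b + m b c + δ := by
  have h1 := h.four a b c b
  have h2 := h.nonneg b b
  have h3 := h.symm b c
  rcases max_cases (m a b + m c b) (m a b + m b c) with ⟨e, _⟩ | ⟨e, _⟩ <;> rw [e] at h1 <;>
    linarith [h.symm c b]

theorem IsHypKernel.virtual_le_add (h : IsHypKernel m δ C) (x y : V) (s : ℝ) (z z' : V) :
    virtualDist m x y s z' ≤ virtualDist m x y s z + m z z' + δ := by
  have h1 := h.triangle x z z'
  have h2 := h.triangle y z z'
  unfold virtualDist
  apply max_le
  · linarith [le_max_left (m x z - s) (m y z - (m x y - s))]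
  · linarith [le_max_right (m x z - s) (m y z - (m x y - s))]

/-- In the four-point inequality for `x, z, y, z'` the term `m x y` cancels against the two shifts
`s` and `m x y - s`, whichever pairing attains the maximum. -/
theorem IsHypKernel.le_virtual_add (h : IsHypKernel m δ C) (x y : V) (s : ℝ) (z z' : V) :
    m z z' ≤ virtualDist m x y s z + virtualDist m x y s z' + δ := by
  have h1 := h.four x z y z'
  have a1 := le_max_left (m x z - s) (m y z - (m x y - s))
  have a2 := le_max_right (m x z - s) (m y z - (m x y - s))
  have b1 := le_max_left (m x z' - s) (m y z' - (m x y - s))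
  have b2 := le_max_right (m x z' - s) (m y z' - (m x y - s))
  unfold virtualDist
  rcases max_cases (m x z + m y z') (m x z' + m z y) with ⟨e, _⟩ | ⟨e, _⟩ <;> rw [e] at h1 <;>
    linarith [h.symm z y]

/-- A virtual point may serve as a vertex of the four-point inequality: whichever of `x`, `y`
attains the maximum at `z'` is used in its place, and it bounds the other two virtual distances from
below. -/
theorem IsHypKernel.virtual_four (h : IsHypKernel m δ C) (x y : V) (s : ℝ) (z z' z'' : V) :
    virtualDist m x y s z' + m z z'' ≤
      max (virtualDist m x y s z + m z' z'') (virtualDist m x y s z'' + m z z') + δ := by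
  have key : ∀ a : V, ∀ r : ℝ, (m a z - r ≤ virtualDist m x y s z) →
      (m a z'' - r ≤ virtualDist m x y s z'') → m a z' - r + m z z'' ≤
      max (virtualDist m x y s z + m z' z'') (virtualDist m x y s z'' + m z z') + δ := by
    intro a r h1 h2
    have h3 := h.four a z z' z''
    rcases max_cases (m a z + m z' z'') (m a z'' + m z z') with ⟨e, _⟩ | ⟨e, _⟩ <;> rw [e] at h3
    · linarith [le_max_left (virtualDist m x y s z + m z' z'')
        (virtualDist m x y s z'' + m z z')]
    · linarith [le_max_right (virtualDist m x y s z + m z' z'')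
        (virtualDist m x y s z'' + m z z')]
  have k1 := key x s (le_max_left _ _) (le_max_left _ _)
  have k2 := key y (m x y - s) (le_max_right _ _) (le_max_right _ _)
  conv_lhs => unfold virtualDist
  rcases max_cases (m x z' - s) (m y z' - (m x y - s)) with ⟨e, _⟩ | ⟨e, _⟩ <;> rw [e] <;> assumption

theorem virtual_lipschitz (x y : V) (s t : ℝ) (z : V) :
    virtualDist m x y s z ≤ virtualDist m x y t z + |s - t| := by
  have h1 := le_abs_self (s - t)
  have h2 := neg_abs_le (s - t)
  unfold virtualDist
  apply max_le
  · linarith [le_max_left (m x z - t) (m y z - (m x y - t))]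
  · linarith [le_max_right (m x z - t) (m y z - (m x y - t))]

/-- Gromov's bisection argument. Twice the Gromov product seen from the virtual point loses `δ` at
each halving, so `2 ^ k` steps lose only `k * δ`. A path that avoids a large ball around the point
while its ends are seen in opposite directions is therefore exponentially long. -/
theorem IsHypKernel.chain (h : IsHypKernel m δ C) (x y : V) (s : ℝ) {U D : ℝ} (hCU : C ≤ U)
    (c : ℕ → V) (k : ℕ) : ∀ p q : ℕ, p ≤ q → q ≤ p + 2 ^ k →
    (∀ j, p ≤ j → j < q → m (c j) (c (j + 1)) ≤ U) →
    (∀ j, p ≤ j → j ≤ q → D ≤ virtualDist m x y s (c j)) →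
    2 * D - U - k * δ ≤
      virtualDist m x y s (c p) + virtualDist m x y s (c q) - m (c p) (c q) := by
  have hδ := h.delta_nonneg
  induction k with
  | zero =>
    intro p q hpq hq hU hD
    have hp := hD p le_rfl hpq
    have hq' := hD q hpq le_rfl
    simp only [pow_zero] at hq
    rcases Nat.eq_or_lt_of_le hpq with e | e
    · subst e
      have := h.self_le (c p)
      norm_num; linarith
    · have e : q = p + 1 := by omega
      subst e
      have := hU p le_rfl (by omega)
      norm_num; linarith
  | succ k ih =>
    intro p q hpq hq hU hD
    by_cases hc : q ≤ p + 2 ^ k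
    · have := ih p q hpq hc hU hD
      push_cast
      linarith
    · push Not at hc
      have i1 := ih p (p + 2 ^ k) (by omega) le_rfl (fun j h1 h2 => hU j h1 (by omega))
        (fun j h1 h2 => hD j h1 (by omega))
      have i2 := ih (p + 2 ^ k) q (by omega) (by rw [pow_succ] at hq; omega)
        (fun j h1 h2 => hU j (by omega) h2) (fun j h1 h2 => hD j (by omega) h2)
      have h3 := h.virtual_four x y s (c p) (c (p + 2 ^ k)) (c q)
      push_cast
      rcases max_cases (virtualDist m x y s (c p) + m (c (p + 2 ^ k)) (c q))
        (virtualDist m x y s (c q) + m (c p) (c (p + 2 ^ k))) with ⟨e, _⟩ | ⟨e, _⟩ <;>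
        rw [e] at h3 <;> linarith

/-- With `k` the integer part of `t / (δ + 1)`, the power `2 ^ k` outgrows every linear function of
`t`, while `k * δ` stays below `t`. -/
theorem exists_pow_two_ge (δ U u : ℝ) (hδ : 0 ≤ δ) (hu : 0 < u) : ∃ D₀ : ℝ, ∀ t ≥ D₀, ∃ k : ℕ,
    u * (6 * t + δ + u) + 1 ≤ 2 ^ k ∧ U + k * δ + δ < 2 * (t - 1) := by
  have hlim := tendsto_pow_const_div_const_pow_of_one_lt 1 (r := (2 : ℝ)) (by norm_num)
  set A := u * (6 * (δ + 1)) with hA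
  set B := u * (6 * (δ + 1) + δ + u) + 1 with hB
  have hApos : 0 ≤ A := by positivity
  have hBpos : 0 < B := by positivity
  have hev : ∀ᶠ k : ℕ in atTop, A * k + B ≤ 2 ^ k := by
    have h1 : ∀ᶠ k : ℕ in atTop, (k : ℝ) ^ 1 / 2 ^ k < 1 / (A + B) :=
      hlim.eventually (gt_mem_nhds (by positivity))
    filter_upwards [h1, eventually_ge_atTop 1] with k hk hk1
    rw [div_lt_div_iff₀ (by positivity) (by positivity)] at hk
    have : (1 : ℝ) ≤ k := by exact_mod_cast hk1
    nlinarith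
  obtain ⟨K, hK⟩ := eventually_atTop.1 hev
  refine ⟨max ((δ + 1) * (K + 1)) (U + δ + 3), fun t ht => ⟨⌊t / (δ + 1)⌋₊, ?_, ?_⟩⟩
  · have ht1 : (δ + 1) * (K + 1) ≤ t := le_trans (le_max_left _ _) ht
    have hk : K ≤ ⌊t / (δ + 1)⌋₊ := by
      apply Nat.le_floor
      rw [le_div_iff₀ (by positivity)]
      nlinarith
    have h2 := hK _ hk
    have h3 := (Nat.lt_floor_add_one (t / (δ + 1))).le
    rw [div_le_iff₀ (by positivity)] at h3
    refine le_trans ?_ h2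
    rw [hA, hB]
    nlinarith
  · have ht1 : (U + δ + 3) ≤ t := le_trans (le_max_right _ _) ht
    have ht0 : 0 ≤ t := by
      have : (0 : ℝ) ≤ (δ + 1) * (K + 1) := by positivity
      exact this.trans (le_trans (le_max_left _ _) ht)
    have h3 := Nat.floor_le (a := t / (δ + 1)) (by positivity)
    rw [le_div_iff₀ (by positivity)] at h3
    have : (0 : ℝ) ≤ (⌊t / (δ + 1)⌋₊ : ℝ) := by positivity
    nlinarith

/-- A discrete quasigeodesic, parametrized by `0, …, N`. -/
structure IsQuasiGeod (m : V → V → ℝ) (u U : ℝ) (c : ℕ → V) (N : ℕ) : Prop where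
  lower : ∀ p q : ℕ, p ≤ q → q ≤ N → (q : ℝ) - p ≤ u * (m (c p) (c q) + u)
  step : ∀ j < N, m (c j) (c (j + 1)) ≤ U

/-- At a nearly worst virtual point, at distance about `t` from the path, vertices near the virtual
points `2 * t` to the left and right are joined by a piece of the path that avoids the ball of
radius `t - 1`. The quasigeodesic condition makes this piece linearly short in `t`, and `chain`
makes it exponentially long. -/
theorem IsHypKernel.exists_near (h : IsHypKernel m δ C) {u U : ℝ} (hu : 0 < u) (hCU : C ≤ U) :
    ∃ D₁ : ℝ, C ≤ D₁ ∧ ∀ (c : ℕ → V) (N : ℕ), IsQuasiGeod m u U c N →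
      ∀ s, 0 ≤ s → s ≤ m (c 0) (c N) →
        ∃ j ≤ N, virtualDist m (c 0) (c N) s (c j) ≤ D₁ := by
  have hδ := h.delta_nonneg
  obtain ⟨D₀, hD₀⟩ := exists_pow_two_ge δ U u hδ hu
  refine ⟨max (max D₀ (C + 1)) (δ + 1), le_trans (by linarith)
    ((le_max_right D₀ (C + 1)).trans (le_max_left _ _)), ?_⟩
  intro c N hc s₀ hs₀ hs₀L
  by_contra hcon
  push Not at hcon
  set x := c 0 with hx
  set y := c N with hy
  set L := m x y with hL
  have hC0 : 0 ≤ C := (h.nonneg x x).trans (h.self_le x)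
  set D : ℝ → ℝ := fun s => (Finset.range (N + 1)).inf' ⟨0, by simp⟩
    (fun j => virtualDist m x y s (c j)) with hD
  have hDle : ∀ s j, j ≤ N → D s ≤ virtualDist m x y s (c j) := fun s j hj =>
    Finset.inf'_le _ (by simpa using Nat.lt_succ_of_le hj)
  have hDex : ∀ s, ∃ j ≤ N, virtualDist m x y s (c j) = D s := by
    intro s
    obtain ⟨j, hj, e⟩ := Finset.exists_mem_eq_inf' (s := Finset.range (N + 1)) ⟨0, by simp⟩
      (fun j => virtualDist m x y s (c j))
    exact ⟨j, by simpa [Nat.lt_succ_iff] using hj, e.symm⟩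
  set S : Set ℝ := D '' Set.Icc 0 L with hS
  have hSb : BddAbove S := by
    refine ⟨C + L, ?_⟩
    rintro _ ⟨s, ⟨h0, h1⟩, rfl⟩
    refine (hDle s 0 (Nat.zero_le _)).trans ?_
    apply max_le
    · have := h.self_le x; linarith
    · rw [h.symm y]; linarith
  have hSn : S.Nonempty := ⟨D s₀, s₀, ⟨hs₀, hs₀L⟩, rfl⟩
  -- The supremum need not be attained; a point within 1 of it is enough, which is where the radius
  -- `t - 1` comes from.
  obtain ⟨_, ⟨s, ⟨hs0, hsL⟩, rfl⟩, hs⟩ := exists_lt_of_lt_csSup hSn (sub_one_lt (sSup S))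
  have hsup : ∀ s', 0 ≤ s' → s' ≤ L → D s' ≤ sSup S := fun s' h0 h1 =>
    le_csSup hSb ⟨s', ⟨h0, h1⟩, rfl⟩
  set t := sSup S with ht
  have htbig : max (max D₀ (C + 1)) (δ + 1) < t := by
    obtain ⟨j, hj, e⟩ := hDex s₀
    have := hcon j hj
    exact this.trans_le (e ▸ hsup s₀ hs₀ hs₀L)
  have htD₀ : D₀ ≤ t := ((le_max_left _ _).trans (le_max_left _ _)).trans htbig.le
  have htC : C + 1 < t := ((le_max_right _ _).trans (le_max_left _ _)).trans_lt htbig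
  have htδ : δ + 1 < t := (le_max_right _ _).trans_lt htbig
  have hDj : ∀ j ≤ N, t - 1 ≤ virtualDist m x y s (c j) := fun j hj => hs.le.trans (hDle s j hj)
  -- a point of the path near the virtual point to the left
  have hleft : ∃ j ≤ N, (m x (c j) ≤ s - t ∧ m y (c j) ≤ L - s + 3 * t) ∨ (j = 0 ∧ s ≤ 2 * t) := by
    by_cases hc2 : 2 * t ≤ s
    · obtain ⟨j, hj, e⟩ := hDex (s - 2 * t)
      refine ⟨j, hj, Or.inl ?_⟩
      have h1 := hsup (s - 2 * t) (by linarith) (by linarith)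
      rw [← e] at h1
      have h2 := (le_max_left _ _).trans h1
      have h3 := (le_max_right _ _).trans h1
      constructor <;> linarith
    · exact ⟨0, Nat.zero_le _, Or.inr ⟨rfl, by linarith⟩⟩
  have hright : ∃ j ≤ N, (m y (c j) ≤ L - s - t ∧ m x (c j) ≤ s + 3 * t) ∨
      (j = N ∧ L - s ≤ 2 * t) := by
    by_cases hc2 : 2 * t ≤ L - s
    · obtain ⟨j, hj, e⟩ := hDex (s + 2 * t)
      refine ⟨j, hj, Or.inl ?_⟩
      have h1 := hsup (s + 2 * t) (by linarith) (by linarith)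
      rw [← e] at h1
      have h2 := (le_max_left _ _).trans h1
      have h3 := (le_max_right _ _).trans h1
      constructor <;> linarith
    · exact ⟨N, le_rfl, Or.inr ⟨rfl, by linarith⟩⟩
  obtain ⟨j₁, hj₁, hl⟩ := hleft
  obtain ⟨j₂, hj₂, hr⟩ := hright
  have ho1 : virtualDist m x y s (c j₁) = m y (c j₁) - (L - s) ∧
      m y (c j₁) - (L - s) ≤ 3 * t := by
    have hlow := hDj j₁ hj₁
    unfold virtualDist at hlow ⊢
    rcases hl with ⟨a, b⟩ | ⟨rfl, b⟩
    · refine ⟨max_eq_right (by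
        by_contra hlt
        rw [max_eq_left (by linarith)] at hlow
        linarith), by linarith⟩
    · rw [← hx] at hlow ⊢
      have h1 := h.self_le x
      have h2 := h.symm y x
      refine ⟨max_eq_right (by
        by_contra hlt
        rw [max_eq_left (by linarith)] at hlow
        linarith), by linarith⟩
  have ho2 : virtualDist m x y s (c j₂) = m x (c j₂) - s ∧ m x (c j₂) - s ≤ 3 * t := by
    have hlow := hDj j₂ hj₂
    unfold virtualDist at hlow ⊢
    rcases hr with ⟨a, b⟩ | ⟨rfl, b⟩
    · refine ⟨max_eq_left (by
        by_contra hlt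
        rw [max_eq_right (by linarith)] at hlow
        linarith), by linarith⟩
    · rw [← hy] at hlow ⊢
      have h1 := h.self_le y
      refine ⟨max_eq_left (by
        by_contra hlt
        rw [max_eq_right (by linarith)] at hlow
        linarith), by linarith⟩
  -- The two vertices lie on opposite sides of the virtual point, so twice their Gromov product
  -- there is at most `δ`.
  have hG : virtualDist m x y s (c j₁) + virtualDist m x y s (c j₂) - m (c j₁) (c j₂) ≤ δ := by
    have hlow1 := hDj j₁ hj₁
    have hlow2 := hDj j₂ hj₂
    rw [ho1.1] at hlow1 ⊢
    rw [ho2.1] at hlow2 ⊢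
    rcases hl with ⟨a, b⟩ | ⟨rfl, b⟩
    · rcases hr with ⟨a', b'⟩ | ⟨rfl, b'⟩
      · have h4 := h.four x (c j₁) (c j₂) y
        have h5 := h.symm (c j₁) y
        have h6 := h.symm (c j₂) y
        rcases max_cases (m x (c j₁) + m (c j₂) y) (m x y + m (c j₁) (c j₂)) with
          ⟨e, _⟩ | ⟨e, _⟩ <;> rw [e] at h4
        · linarith
        · linarith
      · rw [← hy, h.symm (c j₁) y]; linarith
    · rw [← hx] at *
      have := h.symm y x
      linarith
  have hdist : m (c j₁) (c j₂) ≤ 6 * t + δ := by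
    have := h.le_virtual_add x y s (c j₁) (c j₂)
    rw [ho1.1, ho2.1] at this
    linarith [ho1.2, ho2.2]
  obtain ⟨k, hk1, hk2⟩ := hD₀ t htD₀
  rcases le_total j₁ j₂ with hle | hle
  · have hlen := hc.lower j₁ j₂ hle hj₂
    have hlen2 : (j₂ : ℝ) ≤ j₁ + 2 ^ k := by nlinarith
    have hch := h.chain x y s hCU c k j₁ j₂ hle (by exact_mod_cast hlen2)
      (fun j _ h2 => hc.step j (by omega)) (fun j _ h2 => hDj j (by omega))
    linarith
  · have hlen := hc.lower j₂ j₁ hle hj₁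
    rw [h.symm] at hlen
    have hlen2 : (j₁ : ℝ) ≤ j₂ + 2 ^ k := by nlinarith
    have hch := h.chain x y s hCU c k j₂ j₁ hle (by exact_mod_cast hlen2)
      (fun j _ h2 => hc.step j (by omega)) (fun j _ h2 => hDj j (by omega))
    rw [h.symm (c j₂)] at hch
    linarith

theorem IsHypKernel.path_le (h : IsHypKernel m δ C) {u U : ℝ} (hCU : C ≤ U) {c : ℕ → V} {N : ℕ}
    (hc : IsQuasiGeod m u U c N) (p : ℕ) : ∀ r : ℕ, p + r ≤ N →
    m (c p) (c (p + r)) ≤ U + r * (U + δ) := by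
  intro r
  induction r with
  | zero => intro _; have := h.self_le (c p); simp; linarith
  | succ r ih =>
    intro hr
    have h1 := ih (by omega)
    have h2 := hc.step (p + r) (by omega)
    have h3 := h.triangle (c p) (c (p + r)) (c (p + r + 1))
    rw [← add_assoc]
    push_cast
    linarith

/-- Stability of quasigeodesics. -/
theorem IsHypKernel.morse (h : IsHypKernel m δ C) {u U : ℝ} (hu : 0 < u) (hCU : C ≤ U) :
    ∃ R : ℝ, 0 ≤ R ∧ ∀ (c : ℕ → V) (N : ℕ), IsQuasiGeod m u U c N → ∀ n ≤ N,
      m (c 0) (c n) + m (c n) (c N) ≤ m (c 0) (c N) + R := by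
  have hδ := h.delta_nonneg
  obtain ⟨D₁, hCD, hD₁⟩ := h.exists_near hu hCU
  set T := u * (2 * D₁ + 2 + δ + u) with hT
  set R₁ := D₁ + (U + T * (U + δ)) + δ with hR₁
  refine ⟨max 0 (2 * R₁), le_max_left _ _, ?_⟩
  intro c N hc n hn
  have hC0 : 0 ≤ C := (h.nonneg (c 0) (c 0)).trans (h.self_le _)
  have hU0 : 0 ≤ U := hC0.trans hCU
  set x := c 0 with hx
  set y := c N with hy
  set L := m x y with hL
  have hL0 : 0 ≤ L := h.nonneg _ _
  set S : Set ℝ := {s | 0 ≤ s ∧ s ≤ L ∧ ∃ j ≤ n, virtualDist m x y s (c j) ≤ D₁} with hS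
  have hS0 : (0 : ℝ) ∈ S := by
    refine ⟨le_rfl, hL0, 0, Nat.zero_le _, ?_⟩
    have := h.self_le x
    apply max_le
    · linarith
    · rw [h.symm y x]; linarith
  have hSb : BddAbove S := ⟨L, fun s hs => hs.2.1⟩
  obtain ⟨s₁, ⟨hs10, hs1L, j₁, hj₁, hv1⟩, hs1⟩ :=
    exists_lt_of_lt_csSup ⟨0, hS0⟩ (sub_one_lt (sSup S))
  -- As `s₁` exceeds the supremum less one, `s₁ + 2` lies beyond the supremum, so no vertex of time
  -- at most `n` is near that virtual point; a later one must be. Near the end of the segment the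
  -- last vertex serves.
  have hex : ∃ s₂, |s₁ - s₂| ≤ 2 ∧ ∃ j₂, n ≤ j₂ ∧ j₂ ≤ N ∧ virtualDist m x y s₂ (c j₂) ≤ D₁ := by
    by_cases hcase : s₁ + 2 ≤ L
    · refine ⟨s₁ + 2, by norm_num, ?_⟩
      obtain ⟨j, hj, hjv⟩ := hD₁ c N hc (s₁ + 2) (by linarith) hcase
      refine ⟨j, ?_, hj, hjv⟩
      by_contra hlt
      have : s₁ + 2 ∈ S := ⟨by linarith, hcase, j, by omega, hjv⟩
      linarith [le_csSup hSb this]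
    · refine ⟨L, by rw [abs_le]; constructor <;> linarith, N, hn, le_rfl, ?_⟩
      have := h.self_le y
      apply max_le
      · linarith
      · rw [← hy]; linarith
  obtain ⟨s₂, hs12, j₂, hnj, hj₂, hv2⟩ := hex
  have hv2' := virtual_lipschitz (m := m) x y s₁ s₂ (c j₂)
  have hd := h.le_virtual_add x y s₁ (c j₁) (c j₂)
  have hlen := hc.lower j₁ j₂ (by omega) hj₂
  -- The vertices at times `j₁ ≤ n ≤ j₂` are close to almost the same virtual point, so `j₂ - j₁` is
  -- bounded and the vertex at time `n` is close to that point too.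
  have hlen2 : ((n - j₁ : ℕ) : ℝ) ≤ T := by
    have h1 : (n : ℝ) ≤ j₂ := by exact_mod_cast hnj
    rw [Nat.cast_sub hj₁]
    have : u * (m (c j₁) (c j₂) + u) ≤ T := by
      rw [hT]
      apply mul_le_mul_of_nonneg_left _ hu.le
      linarith
    linarith
  have hpath := h.path_le hCU hc j₁ (n - j₁) (by omega)
  rw [Nat.add_sub_cancel' hj₁] at hpath
  have hvn := h.virtual_le_add x y s₁ (c j₁) (c n)
  have hmul : ((n - j₁ : ℕ) : ℝ) * (U + δ) ≤ T * (U + δ) :=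
    mul_le_mul_of_nonneg_right hlen2 (by linarith)
  have hvR : virtualDist m x y s₁ (c n) ≤ R₁ := by rw [hR₁]; linarith
  have h1 := (le_max_left _ _).trans hvR
  have h2 := (le_max_right _ _).trans hvR
  rw [h.symm (c n) y]
  linarith [le_max_right 0 (2 * R₁)]

end Kernel

/-! ### Transfer of hyperbolicity from a kernel to a graph -/

section KernelGraph

variable {V : Type*} {m : V → V → ℝ} {δ C : ℝ}

theorem exists_geodesic {X : SimpleGraph V} (hX : X.Connected) (x y : V) :
    ∃ c : ℕ → V, c 0 = x ∧ c (X.dist x y) = y ∧ (∀ j < X.dist x y, X.Adj (c j) (c (j + 1))) ∧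
      ∀ p q, p ≤ q → q ≤ X.dist x y → X.dist (c p) (c q) = q - p := by
  obtain ⟨w, hw⟩ := hX.exists_walk_length_eq_dist x y
  have hadj : ∀ j < X.dist x y, X.Adj (w.getVert j) (w.getVert (j + 1)) := fun j hj =>
    w.adj_getVert_succ (hw ▸ hj)
  have hle : ∀ p r, p + r ≤ X.dist x y → X.dist (w.getVert p) (w.getVert (p + r)) ≤ r := by
    intro p r
    induction r with
    | zero => intro _; simp
    | succ r ih =>
      intro hr
      have h1 := ih (by omega)
      have h2 := hX.dist_triangle (u := w.getVert p) (v := w.getVert (p + r))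
        (w := w.getVert (p + r + 1))
      have h3 := SimpleGraph.dist_eq_one_iff_adj.2 (hadj (p + r) (by omega))
      rw [← add_assoc]
      omega
  have hN : w.getVert (X.dist x y) = y := by rw [← hw]; exact w.getVert_length
  refine ⟨w.getVert, w.getVert_zero, hN, hadj, fun p q hpq hq => ?_⟩
  have h1 := hle 0 p (by omega)
  have h2 := hle p (q - p) (by omega)
  have h3 := hle q (X.dist x y - q) (by omega)
  rw [Nat.add_sub_cancel' hpq] at h2
  rw [Nat.add_sub_cancel' hq, hN] at h3
  rw [zero_add, w.getVert_zero] at h1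
  have h4 := hX.dist_triangle (u := x) (v := w.getVert p) (w := y)
  have h5 := hX.dist_triangle (u := w.getVert p) (v := w.getVert q) (w := y)
  omega

/-- Every virtual point between two vertices is close to a geodesic of the graph. -/
theorem IsHypKernel.exists_near_geodesic (h : IsHypKernel m δ C) {X : SimpleGraph V}
    (hX : X.Connected) {u U : ℝ} (hu : 0 < u) (hup : ∀ v w, X.Adj v w → m v w ≤ U)
    (hlow : ∀ v w, (X.dist v w : ℝ) ≤ u * (m v w + u)) :
    ∃ D : ℝ, 0 ≤ D ∧ ∀ x y s, 0 ≤ s → s ≤ m x y →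
      ∃ q, X.dist x q + X.dist q y = X.dist x y ∧ m x q ≤ s + D ∧ m y q ≤ m x y - s + D := by
  obtain ⟨D₁, -, hD₁⟩ := h.exists_near hu (le_max_right U C)
  refine ⟨max 0 D₁, le_max_left _ _, fun x y s hs hsL => ?_⟩
  obtain ⟨c, h0, hN, hadj, hdist⟩ := exists_geodesic hX x y
  have hc : IsQuasiGeod m u (max U C) c (X.dist x y) := by
    refine ⟨fun p q hpq hq => ?_, fun j hj => (hup _ _ (hadj j hj)).trans (le_max_left _ _)⟩
    have := hlow (c p) (c q)
    rw [hdist p q hpq hq, Nat.cast_sub hpq] at this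
    exact this
  obtain ⟨j, hj, hv⟩ := hD₁ c _ hc s hs (by rw [h0, hN]; exact hsL)
  rw [h0, hN] at hv
  have h1 := (le_max_left _ _).trans hv
  have h2 := (le_max_right _ _).trans hv
  refine ⟨c j, ?_, by linarith [le_max_right 0 D₁], by linarith [le_max_right 0 D₁]⟩
  have e1 := hdist 0 j (Nat.zero_le _) hj
  have e2 := hdist j _ hj le_rfl
  rw [h0] at e1
  rw [hN] at e2
  omega

/-- A connected graph that is quasi-isometric to a hyperbolic kernel is hyperbolic. -/
theorem IsHypKernel.isHyperbolicGraph (h : IsHypKernel m δ C) {X : SimpleGraph V}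
    (hX : X.Connected) {u U : ℝ} (hu : 0 < u) (hup : ∀ v w, X.Adj v w → m v w ≤ U)
    (hlow : ∀ v w, (X.dist v w : ℝ) ≤ u * (m v w + u)) : IsHyperbolicGraph X := by
  have hδ := h.delta_nonneg
  obtain ⟨D, hD0, hD⟩ := h.exists_near_geodesic hX hu hup hlow
  set K := u * (6 * D + 10 * δ + u) with hK
  -- When the pairing of `x` with `w` and `y` with `z` is the largest, geodesics joining these pairs
  -- pass near each other, at `q` and `q'`. Exchanging their tails there compares this pairing with
  -- that of `x` with `z` and `y` with `w`, for the graph distance itself.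
  have key : ∀ x y z w, m x y + m z w ≤ m x w + m y z + δ → m x z + m y w ≤ m x w + m y z + δ →
      (X.dist x z : ℝ) + X.dist y w ≤ X.dist x w + X.dist y z + 2 * K := by
    intro x y z w h1 h2
    -- The point where `y` branches off: the Gromov product of `y` and `w` at `x`, clipped to the
    -- interval in which virtual points are controlled.
    obtain ⟨s, hs0, hsL, hs1, hs2⟩ : ∃ s, 0 ≤ s ∧ s ≤ m x w ∧
        s ≤ (m x y + m x w - m y w) / 2 + δ ∧ (m x y + m x w - m y w) / 2 ≤ s + δ := by
      have t1 := h.triangle y x w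
      have t2 := h.triangle x w y
      have := h.nonneg x w
      rw [h.symm y x] at t1
      rw [h.symm w y] at t2
      refine ⟨max 0 (min ((m x y + m x w - m y w) / 2) (m x w)), le_max_left _ _,
        max_le this (min_le_right _ _), max_le (by linarith) ((min_le_left _ _).trans
          (by linarith)), ?_⟩
      rcases min_cases ((m x y + m x w - m y w) / 2) (m x w) with ⟨e, _⟩ | ⟨e, _⟩ <;> rw [e] <;>
        linarith [le_max_right 0 ((m x y + m x w - m y w) / 2), le_max_right 0 (m x w)]
    obtain ⟨q, hq, hq1, hq2⟩ := hD x w s hs0 hsL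
    have hqy : m q y ≤ (m x y + m y w - m x w) / 2 + D + 2 * δ := by
      have := h.four q x y w
      rw [h.symm q x, h.symm q w] at this
      rcases max_cases (m x q + m y w) (m w q + m x y) with ⟨e, _⟩ | ⟨e, _⟩ <;>
        rw [e] at this <;> linarith
    have hqz : m q z ≤ m y z - (m x y + m y w - m x w) / 2 + D + 3 * δ := by
      have := h.four q x z w
      rw [h.symm q x, h.symm q w] at this
      rcases max_cases (m x q + m z w) (m w q + m x z) with ⟨e, _⟩ | ⟨e, _⟩ <;>
        rw [e] at this <;> linarith
    -- The position of `q` as seen from `y`: the Gromov product of `x` and `w` at `y`, clipped to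
    -- the segment from `y` to `z`.
    obtain ⟨t, ht0, htL, ht1, ht2⟩ : ∃ t, 0 ≤ t ∧ t ≤ m y z ∧
        t ≤ (m x y + m y w - m x w) / 2 + D + 2 * δ ∧
        (m x y + m y w - m x w) / 2 ≤ t + D + 3 * δ := by
      have n1 := h.nonneg q y
      have n2 := h.nonneg q z
      have n3 := h.nonneg y z
      refine ⟨max 0 (min ((m x y + m y w - m x w) / 2) (m y z)), le_max_left _ _,
        max_le n3 (min_le_right _ _), max_le (by linarith) ((min_le_left _ _).trans
          (by linarith)), ?_⟩
      rcases min_cases ((m x y + m y w - m x w) / 2) (m y z) with ⟨e, _⟩ | ⟨e, _⟩ <;> rw [e] <;>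
        linarith [le_max_right 0 ((m x y + m y w - m x w) / 2), le_max_right 0 (m y z)]
    obtain ⟨q', hq', hq1', hq2'⟩ := hD y z t ht0 htL
    have hqq : m q q' ≤ 6 * D + 10 * δ := by
      have := h.four q y q' z
      rw [h.symm q' z] at this
      rcases max_cases (m q y + m z q') (m q z + m y q') with ⟨e, _⟩ | ⟨e, _⟩ <;>
        rw [e] at this <;> linarith
    have hdd : (X.dist q q' : ℝ) ≤ K := (hlow q q').trans (by rw [hK]; gcongr)
    have d1 := hX.dist_triangle (u := x) (v := q) (w := z)
    have d2 := hX.dist_triangle (u := q) (v := q') (w := z)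
    have d3 := hX.dist_triangle (u := y) (v := q) (w := w)
    have d4 := hX.dist_triangle (u := y) (v := q') (w := q)
    rw [X.dist_comm (u := q') (v := q)] at d4
    have d5 : X.dist x z + X.dist y w ≤ X.dist x w + X.dist y z + 2 * X.dist q q' := by omega
    have d6 : (X.dist x z : ℝ) + X.dist y w ≤ X.dist x w + X.dist y z + 2 * X.dist q q' := by
      exact_mod_cast d5
    linarith
  refine ⟨hX, ⌈K⌉₊, fun x y z w => ?_⟩
  have hceil := Nat.le_ceil K
  rcases le_total (m x y + m z w) (m x w + m y z) with hc | hc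
  · have h4 := h.four x y z w
    rw [max_eq_right hc] at h4
    have := key x y z w (by linarith) h4
    have h5 : (X.dist x z : ℝ) + X.dist y w ≤ X.dist x w + X.dist y z + 2 * ⌈K⌉₊ := by linarith
    have h6 : X.dist x z + X.dist y w ≤ X.dist x w + X.dist y z + 2 * ⌈K⌉₊ := by exact_mod_cast h5
    exact h6.trans (Nat.add_le_add_right (le_max_right _ _) _)
  · have h4 := h.four x y z w
    rw [max_eq_left hc] at h4
    have := key x w z y (by rw [h.symm z y, h.symm w z]; linarith)
      (by rw [h.symm w y, h.symm w z]; linarith)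
    rw [X.dist_comm (u := w) (v := y), X.dist_comm (u := w) (v := z)] at this
    have h5 : (X.dist x z : ℝ) + X.dist y w ≤ X.dist x y + X.dist z w + 2 * ⌈K⌉₊ := by linarith
    have h6 : X.dist x z + X.dist y w ≤ X.dist x y + X.dist z w + 2 * ⌈K⌉₊ := by exact_mod_cast h5
    exact h6.trans (Nat.add_le_add_right (le_max_left _ _) _)

end KernelGraph

/-! ### Reduced words in a free product of infinite cyclic groups -/

/-- The free product of infinite cyclic groups, that is the free group, with its syllables. -/
abbrev CyclicProd (ι : Type*) : Type _ := Monoid.CoprodI (fun _ : ι => Multiplicative ℤ)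

section Words

variable {ι : Type*}

/-- The power `p` of the generator `i`. -/
def syl (i : ι) (p : ℤ) : CyclicProd ι :=
  Monoid.CoprodI.of (M := fun _ : ι => Multiplicative ℤ) (i := i) (Multiplicative.ofAdd p)

theorem syl_zero (i : ι) : syl i 0 = 1 := by simp [syl]

theorem syl_add (i : ι) (p q : ℤ) : syl i (p + q) = syl i p * syl i q := by simp [syl]

theorem syl_neg (i : ι) (p : ℤ) : syl i (-p) = (syl i p)⁻¹ := by
  rw [eq_inv_iff_mul_eq_one, ← syl_add, neg_add_cancel, syl_zero]

theorem syl_zpow (i : ι) (p q : ℤ) : syl i p ^ q = syl i (q * p) := by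
  unfold syl
  rw [← map_zpow]
  rfl

/-- The product of a list of syllables. -/
def ev (L : List (ι × ℤ)) : CyclicProd ι := (L.map fun l => syl l.1 l.2).prod

theorem ev_nil : ev ([] : List (ι × ℤ)) = 1 := rfl

theorem ev_cons (l : ι × ℤ) (L : List (ι × ℤ)) : ev (l :: L) = syl l.1 l.2 * ev L := by
  simp [ev]

theorem ev_append (L L' : List (ι × ℤ)) : ev (L ++ L') = ev L * ev L' := by
  simp [ev]

/-- Reduced lists of syllables. -/
def Reduced (L : List (ι × ℤ)) : Prop :=
  (∀ l ∈ L, l.2 ≠ 0) ∧ L.IsChain (fun a b => a.1 ≠ b.1)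

theorem Reduced.nil : Reduced ([] : List (ι × ℤ)) := ⟨by simp, List.isChain_nil⟩

theorem reduced_cons {i : ι} {p : ℤ} {L : List (ι × ℤ)} :
    Reduced ((i, p) :: L) ↔ p ≠ 0 ∧ (∀ l ∈ L.head?, l.1 ≠ i) ∧ Reduced L := by
  unfold Reduced
  rw [List.isChain_cons]
  constructor
  · rintro ⟨h1, h2, h3⟩
    exact ⟨h1 _ (List.mem_cons_self ..), fun l hl => (h2 l hl).symm,
      fun l hl => h1 l (List.mem_cons_of_mem _ hl), h3⟩
  · rintro ⟨h1, h2, h3, h4⟩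
    refine ⟨?_, fun l hl => (h2 l hl).symm, h4⟩
    intro l hl
    rcases List.mem_cons.1 hl with rfl | hl
    · exact h1
    · exact h3 l hl

theorem reduced_append {L L' : List (ι × ℤ)} :
    Reduced (L ++ L') ↔ Reduced L ∧ Reduced L' ∧
      ∀ a ∈ L.getLast?, ∀ b ∈ L'.head?, a.1 ≠ b.1 := by
  unfold Reduced
  rw [List.isChain_append]
  simp only [List.mem_append]
  constructor
  · rintro ⟨h1, h2, h3, h4⟩
    exact ⟨⟨fun l hl => h1 l (Or.inl hl), h2⟩, ⟨fun l hl => h1 l (Or.inr hl), h3⟩, h4⟩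
  · rintro ⟨⟨h1, h2⟩, ⟨h3, h4⟩, h5⟩
    exact ⟨fun l hl => hl.elim (h1 l) (h3 l), h2, h4, h5⟩

/-- The reduced form of the inverse. -/
def invList (L : List (ι × ℤ)) : List (ι × ℤ) := (L.map fun l => (l.1, -l.2)).reverse

theorem reduced_invList {L : List (ι × ℤ)} (hL : Reduced L) : Reduced (invList L) := by
  constructor
  · intro l hl
    simp only [invList, List.mem_reverse, List.mem_map] at hl
    obtain ⟨a, ha, rfl⟩ := hl
    simpa using hL.1 a ha
  · unfold invList
    rw [List.isChain_reverse, List.isChain_map]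
    exact hL.2.imp fun a b h => h.symm

theorem ev_invList (L : List (ι × ℤ)) : ev (invList L) = (ev L)⁻¹ := by
  induction L with
  | nil => simp [invList, ev]
  | cons l L ih =>
    have : invList (l :: L) = invList L ++ [(l.1, -l.2)] := by simp [invList]
    rw [this, ev_append, ih, ev_cons, ev_cons, mul_inv_rev, ev_nil, mul_one, syl_neg]

theorem getLast?_invList {L : List (ι × ℤ)} {a : ι × ℤ} :
    a ∈ (invList L).getLast? ↔ (a.1, -a.2) ∈ L.head? := by
  unfold invList
  rw [List.getLast?_reverse, List.head?_map]
  cases L.head? with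
  | none => simp
  | some b => simp [Prod.ext_iff, neg_eq_iff_eq_neg]

theorem head?_invList {L : List (ι × ℤ)} {a : ι × ℤ} :
    a ∈ (invList L).head? ↔ (a.1, -a.2) ∈ L.getLast? := by
  unfold invList
  rw [List.head?_reverse, List.getLast?_map]
  cases L.getLast? with
  | none => simp
  | some b => simp [Prod.ext_iff, neg_eq_iff_eq_neg]

/-- Weights of syllables. -/
structure IsWeight (f : ι → ℤ → ℝ) (δ : ℝ) : Prop where
  delta_nonneg : 0 ≤ δ
  zero : ∀ i, f i 0 = 0
  one_le : ∀ i p, p ≠ 0 → 1 ≤ f i p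
  neg : ∀ i p, f i (-p) = f i p
  add_le : ∀ i p q, f i (p + q) ≤ f i p + f i q
  four : ∀ i (x y z w : ℤ), f i (x - z) + f i (y - w) ≤
    max (f i (x - y) + f i (z - w)) (f i (x - w) + f i (y - z)) + δ

theorem IsWeight.nonneg {f : ι → ℤ → ℝ} {δ : ℝ} (h : IsWeight f δ) (i : ι) (p : ℤ) : 0 ≤ f i p := by
  by_cases hp : p = 0
  · simp [hp, h.zero]
  · linarith [h.one_le i p hp]

variable [DecidableEq ι]

/-- The syllables of the reduced form. -/
def letters (x : CyclicProd ι) : List (ι × ℤ) :=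
  (Monoid.CoprodI.Word.equiv x).toList.map fun l => (l.1, l.2.toAdd)

theorem letters_reduced (x : CyclicProd ι) : Reduced (letters x) := by
  constructor
  · intro l hl
    simp only [letters, List.mem_map] at hl
    obtain ⟨a, ha, rfl⟩ := hl
    intro h0
    exact (Monoid.CoprodI.Word.equiv x).ne_one a ha (by simpa using h0)
  · unfold letters
    rw [List.isChain_map]
    exact (Monoid.CoprodI.Word.equiv x).chain_ne

theorem ev_letters (x : CyclicProd ι) : ev (letters x) = x := by
  have : Monoid.CoprodI.Word.prod (Monoid.CoprodI.Word.equiv x) = x :=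
    Monoid.CoprodI.Word.equiv.symm_apply_apply x
  conv_rhs => rw [← this]
  unfold ev letters Monoid.CoprodI.Word.prod
  rw [List.map_map]
  rfl

/-- Uniqueness of the reduced form: a reduced list is a `Word`, and `Word.equiv` is a bijection. -/
theorem letters_ev {L : List (ι × ℤ)} (hL : Reduced L) : letters (ev L) = L := by
  set W : Monoid.CoprodI.Word (fun _ : ι => Multiplicative ℤ) :=
    { toList := L.map fun l => ⟨l.1, Multiplicative.ofAdd l.2⟩
      ne_one := by
        intro l hl
        simp only [List.mem_map] at hl
        obtain ⟨a, ha, rfl⟩ := hl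
        have := hL.1 a ha
        simpa using this
      chain_ne := by
        rw [List.isChain_map]
        exact hL.2 } with hW
  have hprod : W.prod = ev L := by
    unfold ev Monoid.CoprodI.Word.prod
    rw [hW, List.map_map]
    rfl
  have : Monoid.CoprodI.Word.equiv (ev L) = W := by
    rw [← hprod]
    exact Monoid.CoprodI.Word.equiv.apply_symm_apply W
  unfold letters
  rw [this, hW]
  simp [List.map_map, Function.comp_def]

@[simp] theorem letters_one : letters (1 : CyclicProd ι) = [] := letters_ev (L := []) Reduced.nil

theorem letters_syl {i : ι} {p : ℤ} (hp : p ≠ 0) : letters (syl i p) = [(i, p)] := by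
  have := letters_ev (L := [(i, p)]) (reduced_cons.2 ⟨hp, by simp, Reduced.nil⟩)
  simpa [ev] using this

/-- The first syllable of `x` is not a power of the generator `i`. -/
def NoHead (i : ι) (x : CyclicProd ι) : Prop := ∀ l ∈ (letters x).head?, l.1 ≠ i

theorem noHead_one (i : ι) : NoHead i (1 : CyclicProd ι) := by simp [NoHead]

theorem letters_syl_mul {i : ι} {p : ℤ} (hp : p ≠ 0) {x : CyclicProd ι} (hx : NoHead i x) :
    letters (syl i p * x) = (i, p) :: letters x := by
  rw [← letters_ev (L := (i, p) :: letters x) (reduced_cons.2 ⟨hp, hx, letters_reduced x⟩),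
    ev_cons, ev_letters]

theorem letters_mul {x y : CyclicProd ι} (h : Reduced (letters x ++ letters y)) :
    letters (x * y) = letters x ++ letters y := by
  rw [← letters_ev h, ev_append, ev_letters, ev_letters]

theorem letters_inv (x : CyclicProd ι) : letters x⁻¹ = invList (letters x) := by
  rw [← letters_ev (reduced_invList (letters_reduced x)), ev_invList, ev_letters]

/-- The exponent may be 0, so several words can be expanded at once with respect to the same
generator `i`. -/
theorem exists_head (i : ι) (x : CyclicProd ι) :
    ∃ (p : ℤ) (y : CyclicProd ι), NoHead i y ∧ x = syl i p * y := by
  rcases hL : letters x with _ | ⟨⟨j, q⟩, L⟩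
  · exact ⟨0, x, by simp [NoHead, hL], by simp [syl_zero]⟩
  · by_cases hj : j = i
    · subst hj
      have hr := letters_reduced x
      rw [hL, reduced_cons] at hr
      refine ⟨q, ev L, ?_, ?_⟩
      · rw [NoHead, letters_ev hr.2.2]; exact hr.2.1
      · rw [← ev_letters x, hL, ev_cons]
    · exact ⟨0, x, by simpa [NoHead, hL] using hj, by simp [syl_zero]⟩

theorem length_letters_syl_mul {i : ι} (p : ℤ) {x : CyclicProd ι} (hx : NoHead i x) :
    (letters (syl i p * x)).length = (letters x).length + if p = 0 then 0 else 1 := by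
  split_ifs with hp
  · simp [hp, syl_zero]
  · simp [letters_syl_mul hp hx]

/-- Induction on the reduced form. -/
theorem syl_induction {motive : CyclicProd ι → Prop} (one : motive 1)
    (mul : ∀ i p x, p ≠ 0 → NoHead i x → motive x → motive (syl i p * x)) (x : CyclicProd ι) :
    motive x := by
  rw [← ev_letters x]
  have := letters_reduced x
  revert this
  generalize letters x = L
  intro hL
  induction L with
  | nil => exact one
  | cons l L ih =>
    obtain ⟨i, p⟩ := l
    rw [reduced_cons] at hL
    rw [ev_cons]
    exact mul i p _ hL.1 (by rw [NoHead, letters_ev hL.2.2]; exact hL.2.1) (ih hL.2.2)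

/-! ### Weighted length -/

/-- The weighted length. -/
def len (f : ι → ℤ → ℝ) (x : CyclicProd ι) : ℝ := ((letters x).map fun l => f l.1 l.2).sum

variable {f : ι → ℤ → ℝ} {δ : ℝ}

theorem len_one : len f (1 : CyclicProd ι) = 0 := by simp [len]

theorem len_syl (h : IsWeight f δ) (i : ι) (p : ℤ) : len f (syl i p) = f i p := by
  by_cases hp : p = 0
  · simp [hp, syl_zero, len_one, h.zero]
  · simp [len, letters_syl hp]

theorem len_nonneg (h : IsWeight f δ) (x : CyclicProd ι) : 0 ≤ len f x := by
  unfold len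
  apply List.sum_nonneg
  intro a ha
  simp only [List.mem_map] at ha
  obtain ⟨l, -, rfl⟩ := ha
  exact h.nonneg _ _

theorem len_mul_of_reduced {x y : CyclicProd ι} (h : Reduced (letters x ++ letters y)) :
    len f (x * y) = len f x + len f y := by
  simp [len, letters_mul h]

theorem len_syl_mul (h : IsWeight f δ) {i : ι} (p : ℤ) {x : CyclicProd ι} (hx : NoHead i x) :
    len f (syl i p * x) = f i p + len f x := by
  by_cases hp : p = 0
  · simp [hp, syl_zero, h.zero]
  · simp [len, letters_syl_mul hp hx]

theorem len_inv (h : IsWeight f δ) (x : CyclicProd ι) : len f x⁻¹ = len f x := by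
  unfold len
  rw [letters_inv, invList, List.map_reverse, List.sum_reverse, List.map_map]
  congr 1
  apply List.map_congr_left
  intro l _
  exact h.neg _ _

theorem len_syl_mul_le (h : IsWeight f δ) (i : ι) (p : ℤ) (x : CyclicProd ι) :
    len f (syl i p * x) ≤ f i p + len f x := by
  obtain ⟨q, y, hy, rfl⟩ := exists_head i x
  rw [← mul_assoc, ← syl_add, len_syl_mul h _ hy, len_syl_mul h _ hy]
  linarith [h.add_le i p q]

theorem len_mul_le (h : IsWeight f δ) (x y : CyclicProd ι) :
    len f (x * y) ≤ len f x + len f y := by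
  induction x using syl_induction with
  | one => simp [len_one]
  | mul i p x hp hx ih =>
    rw [mul_assoc, len_syl_mul h p hx]
    linarith [len_syl_mul_le h i p (x * y)]

/-- Concatenation without cancellation. -/
theorem reduced_inv_append {x y : CyclicProd ι}
    (hxy : ∀ a ∈ (letters x).head?, ∀ b ∈ (letters y).head?, a.1 ≠ b.1) :
    Reduced (letters x⁻¹ ++ letters y) := by
  rw [reduced_append]
  refine ⟨letters_reduced _, letters_reduced _, fun a ha b hb => ?_⟩
  rw [letters_inv, getLast?_invList] at ha
  exact hxy _ ha b hb

theorem noHead_syl_mul {i j : ι} (hij : i ≠ j) {p : ℤ} (hp : p ≠ 0) {x : CyclicProd ι}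
    (hx : NoHead i x) : NoHead j (syl i p * x) := by
  rw [NoHead, letters_syl_mul hp hx]
  simpa using hij

theorem head?_syl_mul {i : ι} {p : ℤ} (hp : p ≠ 0) {x : CyclicProd ι} (hx : NoHead i x) :
    (letters (syl i p * x)).head? = some (i, p) := by
  rw [letters_syl_mul hp hx]; rfl

theorem reduced_inv_syl_append {i : ι} {p : ℤ} (hp : p ≠ 0) {x y : CyclicProd ι}
    (hx : NoHead i x) (hy : NoHead i y) : Reduced (letters x⁻¹ ++ letters (syl i p * y)) := by
  apply reduced_inv_append
  intro a ha b hb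
  rw [head?_syl_mul hp hy] at hb
  obtain rfl : (i, p) = b := by simpa using hb
  exact hx a ha

/-- The two powers of `i` merge into one non-trivial syllable, after which nothing cancels. -/
theorem len_inv_mul_eq (h : IsWeight f δ) {i : ι} {p q : ℤ} (hpq : p ≠ q) {x y : CyclicProd ι}
    (hx : NoHead i x) (hy : NoHead i y) :
    len f ((syl i p * x)⁻¹ * (syl i q * y)) = len f x + len f y + f i (p - q) := by
  have e : (syl i p * x)⁻¹ * (syl i q * y) = x⁻¹ * (syl i (q - p) * y) := by
    rw [sub_eq_neg_add, syl_add, syl_neg]; group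
  rw [e, len_mul_of_reduced (reduced_inv_syl_append (sub_ne_zero.2 hpq.symm) hx hy),
    len_inv h, len_syl_mul h _ hy, ← h.neg i (p - q), neg_sub]
  ring

theorem len_inv_mul_le (h : IsWeight f δ) {i : ι} (p q : ℤ) (x y : CyclicProd ι) :
    len f ((syl i p * x)⁻¹ * (syl i q * y)) ≤ len f x + len f y + f i (p - q) := by
  have e : (syl i p * x)⁻¹ * (syl i q * y) = x⁻¹ * (syl i (q - p) * y) := by
    rw [sub_eq_neg_add, syl_add, syl_neg]; group
  rw [e, ← h.neg i (p - q), neg_sub]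
  have h1 := len_mul_le h x⁻¹ (syl i (q - p) * y)
  have h2 := len_syl_mul_le h i (q - p) y
  rw [len_inv h] at h1
  linarith

/-- The distance on words. -/
def wdist (f : ι → ℤ → ℝ) (x y : CyclicProd ι) : ℝ := len f (x⁻¹ * y)

theorem wdist_comm (h : IsWeight f δ) (x y : CyclicProd ι) : wdist f x y = wdist f y x := by
  unfold wdist
  rw [← len_inv h, mul_inv_rev, inv_inv]

theorem wdist_mul_left (g x y : CyclicProd ι) : wdist f (g * x) (g * y) = wdist f x y := by
  unfold wdist; congr 1; group

theorem wdist_triangle (h : IsWeight f δ) (x y z : CyclicProd ι) :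
    wdist f x z ≤ wdist f x y + wdist f y z := by
  unfold wdist
  have := len_mul_le h (x⁻¹ * y) (y⁻¹ * z)
  rwa [mul_assoc, mul_inv_cancel_left] at this

/-- The left side needs only an upper bound, the right side one pairing that is known exactly. As no
three exponents agree, two equal exponents in one pairing on the right leave the other one exact,
and its weights then match those on the left. Without coincidences both pairings are exact, and the
four-point inequality for the weights of `i` applies, the tails contributing equally throughout. -/
theorem wdist_four_of_heads (h : IsWeight f δ) (i : ι) {a b c e : ℤ} {x y z w : CyclicProd ι}
    (hx : NoHead i x) (hy : NoHead i y) (hz : NoHead i z) (hw : NoHead i w)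
    (n1 : ¬(a = b ∧ b = c)) (n2 : ¬(a = b ∧ b = e)) (n3 : ¬(a = c ∧ c = e))
    (n4 : ¬(b = c ∧ c = e)) :
    wdist f (syl i a * x) (syl i c * z) + wdist f (syl i b * y) (syl i e * w) ≤
      max (wdist f (syl i a * x) (syl i b * y) + wdist f (syl i c * z) (syl i e * w))
        (wdist f (syl i a * x) (syl i e * w) + wdist f (syl i b * y) (syl i c * z)) + δ := by
  have hδ := h.delta_nonneg
  unfold wdist
  have l1 := len_inv_mul_le h (i := i) a c x z
  have l2 := len_inv_mul_le h (i := i) b e y w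
  have sub_comm' : ∀ p q : ℤ, f i (p - q) = f i (q - p) := fun p q => by
    rw [← h.neg i (p - q), neg_sub]
  have tri : ∀ p q r : ℤ, f i (p - r) ≤ f i (p - q) + f i (q - r) := fun p q r => by
    have := h.add_le i (p - q) (q - r)
    rwa [sub_add_sub_cancel] at this
  have first : a ≠ b → c ≠ e → len f ((syl i a * x)⁻¹ * (syl i b * y)) +
      len f ((syl i c * z)⁻¹ * (syl i e * w)) =
      len f x + len f y + len f z + len f w + f i (a - b) + f i (c - e) := fun h1 h2 => by
    rw [len_inv_mul_eq h h1 hx hy, len_inv_mul_eq h h2 hz hw]; ring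
  have second : a ≠ e → b ≠ c → len f ((syl i a * x)⁻¹ * (syl i e * w)) +
      len f ((syl i b * y)⁻¹ * (syl i c * z)) =
      len f x + len f y + len f z + len f w + f i (a - e) + f i (b - c) := fun h1 h2 => by
    rw [len_inv_mul_eq h h1 hx hw, len_inv_mul_eq h h2 hy hz]; ring
  by_cases hab : a = b
  · subst hab
    have s := second (by tauto) (by tauto)
    rw [s]
    refine le_trans ?_ (add_le_add_left (le_max_right _ _) _)
    linarith [h.zero i]
  by_cases hce : c = e
  · subst hce
    have s := second (by tauto) (by tauto)
    rw [s]
    refine le_trans ?_ (add_le_add_left (le_max_right _ _) _)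
    linarith
  rw [first hab hce]
  by_cases hae : a = e
  · subst hae
    refine le_trans ?_ (add_le_add_left (le_max_left _ _) _)
    linarith [sub_comm' a c, sub_comm' a b]
  by_cases hbc : b = c
  · subst hbc
    refine le_trans ?_ (add_le_add_left (le_max_left _ _) _)
    linarith
  rw [second hae hbc]
  rcases max_cases (f i (a - b) + f i (c - e)) (f i (a - e) + f i (b - c)) with ⟨e', _⟩ | ⟨e', _⟩
  · refine le_trans ?_ (add_le_add_left (le_max_left _ _) _)
    have := h.four i a b c e
    linarith
  · refine le_trans ?_ (add_le_add_left (le_max_right _ _) _)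
    have := h.four i a b c e
    linarith

theorem len_inv_mul_of_heads_ne (h : IsWeight f δ) {x y : CyclicProd ι}
    (hxy : ∀ a ∈ (letters x).head?, ∀ b ∈ (letters y).head?, a.1 ≠ b.1) :
    wdist f x y = len f x + len f y := by
  unfold wdist
  rw [len_mul_of_reduced (reduced_inv_append hxy), len_inv h]

theorem noHead_or_head {i : ι} {p : ℤ} {x : CyclicProd ι} (hx : NoHead i x)
    (ha : ∃ a ∈ (letters (syl i p * x)).head?, a.1 = i) : p ≠ 0 := by
  rintro rfl
  obtain ⟨a, ha, e⟩ := ha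
  rw [syl_zero, one_mul] at ha
  exact hx a ha e

/-- At least two of the words begin with a power of `i`. If three exponents equal the same `s`, then
`s` is not 0, and left translation by the power `-s` removes three first syllables and creates at
most one, so the inductive hypothesis applies. Otherwise `wdist_four_of_heads` does. -/
theorem wdist_four_of_common_head (h : IsWeight f δ) {n : ℕ}
    (ih : ∀ x y z w : CyclicProd ι, (letters x).length + (letters y).length +
      (letters z).length + (letters w).length < n →
      wdist f x z + wdist f y w ≤
        max (wdist f x y + wdist f z w) (wdist f x w + wdist f y z) + δ)
    (i : ι) {a b c e : ℤ} {x y z w : CyclicProd ι}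
    (hx : NoHead i x) (hy : NoHead i y) (hz : NoHead i z) (hw : NoHead i w)
    (hn : (letters (syl i a * x)).length + (letters (syl i b * y)).length +
      (letters (syl i c * z)).length + (letters (syl i e * w)).length ≤ n)
    (n1 : ¬(a = 0 ∧ b = 0 ∧ c = 0)) (n2 : ¬(a = 0 ∧ b = 0 ∧ e = 0))
    (n3 : ¬(a = 0 ∧ c = 0 ∧ e = 0)) (n4 : ¬(b = 0 ∧ c = 0 ∧ e = 0)) :
    wdist f (syl i a * x) (syl i c * z) + wdist f (syl i b * y) (syl i e * w) ≤
      max (wdist f (syl i a * x) (syl i b * y) + wdist f (syl i c * z) (syl i e * w))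
        (wdist f (syl i a * x) (syl i e * w) + wdist f (syl i b * y) (syl i c * z)) + δ := by
  have trans : ∀ s : ℤ, (s ≠ 0) → ((a = s ∧ b = s ∧ c = s) ∨ (a = s ∧ b = s ∧ e = s) ∨
      (a = s ∧ c = s ∧ e = s) ∨ (b = s ∧ c = s ∧ e = s)) →
      wdist f (syl i a * x) (syl i c * z) + wdist f (syl i b * y) (syl i e * w) ≤
      max (wdist f (syl i a * x) (syl i b * y) + wdist f (syl i c * z) (syl i e * w))
        (wdist f (syl i a * x) (syl i e * w) + wdist f (syl i b * y) (syl i c * z)) + δ := by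
    intro s hs hcase
    have key := ih (syl i (a - s) * x) (syl i (b - s) * y) (syl i (c - s) * z)
      (syl i (e - s) * w) (by
        rw [length_letters_syl_mul _ hx, length_letters_syl_mul _ hy,
          length_letters_syl_mul _ hz, length_letters_syl_mul _ hw] at hn ⊢
        simp only [sub_eq_zero]
        rcases hcase with ⟨rfl, rfl, rfl⟩ | ⟨rfl, rfl, rfl⟩ | ⟨rfl, rfl, rfl⟩ | ⟨rfl, rfl, rfl⟩ <;>
          simp only [hs, if_true, if_false] at hn ⊢ <;> split_ifs <;> omega)
    have tr : ∀ (p : ℤ) (v : CyclicProd ι), syl i p * v = syl i s * (syl i (p - s) * v) := by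
      intro p v
      rw [← mul_assoc, ← syl_add, add_sub_cancel]
    rw [tr a, tr b, tr c, tr e]
    simpa only [wdist_mul_left] using key
  by_cases h1 : a = b ∧ b = c
  · exact trans a (by rintro rfl; exact n1 ⟨rfl, h1.1.symm, by rw [← h1.2, ← h1.1]⟩)
      (Or.inl ⟨rfl, h1.1.symm, by rw [← h1.2, ← h1.1]⟩)
  by_cases h2 : a = b ∧ b = e
  · exact trans a (by rintro rfl; exact n2 ⟨rfl, h2.1.symm, by rw [← h2.2, ← h2.1]⟩)
      (Or.inr (Or.inl ⟨rfl, h2.1.symm, by rw [← h2.2, ← h2.1]⟩))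
  by_cases h3 : a = c ∧ c = e
  · exact trans a (by rintro rfl; exact n3 ⟨rfl, h3.1.symm, by rw [← h3.2, ← h3.1]⟩)
      (Or.inr (Or.inr (Or.inl ⟨rfl, h3.1.symm, by rw [← h3.2, ← h3.1]⟩)))
  by_cases h4 : b = c ∧ c = e
  · exact trans b (by rintro rfl; exact n4 ⟨rfl, h4.1.symm, by rw [← h4.2, ← h4.1]⟩)
      (Or.inr (Or.inr (Or.inr ⟨rfl, h4.1.symm, by rw [← h4.2, ← h4.1]⟩)))
  exact wdist_four_of_heads h i hx hy hz hw h1 h2 h3 h4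

/-- Strong induction on the total number of syllables. If no two words begin with powers of the same
generator, every distance between two of them is the sum of their lengths and the pairings agree.
The error `δ` of a single factor does not accumulate, since the free product is a tree of its
factors. -/
theorem wdist_four (h : IsWeight f δ) (x y z w : CyclicProd ι) :
    wdist f x z + wdist f y w ≤
      max (wdist f x y + wdist f z w) (wdist f x w + wdist f y z) + δ := by
  have hδ := h.delta_nonneg
  obtain ⟨n, hn⟩ : ∃ n, (letters x).length + (letters y).length +
      (letters z).length + (letters w).length = n := ⟨_, rfl⟩
  induction n using Nat.strong_induction_on generalizing x y z w with
  | _ n ih =>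
  have ih' : ∀ x y z w : CyclicProd ι, (letters x).length + (letters y).length +
      (letters z).length + (letters w).length < n →
      wdist f x z + wdist f y w ≤
        max (wdist f x y + wdist f z w) (wdist f x w + wdist f y z) + δ :=
    fun x y z w hlt => ih _ hlt x y z w rfl
  have common : ∀ i : ι, ((∃ a ∈ (letters x).head?, a.1 = i) ∧ (∃ a ∈ (letters y).head?, a.1 = i) ∨
      (∃ a ∈ (letters x).head?, a.1 = i) ∧ (∃ a ∈ (letters z).head?, a.1 = i) ∨
      (∃ a ∈ (letters x).head?, a.1 = i) ∧ (∃ a ∈ (letters w).head?, a.1 = i) ∨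
      (∃ a ∈ (letters y).head?, a.1 = i) ∧ (∃ a ∈ (letters z).head?, a.1 = i) ∨
      (∃ a ∈ (letters y).head?, a.1 = i) ∧ (∃ a ∈ (letters w).head?, a.1 = i) ∨
      (∃ a ∈ (letters z).head?, a.1 = i) ∧ (∃ a ∈ (letters w).head?, a.1 = i)) →
      wdist f x z + wdist f y w ≤
        max (wdist f x y + wdist f z w) (wdist f x w + wdist f y z) + δ := by
    intro i hc
    obtain ⟨a, x', hx, rfl⟩ := exists_head i x
    obtain ⟨b, y', hy, rfl⟩ := exists_head i y
    obtain ⟨c, z', hz, rfl⟩ := exists_head i z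
    obtain ⟨e, w', hw, rfl⟩ := exists_head i w
    have ha := noHead_or_head (p := a) hx
    have hb := noHead_or_head (p := b) hy
    have hc' := noHead_or_head (p := c) hz
    have he := noHead_or_head (p := e) hw
    refine wdist_four_of_common_head h ih' i hx hy hz hw hn.le ?_ ?_ ?_ ?_ <;>
      rintro ⟨rfl, rfl, rfl⟩ <;>
      rcases hc with hc | hc | hc | hc | hc | hc <;>
      first
        | exact ha hc.1 rfl
        | exact hb hc.1 rfl
        | exact hb hc.2 rfl
        | exact hc' hc.1 rfl
        | exact hc' hc.2 rfl
        | exact he hc.2 rfl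
  by_contra hcon
  have heads : ∀ u v : CyclicProd ι, (∀ i, ¬((∃ a ∈ (letters u).head?, a.1 = i) ∧
      (∃ a ∈ (letters v).head?, a.1 = i))) → wdist f u v = len f u + len f v := by
    intro u v huv
    apply len_inv_mul_of_heads_ne h
    intro a ha b hb hab
    exact huv a.1 ⟨⟨a, ha, rfl⟩, ⟨b, hb, hab.symm⟩⟩
  have hno := fun i hi => hcon (common i hi)
  have exz := heads x z (fun i hi => hno i (Or.inr (Or.inl hi)))
  have eyw := heads y w (fun i hi => hno i (Or.inr (Or.inr (Or.inr (Or.inr (Or.inl hi))))))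
  have exy := heads x y (fun i hi => hno i (Or.inl hi))
  have ezw := heads z w (fun i hi => hno i (Or.inr (Or.inr (Or.inr (Or.inr (Or.inr hi))))))
  apply hcon
  rw [exz, eyw, exy, ezw]
  refine le_trans ?_ (add_le_add_left (le_max_left _ _) _)
  linarith

end Words

/-! ### The kernel that models the cusped space -/

section Doubling

variable {V X : Type*} (W : X → X → ℝ) (ends : V → Bool → X) (ht : V → ℝ) (δ : ℝ)

/-- The kernel on points that are seen through a pair of ends at a given height. -/
def endsKernel (v w : V) : ℝ :=
  (Finset.univ : Finset (Bool × Bool)).sup' Finset.univ_nonempty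
    (fun b => W (ends v b.1) (ends w b.2)) - ht v - ht w + δ / 2

theorem le_endsKernel (v w : V) (b b' : Bool) :
    W (ends v b) (ends w b') - ht v - ht w + δ / 2 ≤ endsKernel W ends ht δ v w := by
  unfold endsKernel
  have := Finset.le_sup' (fun b : Bool × Bool => W (ends v b.1) (ends w b.2))
    (Finset.mem_univ (b, b'))
  simp only at this
  linarith

theorem exists_endsKernel (v w : V) : ∃ b b' : Bool,
    endsKernel W ends ht δ v w = W (ends v b) (ends w b') - ht v - ht w + δ / 2 := by
  obtain ⟨b, -, hb⟩ := Finset.exists_mem_eq_sup' (s := (Finset.univ : Finset (Bool × Bool)))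
    Finset.univ_nonempty (fun b => W (ends v b.1) (ends w b.2))
  exact ⟨b.1, b.2, by unfold endsKernel; rw [hb]⟩

/-- A point halfway between its two ends is seen like a virtual point: at the distance of the
farther end, less its height. Maxima over ends preserve the four-point inequality, because the ends
that maximise the left side are admissible on the right. The shift `δ / 2` makes the kernel
nonnegative. -/
theorem isHypKernel_endsKernel (hδ : 0 ≤ δ) (hsymm : ∀ x y, W x y = W y x)
    (hself : ∀ x, W x x = 0)
    (hfour : ∀ x y z w, W x z + W y w ≤ max (W x y + W z w) (W x w + W y z) + δ)
    (hlow : ∀ v, 2 * ht v ≤ W (ends v true) (ends v false)) (hht : ∀ v, 0 ≤ ht v)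
    (hup : ∀ v, W (ends v true) (ends v false) ≤ 2 * ht v + 2) :
    IsHypKernel (endsKernel W ends ht δ) δ (2 + δ / 2) where
  delta_nonneg := hδ
  symm x y := by
    obtain ⟨b, b', h⟩ := exists_endsKernel W ends ht δ x y
    obtain ⟨c, c', h'⟩ := exists_endsKernel W ends ht δ y x
    have h1 := le_endsKernel W ends ht δ x y c' c
    have h2 := le_endsKernel W ends ht δ y x b' b
    rw [hsymm] at h1 h2
    apply le_antisymm <;> linarith
  nonneg x y := by
    have h4 := hfour (ends x true) (ends y true) (ends x false) (ends y false)
    have a1 := le_endsKernel W ends ht δ x y true true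
    have a2 := le_endsKernel W ends ht δ x y true false
    have a3 := le_endsKernel W ends ht δ x y false true
    have a4 := le_endsKernel W ends ht δ x y false false
    have l1 := hlow x
    have l2 := hlow y
    rw [hsymm (ends y true) (ends x false)] at h4
    rcases max_cases (W (ends x true) (ends y true) + W (ends x false) (ends y false))
      (W (ends x true) (ends y false) + W (ends x false) (ends y true)) with ⟨e, _⟩ | ⟨e, _⟩ <;>
      rw [e] at h4 <;> linarith
  self_le x := by
    obtain ⟨b, b', h⟩ := exists_endsKernel W ends ht δ x x
    have l1 := hup x
    have l2 := hht x
    have l3 := hsymm (ends x true) (ends x false)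
    rw [h]
    have l4 := hself (ends x true)
    have l5 := hself (ends x false)
    cases b <;> cases b' <;> linarith
  four x y z w := by
    obtain ⟨a, c, h1⟩ := exists_endsKernel W ends ht δ x z
    obtain ⟨b, e, h2⟩ := exists_endsKernel W ends ht δ y w
    have h4 := hfour (ends x a) (ends y b) (ends z c) (ends w e)
    have a1 := le_endsKernel W ends ht δ x y a b
    have a2 := le_endsKernel W ends ht δ z w c e
    have a3 := le_endsKernel W ends ht δ x w a e
    have a4 := le_endsKernel W ends ht δ y z b c
    rw [h1, h2]
    rcases max_cases (W (ends x a) (ends y b) + W (ends z c) (ends w e))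
      (W (ends x a) (ends w e) + W (ends y b) (ends z c)) with ⟨e', _⟩ | ⟨e', _⟩ <;> rw [e'] at h4
    · refine le_trans ?_ (add_le_add_left (le_max_left _ _) _)
      linarith
    · refine le_trans ?_ (add_le_add_left (le_max_right _ _) _)
      linarith

end Doubling

/-! ### The weights of the syllables -/

/-- The weight of a peripheral syllable. -/
def logWeight (p : ℤ) : ℝ := 2 * Real.logb 2 (1 + |(p : ℝ)|)

theorem logWeight_le {p : ℤ} {t : ℝ} (h : 1 + |(p : ℝ)| ≤ 2 ^ t) : logWeight p ≤ 2 * t := by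
  unfold logWeight
  have := Real.logb_le_logb_of_le (b := 2) (by norm_num) (by positivity) h
  rw [Real.logb_rpow (by norm_num) (by norm_num)] at this
  linarith

theorem le_logWeight {p : ℤ} {t : ℝ} (h : 2 ^ t ≤ 1 + |(p : ℝ)|) : 2 * t ≤ logWeight p := by
  unfold logWeight
  have := Real.logb_le_logb_of_le (b := 2) (by norm_num) (by positivity) h
  rw [Real.logb_rpow (by norm_num) (by norm_num)] at this
  linarith

theorem two_le_logWeight {p : ℤ} (hp : p ≠ 0) : 2 ≤ logWeight p := by
  have h1 : (1 : ℝ) ≤ |(p : ℝ)| := by exact_mod_cast Int.one_le_abs hp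
  have := le_logWeight (p := p) (t := 1) (by rw [Real.rpow_one]; linarith)
  linarith

theorem logWeight_nonneg (p : ℤ) : 0 ≤ logWeight p := by
  have := le_logWeight (p := p) (t := 0) (by rw [Real.rpow_zero]; linarith [abs_nonneg (p : ℝ)])
  linarith

/-- From `1 + |p + q| ≤ 2 * (1 + max |p| |q|)`: the logarithm turns the triangle inequality of the
integers into an ultrametric one up to a constant. -/
theorem logWeight_ultra (p q : ℤ) :
    logWeight (p + q) ≤ max (logWeight p) (logWeight q) + 2 := by
  have key : ∀ a b : ℤ, |(a : ℝ)| ≤ |(b : ℝ)| → logWeight (a + b) ≤ logWeight b + 2 := by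
    intro a b hab
    unfold logWeight
    have h1 : (1 : ℝ) + |((a + b : ℤ) : ℝ)| ≤ 2 * (1 + |(b : ℝ)|) := by
      push_cast
      linarith [abs_add_le (a : ℝ) b]
    have := Real.logb_le_logb_of_le (b := 2) (by norm_num) (by positivity) h1
    rw [Real.logb_mul (by norm_num) (by positivity), Real.logb_self_eq_one (by norm_num)] at this
    linarith
  rcases le_total |(p : ℝ)| |(q : ℝ)| with h | h
  · exact (key p q h).trans (add_le_add_left (le_max_right _ _) _)
  · rw [add_comm p q]
    exact (key q p h).trans (add_le_add_left (le_max_left _ _) _)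

theorem logWeight_neg (p : ℤ) : logWeight (-p) = logWeight p := by simp [logWeight]

theorem logWeight_add_le (p q : ℤ) : logWeight (p + q) ≤ logWeight p + logWeight q := by
  unfold logWeight
  have h1 : (1 : ℝ) + |((p + q : ℤ) : ℝ)| ≤ (1 + |(p : ℝ)|) * (1 + |(q : ℝ)|) := by
    push_cast
    nlinarith [abs_add_le (p : ℝ) q, mul_nonneg (abs_nonneg (p : ℝ)) (abs_nonneg (q : ℝ))]
  have := Real.logb_le_logb_of_le (b := 2) (by norm_num) (by positivity) h1
  rw [Real.logb_mul (by positivity) (by positivity)] at this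
  linarith

/-- Ultrametrics satisfy the four-point inequality. Each ultrametric inequality has error 2, and two
of them are added. -/
theorem logWeight_four (x y z w : ℤ) : logWeight (x - z) + logWeight (y - w) ≤
    max (logWeight (x - y) + logWeight (z - w)) (logWeight (x - w) + logWeight (y - z)) + 4 := by
  have hs : ∀ p q, logWeight (p - q) = logWeight (q - p) := fun p q => by
    rw [← logWeight_neg (p - q), neg_sub]
  have tri : ∀ a b c : ℤ, logWeight (a - c) ≤ max (logWeight (a - b)) (logWeight (b - c)) + 2 :=
    fun a b c => by
      have := logWeight_ultra (a - b) (b - c)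
      rwa [sub_add_sub_cancel] at this
  have h1 := tri x y z
  have h2 := tri x w z
  have h3 := tri y x w
  have h4 := tri y z w
  rw [hs w z] at h2
  rw [hs y x] at h3
  by_contra hcon
  push Not at hcon
  have c1 := (add_le_add_left (le_max_left (logWeight (x - y) + logWeight (z - w))
    (logWeight (x - w) + logWeight (y - z))) 4).trans_lt hcon
  have c2 := (add_le_add_left (le_max_right (logWeight (x - y) + logWeight (z - w))
    (logWeight (x - w) + logWeight (y - z))) 4).trans_lt hcon
  rcases max_cases (logWeight (x - y)) (logWeight (y - z)) with ⟨e1, _⟩ | ⟨e1, _⟩ <;>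
  rcases max_cases (logWeight (x - w)) (logWeight (z - w)) with ⟨e2, _⟩ | ⟨e2, _⟩ <;>
  rcases max_cases (logWeight (x - y)) (logWeight (x - w)) with ⟨e3, _⟩ | ⟨e3, _⟩ <;>
  rcases max_cases (logWeight (y - z)) (logWeight (z - w)) with ⟨e4, _⟩ | ⟨e4, _⟩ <;>
  rw [e1] at h1 <;> rw [e2] at h2 <;> rw [e3] at h3 <;> rw [e4] at h4 <;> linarith

theorem abs_four (x y z w : ℝ) : |x - z| + |y - w| ≤
    max (|x - y| + |z - w|) (|x - w| + |y - z|) := by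
  rcases max_cases (|x - y| + |z - w|) (|x - w| + |y - z|) with ⟨e, h⟩ | ⟨e, h⟩ <;> rw [e] <;>
  rcases abs_cases (x - z) with ⟨e1, _⟩ | ⟨e1, _⟩ <;>
  rcases abs_cases (y - w) with ⟨e2, _⟩ | ⟨e2, _⟩ <;>
  rcases abs_cases (x - y) with ⟨e3, _⟩ | ⟨e3, _⟩ <;>
  rcases abs_cases (z - w) with ⟨e4, _⟩ | ⟨e4, _⟩ <;>
  rcases abs_cases (x - w) with ⟨e5, _⟩ | ⟨e5, _⟩ <;>
  rcases abs_cases (y - z) with ⟨e6, _⟩ | ⟨e6, _⟩ <;>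
  rw [e1, e2] <;> simp only [e3, e4, e5, e6] at h ⊢ <;> linarith

/-- The weights: powers of the first `k` generators have their usual length, powers of the last
`l` generators have logarithmic length. -/
def wt (k l : ℕ) : Fin k ⊕ Fin l → ℤ → ℝ :=
  Sum.elim (fun _ p => |(p : ℝ)|) (fun _ p => logWeight p)

theorem isWeight_wt (k l : ℕ) : IsWeight (wt k l) 4 where
  delta_nonneg := by norm_num
  zero i := by cases i <;> simp [wt, logWeight]
  one_le i p hp := by
    cases i with
    | inl i => simp only [wt, Sum.elim_inl]; exact_mod_cast Int.one_le_abs hp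
    | inr i => simp only [wt, Sum.elim_inr]; linarith [two_le_logWeight hp]
  neg i p := by cases i <;> simp [wt, logWeight]
  add_le i p q := by
    cases i with
    | inl i => simp only [wt, Sum.elim_inl]; push_cast; exact abs_add_le _ _
    | inr i => exact logWeight_add_le p q
  four i x y z w := by
    cases i with
    | inl i =>
      simp only [wt, Sum.elim_inl]; push_cast
      linarith [abs_four (x : ℝ) y z w]
    | inr i => exact logWeight_four x y z w

/-! ### The cusped space of a free product of cyclic groups -/

/-- The appended syllable meets the first one only if `y` is trivial or a power of `j`. In the
second case the product is still a power of `j`, and `j ≠ i`. -/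
theorem noHead_mul_syl {ι : Type*} [DecidableEq ι] (j : ι) (q : ℤ) (y : CyclicProd ι) :
    ∀ i, NoHead i y → (y ≠ 1 ∨ i ≠ j) → NoHead i (y * syl j q) := by
  induction y using syl_induction with
  | one =>
    intro i _ hi
    have hij : i ≠ j := by tauto
    rw [one_mul]
    by_cases hq : q = 0
    · rw [hq, syl_zero]; exact noHead_one i
    · rw [NoHead, letters_syl hq]
      simpa using hij.symm
  | mul a p x hp hx ih =>
    intro i hi _
    rw [NoHead, letters_syl_mul hp hx] at hi
    have hai : a ≠ i := by simpa using hi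
    by_cases hc : x ≠ 1 ∨ a ≠ j
    · rw [mul_assoc]
      exact noHead_syl_mul hai hp (ih a hx hc)
    · push Not at hc
      rw [hc.1, mul_one, hc.2, ← syl_add]
      rw [hc.2] at hai
      by_cases hq : p + q = 0
      · rw [hq, syl_zero]; exact noHead_one i
      · rw [NoHead, letters_syl hq]
        simpa using hai

/-! ### The model kernel and peripheral distances -/

section CuspedFree

variable {Γ : Type*} [Group Γ] {k l : ℕ} (e : Γ ≃* CyclicProd (Fin k ⊕ Fin l))
  {P : Fin l → Subgroup Γ} {G : Set Γ}

/-- The peripheral subgroups are generated by the last generators. -/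
def IsStdPeripheral (P : Fin l → Subgroup Γ) : Prop :=
  ∀ j g, g ∈ P j ↔ ∃ q : ℤ, e g = syl (Sum.inr j) q

/-- The sign of an end. -/
def endSign (b : Bool) : ℤ := if b then 1 else -1

/-- The two ends through which a vertex of the cusped space is seen. -/
def cuspEnds : CuspedVertex Γ l → Bool → CyclicProd (Fin k ⊕ Fin l)
  | .base g, _ => e g
  | .horo j g n, b => e g * syl (Sum.inr j) (endSign b * 2 ^ n)

/-- The height of a vertex of the cusped space. -/
def height : CuspedVertex Γ l → ℝ
  | .base _ => 0
  | .horo _ _ n => n + 1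

/-- The kernel that models the distance of the cusped space. -/
def cuspKernel : CuspedVertex Γ l → CuspedVertex Γ l → ℝ :=
  endsKernel (wdist (wt k l)) (cuspEnds e) height 4

theorem wdist_mul_syl (x : CyclicProd (Fin k ⊕ Fin l)) (j : Fin l) (p q : ℤ) :
    wdist (wt k l) (x * syl (Sum.inr j) p) (x * syl (Sum.inr j) q) = logWeight (q - p) := by
  rw [wdist_mul_left, wdist, ← syl_neg, ← syl_add, len_syl (isWeight_wt k l), neg_add_eq_sub]
  rfl

/-- The two ends of a vertex of height `n + 1` differ by the exponent `2 ^ (n + 1)`, so their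
distance is `2 log₂ (1 + 2 ^ (n + 1))`, between twice the height and twice the height plus 2. The
vertex is their midpoint up to a bounded error. -/
theorem isHypKernel_cuspKernel : IsHypKernel (cuspKernel e) 4 4 := by
  have hw := isWeight_wt k l
  have := isHypKernel_endsKernel (wdist (wt k l)) (cuspEnds e) height 4 (by norm_num)
    (wdist_comm hw) (fun x => by simp [wdist, len_one]) (wdist_four hw) ?_ ?_ ?_
  · norm_num at this
    exact this
  · rintro (g | ⟨j, g, n⟩)
    · simp [height, cuspEnds, wdist, len_one]
    · simp only [height, cuspEnds, wdist_mul_syl]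
      apply le_logWeight
      norm_num [endSign]
      rw [abs_of_nonpos (by have : (0 : ℝ) < 2 ^ n := by positivity
                            linarith)]
      rw [← Nat.cast_succ, Real.rpow_natCast, pow_succ]
      linarith
  · rintro (g | ⟨j, g, n⟩)
    · simp [height]
    · simp only [height]; positivity
  · rintro (g | ⟨j, g, n⟩)
    · simp [height, cuspEnds, wdist, len_one]
    · simp only [height, cuspEnds, wdist_mul_syl]
      have := logWeight_le (p := endSign false * 2 ^ n - endSign true * 2 ^ n)
        (t := (n : ℝ) + 1 + 1) ?_
      · linarith
      · norm_num [endSign]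
        rw [abs_of_nonpos (by have : (0 : ℝ) < 2 ^ n := by positivity
                              linarith)]
        rw [show ((n : ℝ) + 1 + 1) = ((n + 1 + 1 : ℕ) : ℝ) by push_cast; ring, Real.rpow_natCast,
          pow_succ, pow_succ]
        have : (1 : ℝ) ≤ 2 ^ n := one_le_pow₀ (by norm_num)
        linarith

theorem mulCayley_reachable {Γ : Type*} [Group Γ] (s : Set Γ) {x : Γ}
    (hx : x ∈ Subgroup.closure s) (g : Γ) : (SimpleGraph.mulCayley s).Reachable g (g * x) := by
  induction hx using Subgroup.closure_induction generalizing g with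
  | mem x hx =>
    by_cases h1 : g = g * x
    · rw [← h1]
    · exact SimpleGraph.Adj.reachable ((SimpleGraph.mulCayley_adj s _ _).2
        ⟨h1, Or.inl (by simpa using hx)⟩)
  | one => simp
  | mul x y _ _ hx hy =>
    rw [← mul_assoc]
    exact (hx g).trans (hy (g * x))
  | inv x _ hx =>
    have := hx (g * x⁻¹)
    rw [inv_mul_cancel_right] at this
    exact this.symm

/-- Left translations act on the Cayley graph, so one walk from 1 to `s` can be repeated; negative
powers are reached by reversal. -/
theorem exists_walk_zpow {Γ : Type*} [Group Γ] {S : Set Γ} {s : Γ}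
    (hs : s ∈ Subgroup.closure S) : ∃ K : ℕ, ∀ (g h : Γ) (q : ℤ), h = g * s ^ q →
      ∃ p : (SimpleGraph.mulCayley S).Walk g h, p.length ≤ K * q.natAbs := by
  obtain ⟨w, hw⟩ := (mulCayley_reachable _ hs 1).exists_walk_length_eq_dist
  have step : ∀ (n : ℕ) (g : Γ), ∃ p : (SimpleGraph.mulCayley S).Walk g (g * s ^ n),
      p.length = w.length * n := by
    intro n
    induction n with
    | zero => intro g; exact ⟨SimpleGraph.Walk.nil.copy rfl (by simp), by simp⟩
    | succ n ih =>
      intro g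
      obtain ⟨p, hp⟩ := ih g
      let φ : SimpleGraph.mulCayley S →g SimpleGraph.mulCayley S :=
        ⟨fun x => g * s ^ n * x, fun h => (SimpleGraph.mulCayley_adj_mul_iff_right).2 h⟩
      refine ⟨p.append ((w.map φ).copy (by simp [φ]) (by simp [φ, pow_succ, mul_assoc])), ?_⟩
      simp [hp]; ring
  have step' : ∀ (n : ℕ) (g h : Γ), h = g * s ^ n →
      ∃ p : (SimpleGraph.mulCayley S).Walk g h, p.length ≤ w.length * n := by
    rintro n g _ rfl
    obtain ⟨p, hp⟩ := step n g
    exact ⟨p, hp.le⟩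
  refine ⟨w.length, fun g h q hgh => ?_⟩
  rcases Int.natAbs_eq q with hqn | hqn
  · refine step' q.natAbs g h ?_
    rw [hgh]
    conv_lhs => rw [hqn, zpow_natCast]
  · obtain ⟨p, hp⟩ := step' q.natAbs h g (by
      rw [hgh, ← zpow_natCast, mul_assoc, ← zpow_add]
      conv_rhs => rw [show q + (q.natAbs : ℤ) = 0 by omega]
      simp)
    exact ⟨p.reverse, by simpa using hp⟩

variable {e}

/-- A compatible set contains only finitely many peripheral generators, each a bounded power of the
cusp generator. Together with `periphDist_le` this makes the peripheral distance comparable with the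
exponent, whatever the generating set. -/
theorem exists_syl_of_walk (hP : IsStdPeripheral e P) (hG : IsCompatible P G) (j : Fin l) :
    ∃ K : ℝ, 0 ≤ K ∧ ∀ (g h : Γ) (w : (SimpleGraph.mulCayley (G ∩ (P j : Set Γ))).Walk g h),
      ∃ q : ℤ, e (g⁻¹ * h) = syl (Sum.inr j) q ∧ |(q : ℝ)| ≤ K * w.length := by
  have hfin : (G ∩ (P j : Set Γ)).Finite := hG.1.subset Set.inter_subset_left
  have hex : ∀ x ∈ G ∩ (P j : Set Γ), ∃ q : ℤ, e x = syl (Sum.inr j) q :=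
    fun x hx => (hP j x).1 hx.2
  choose! q hq using hex
  obtain ⟨K, hK⟩ := (hfin.image fun x => |(q x : ℝ)|).bddAbove
  refine ⟨max K 0, le_max_right _ _, fun g h w => ?_⟩
  induction w with
  | nil => exact ⟨0, by simp [syl_zero], by simp⟩
  | @cons u v w hadj p ih =>
    obtain ⟨a, ha, hab⟩ := ih
    rw [SimpleGraph.mulCayley_adj] at hadj
    have hb : ∃ b : ℤ, e (u⁻¹ * v) = syl (Sum.inr j) b ∧ |(b : ℝ)| ≤ max K 0 := by
      rcases hadj.2 with h1 | h1
      · exact ⟨q _, hq _ h1, (hK ⟨_, h1, rfl⟩).trans (le_max_left _ _)⟩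
      · refine ⟨-q (v⁻¹ * u), ?_, ?_⟩
        · rw [syl_neg, ← hq _ h1, ← map_inv]; congr 1; group
        · push_cast
          rw [abs_neg]
          exact (hK ⟨_, h1, rfl⟩).trans (le_max_left _ _)
    obtain ⟨b, hb, hbb⟩ := hb
    refine ⟨b + a, ?_, ?_⟩
    · rw [syl_add, ← hb, ← ha, ← map_mul]; congr 1; group
    · rw [SimpleGraph.Walk.length_cons]
      push_cast
      linarith [abs_add_le (b : ℝ) a]

theorem abs_le_periphDist (hP : IsStdPeripheral e P) (hG : IsCompatible P G) (j : Fin l) :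
    ∃ K : ℝ, 0 ≤ K ∧ ∀ (g h : Γ) (q : ℤ), e (g⁻¹ * h) = syl (Sum.inr j) q →
      |(q : ℝ)| ≤ K * periphDist P G j g h := by
  obtain ⟨K, hK0, hK⟩ := exists_syl_of_walk hP hG j
  refine ⟨K, hK0, fun g h q hq => ?_⟩
  have hmem : g⁻¹ * h ∈ Subgroup.closure (G ∩ (P j : Set Γ)) := by
    rw [hG.2.2 j]
    exact (hP j _).2 ⟨q, hq⟩
  have hr := mulCayley_reachable _ hmem g
  rw [mul_inv_cancel_left] at hr
  obtain ⟨w, hw⟩ := hr.exists_walk_length_eq_dist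
  obtain ⟨a, ha, hab⟩ := hK g h w
  have hqa : q = a := by
    by_contra hne
    have : syl (Sum.inr j : Fin k ⊕ Fin l) (q - a) = 1 := by
      rw [sub_eq_add_neg, syl_add, syl_neg, ← hq, ← ha, mul_inv_cancel]
    have := congrArg letters this
    rw [letters_syl (sub_ne_zero.2 hne), letters_one] at this
    simp at this
  rw [hqa]
  unfold periphDist
  rw [← hw]
  exact hab

theorem periphDist_le (hP : IsStdPeripheral e P) (hG : IsCompatible P G) (j : Fin l) :
    ∃ K : ℕ, 1 ≤ K ∧ ∀ (g h : Γ) (q : ℤ), e (g⁻¹ * h) = syl (Sum.inr j) q →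
      periphDist P G j g h ≤ K * q.natAbs := by
  have hsP : e.symm (syl (Sum.inr j) 1) ∈ Subgroup.closure (G ∩ (P j : Set Γ)) := by
    rw [hG.2.2 j]
    exact (hP j _).2 ⟨1, by simp⟩
  obtain ⟨K, hK⟩ := exists_walk_zpow hsP
  refine ⟨K + 1, by omega, fun g h q hq => ?_⟩
  obtain ⟨p, hp⟩ := hK g h q (by
    apply e.injective
    rw [map_mul, map_zpow, MulEquiv.apply_symm_apply, syl_zpow, mul_one, ← hq, ← map_mul]
    congr 1; group)
  exact (SimpleGraph.dist_le p).trans (hp.trans (Nat.mul_le_mul_right _ (by omega)))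

end CuspedFree

/-! ### Upper bounds on the cusped distance by explicit walks -/

section CuspedWalks

variable {Γ : Type*} [Group Γ] {k l : ℕ} {e : Γ ≃* CyclicProd (Fin k ⊕ Fin l)}
  {P : Fin l → Subgroup Γ} {G : Set Γ}

/-- There is a walk of length at most `t` in the cusped space. -/
def WalkLe (P : Fin l → Subgroup Γ) (G : Set Γ) (v w : CuspedVertex Γ l) (t : ℝ) : Prop :=
  ∃ p : (cuspedGraph P G).Walk v w, (p.length : ℝ) ≤ t

theorem WalkLe.trans {v w x : CuspedVertex Γ l} {t t' : ℝ} (h : WalkLe P G v w t)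
    (h' : WalkLe P G w x t') : WalkLe P G v x (t + t') := by
  obtain ⟨p, hp⟩ := h
  obtain ⟨q, hq⟩ := h'
  exact ⟨p.append q, by rw [SimpleGraph.Walk.length_append]; push_cast; linarith⟩

theorem WalkLe.symm {v w : CuspedVertex Γ l} {t : ℝ} (h : WalkLe P G v w t) :
    WalkLe P G w v t := by
  obtain ⟨p, hp⟩ := h
  exact ⟨p.reverse, by rwa [SimpleGraph.Walk.length_reverse]⟩

theorem WalkLe.mono {v w : CuspedVertex Γ l} {t t' : ℝ} (h : WalkLe P G v w t) (ht : t ≤ t') :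
    WalkLe P G v w t' := by
  obtain ⟨p, hp⟩ := h
  exact ⟨p, hp.trans ht⟩

theorem WalkLe.refl (v : CuspedVertex Γ l) {t : ℝ} (ht : 0 ≤ t) : WalkLe P G v v t :=
  ⟨SimpleGraph.Walk.nil, by simpa using ht⟩

theorem WalkLe.of_rel {v w : CuspedVertex Γ l} (h : CuspedRel P G v w) : WalkLe P G v w 1 := by
  by_cases hvw : v = w
  · subst hvw; exact WalkLe.refl _ zero_le_one
  · have : (cuspedGraph P G).Adj v w := (SimpleGraph.fromRel_adj _ _ _).2 ⟨hvw, Or.inl h⟩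
    exact ⟨this.toWalk, by simp⟩

theorem WalkLe.dist_le {v w : CuspedVertex Γ l} {t : ℝ} (h : WalkLe P G v w t) :
    ((cuspedGraph P G).dist v w : ℝ) ≤ t := by
  obtain ⟨p, hp⟩ := h
  exact le_trans (by exact_mod_cast SimpleGraph.dist_le p) hp

theorem walkLe_vertical (j : Fin l) (g : Γ) {n N : ℕ} (h : n ≤ N) :
    WalkLe P G (.horo j g n) (.horo j g N) (N - n) := by
  induction N, h using Nat.le_induction with
  | base => exact WalkLe.refl _ (by simp)
  | succ N hN ih =>
    refine (ih.trans (WalkLe.of_rel (.vertical j g N))).mono ?_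
    push_cast; linarith

theorem walkLe_horo_aux (j : Fin l) {g h : Γ} {n n' N : ℕ} (hn : n ≤ N) (hn' : n' ≤ N)
    (hgh : g⁻¹ * h ∈ P j) (hd : periphDist P G j g h ≤ 2 ^ (N + 1)) :
    WalkLe P G (.horo j g n) (.horo j h n') (2 * N - n - n' + 1) := by
  refine (((walkLe_vertical j g hn).trans (WalkLe.of_rel (.horizontal j g h N hgh hd))).trans
    (walkLe_vertical j h hn').symm).mono ?_
  linarith

/-- Climb to a common level, cross by one horizontal edge, and descend. -/
theorem walkLe_horo (hP : IsStdPeripheral e P) (hG : IsCompatible P G) (j : Fin l) :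
    ∃ c : ℝ, 0 ≤ c ∧ ∀ (g h : Γ) (n n' : ℕ) (q : ℤ), e (g⁻¹ * h) = syl (Sum.inr j) q →
      WalkLe P G (.horo j g n) (.horo j h n')
        (2 * Real.logb 2 (1 + |(q : ℝ)| + 2 ^ n + 2 ^ n') - n - n' + c) := by
  obtain ⟨K, hK1, hK⟩ := periphDist_le hP hG j
  have hK1' : (1 : ℝ) ≤ K := by exact_mod_cast hK1
  have hlogK : 0 ≤ Real.logb 2 K := Real.logb_nonneg (by norm_num) hK1'
  refine ⟨2 * Real.logb 2 K + 3, by linarith, fun g h n n' q hq => ?_⟩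
  set A : ℝ := 1 + |(q : ℝ)| + 2 ^ n + 2 ^ n' with hA
  have hApos : 0 < A := by positivity
  have hA1 : 1 ≤ A := by
    rw [hA]
    have : (0 : ℝ) ≤ |(q : ℝ)| + 2 ^ n + 2 ^ n' := by positivity
    linarith
  have hKA : 1 ≤ K * A := one_le_mul_of_one_le_of_one_le hK1' hA1
  -- The level at which `2 ^ N` is at least `K * A`: since `A` exceeds `2 ^ n`, `2 ^ n'` and `|q|`,
  -- this is above both vertices and makes the horizontal edge available.
  set N := ⌈Real.logb 2 (K * A)⌉₊ with hN
  have hlogKA : 0 ≤ Real.logb 2 (K * A) := Real.logb_nonneg (by norm_num) hKA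
  have hNle : (N : ℝ) ≤ Real.logb 2 K + Real.logb 2 A + 1 := by
    rw [← Real.logb_mul (by positivity) (by positivity)]
    exact (Nat.ceil_lt_add_one hlogKA).le
  have hpow : K * A ≤ 2 ^ N := by
    rw [← Real.rpow_natCast, ← Real.logb_le_iff_le_rpow (by norm_num) (by linarith)]
    exact Nat.le_ceil _
  have hAK : A ≤ K * A := by nlinarith
  have hle : ∀ r : ℕ, (2 : ℝ) ^ r ≤ A → r ≤ N := by
    intro r hr
    have h1 : (2 : ℝ) ^ r ≤ 2 ^ N := hr.trans (hAK.trans hpow)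
    exact (pow_le_pow_iff_right₀ (by norm_num)).1 h1
  have hq0 := abs_nonneg (q : ℝ)
  have p1 : (0 : ℝ) < 2 ^ n := by positivity
  have p2 : (0 : ℝ) < 2 ^ n' := by positivity
  have hd : periphDist P G j g h ≤ 2 ^ (N + 1) := by
    have h1 : (periphDist P G j g h : ℝ) ≤ K * |(q : ℝ)| := by
      have := hK g h q hq
      have h2 : (periphDist P G j g h : ℝ) ≤ ((K * q.natAbs : ℕ) : ℝ) := by exact_mod_cast this
      rwa [Nat.cast_mul, Nat.cast_natAbs, Int.cast_abs] at h2
    have h3 : K * |(q : ℝ)| ≤ K * A := by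
      apply mul_le_mul_of_nonneg_left _ (by positivity)
      linarith
    have h4 : (periphDist P G j g h : ℝ) ≤ 2 ^ (N + 1) := by
      rw [pow_succ]
      have : (0 : ℝ) < 2 ^ N := by positivity
      linarith
    exact_mod_cast h4
  refine (walkLe_horo_aux j (hle n (by linarith)) (hle n' (by linarith)) ((hP j _).2 ⟨q, hq⟩)
    hd).mono ?_
  linarith

theorem logb_two_mul_le {x y : ℝ} (hx : 0 < x) (hy : 0 < y) (h : x ≤ 4 * y) :
    Real.logb 2 x ≤ Real.logb 2 y + 2 := by
  have := Real.logb_le_logb_of_le (b := 2) (by norm_num) hx h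
  rw [Real.logb_mul (by norm_num) hy.ne'] at this
  have h4 : Real.logb 2 4 = 2 := by
    rw [show (4 : ℝ) = 2 ^ (2 : ℝ) by norm_num]
    exact Real.logb_rpow (by norm_num) (by norm_num)
  linarith

theorem walkLe_base_horo (hP : IsStdPeripheral e P) (hG : IsCompatible P G) (j : Fin l) :
    ∃ c : ℝ, 0 ≤ c ∧ ∀ (g h : Γ) (n : ℕ) (q : ℤ), e (g⁻¹ * h) = syl (Sum.inr j) q →
      WalkLe P G (.base g) (.horo j h n)
        (2 * Real.logb 2 (1 + |(q : ℝ)| + 2 ^ n) - n + c) := by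
  obtain ⟨c, hc, hw⟩ := walkLe_horo hP hG j
  refine ⟨c + 5, by linarith, fun g h n q hq => ?_⟩
  refine ((WalkLe.of_rel (.vertical_base j g)).trans (hw g h 0 n q hq)).mono ?_
  have := logb_two_mul_le (x := 1 + |(q : ℝ)| + 2 ^ 0 + 2 ^ n) (y := 1 + |(q : ℝ)| + 2 ^ n)
    (by positivity) (by positivity) (by
      have : (0 : ℝ) < 2 ^ n := by positivity
      have := abs_nonneg (q : ℝ)
      norm_num; linarith)
  push_cast
  linarith

theorem walkLe_base_base (hP : IsStdPeripheral e P) (hG : IsCompatible P G) (j : Fin l) :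
    ∃ c : ℝ, 0 ≤ c ∧ ∀ (g h : Γ) (q : ℤ), e (g⁻¹ * h) = syl (Sum.inr j) q →
      WalkLe P G (.base g) (.base h) (logWeight q + c) := by
  obtain ⟨c, hc, hw⟩ := walkLe_base_horo hP hG j
  refine ⟨c + 5, by linarith, fun g h q hq => ?_⟩
  refine ((hw g h 0 q hq).trans (WalkLe.of_rel (.vertical_base j h)).symm).mono ?_
  have := logb_two_mul_le (x := 1 + |(q : ℝ)| + 2 ^ 0) (y := 1 + |(q : ℝ)|)
    (by positivity) (by positivity) (by
      have := abs_nonneg (q : ℝ)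
      norm_num; linarith)
  unfold logWeight
  push_cast
  linarith

/-- A non-trivial peripheral syllable has weight at least 2, so the additive constant of
`walkLe_base_base` is absorbed into a factor. This permits summation over syllables in
`walkLe_base`. -/
theorem walkLe_syl (hP : IsStdPeripheral e P) (hG : IsCompatible P G) (i : Fin k ⊕ Fin l) :
    ∃ W : ℝ, 0 ≤ W ∧ ∀ (g h : Γ) (p : ℤ), e (g⁻¹ * h) = syl i p →
      WalkLe P G (.base g) (.base h) (W * wt k l i p) := by
  have triv : ∀ (g h : Γ), e (g⁻¹ * h) = syl i 0 → h = g := by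
    intro g h hgh
    rw [syl_zero, map_eq_one_iff e e.injective, inv_mul_eq_one] at hgh
    exact hgh.symm
  cases i with
  | inl i =>
    have hs : e.symm (syl (Sum.inl i) 1) ∈ Subgroup.closure G := by rw [hG.2.1]; trivial
    obtain ⟨K, hK⟩ := exists_walk_zpow hs
    refine ⟨K, by positivity, fun g h p hp => ?_⟩
    obtain ⟨w, hw⟩ := hK g h p (by
      apply e.injective
      rw [map_mul, map_zpow, MulEquiv.apply_symm_apply, syl_zpow, mul_one, ← hp, ← map_mul]
      congr 1; group)
    let φ : SimpleGraph.mulCayley G →g cuspedGraph P G :=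
      ⟨fun x => .base x, fun {a b} hab => (SimpleGraph.fromRel_adj _ _ _).2
        ⟨fun heq => hab.ne (by injection heq), Or.inl (.cayley a b hab)⟩⟩
    refine ⟨w.map φ, ?_⟩
    rw [SimpleGraph.Walk.length_map]
    have h2 : (w.length : ℝ) ≤ ((K * p.natAbs : ℕ) : ℝ) := by exact_mod_cast hw
    rwa [Nat.cast_mul, Nat.cast_natAbs, Int.cast_abs] at h2
  | inr j =>
    obtain ⟨c, hc, hw⟩ := walkLe_base_base hP hG j
    refine ⟨1 + c, by linarith, fun g h p hp => ?_⟩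
    by_cases h0 : p = 0
    · subst h0
      rw [triv g h hp]
      exact WalkLe.refl _ (by simp [wt, logWeight])
    · refine (hw g h p hp).mono ?_
      have := two_le_logWeight h0
      simp only [wt, Sum.elim_inr]
      nlinarith

theorem walkLe_base (hP : IsStdPeripheral e P) (hG : IsCompatible P G) :
    ∃ W : ℝ, 0 < W ∧ ∀ (g h : Γ), WalkLe P G (.base g) (.base h)
      (W * len (wt k l) (e (g⁻¹ * h))) := by
  choose W hW0 hW using walkLe_syl (e := e) hP hG
  set Wm := 1 + ∑ i, W i with hWm
  have hle : ∀ i, W i ≤ Wm := fun i => by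
    have := Finset.single_le_sum (fun i _ => hW0 i) (Finset.mem_univ i)
    linarith
  have hsum : 0 ≤ ∑ i, W i := Finset.sum_nonneg fun i _ => hW0 i
  refine ⟨Wm, by linarith, ?_⟩
  have key : ∀ x : CyclicProd (Fin k ⊕ Fin l), ∀ g : Γ,
      WalkLe P G (.base g) (.base (g * e.symm x)) (Wm * len (wt k l) x) := by
    intro x
    induction x using syl_induction with
    | one => intro g; simpa [len_one] using WalkLe.refl _ le_rfl
    | mul i p x hp hx ih =>
      intro g
      have h1 := hW i g (g * e.symm (syl i p)) p (by simp)
      have h2 := ih (g * e.symm (syl i p))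
      rw [map_mul, ← mul_assoc]
      refine (h1.trans h2).mono ?_
      rw [len_syl_mul (isWeight_wt k l) p hx, mul_add]
      have := mul_le_mul_of_nonneg_right (hle i) ((isWeight_wt k l).nonneg i p)
      linarith
  intro g h
  have := key (e (g⁻¹ * h)) g
  rwa [MulEquiv.symm_apply_apply, mul_inv_cancel_left] at this

end CuspedWalks

/-! ### Comparison of the kernel with the cusped distance -/

section CuspedHyperbolic

variable {Γ : Type*} [Group Γ] {k l : ℕ} {e : Γ ≃* CyclicProd (Fin k ⊕ Fin l)}
  {P : Fin l → Subgroup Γ} {G : Set Γ}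

/-- The end on the side away from `p` sees it without cancellation, and so gives the good lower
bounds for the kernel. -/
theorem exists_endSign (p : ℤ) (n : ℕ) :
    ∃ b : Bool, |((p - endSign b * 2 ^ n : ℤ) : ℝ)| = |(p : ℝ)| + 2 ^ n := by
  have h2 : (0 : ℝ) < 2 ^ n := by positivity
  rcases le_total 0 (p : ℝ) with h | h
  · refine ⟨false, ?_⟩
    rw [abs_of_nonneg h]
    norm_num [endSign]
    linarith
  · refine ⟨true, ?_⟩
    rw [abs_of_nonpos h]
    norm_num [endSign]
    rw [abs_of_nonpos (by linarith)]
    ring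

theorem wdist_syl_left (x y : CyclicProd (Fin k ⊕ Fin l)) {j : Fin k ⊕ Fin l} {p q : ℤ}
    {z : CyclicProd (Fin k ⊕ Fin l)} (hz : NoHead j z) (h : x⁻¹ * y = syl j p * z) :
    wdist (wt k l) (x * syl j q) y = wt k l j (p - q) + len (wt k l) z := by
  rw [wdist, mul_inv_rev, mul_assoc, h, ← syl_neg, ← mul_assoc, ← syl_add, neg_add_eq_sub,
    len_syl_mul (isWeight_wt k l) _ hz]

theorem logb_sub_nonneg (p : ℤ) (n : ℕ) : 0 ≤ 2 * Real.logb 2 (1 + |(p : ℝ)| + 2 ^ n) - n := by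
  have h1 : (n : ℝ) ≤ Real.logb 2 (1 + |(p : ℝ)| + 2 ^ n) := by
    rw [Real.le_logb_iff_rpow_le (by norm_num) (by positivity), Real.rpow_natCast]
    have := abs_nonneg (p : ℝ)
    linarith
  have : (0 : ℝ) ≤ n := by positivity
  linarith

theorem cuspKernel_base_horo_ge {j : Fin l} {g x : Γ} {n : ℕ} {p : ℤ}
    {y : CyclicProd (Fin k ⊕ Fin l)} (hy : NoHead (Sum.inr j) y)
    (h : (e g)⁻¹ * e x = syl (Sum.inr j) p * y) :
    2 * Real.logb 2 (1 + |(p : ℝ)| + 2 ^ n) - n + len (wt k l) y ≤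
      cuspKernel e (.horo j g n) (.base x) := by
  obtain ⟨b, hb⟩ := exists_endSign p n
  have h1 := le_endsKernel (wdist (wt k l)) (cuspEnds e) height 4 (.horo j g n) (.base x) b true
  simp only [cuspEnds, height] at h1
  rw [wdist_syl_left _ _ hy h] at h1
  have h2 : wt k l (Sum.inr j) (p - endSign b * 2 ^ n) =
      2 * Real.logb 2 (1 + |(p : ℝ)| + 2 ^ n) := by
    simp only [wt, Sum.elim_inr, logWeight, hb, add_assoc]
  unfold cuspKernel
  linarith

/-- The walk descends to the point `z` of the coset from which the rest `y` of the reduced word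
starts, and then follows `y`. By `cuspKernel_base_horo_ge` the kernel dominates the cost of both
pieces. -/
theorem walkLe_kernel_horo_base (hP : IsStdPeripheral e P) (hG : IsCompatible P G) :
    ∃ u : ℝ, 0 < u ∧ ∀ (j : Fin l) (g x : Γ) (n : ℕ),
      WalkLe P G (.horo j g n) (.base x) (u * (cuspKernel e (.horo j g n) (.base x) + u)) := by
  choose c hc0 hc using walkLe_base_horo (e := e) hP hG
  obtain ⟨W, hW0, hW⟩ := walkLe_base hP hG
  set cm := ∑ j, c j with hcm
  have hcm0 : 0 ≤ cm := Finset.sum_nonneg fun i _ => hc0 i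
  refine ⟨1 + W + cm, by positivity, fun j g x n => ?_⟩
  obtain ⟨p, y, hy, hpy⟩ := exists_head (Sum.inr j) ((e g)⁻¹ * e x)
  set z := g * e.symm (syl (Sum.inr j) p) with hz
  have h1 := hc j z g n (-p) (by rw [hz, syl_neg]; simp)
  have h2 := hW z x
  have h3 : e (z⁻¹ * x) = y := by
    rw [hz]
    simp only [map_mul, map_inv, mul_inv_rev, MulEquiv.apply_symm_apply, mul_assoc, hpy]
    group
  rw [h3] at h2
  refine (h1.symm.trans h2).mono ?_
  have h4 := cuspKernel_base_horo_ge (n := n) hy hpy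
  have h5 := logb_sub_nonneg p n
  have h6 := len_nonneg (isWeight_wt k l) y
  have h7 : c j ≤ cm := Finset.single_le_sum (fun i _ => hc0 i) (Finset.mem_univ j)
  push_cast
  rw [abs_neg]
  set Q := 2 * Real.logb 2 (1 + |(p : ℝ)| + 2 ^ n) - n
  set m := cuspKernel e (.horo j g n) (.base x)
  have h8 : (1 + W + cm) * (Q + len (wt k l) y) ≤ (1 + W + cm) * m :=
    mul_le_mul_of_nonneg_left h4 (by positivity)
  nlinarith [mul_nonneg hW0.le h5, mul_nonneg hcm0 h5, mul_nonneg hcm0 h6, mul_nonneg hW0.le hcm0]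

/-- Two vertices of one horoball are joined inside it. Otherwise the walk leaves the first horoball
at the point `z` of its coset, and the problem is reduced to `walkLe_kernel_horo_base`. -/
theorem walkLe_kernel_horo_horo (hP : IsStdPeripheral e P) (hG : IsCompatible P G) :
    ∃ u : ℝ, 0 < u ∧ ∀ (j j' : Fin l) (g g' : Γ) (n n' : ℕ),
      WalkLe P G (.horo j g n) (.horo j' g' n')
        (u * (cuspKernel e (.horo j g n) (.horo j' g' n') + u)) := by
  choose c hc0 hc using walkLe_base_horo (e := e) hP hG
  choose c' hc0' hc' using walkLe_horo (e := e) hP hG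
  obtain ⟨u, hu0, hu⟩ := walkLe_kernel_horo_base (e := e) hP hG
  set cm := ∑ j, c j with hcm
  have hcm0 : 0 ≤ cm := Finset.sum_nonneg fun i _ => hc0 i
  set cm' := ∑ j, c' j with hcm'
  have hcm0' : 0 ≤ cm' := Finset.sum_nonneg fun i _ => hc0' i
  refine ⟨1 + u + cm + cm', by positivity, fun j j' g g' n n' => ?_⟩
  have hk := isHypKernel_cuspKernel e
  obtain ⟨p, y, hy, hpy⟩ := exists_head (Sum.inr j) ((e g)⁻¹ * e g')
  set m := cuspKernel e (.horo j g n) (.horo j' g' n') with hm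
  have h7 : c j ≤ cm := Finset.single_le_sum (fun i _ => hc0 i) (Finset.mem_univ j)
  have h7' : c' j ≤ cm' := Finset.single_le_sum (fun i _ => hc0' i) (Finset.mem_univ j)
  have hm0 : 0 ≤ m := hk.nonneg _ _
  by_cases hcase : y = 1 ∧ j = j'
  · obtain ⟨rfl, rfl⟩ := hcase
    rw [mul_one] at hpy
    refine (hc' j g g' n n' p (by rw [map_mul, map_inv, hpy])).mono ?_
    obtain ⟨b, hb⟩ := exists_endSign p n
    obtain ⟨b', hb'⟩ := exists_endSign (-(p - endSign b * 2 ^ n)) n'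
    have h1 := le_endsKernel (wdist (wt k l)) (cuspEnds e) height 4 (.horo j g n)
      (.horo j g' n') b b'
    simp only [cuspEnds, height] at h1
    have e1 : e g' = e g * syl (Sum.inr j) p := by rw [← hpy]; group
    rw [e1, mul_assoc, ← syl_add, wdist_mul_syl] at h1
    have h2 : logWeight (p + endSign b' * 2 ^ n' - endSign b * 2 ^ n) =
        2 * Real.logb 2 (1 + |(p : ℝ)| + 2 ^ n + 2 ^ n') := by
      unfold logWeight
      rw [show p + endSign b' * 2 ^ n' - endSign b * 2 ^ n =
        -(-(p - endSign b * 2 ^ n) - endSign b' * 2 ^ n') by ring]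
      conv_lhs => rw [Int.cast_neg, abs_neg, hb', Int.cast_neg, abs_neg, hb]
      ring_nf
    have h3 : 2 * Real.logb 2 (1 + |(p : ℝ)| + 2 ^ n + 2 ^ n') - n - n' ≤ m := by
      rw [hm]; unfold cuspKernel; linarith
    nlinarith [mul_nonneg hu0.le hm0, mul_nonneg hcm0 hm0, mul_nonneg hcm0' hm0,
      mul_nonneg hu0.le hcm0, mul_nonneg hu0.le hcm0', mul_nonneg hcm0 hcm0']
  · set z := g * e.symm (syl (Sum.inr j) p) with hz
    have h1 := hc j z g n (-p) (by rw [hz, syl_neg]; simp)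
    have h2 := (hu j' g' z n').symm
    refine (h1.symm.trans h2).mono ?_
    push_cast
    rw [abs_neg]
    set Q := 2 * Real.logb 2 (1 + |(p : ℝ)| + 2 ^ n) - n with hQ
    set m' := cuspKernel e (.horo j' g' n') (.base z) with hm'
    have hQ0 : 0 ≤ Q := logb_sub_nonneg p n
    have hm0' : 0 ≤ m' := hk.nonneg _ _
    -- The kernel splits at `z`: take the end of the second vertex that is best as seen from `z`,
    -- and the end of the first that lies away from `p`. By `noHead_mul_syl` no cancellation occurs
    -- between the two.
    have key : Q + m' ≤ m + 1 := by
      obtain ⟨b', t, hb't⟩ := exists_endsKernel (wdist (wt k l)) (cuspEnds e) height 4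
        (.horo j' g' n') (.base z)
      obtain ⟨b, hb⟩ := exists_endSign p n
      have h4 := le_endsKernel (wdist (wt k l)) (cuspEnds e) height 4 (.horo j g n)
        (.horo j' g' n') b b'
      simp only [cuspEnds, height] at h4 hb't
      have hno : NoHead (Sum.inr j) (y * syl (Sum.inr j') (endSign b' * 2 ^ n')) := by
        apply noHead_mul_syl _ _ _ _ hy
        by_contra hcon
        push Not at hcon
        exact hcase ⟨hcon.1, Sum.inr_injective hcon.2⟩
      rw [wdist_syl_left (p := p) _ _ hno (by rw [← mul_assoc, hpy, mul_assoc])] at h4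
      rw [wdist_comm (isWeight_wt k l)] at hb't
      have e1 : wdist (wt k l) (e z) (e g' * syl (Sum.inr j') (endSign b' * 2 ^ n')) =
          len (wt k l) (y * syl (Sum.inr j') (endSign b' * 2 ^ n')) := by
        unfold wdist
        congr 1
        rw [hz, map_mul, MulEquiv.apply_symm_apply, mul_inv_rev, mul_assoc, ← mul_assoc (e g)⁻¹,
          hpy]
        group
      rw [e1] at hb't
      have h5 : wt k l (Sum.inr j) (p - endSign b * 2 ^ n) =
          2 * Real.logb 2 (1 + |(p : ℝ)| + 2 ^ n) := by
        simp only [wt, Sum.elim_inr, logWeight, hb, add_assoc]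
      rw [hm', hm, hQ]
      unfold cuspKernel
      linarith
    have h9 : u * (Q + m') ≤ u * (m + 1) := mul_le_mul_of_nonneg_left key hu0.le
    nlinarith [mul_nonneg hu0.le hm0, mul_nonneg hcm0 hm0, mul_nonneg hcm0' hm0,
      mul_nonneg hu0.le hcm0, mul_nonneg hu0.le hcm0', mul_nonneg hcm0 hcm0',
      mul_nonneg hu0.le hQ0]

theorem cuspKernel_base (g h : Γ) :
    cuspKernel e (.base g) (.base h : CuspedVertex Γ l) = len (wt k l) (e (g⁻¹ * h)) + 2 := by
  obtain ⟨b, b', hb⟩ := exists_endsKernel (wdist (wt k l)) (cuspEnds e) height 4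
    (.base g) (.base h : CuspedVertex Γ l)
  unfold cuspKernel
  rw [hb]
  simp only [cuspEnds, height, wdist, map_mul, map_inv]
  ring

theorem walkLe_kernel (hP : IsStdPeripheral e P) (hG : IsCompatible P G) :
    ∃ u : ℝ, 0 < u ∧ ∀ v w : CuspedVertex Γ l, WalkLe P G v w (u * (cuspKernel e v w + u)) := by
  obtain ⟨u₁, h10, h1⟩ := walkLe_base (e := e) hP hG
  obtain ⟨u₂, h20, h2⟩ := walkLe_kernel_horo_base (e := e) hP hG
  obtain ⟨u₃, h30, h3⟩ := walkLe_kernel_horo_horo (e := e) hP hG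
  have hk := isHypKernel_cuspKernel e
  refine ⟨u₁ + u₂ + u₃, by positivity, fun v w => ?_⟩
  have hm := hk.nonneg v w
  have mono : ∀ u, 0 < u → u ≤ u₁ + u₂ + u₃ → u * (cuspKernel e v w + u) ≤
      (u₁ + u₂ + u₃) * (cuspKernel e v w + (u₁ + u₂ + u₃)) := fun u h0 hu => by gcongr
  cases v with
  | base g =>
    cases w with
    | base h =>
      refine (h1 g h).mono (le_trans ?_ (mono u₁ h10 (by linarith)))
      rw [cuspKernel_base]
      nlinarith
    | horo j h n =>
      have := (h2 j h g n).symm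
      rw [hk.symm] at this
      exact this.mono (mono u₂ h20 (by linarith))
  | horo j g n =>
    cases w with
    | base h => exact (h2 j g h n).mono (mono u₂ h20 (by linarith))
    | horo j' h n' => exact (h3 j j' g h n n').mono (mono u₃ h30 (by linarith))

theorem cuspedGraph_connected (hP : IsStdPeripheral e P) (hG : IsCompatible P G) :
    (cuspedGraph P G).Connected := by
  obtain ⟨u, -, hu⟩ := walkLe_kernel (e := e) hP hG
  have : Nonempty (CuspedVertex Γ l) := ⟨.base 1⟩
  exact ⟨fun v w => (hu v w).elim fun p _ => ⟨p⟩⟩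

theorem exists_abs_endSign_le (b b' : Bool) (q : ℤ) (n n' : ℕ) {t : ℝ}
    (h : 1 + |(q : ℝ)| + 2 ^ n + 2 ^ n' ≤ 2 ^ t) :
    logWeight (q + endSign b' * 2 ^ n' - endSign b * 2 ^ n) ≤ 2 * t := by
  apply logWeight_le
  refine le_trans ?_ h
  have hs : ∀ b : Bool, ∀ n : ℕ, |((endSign b * 2 ^ n : ℤ) : ℝ)| = 2 ^ n := by
    intro b n
    cases b <;> simp [endSign]
  have h1 := abs_sub (((q + endSign b' * 2 ^ n' : ℤ)) : ℝ) ((endSign b * 2 ^ n : ℤ) : ℝ)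
  have h2 := abs_add_le (q : ℝ) ((endSign b' * 2 ^ n' : ℤ) : ℝ)
  rw [hs] at h1 h2
  rw [Int.cast_sub]
  rw [Int.cast_add] at h1 ⊢
  linarith

/-- Edges move the ends by bounded amounts relative to the heights. For a horizontal edge the
exponent is at most a constant times `2 ^ (n + 1)`; its weight is `2 * (n + 1)` up to a constant,
and the two heights cancel this. -/
theorem cuspKernel_rel_le (hP : IsStdPeripheral e P) (hG : IsCompatible P G) :
    ∃ U : ℝ, ∀ v w : CuspedVertex Γ l, CuspedRel P G v w → cuspKernel e v w ≤ U := by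
  have hw := isWeight_wt k l
  choose K hK0 hK using abs_le_periphDist (e := e) hP hG
  obtain ⟨B, hB⟩ := (hG.1.image fun x => len (wt k l) (e x)).bddAbove
  set Km := ∑ j, K j with hKm
  have hKm0 : 0 ≤ Km := Finset.sum_nonneg fun i _ => hK0 i
  have hlog : 0 ≤ Real.logb 2 (Km + 2) := Real.logb_nonneg (by norm_num) (by linarith)
  refine ⟨|B| + 20 + 2 * Real.logb 2 (Km + 2), ?_⟩
  have hB0 := abs_nonneg B
  intro v w hvw
  cases hvw with
  | cayley g h hgh =>
    rw [cuspKernel_base]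
    rw [SimpleGraph.mulCayley_adj] at hgh
    rcases hgh.2 with h1 | h1
    · have := hB ⟨_, h1, rfl⟩
      simp only at this
      linarith [le_abs_self B]
    · have := hB ⟨_, h1, rfl⟩
      simp only at this
      rw [← len_inv hw, ← map_inv, mul_inv_rev, inv_inv] at this
      linarith [le_abs_self B]
  | vertical_base j g =>
    obtain ⟨b, b', hb⟩ := exists_endsKernel (wdist (wt k l)) (cuspEnds e) height 4
      (.base g) (.horo j g 0)
    unfold cuspKernel
    rw [hb]
    simp only [cuspEnds, height]
    have h1 := wdist_mul_syl (e g) j 0 (endSign b' * 2 ^ 0)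
    rw [syl_zero, mul_one] at h1
    rw [h1]
    have h2 := exists_abs_endSign_le true b' 1 0 0 (t := 2) (by norm_num)
    have h3 : logWeight (endSign b' * 2 ^ 0 - 0) ≤ 4 := by
      have : endSign b' * 2 ^ 0 - 0 = 1 + endSign b' * 2 ^ 0 - endSign true * 2 ^ 0 := by
        simp [endSign]
      rw [this]; linarith
    have h5 : ∀ w : ℝ, w ≤ 4 →
        w - 0 - (((0 : ℕ) : ℝ) + 1) + 4 / 2 ≤ |B| + 20 + 2 * Real.logb 2 (Km + 2) := by
      intro w hw
      rw [Nat.cast_zero]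
      linarith
    exact h5 _ h3
  | vertical j g n =>
    obtain ⟨b, b', hb⟩ := exists_endsKernel (wdist (wt k l)) (cuspEnds e) height 4
      (.horo j g n) (.horo j g (n + 1))
    unfold cuspKernel
    rw [hb]
    simp only [cuspEnds, height]
    rw [wdist_mul_syl]
    have h2 := exists_abs_endSign_le b b' 0 n (n + 1) (t := (n : ℝ) + 2) (by
      rw [show (n : ℝ) + 2 = ((n + 2 : ℕ) : ℝ) by push_cast; ring, Real.rpow_natCast]
      have : (1 : ℝ) ≤ 2 ^ n := one_le_pow₀ (by norm_num)
      simp only [Int.cast_zero, abs_zero]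
      rw [pow_succ, pow_succ, pow_succ]
      linarith)
    rw [zero_add] at h2
    push_cast
    linarith
  | horizontal j g h n hgh hd =>
    obtain ⟨b, b', hb⟩ := exists_endsKernel (wdist (wt k l)) (cuspEnds e) height 4
      (.horo j g n) (.horo j h n)
    obtain ⟨q, hq⟩ := (hP j _).1 hgh
    have hqK := hK j g h q hq
    unfold cuspKernel
    rw [hb]
    simp only [cuspEnds, height]
    have e1 : e h = e g * syl (Sum.inr j) q := by rw [← hq, map_mul, map_inv]; group
    rw [e1, mul_assoc, ← syl_add, wdist_mul_syl]
    have h2 := exists_abs_endSign_le b b' q n n (t := Real.logb 2 (Km + 2) + ((n : ℝ) + 1)) (by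
      rw [Real.rpow_add (by norm_num), Real.rpow_logb (by norm_num) (by norm_num) (by linarith),
        ← Nat.cast_succ, Real.rpow_natCast]
      have h7 : K j ≤ Km := Finset.single_le_sum (fun i _ => hK0 i) (Finset.mem_univ j)
      have h8 : (periphDist P G j g h : ℝ) ≤ 2 ^ (n + 1) := by exact_mod_cast hd
      have h9 : K j * (periphDist P G j g h : ℝ) ≤ Km * 2 ^ (n + 1) := by gcongr
      have h10 : (1 : ℝ) ≤ 2 ^ n := one_le_pow₀ (by norm_num)
      rw [Nat.succ_eq_add_one, add_mul]
      have h11 : (2 : ℝ) ^ (n + 1) = 2 * 2 ^ n := by rw [pow_succ]; ring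
      linarith)
    linarith

theorem cuspKernel_adj_le (hP : IsStdPeripheral e P) (hG : IsCompatible P G) :
    ∃ U : ℝ, ∀ v w : CuspedVertex Γ l, (cuspedGraph P G).Adj v w → cuspKernel e v w ≤ U := by
  obtain ⟨U, hU⟩ := cuspKernel_rel_le (e := e) hP hG
  refine ⟨U, fun v w hvw => ?_⟩
  rcases ((SimpleGraph.fromRel_adj _ _ _).1 hvw).2 with h | h
  · exact hU v w h
  · rw [(isHypKernel_cuspKernel e).symm]; exact hU w v h

/-- The kernel is bounded linearly by the distance of the cusped space. -/
theorem cuspKernel_le (hP : IsStdPeripheral e P) (hG : IsCompatible P G) :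
    ∃ U : ℝ, 0 < U ∧ ∀ v w : CuspedVertex Γ l, cuspKernel e v w ≤ U * cuspedDist P G v w + U := by
  obtain ⟨U, hU⟩ := cuspKernel_adj_le (e := e) hP hG
  have hk := isHypKernel_cuspKernel e
  refine ⟨|U| + 4, by positivity, fun v w => ?_⟩
  obtain ⟨p, hp⟩ := (cuspedGraph_connected (e := e) hP hG).exists_walk_length_eq_dist v w
  unfold cuspedDist
  rw [← hp]
  clear hp
  induction p with
  | nil => have := hk.self_le; simp; linarith [this ‹_›, abs_nonneg U]
  | @cons a b c hadj p ih =>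
    have h1 := hU _ _ hadj
    have h2 := hk.triangle a b c
    rw [SimpleGraph.Walk.length_cons]
    push_cast
    linarith [le_abs_self U]

theorem cuspedDist_le (hP : IsStdPeripheral e P) (hG : IsCompatible P G) :
    ∃ u : ℝ, 0 < u ∧ ∀ v w : CuspedVertex Γ l,
      (cuspedDist P G v w : ℝ) ≤ u * (cuspKernel e v w + u) := by
  obtain ⟨u, hu0, hu⟩ := walkLe_kernel (e := e) hP hG
  exact ⟨u, hu0, fun v w => (hu v w).dist_le⟩

theorem cuspedLength_le (hP : IsStdPeripheral e P) (hG : IsCompatible P G) :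
    ∃ u : ℝ, 0 < u ∧ ∀ g : Γ, (cuspedLength P G g : ℝ) ≤ u * len (wt k l) (e g) := by
  obtain ⟨u, hu0, hu⟩ := walkLe_base (e := e) hP hG
  refine ⟨u, hu0, fun g => ?_⟩
  have := (hu 1 g).dist_le
  rwa [inv_one, one_mul] at this

theorem len_le_cuspedLength (hP : IsStdPeripheral e P) (hG : IsCompatible P G) :
    ∃ U : ℝ, 0 < U ∧ ∀ g : Γ, len (wt k l) (e g) ≤ U * cuspedLength P G g + U := by
  obtain ⟨U, hU0, hU⟩ := cuspKernel_le (e := e) hP hG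
  refine ⟨U, hU0, fun g => ?_⟩
  have := hU (.base 1) (.base g)
  rw [cuspKernel_base, inv_one, one_mul] at this
  unfold cuspedLength
  linarith

/-- The standard generators form a compatible set. For an arbitrary compatible set the cusped graph
is quasi-isometric to the same hyperbolic kernel, with constants depending on the set. -/
theorem isRelHyperbolic_of_std (hP : IsStdPeripheral e P) : IsRelHyperbolic P := by
  constructor
  · refine ⟨Set.range fun i => e.symm (syl i 1), Set.finite_range _, ?_, ?_⟩
    · rw [eq_top_iff]
      intro g _
      rw [← e.symm_apply_apply g]
      induction e g using syl_induction with
      | one => rw [map_one]; exact one_mem _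
      | mul i p x hp hx ih =>
        rw [map_mul]
        refine mul_mem ?_ ih
        have : syl i p = syl i 1 ^ p := by rw [syl_zpow, mul_one]
        rw [this, map_zpow]
        exact zpow_mem (Subgroup.subset_closure (Set.mem_range_self i)) _
    · intro j
      apply le_antisymm
      · exact (Subgroup.closure_le _).2 Set.inter_subset_right
      · intro g hg
        obtain ⟨q, hq⟩ := (hP j g).1 hg
        have hs : e.symm (syl (Sum.inr j) 1) ∈ P j := (hP j _).2 ⟨1, by simp⟩
        have hmem : e.symm (syl (Sum.inr j) 1) ∈
            Subgroup.closure ((Set.range fun i => e.symm (syl i 1)) ∩ (P j : Set Γ)) :=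
          Subgroup.subset_closure (Set.mem_inter
            (Set.mem_range_self (f := fun i => e.symm (syl i 1)) _) hs)
        have : g = e.symm (syl (Sum.inr j) 1) ^ q := by
          rw [← map_zpow, syl_zpow, mul_one, ← hq, MulEquiv.symm_apply_apply]
        rw [this]
        exact zpow_mem hmem q
  · intro G hG
    obtain ⟨U, hU⟩ := cuspKernel_adj_le (e := e) hP hG
    obtain ⟨u, hu0, hu⟩ := cuspedDist_le (e := e) hP hG
    exact (isHypKernel_cuspKernel e).isHyperbolicGraph (cuspedGraph_connected (e := e) hP hG) hu0
      hU hu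

end CuspedHyperbolic

/-! ### Lifts to linear maps -/

/-- Euclidean space. -/
abbrev Euc (d : ℕ) : Type := EuclideanSpace ℝ (Fin d)

section Lifts

variable {d : ℕ}

/-- The linear map of a matrix on Euclidean space. -/
def matCLM (M : GL (Fin d) ℝ) : Euc d →L[ℝ] Euc d :=
  Matrix.toEuclideanCLM (𝕜 := ℝ) (n := Fin d) (M : Matrix (Fin d) (Fin d) ℝ)

/-- `A` is a linear map that induces the projective transformation `g`. -/
def IsLift (A : Euc d →L[ℝ] Euc d) (g : PGLR d) : Prop :=
  ∃ M : GL (Fin d) ℝ, Matrix.ProjGenLinGroup.mk M = g ∧ matCLM M = A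

theorem matCLM_mul (M N : GL (Fin d) ℝ) : matCLM (M * N) = matCLM M * matCLM N := by
  simp [matCLM]

theorem matCLM_one : matCLM (1 : GL (Fin d) ℝ) = 1 := by
  simp [matCLM]

theorem matCLM_scalar (u : ℝˣ) :
    matCLM (Matrix.GeneralLinearGroup.scalar (Fin d) u) = (u : ℝ) • (1 : Euc d →L[ℝ] Euc d) := by
  unfold matCLM
  rw [← map_one (Matrix.toEuclideanCLM (𝕜 := ℝ) (n := Fin d)), ← map_smul]
  congr 1
  ext i j
  simp [Matrix.smul_apply, Matrix.one_apply, Matrix.scalar_apply, Matrix.diagonal_apply]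

theorem IsLift.mul {A B : Euc d →L[ℝ] Euc d} {g h : PGLR d} (hA : IsLift A g) (hB : IsLift B h) :
    IsLift (A * B) (g * h) := by
  obtain ⟨M, rfl, rfl⟩ := hA
  obtain ⟨N, rfl, rfl⟩ := hB
  exact ⟨M * N, map_mul _ _ _, matCLM_mul _ _⟩

theorem isLift_one : IsLift (1 : Euc d →L[ℝ] Euc d) (1 : PGLR d) :=
  ⟨1, map_one _, matCLM_one⟩

theorem IsLift.smul {A : Euc d →L[ℝ] Euc d} {g : PGLR d} (hA : IsLift A g) {c : ℝ} (hc : c ≠ 0) :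
    IsLift (c • A) g := by
  obtain ⟨M, rfl, rfl⟩ := hA
  refine ⟨Matrix.GeneralLinearGroup.scalar (Fin d) (Units.mk0 c hc) * M, ?_, ?_⟩
  · rw [map_mul, Matrix.ProjGenLinGroup.mk_scalar, one_mul]
  · rw [matCLM_mul, matCLM_scalar]
    ext x
    rfl

theorem IsLift.eq_smul {A B : Euc d →L[ℝ] Euc d} {g : PGLR d} (hA : IsLift A g)
    (hB : IsLift B g) : ∃ c : ℝ, c ≠ 0 ∧ B = c • A := by
  obtain ⟨M, rfl, rfl⟩ := hA
  obtain ⟨N, hN, rfl⟩ := hB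
  obtain ⟨u, hu⟩ := Matrix.ProjGenLinGroup.mk_eq_mk_iff.1 hN.symm
  refine ⟨u, u.ne_zero, ?_⟩
  rw [← hu, matCLM_mul, matCLM_scalar]
  exact ContinuousLinearMap.ext fun x => map_smul (matCLM M) (u : ℝ) x

theorem exists_isLift (g : PGLR d) : ∃ A B : Euc d →L[ℝ] Euc d, IsLift A g ∧ IsLift B g⁻¹ ∧
    A * B = 1 ∧ B * A = 1 := by
  obtain ⟨M, rfl⟩ := Matrix.ProjGenLinGroup.mk_surjective g
  refine ⟨matCLM M, matCLM M⁻¹, ⟨M, rfl, rfl⟩, ⟨M⁻¹, map_inv _ _, rfl⟩, ?_, ?_⟩ <;>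
    simp [← matCLM_mul, matCLM_one]

theorem IsLift.exists_inv {A : Euc d →L[ℝ] Euc d} {g : PGLR d} (hA : IsLift A g) :
    ∃ B, IsLift B g⁻¹ ∧ A * B = 1 ∧ B * A = 1 := by
  obtain ⟨M, rfl, rfl⟩ := hA
  refine ⟨matCLM M⁻¹, ⟨M⁻¹, map_inv _ _, rfl⟩, ?_, ?_⟩ <;>
    simp [← matCLM_mul, matCLM_one]

/-- The representative `repLin` as a continuous linear map. -/
theorem exists_repLin_eq (g : PGLR d) :
    ∃ R : Euc d →L[ℝ] Euc d, IsLift R g ∧ repLin g = (R : Euc d →ₗ[ℝ] Euc d) := by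
  refine ⟨matCLM (Function.surjInv Matrix.ProjGenLinGroup.mk_surjective g),
    ⟨_, Function.surjInv_eq _ _, rfl⟩, ?_⟩
  unfold repLin matCLM
  rw [Matrix.coe_toEuclideanCLM_eq_toEuclideanLin]

theorem IsLift.repLin_eq {A : Euc d →L[ℝ] Euc d} {g : PGLR d} (hA : IsLift A g) :
    ∃ c : ℝ, c ≠ 0 ∧ repLin g = ((c • A : Euc d →L[ℝ] Euc d) : Euc d →ₗ[ℝ] Euc d) := by
  obtain ⟨R, hR, e⟩ := exists_repLin_eq g
  obtain ⟨c, hc, rfl⟩ := hA.eq_smul hR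
  exact ⟨c, hc, e⟩

end Lifts

/-! ### Products of maps close to rank one -/

section RankOne

variable {E : Type*} [NormedAddCommGroup E] [NormedSpace ℝ E]

/-- The terms linear in `D₁` or `D₂` are absorbed by changing the vector and the functional, as in
completing a square. What remains is bilinear in the errors, so errors multiply instead of adding.
-/
theorem rankOne_mul (φ₁ φ₂ : E →L[ℝ] ℝ) (v₁ v₂ : E) (D₁ D₂ : E →L[ℝ] E) {t : ℝ}
    (ht : φ₁ v₂ = t) (ht0 : t ≠ 0) :
    t⁻¹ • ((φ₁.smulRight v₁ + D₁) * (φ₂.smulRight v₂ + D₂)) =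
      (φ₂ + t⁻¹ • φ₁.comp D₂).smulRight (v₁ + t⁻¹ • D₁ v₂) +
        t⁻¹ • (D₁ * D₂ - t⁻¹ • (φ₁.comp D₂).smulRight (D₁ v₂)) := by
  ext x
  simp only [smul_apply, mul_apply_eq_comp,
    add_apply, ContinuousLinearMap.smulRight_apply, map_add, map_smul,
    sub_apply, ContinuousLinearMap.comp_apply, smul_eq_mul, ht]
  match_scalars <;> field_simp
  all_goals ring

/-- The new vector is controlled by the error of the left factor alone, the new functional by that
of the right factor alone. Hence in a long product the vector stays near that of the first syllable
and the functional near that of the last. -/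
theorem rankOne_step (φ₁ φ₂ : E →L[ℝ] ℝ) (v₁ v₂ : E) (D₁ D₂ : E →L[ℝ] E) {c B ε : ℝ}
    (hc : 0 < c) (hB : 1 ≤ B) (ht : c / 2 ≤ |φ₁ v₂|) (hφ : ‖φ₁‖ ≤ B) (hv : ‖v₂‖ ≤ 2 * B)
    (hD : ‖D₁‖ ≤ ε) :
    ∃ (s : ℝ) (w : E) (ψ : E →L[ℝ] ℝ) (D : E →L[ℝ] E), s ≠ 0 ∧
      s • ((φ₁.smulRight v₁ + D₁) * (φ₂.smulRight v₂ + D₂)) = ψ.smulRight w + D ∧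
      ‖w - v₁‖ ≤ (4 * B / c) * ε ∧ ‖ψ - φ₂‖ ≤ (2 * B / c) * ‖D₂‖ ∧
      ‖D‖ ≤ (2 / c + 8 * B ^ 2 / c ^ 2) * ε * ‖D₂‖ := by
  set t := φ₁ v₂ with htdef
  have ht0 : t ≠ 0 := by
    intro h0
    rw [h0, abs_zero] at ht
    linarith
  have hti : ‖t⁻¹‖ ≤ 2 / c := by
    rw [norm_inv, Real.norm_eq_abs, inv_le_comm₀ (abs_pos.2 ht0) (by positivity), inv_div]
    exact ht
  have hε : 0 ≤ ε := (norm_nonneg _).trans hD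
  have hB0 : 0 ≤ B := by linarith
  have hDv : ‖D₁ v₂‖ ≤ ε * (2 * B) :=
    (D₁.le_opNorm v₂).trans (mul_le_mul hD hv (norm_nonneg _) hε)
  have hφD : ‖φ₁.comp D₂‖ ≤ B * ‖D₂‖ :=
    (φ₁.opNorm_comp_le D₂).trans (mul_le_mul_of_nonneg_right hφ (norm_nonneg _))
  refine ⟨t⁻¹, v₁ + t⁻¹ • D₁ v₂, φ₂ + t⁻¹ • φ₁.comp D₂, _, inv_ne_zero ht0,
    rankOne_mul φ₁ φ₂ v₁ v₂ D₁ D₂ htdef.symm ht0, ?_, ?_, ?_⟩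
  · rw [add_sub_cancel_left, norm_smul]
    calc ‖t⁻¹‖ * ‖D₁ v₂‖ ≤ 2 / c * (ε * (2 * B)) := mul_le_mul hti hDv (norm_nonneg _) (by positivity)
      _ = (4 * B / c) * ε := by ring
  · rw [add_sub_cancel_left, norm_smul]
    calc ‖t⁻¹‖ * ‖φ₁.comp D₂‖ ≤ 2 / c * (B * ‖D₂‖) :=
          mul_le_mul hti hφD (norm_nonneg _) (by positivity)
      _ = (2 * B / c) * ‖D₂‖ := by ring
  · rw [norm_smul]
    have h1 : ‖D₁ * D₂‖ ≤ ε * ‖D₂‖ :=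
      (norm_mul_le _ _).trans (mul_le_mul_of_nonneg_right hD (norm_nonneg _))
    have h2 : ‖t⁻¹ • (φ₁.comp D₂).smulRight (D₁ v₂)‖ ≤ 2 / c * ((B * ‖D₂‖) * (ε * (2 * B))) := by
      rw [norm_smul, ContinuousLinearMap.norm_smulRight_apply]
      exact mul_le_mul hti (mul_le_mul hφD hDv (norm_nonneg _) (by positivity)) (by positivity)
        (by positivity)
    have h3 := norm_sub_le (D₁ * D₂) (t⁻¹ • (φ₁.comp D₂).smulRight (D₁ v₂))
    calc ‖t⁻¹‖ * ‖D₁ * D₂ - t⁻¹ • (φ₁.comp D₂).smulRight (D₁ v₂)‖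
        ≤ 2 / c * (ε * ‖D₂‖ + 2 / c * ((B * ‖D₂‖) * (ε * (2 * B)))) :=
          mul_le_mul hti (by linarith) (norm_nonneg _) (by positivity)
      _ = (2 / c + 8 * B ^ 2 / c ^ 2) * ε * ‖D₂‖ := by ring

end RankOne

/-! ### Reduced words are close to rank one -/

section WordApprox

variable {d : ℕ} {ι : Type*} [DecidableEq ι]

/-- The sign of an exponent. -/
def expSign (p : ℤ) : ℤˣ := if 0 < p then 1 else -1

/-- Attracting vectors and repelling functionals, transverse for distinct indices. -/
structure TransverseData (d : ℕ) {ι : Type*} (v : ι → ℤˣ → Euc d)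
    (φ : ι → ℤˣ → Euc d →L[ℝ] ℝ) (B c : ℝ) : Prop where
  one_le : 1 ≤ B
  pos : 0 < c
  norm_v : ∀ i ε, ‖v i ε‖ ≤ B
  norm_φ : ∀ i ε, ‖φ i ε‖ ≤ B
  transverse : ∀ i ε i' ε', i ≠ i' → c ≤ |φ i ε (v i' ε')|

/-- The powers of the generators are close to maps of rank one. -/
def IsApprox (ρ : CyclicProd ι →* PGLR d) (v : ι → ℤˣ → Euc d) (φ : ι → ℤˣ → Euc d →L[ℝ] ℝ)
    (f : ι → ℤ → ℝ) (μ K : ℝ) : Prop :=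
  ∀ i p, p ≠ 0 → ∃ A, IsLift A (ρ (syl i p)) ∧
    ‖A - (φ i (expSign p)).smulRight (v i (expSign p))‖ ≤ Real.exp (-(μ * f i p)) / K

/-- The lift of `x` is close to a map of rank one, whose range and kernel are near those of the
first and the last syllable. -/
def IsWordApprox (ρ : CyclicProd ι →* PGLR d) (v : ι → ℤˣ → Euc d)
    (φ : ι → ℤˣ → Euc d →L[ℝ] ℝ) (f : ι → ℤ → ℝ) (μ η : ℝ) (x : CyclicProd ι) : Prop :=
  ∃ (w : Euc d) (ψ : Euc d →L[ℝ] ℝ) (D : Euc d →L[ℝ] Euc d) (a b : ι × ℤ),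
    IsLift (ψ.smulRight w + D) (ρ x) ∧ a ∈ (letters x).head? ∧ b ∈ (letters x).getLast? ∧
    ‖w - v a.1 (expSign a.2)‖ ≤ η ∧ ‖ψ - φ b.1 (expSign b.2)‖ ≤ η ∧
    ‖D‖ ≤ η * Real.exp (-(μ * len f x))

-- One syllable is added on the left at each step of the induction. Its index differs from that of
-- the next syllable, so transversality provides the lower bound on the pairing that `rankOne_step`
-- requires. One threshold `K₀` serves words of all lengths.
set_option maxHeartbeats 1600000 in
theorem exists_isWordApprox {v : ι → ℤˣ → Euc d} {φ : ι → ℤˣ → Euc d →L[ℝ] ℝ} {B c : ℝ}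
    (hd : TransverseData d v φ B c) {f : ι → ℤ → ℝ} {δ : ℝ} (hf : IsWeight f δ) {μ : ℝ}
    (hμ : 0 ≤ μ) {η : ℝ} (hη : 0 < η) : ∃ K₀ : ℝ, 0 < K₀ ∧ ∀ K ≥ K₀,
      ∀ ρ : CyclicProd ι →* PGLR d, IsApprox ρ v φ f μ K → ∀ x, x ≠ 1 →
        IsWordApprox ρ v φ f μ η x := by
  have hB := hd.one_le
  have hc := hd.pos
  have hB0 : 0 < B := by linarith
  set θ := min η (min 1 (c / (2 * B))) with hθ
  have hθ0 : 0 < θ := by positivity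
  have hθη : θ ≤ η := min_le_left _ _
  have hθ1 : θ ≤ 1 := (min_le_right _ _).trans (min_le_left _ _)
  have hθc : θ * B ≤ c / 2 := by
    have : θ ≤ c / (2 * B) := (min_le_right _ _).trans (min_le_right _ _)
    calc θ * B ≤ c / (2 * B) * B := by gcongr
      _ = c / 2 := by field_simp
  set C := 1 + (2 / c + 8 * B ^ 2 / c ^ 2) with hC
  have hC1 : 1 ≤ C := by
    rw [hC]
    have : (0 : ℝ) ≤ 2 / c + 8 * B ^ 2 / c ^ 2 := by positivity
    linarith
  -- The four summands yield the four bounds `hr2`, `hrθ`, `hKθ` and `hrd` below.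
  set K₀ := 2 * C + C / θ + 4 * B / c / θ + 8 * B / c * C / θ with hK₀
  have hK₀0 : 0 < K₀ := by positivity
  refine ⟨K₀, hK₀0, fun K hK ρ hρ => ?_⟩
  have hK0 : 0 < K := hK₀0.trans_le hK
  have hnn1 : 0 ≤ C / θ := by positivity
  have hnn2 : 0 ≤ 4 * B / c / θ := by positivity
  have hnn3 : 0 ≤ 8 * B / c * C / θ := by positivity
  set r := C / K with hr
  have hr0 : 0 < r := by positivity
  have hr2 : r ≤ 1 / 2 := by
    rw [hr, div_le_div_iff₀ hK0 (by norm_num)]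
    linarith
  have hrθ : r ≤ θ := by
    rw [hr, div_le_iff₀ hK0]
    have : C = θ * (C / θ) := by field_simp
    rw [this]
    gcongr
    linarith
  have hKθ : 4 * B / c * (1 / K) ≤ θ := by
    rw [mul_one_div, div_le_iff₀ hK0]
    have : 4 * B / c = θ * (4 * B / c / θ) := by field_simp
    rw [this]
    gcongr
    linarith
  have hrd : 8 * B / c * r ≤ θ := by
    rw [hr, ← mul_div_assoc, div_le_iff₀ hK0]
    have : 8 * B / c * C = θ * (8 * B / c * C / θ) := by field_simp
    rw [this]
    gcongr
    linarith
  have herr : ∀ i p, Real.exp (-(μ * f i p)) / K ≤ 1 / K := by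
    intro i p
    gcongr
    rw [Real.exp_le_one_iff]
    have := mul_nonneg hμ (hf.nonneg i p)
    linarith
  -- Here `n` counts syllables. The vector is renewed at every step, so its tolerance `θ` does not
  -- accumulate. The functional is modified at every step, so its tolerance is a partial sum of a
  -- geometric series; the extra factor `r ^ n` in the error makes these modifications summable.
  have key : ∀ x : CyclicProd ι, x ≠ 1 → ∃ (n : ℕ) (w : Euc d) (ψ : Euc d →L[ℝ] ℝ)
      (D : Euc d →L[ℝ] Euc d) (a b : ι × ℤ), 1 ≤ n ∧
      IsLift (ψ.smulRight w + D) (ρ x) ∧ a ∈ (letters x).head? ∧ b ∈ (letters x).getLast? ∧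
      ‖w - v a.1 (expSign a.2)‖ ≤ θ ∧ ‖ψ - φ b.1 (expSign b.2)‖ ≤ θ * (1 - (1 / 2) ^ n) ∧
      ‖D‖ ≤ r ^ n * Real.exp (-(μ * len f x)) := by
    intro x
    induction x using syl_induction with
    | one => intro h; exact absurd rfl h
    | mul i p y hp hy ih =>
      intro _
      obtain ⟨A, hA, hAe⟩ := hρ i p hp
      set v₁ := v i (expSign p)
      set φ₁ := φ i (expSign p)
      set D₁ := A - φ₁.smulRight v₁ with hD₁
      have hAD : A = φ₁.smulRight v₁ + D₁ := by rw [hD₁]; abel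
      by_cases hy1 : y = 1
      · refine ⟨1, v₁, φ₁, D₁, (i, p), (i, p), le_rfl, ?_, ?_, ?_, ?_, ?_, ?_⟩
        · rw [hy1, mul_one, ← hAD]; exact hA
        · rw [letters_syl_mul hp hy]; rfl
        · rw [hy1, mul_one, letters_syl hp]; rfl
        · simp only [v₁, sub_self, norm_zero]; exact hθ0.le
        · simp only [φ₁, sub_self, norm_zero]; positivity
        · rw [hy1, mul_one, len_syl hf, pow_one]
          refine hAe.trans ?_
          rw [hr, div_mul_eq_mul_div]
          gcongr
          nlinarith [Real.exp_pos (-(μ * f i p))]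
      · obtain ⟨n, w₂, ψ₂, D₂, a, b, hn, hl, ha, hb, hw₂, hψ₂, hD₂⟩ := ih hy1
        have hai : i ≠ a.1 := (hy a ha).symm
        have hv2 : ‖w₂‖ ≤ 2 * B := by
          have := norm_le_norm_add_norm_sub' w₂ (v a.1 (expSign a.2))
          linarith [hd.norm_v a.1 (expSign a.2)]
        have ht : c / 2 ≤ |φ₁ w₂| := by
          have h1 := hd.transverse i (expSign p) a.1 (expSign a.2) hai
          have h2 : |φ₁ (w₂ - v a.1 (expSign a.2))| ≤ B * θ := by
            rw [← Real.norm_eq_abs]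
            exact (φ₁.le_opNorm _).trans (mul_le_mul (hd.norm_φ _ _) hw₂ (norm_nonneg _) hB0.le)
          rw [map_sub] at h2
          have h3 := abs_sub_abs_le_abs_sub (φ₁ (v a.1 (expSign a.2))) (φ₁ w₂)
          rw [abs_sub_comm] at h3
          linarith
        obtain ⟨s, w, ψ, D, hs, he, hw, hψ, hD⟩ := rankOne_step φ₁ ψ₂ v₁ w₂ D₁ D₂ hc hB ht
          (hd.norm_φ _ _) hv2 hAe
        have hlen : len f (syl i p * y) = f i p + len f y := len_syl_mul hf p hy
        have hexp1 : Real.exp (-(μ * len f y)) ≤ 1 := by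
          rw [Real.exp_le_one_iff]
          have := mul_nonneg hμ (len_nonneg hf y)
          linarith
        have hD₂' : ‖D₂‖ ≤ r ^ n := by
          refine hD₂.trans ?_
          have : (0 : ℝ) ≤ r ^ n := by positivity
          nlinarith
        refine ⟨n + 1, w, ψ, D, (i, p), b, by omega, ?_, ?_, ?_, ?_, ?_, ?_⟩
        · rw [← he, ← hAD, map_mul]
          exact (hA.mul hl).smul hs
        · rw [letters_syl_mul hp hy]; rfl
        · rw [letters_syl_mul hp hy]
          rw [List.getLast?_cons]
          rw [Option.mem_def] at hb ⊢
          rw [hb]; rfl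
        · exact (hw.trans (mul_le_mul_of_nonneg_left (herr i p) (by positivity))).trans hKθ
        · have h1 : ‖ψ - ψ₂‖ ≤ θ * (1 / 2) ^ (n + 1) := by
            have h2 : r ^ n ≤ r * (1 / 2) ^ (n - 1) := by
              obtain ⟨m, rfl⟩ : ∃ m, n = m + 1 := ⟨n - 1, by omega⟩
              rw [pow_succ, mul_comm, Nat.add_sub_cancel]
              gcongr
            calc ‖ψ - ψ₂‖ ≤ 2 * B / c * ‖D₂‖ := hψ
              _ ≤ 2 * B / c * (r * (1 / 2) ^ (n - 1)) :=
                  mul_le_mul_of_nonneg_left (hD₂'.trans h2) (by positivity)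
              _ = (8 * B / c * r) * (1 / 2) ^ (n + 1) := by
                  obtain ⟨m, rfl⟩ : ∃ m, n = m + 1 := ⟨n - 1, by omega⟩
                  rw [Nat.add_sub_cancel, pow_succ, pow_succ]
                  ring
              _ ≤ θ * (1 / 2) ^ (n + 1) := mul_le_mul_of_nonneg_right hrd (by positivity)
          have h3 := norm_add_le (ψ - ψ₂) (ψ₂ - φ b.1 (expSign b.2))
          rw [sub_add_sub_cancel] at h3
          have h4 : (1 / 2 : ℝ) ^ n = 2 * (1 / 2) ^ (n + 1) := by rw [pow_succ]; ring
          rw [h4] at hψ₂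
          nlinarith
        · rw [hlen, mul_add, neg_add, Real.exp_add]
          calc ‖D‖ ≤ (2 / c + 8 * B ^ 2 / c ^ 2) * (Real.exp (-(μ * f i p)) / K) * ‖D₂‖ := hD
            _ ≤ C * (Real.exp (-(μ * f i p)) / K) * (r ^ n * Real.exp (-(μ * len f y))) :=
                mul_le_mul (mul_le_mul_of_nonneg_right (by linarith) (by positivity)) hD₂
                  (norm_nonneg _) (by positivity)
            _ = r ^ (n + 1) * (Real.exp (-(μ * f i p)) * Real.exp (-(μ * len f y))) := by
                rw [hr, pow_succ]; ring
  intro x hx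
  obtain ⟨n, w, ψ, D, a, b, hn, hl, ha, hb, hw, hψ, hD⟩ := key x hx
  refine ⟨w, ψ, D, a, b, hl, ha, hb, hw.trans hθη, hψ.trans (le_trans ?_ hθη), hD.trans ?_⟩
  · have : (0 : ℝ) ≤ (1 / 2) ^ n := by positivity
    nlinarith
  · gcongr
    calc r ^ n ≤ r ^ 1 := pow_le_pow_of_le_one hr0.le (by linarith) hn
      _ ≤ η := by rw [pow_one]; exact hrθ.trans hθη

end WordApprox

/-! ### Singular values -/

section SingularValues

open LinearMap

variable {d : ℕ}

theorem finrank_euc : Module.finrank ℝ (Euc d) = d := by simp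

/-- An orthonormal basis of right singular vectors. -/
def svBasis (R : Euc d →ₗ[ℝ] Euc d) : OrthonormalBasis (Fin d) ℝ (Euc d) :=
  R.isSymmetric_adjoint_comp_self.eigenvectorBasis finrank_euc

theorem adjoint_apply_svBasis (R : Euc d →ₗ[ℝ] Euc d) (i : Fin d) :
    adjoint R (R (svBasis R i)) = (R.singularValues i ^ 2) • svBasis R i := by
  have := R.isSymmetric_adjoint_comp_self.apply_eigenvectorBasis finrank_euc i
  rw [← R.sq_singularValues_fin finrank_euc] at this
  exact this

theorem inner_apply_svBasis (R : Euc d →ₗ[ℝ] Euc d) (i : Fin d) (x : Euc d) :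
    inner ℝ (R (svBasis R i)) (R x) = R.singularValues i ^ 2 * inner ℝ (svBasis R i) x := by
  rw [← adjoint_inner_left, adjoint_apply_svBasis, real_inner_smul_left]

theorem norm_sq_apply_eq (R : Euc d →ₗ[ℝ] Euc d) (x : Euc d) :
    ‖R x‖ ^ 2 = ∑ i : Fin d, R.singularValues i ^ 2 * inner ℝ (svBasis R i) x ^ 2 := by
  rw [← real_inner_self_eq_norm_sq]
  have hx : R x = ∑ i : Fin d, inner ℝ (svBasis R i) x • R (svBasis R i) := by
    conv_lhs => rw [← (svBasis R).sum_repr' x]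
    rw [map_sum]
    simp only [map_smul]
  conv_lhs => enter [2]; rw [hx]
  rw [sum_inner]
  refine Finset.sum_congr rfl fun i _ => ?_
  rw [real_inner_smul_left, inner_apply_svBasis]
  ring

theorem norm_sq_eq (R : Euc d →ₗ[ℝ] Euc d) (x : Euc d) :
    ‖x‖ ^ 2 = ∑ i, inner ℝ (svBasis R i) x ^ 2 :=
  ((svBasis R).sum_sq_inner_right x).symm

theorem norm_apply_svBasis (R : Euc d →ₗ[ℝ] Euc d) (i : Fin d) :
    ‖R (svBasis R i)‖ = R.singularValues i := by
  rw [← sq_eq_sq₀ (norm_nonneg _) (R.singularValues_nonneg _), ← real_inner_self_eq_norm_sq,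
    inner_apply_svBasis, real_inner_self_eq_norm_sq, (svBasis R).norm_eq_one]
  ring

theorem norm_eq_singularValues_zero [NeZero d] (R : Euc d →L[ℝ] Euc d) :
    (R : Euc d →ₗ[ℝ] Euc d).singularValues 0 = ‖R‖ := by
  set S := (R : Euc d →ₗ[ℝ] Euc d) with hS
  apply le_antisymm
  · have h := norm_apply_svBasis S 0
    have h2 := R.le_opNorm (svBasis S 0)
    rw [(svBasis S).norm_eq_one, mul_one] at h2
    rw [Fin.val_zero] at h
    rw [← h]
    exact h2
  · refine R.opNorm_le_bound (S.singularValues_nonneg _) fun x => ?_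
    rw [← sq_le_sq₀ (norm_nonneg _) (mul_nonneg (S.singularValues_nonneg _) (norm_nonneg _)),
      mul_pow]
    have h := norm_sq_apply_eq S x
    rw [show R x = S x from rfl, h, norm_sq_eq S, Finset.mul_sum]
    refine Finset.sum_le_sum fun i _ => mul_le_mul_of_nonneg_right ?_ (sq_nonneg _)
    exact pow_le_pow_left₀ (S.singularValues_nonneg _)
      (S.singularValues_antitone (Nat.zero_le _)) 2

/-- Min-max: the plane of the first two singular vectors meets the kernel of `ψ` in a non-zero
vector, and on this plane `R` stretches at least by its second singular value. -/
theorem singularValues_one_le (hd : 2 ≤ d) {R D : Euc d →L[ℝ] Euc d} {ψ : Euc d →L[ℝ] ℝ}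
    (h : ∀ x, ψ x = 0 → ‖R x‖ ≤ ‖D x‖) :
    (R : Euc d →ₗ[ℝ] Euc d).singularValues 1 ≤ ‖D‖ := by
  set S := (R : Euc d →ₗ[ℝ] Euc d) with hS
  set b := svBasis S
  let i0 : Fin d := ⟨0, by omega⟩
  let i1 : Fin d := ⟨1, by omega⟩
  have hne : i0 ≠ i1 := by simp [i0, i1, Fin.ext_iff]
  obtain ⟨α, β, hαβ, hψ⟩ : ∃ α β : ℝ, (α ≠ 0 ∨ β ≠ 0) ∧ ψ (α • b i0 + β • b i1) = 0 := by
    by_cases h0 : ψ (b i0) = 0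
    · exact ⟨1, 0, Or.inl one_ne_zero, by simp [h0]⟩
    · refine ⟨ψ (b i1), -ψ (b i0), Or.inr (neg_ne_zero.2 h0), ?_⟩
      simp only [map_add, map_smul, smul_eq_mul]
      ring
  set x := α • b i0 + β • b i1 with hx
  have hb : ∀ i j, inner ℝ (b i) (b j) = if i = j then (1 : ℝ) else 0 := fun i j => by
    rw [b.inner_eq_ite]
  have hin : ∀ i, inner ℝ (b i) x = α * (if i = i0 then 1 else 0) + β * (if i = i1 then 1 else 0) := by
    intro i
    rw [hx, inner_add_right, real_inner_smul_right, real_inner_smul_right, hb, hb]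
  have hx0 : x ≠ 0 := by
    intro h0
    have h1 := hin i0
    have h2 := hin i1
    rw [h0, inner_zero_right] at h1 h2
    simp only [if_true, if_neg hne, if_neg hne.symm] at h1 h2
    rcases hαβ with h | h
    · exact h (by linarith)
    · exact h (by linarith)
  have hσ : S.singularValues 1 * ‖x‖ ≤ ‖R x‖ := by
    rw [← sq_le_sq₀ (mul_nonneg (S.singularValues_nonneg _) (norm_nonneg _)) (norm_nonneg _),
      mul_pow]
    rw [show R x = S x from rfl, norm_sq_apply_eq S x, norm_sq_eq S, Finset.mul_sum]
    refine Finset.sum_le_sum fun i _ => ?_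
    by_cases hi : (i : ℕ) ≤ 1
    · exact mul_le_mul_of_nonneg_right (pow_le_pow_left₀ (S.singularValues_nonneg _)
        (S.singularValues_antitone hi) 2) (sq_nonneg _)
    · have e : inner ℝ (b i) x = 0 := by
        rw [hin, if_neg, if_neg]
        · ring
        · rintro rfl; exact hi le_rfl
        · rintro rfl; exact hi zero_le_one
      change _ * inner ℝ (b i) x ^ 2 ≤ _ * inner ℝ (b i) x ^ 2
      rw [e]
      simp
  have := (hσ.trans (h x hψ)).trans (D.le_opNorm x)
  exact le_of_mul_le_mul_right this (norm_pos_iff.2 hx0)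

theorem singularValues_pos {R B : Euc d →L[ℝ] Euc d} (h : B * R = 1) {i : ℕ} (hi : i < d) :
    0 < (R : Euc d →ₗ[ℝ] Euc d).singularValues i := by
  set S := (R : Euc d →ₗ[ℝ] Euc d) with hS
  refine (S.singularValues_nonneg i).lt_of_ne fun h0 => ?_
  have h1 := norm_apply_svBasis S ⟨i, hi⟩
  rw [← h0, norm_eq_zero] at h1
  have h2 : B (R (svBasis S ⟨i, hi⟩)) = svBasis S ⟨i, hi⟩ := by
    rw [← mul_apply_eq_comp, h, one_apply_eq_self]
  rw [show R (svBasis S ⟨i, hi⟩) = 0 from h1, map_zero] at h2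
  have h3 := (svBasis S).norm_eq_one ⟨i, hi⟩
  rw [← h2, norm_zero] at h3
  exact zero_ne_one h3

theorem inv_singularValues_last [NeZero d] {R B : Euc d →L[ℝ] Euc d} (h : B * R = 1)
    (h' : R * B = 1) :
    ((R : Euc d →ₗ[ℝ] Euc d).singularValues (d - 1))⁻¹ = ‖B‖ := by
  set S := (R : Euc d →ₗ[ℝ] Euc d) with hS
  have hd : d - 1 < d := Nat.sub_lt (NeZero.pos d) one_pos
  have hpos := singularValues_pos h hd
  apply le_antisymm
  · rw [inv_le_iff_one_le_mul₀ hpos]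
    have h1 := norm_apply_svBasis S ⟨d - 1, hd⟩
    have h2 : B (R (svBasis S ⟨d - 1, hd⟩)) = svBasis S ⟨d - 1, hd⟩ := by
      rw [← mul_apply_eq_comp, h, one_apply_eq_self]
    have h3 := B.le_opNorm (R (svBasis S ⟨d - 1, hd⟩))
    rw [h2, (svBasis S).norm_eq_one, show ‖R (svBasis S ⟨d - 1, hd⟩)‖ = _ from h1] at h3
    exact h3
  · refine B.opNorm_le_bound (inv_nonneg.2 hpos.le) fun x => ?_
    rw [inv_mul_eq_div, le_div_iff₀ hpos, mul_comm]
    have h1 : R (B x) = x := by rw [← mul_apply_eq_comp, h', one_apply_eq_self]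
    have : S.singularValues (d - 1) * ‖B x‖ ≤ ‖R (B x)‖ := by
      rw [← sq_le_sq₀ (mul_nonneg (S.singularValues_nonneg _) (norm_nonneg _)) (norm_nonneg _),
        mul_pow]
      rw [show R (B x) = S (B x) from rfl, norm_sq_apply_eq S, norm_sq_eq S, Finset.mul_sum]
      refine Finset.sum_le_sum fun i _ => mul_le_mul_of_nonneg_right
        (pow_le_pow_left₀ (S.singularValues_nonneg _) (S.singularValues_antitone ?_) 2)
        (sq_nonneg _)
      have := i.isLt
      omega
    rwa [h1] at this

/-- A lower bound for the first gap of a map close to rank one. -/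
theorem le_svRatio_one_two (hd : 2 ≤ d) {g : PGLR d} {w : Euc d} {ψ : Euc d →L[ℝ] ℝ}
    {D : Euc d →L[ℝ] Euc d} (hA : IsLift (ψ.smulRight w + D) g) {X Y : ℝ} (hX : 0 < X) (hY : 0 < Y)
    (hXY : X ≤ ‖ψ‖ * ‖w‖ - ‖D‖) (hD : ‖D‖ ≤ Y) : X / Y ≤ svRatio 1 2 g := by
  have : NeZero d := ⟨by omega⟩
  obtain ⟨c, hc, e⟩ := hA.repLin_eq
  obtain ⟨B, hB, -, hBA⟩ := (hA.smul hc).exists_inv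
  unfold svRatio
  rw [e]
  have h1 := norm_eq_singularValues_zero (c • (ψ.smulRight w + D))
  have h2 : ((c • (ψ.smulRight w + D) : Euc d →L[ℝ] Euc d) :
      Euc d →ₗ[ℝ] Euc d).singularValues 1 ≤ ‖c • D‖ := by
    refine singularValues_one_le hd (ψ := ψ) fun x hx => ?_
    simp [hx]
  have h3 := singularValues_pos hBA (i := 1) (by omega)
  change _ ≤ _ / ((c • (ψ.smulRight w + D) : Euc d →L[ℝ] Euc d) :
      Euc d →ₗ[ℝ] Euc d).singularValues 1
  rw [Nat.sub_self, h1, div_le_div_iff₀ hY h3, norm_smul]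
  rw [norm_smul] at h2
  have h4 : X ≤ ‖ψ.smulRight w + D‖ := by
    have := norm_sub_norm_le (ψ.smulRight w) (-D)
    rw [sub_neg_eq_add, ContinuousLinearMap.norm_smulRight_apply, norm_neg] at this
    linarith
  calc _ ≤ X * (‖c‖ * Y) := by gcongr; exact h2.trans (by gcongr)
    _ ≤ ‖ψ.smulRight w + D‖ * (‖c‖ * Y) := by gcongr
    _ = _ := by ring

/-- The ratio of extreme singular values is the condition number of a lift. -/
theorem svRatio_one_eq [NeZero d] {g : PGLR d} {A B : Euc d →L[ℝ] Euc d} (hA : IsLift A g)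
    (h : A * B = 1) (h' : B * A = 1) : svRatio 1 d g = ‖A‖ * ‖B‖ := by
  obtain ⟨c, hc, e⟩ := hA.repLin_eq
  unfold svRatio
  rw [e, Nat.sub_self, norm_eq_singularValues_zero, div_eq_mul_inv,
    inv_singularValues_last (B := c⁻¹ • B), norm_smul, norm_smul, norm_inv]
  · have : ‖c‖ ≠ 0 := norm_ne_zero_iff.2 hc
    field_simp
  · ext1 x
    have := congrArg (fun F : Euc d →L[ℝ] Euc d => F x) h'
    simp only [mul_apply_eq_comp] at this
    simp [this, hc]
  · ext1 x
    have := congrArg (fun F : Euc d →L[ℝ] Euc d => F x) h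
    simp only [mul_apply_eq_comp] at this
    simp [this, hc]

end SingularValues

/-! ### Convergence of spaces spanned by axes -/

section Axes

variable {d : ℕ}

/-- The projection to the line of `v` is injective on `V`, so `V` is a line. For the norm, `y` is
split into its part in `V`, which contributes `ε`, and its part orthogonal to `V`, which contributes
`2 * ε`. -/
theorem starProjection_near {V : Submodule ℝ (Euc d)} {v : Euc d} (hV : V ≠ ⊥)
    {ε : ℝ} (hε : ε ≤ 1 / 2)
    (h : ∀ x ∈ V, ‖x - (ℝ ∙ v).starProjection x‖ ≤ ε * ‖x‖) :
    (∃ x₀ ∈ V, x₀ ≠ 0 ∧ V = ℝ ∙ x₀) ∧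
      ‖V.starProjection - (ℝ ∙ v).starProjection‖ ≤ 3 * ε := by
  set W := (ℝ ∙ v : Submodule ℝ (Euc d)) with hW
  obtain ⟨x₀, hx₀, hx₀0⟩ := Submodule.exists_mem_ne_zero_of_ne_bot hV
  have hε0 : 0 ≤ ε := by
    by_contra hneg
    have h1 := h x₀ hx₀
    have h2 := norm_pos_iff.2 hx₀0
    have h3 := norm_nonneg (x₀ - W.starProjection x₀)
    nlinarith
  have hinj : ∀ x ∈ V, W.starProjection x = 0 → x = 0 := by
    intro x hx h0
    have h1 := h x hx
    rw [h0, sub_zero] at h1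
    by_contra hx0
    have := norm_pos_iff.2 hx0
    nlinarith
  obtain ⟨t, ht⟩ := Submodule.mem_span_singleton.1 (W.starProjection_apply_mem x₀)
  have ht0 : t ≠ 0 := by
    rintro rfl
    rw [zero_smul] at ht
    exact hx₀0 (hinj x₀ hx₀ ht.symm)
  have hv0 : v ≠ 0 := by
    rintro rfl
    rw [smul_zero] at ht
    exact hx₀0 (hinj x₀ hx₀ ht.symm)
  refine ⟨⟨x₀, hx₀, hx₀0, le_antisymm (fun y hy => ?_) ?_⟩, ?_⟩
  · obtain ⟨s, hs⟩ := Submodule.mem_span_singleton.1 (W.starProjection_apply_mem y)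
    have : y - (s / t) • x₀ = 0 := by
      refine hinj _ (V.sub_mem hy (V.smul_mem _ hx₀)) ?_
      rw [map_sub, map_smul, ← hs, ← ht, smul_smul, div_mul_cancel₀ _ ht0, sub_self]
    rw [sub_eq_zero.1 this]
    exact Submodule.smul_mem _ _ (Submodule.mem_span_singleton_self _)
  · rw [Submodule.span_singleton_le_iff_mem]; exact hx₀
  · -- vectors of `W` are near `V`
    have hWV : ∀ w ∈ W, ‖w - V.starProjection w‖ ≤ 2 * ε * ‖w‖ := by
      intro w hw
      obtain ⟨s, rfl⟩ := Submodule.mem_span_singleton.1 hw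
      have e1 : s • v = (s / t) • W.starProjection x₀ := by
        rw [← ht, smul_smul, div_mul_cancel₀ _ ht0]
      rw [e1, map_smul, ← smul_sub, norm_smul, norm_smul]
      have e2 : ‖W.starProjection x₀ - V.starProjection (W.starProjection x₀)‖ ≤
          ‖W.starProjection x₀ - x₀‖ := by
        have e4 : V.starProjection x₀ = x₀ := V.starProjection_eq_self_iff.2 hx₀
        have e3 : W.starProjection x₀ - V.starProjection (W.starProjection x₀) =
            Vᗮ.starProjection (W.starProjection x₀ - x₀) := by
          rw [Submodule.starProjection_orthogonal_val, map_sub, e4]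
          abel
        rw [e3]
        exact Submodule.norm_starProjection_apply_le _ _
      have e5 := h x₀ hx₀
      rw [norm_sub_rev] at e5
      have e6 : ‖x₀‖ ≤ 2 * ‖W.starProjection x₀‖ := by
        have := norm_sub_norm_le x₀ (x₀ - W.starProjection x₀)
        rw [sub_sub_cancel] at this
        have h7 := norm_nonneg x₀
        rw [norm_sub_rev] at e5
        nlinarith
      calc _ ≤ ‖s / t‖ * (ε * (2 * ‖W.starProjection x₀‖)) := by
            gcongr
            exact (e2.trans e5).trans (by gcongr)
        _ = _ := by ring
    refine ContinuousLinearMap.opNorm_le_bound _ (by positivity) fun y => ?_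
    set q := y - V.starProjection y with hq
    have hqn : ‖q‖ ≤ ‖y‖ := by
      rw [hq, ← Submodule.starProjection_orthogonal_val]
      exact Submodule.norm_starProjection_apply_le _ _
    set w := W.starProjection q with hw
    have h1 : ‖w‖ ≤ 2 * ε * ‖y‖ := by
      -- Projections are self-adjoint, so the orthogonal part of `y` can be traded for the
      -- orthogonal part of `w`, which is small because `w` lies in `W`.
      have e1 : ‖w‖ ^ 2 = inner ℝ (w - V.starProjection w) y := by
        rw [← real_inner_self_eq_norm_sq]
        conv_lhs => rw [hw, Submodule.inner_starProjection_left_eq_right]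
        rw [W.starProjection_eq_self_iff.2 (W.starProjection_apply_mem q), hq, inner_sub_left,
          inner_sub_left, Submodule.inner_starProjection_left_eq_right, real_inner_comm w y,
          real_inner_comm _ y]
      have e2 : ‖w‖ ^ 2 ≤ 2 * ε * ‖w‖ * ‖y‖ := by
        rw [e1]
        refine (real_inner_le_norm _ _).trans ?_
        gcongr
        exact hWV w (W.starProjection_apply_mem q)
      by_contra hlt
      push Not at hlt
      have : 0 < ‖w‖ := lt_of_le_of_lt (by positivity) hlt
      nlinarith
    have h2 : ‖V.starProjection y - W.starProjection (V.starProjection y)‖ ≤ ε * ‖y‖ :=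
      (h _ (V.starProjection_apply_mem y)).trans
        (mul_le_mul_of_nonneg_left (Submodule.norm_starProjection_apply_le _ _) hε0)
    have e : (V.starProjection - W.starProjection) y =
        (V.starProjection y - W.starProjection (V.starProjection y)) - w := by
      rw [hw, hq, map_sub, sub_apply]
      abel
    rw [e]
    refine (norm_sub_le _ _).trans ?_
    linarith

/-- Convergence of eigenspaces to the range of a limit of rank one. -/
theorem tendsto_starProjection_of_eigen {S : ℕ → Euc d →L[ℝ] Euc d} {v : Euc d} {μ : ℝ}
    (hμ : 0 < μ) (hS : Tendsto S atTop (𝓝 (μ • (ℝ ∙ v).starProjection))) {ev : ℕ → ℝ}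
    (hev : Tendsto ev atTop (𝓝 μ)) {V : ℕ → Submodule ℝ (Euc d)} (hV : ∀ n, V n ≠ ⊥)
    (h : ∀ n, ∀ x ∈ V n, S n x = ev n • x) :
    (∀ᶠ n in atTop, ∃ x₀ ∈ V n, x₀ ≠ 0 ∧ V n = ℝ ∙ x₀) ∧
      Tendsto (fun n => (V n).starProjection) atTop (𝓝 (ℝ ∙ v).starProjection) := by
  set W := (ℝ ∙ v : Submodule ℝ (Euc d)) with hW
  set ε : ℕ → ℝ := fun n => (|μ - ev n| + ‖S n - μ • W.starProjection‖) / μ with hε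
  have hε0 : Tendsto ε atTop (𝓝 0) := by
    have h1 : Tendsto (fun n => |μ - ev n|) atTop (𝓝 0) := by
      have := (tendsto_const_nhds (x := μ)).sub hev
      rw [sub_self] at this
      simpa using this.abs
    have h2 := tendsto_iff_norm_sub_tendsto_zero.1 hS
    have := (h1.add h2).div_const μ
    simpa using this
  have hnear : ∀ n, ∀ x ∈ V n, ‖x - W.starProjection x‖ ≤ ε n * ‖x‖ := by
    intro n x hx
    rw [hε, div_mul_eq_mul_div, le_div_iff₀ hμ]
    have e : μ • (x - W.starProjection x) =
        (μ - ev n) • x + (S n - μ • W.starProjection) x := by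
      rw [sub_apply, smul_apply, h n x hx, smul_sub, sub_smul]
      abel
    calc ‖x - W.starProjection x‖ * μ = ‖μ • (x - W.starProjection x)‖ := by
          rw [norm_smul, Real.norm_of_nonneg hμ.le, mul_comm]
      _ ≤ ‖(μ - ev n) • x‖ + ‖(S n - μ • W.starProjection) x‖ := by
          rw [e]; exact norm_add_le _ _
      _ ≤ |μ - ev n| * ‖x‖ + ‖S n - μ • W.starProjection‖ * ‖x‖ := by
          rw [norm_smul, Real.norm_eq_abs]
          gcongr
          exact ContinuousLinearMap.le_opNorm _ _
      _ = _ := by ring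
  have hev2 : ∀ᶠ n in atTop, ε n ≤ 1 / 2 :=
    (hε0.eventually_lt_const (by norm_num : (0 : ℝ) < 1 / 2)).mono fun _ h => h.le
  refine ⟨hev2.mono fun n hn => (starProjection_near (hV n) hn (hnear n)).1, ?_⟩
  rw [tendsto_iff_norm_sub_tendsto_zero]
  refine squeeze_zero' (Eventually.of_forall fun _ => norm_nonneg _)
    (hev2.mono fun n hn => (starProjection_near (hV n) hn (hnear n)).2) ?_
  simpa using hε0.const_mul 3

/-- The vector that represents a functional. -/
def dualVec (φ : Euc d →L[ℝ] ℝ) : Euc d := (InnerProductSpace.toDual ℝ (Euc d)).symm φ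

theorem inner_dualVec (φ : Euc d →L[ℝ] ℝ) (x : Euc d) : inner ℝ (dualVec φ) x = φ x := by
  rw [dualVec, InnerProductSpace.toDual_symm_apply]

theorem norm_dualVec (φ : Euc d →L[ℝ] ℝ) : ‖dualVec φ‖ = ‖φ‖ := by
  rw [dualVec, LinearIsometryEquiv.norm_map]

theorem ker_eq_orthogonal (φ : Euc d →L[ℝ] ℝ) :
    LinearMap.ker (φ : Euc d →ₗ[ℝ] ℝ) = (ℝ ∙ dualVec φ)ᗮ := by
  ext x
  rw [LinearMap.mem_ker, Submodule.mem_orthogonal_singleton_iff_inner_right, inner_dualVec]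
  rfl

theorem adjoint_smulRight_apply (φ : Euc d →L[ℝ] ℝ) (v x : Euc d) :
    ContinuousLinearMap.adjoint (φ.smulRight v) x = (inner ℝ v x : ℝ) • dualVec φ := by
  refine ext_inner_right ℝ fun y => ?_
  rw [ContinuousLinearMap.adjoint_inner_left, ContinuousLinearMap.smulRight_apply,
    real_inner_smul_right, real_inner_smul_left, inner_dualVec, real_inner_comm v x]
  ring

theorem smul_starProjection_singleton_apply (a : ℝ) {v : Euc d} (hv : v ≠ 0) (x : Euc d) :
    ((a * ‖v‖ ^ 2) • (ℝ ∙ v).starProjection) x = (a * inner ℝ v x : ℝ) • v := by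
  rw [smul_apply, Submodule.starProjection_singleton, smul_smul]
  congr 1
  have : ‖v‖ ≠ 0 := norm_ne_zero_iff.2 hv
  simp only [RCLike.ofReal_real_eq_id, id]
  field_simp

theorem smulRight_comp_adjoint (φ : Euc d →L[ℝ] ℝ) {v : Euc d} (hv : v ≠ 0) :
    (φ.smulRight v) * ContinuousLinearMap.adjoint (φ.smulRight v) =
      (‖φ‖ ^ 2 * ‖v‖ ^ 2) • (ℝ ∙ v).starProjection := by
  ext1 x
  rw [mul_apply_eq_comp, adjoint_smulRight_apply, ContinuousLinearMap.smulRight_apply, map_smul,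
    smul_starProjection_singleton_apply _ hv, ← inner_dualVec, real_inner_self_eq_norm_sq,
    norm_dualVec, smul_eq_mul, mul_comm]

theorem adjoint_comp_smulRight {φ : Euc d →L[ℝ] ℝ} (hφ : φ ≠ 0) (v : Euc d) :
    ContinuousLinearMap.adjoint (φ.smulRight v) * (φ.smulRight v) =
      (‖v‖ ^ 2 * ‖φ‖ ^ 2) • (ℝ ∙ dualVec φ).starProjection := by
  have hu0 : dualVec φ ≠ 0 := by rw [← norm_ne_zero_iff, norm_dualVec]; exact norm_ne_zero_iff.2 hφ
  ext1 x
  rw [mul_apply_eq_comp, adjoint_smulRight_apply, ContinuousLinearMap.smulRight_apply,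
    ← norm_dualVec, smul_starProjection_singleton_apply _ hu0, inner_dualVec,
    real_inner_smul_right, real_inner_self_eq_norm_sq, mul_comm]

theorem smul_mul_adjoint_smul (c : ℝ) (A : Euc d →L[ℝ] Euc d) :
    (c • A) * ContinuousLinearMap.adjoint (c • A) =
      c ^ 2 • (A * ContinuousLinearMap.adjoint A) := by
  ext1 x
  simp [smul_smul, pow_two]

theorem adjoint_smul_mul_smul (c : ℝ) (A : Euc d →L[ℝ] Euc d) :
    ContinuousLinearMap.adjoint (c • A) * (c • A) =
      c ^ 2 • (ContinuousLinearMap.adjoint A * A) := by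
  ext1 x
  simp [smul_smul, pow_two]

theorem apply_adjoint_apply_svBasis (R : Euc d →ₗ[ℝ] Euc d) (i : Fin d) :
    R (LinearMap.adjoint R (R (svBasis R i))) =
      (R.singularValues i ^ 2) • R (svBasis R i) := by
  rw [adjoint_apply_svBasis, map_smul]

/-- No eigenvalue of `g g^*` exceeds the square of the norm, so only the top eigenspace contributes
non-zero vectors to the supremum defining `axesSpan`. The scalar between two lifts rescales both
sides alike. -/
theorem axesSpan_one_spec [NeZero d] {A : Euc d →L[ℝ] Euc d} {g : PGLR d} (hA : IsLift A g) :
    axesSpan 1 g ≠ ⊥ ∧ ∀ x ∈ axesSpan 1 g,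
      (A * ContinuousLinearMap.adjoint A) x = (‖A‖ ^ 2) • x := by
  obtain ⟨c, hc, e⟩ := hA.repLin_eq
  set R : Euc d →L[ℝ] Euc d := c • A with hR
  obtain ⟨B, -, -, hBR⟩ := (hA.smul hc).exists_inv
  have h0 : (repLin g).singularValues 0 = ‖R‖ := by
    rw [e]; exact norm_eq_singularValues_zero R
  have happ : ∀ x, (repLin g ∘ₗ LinearMap.adjoint (repLin g)) x =
      R (ContinuousLinearMap.adjoint R x) := by
    intro x; rw [e]; rfl
  constructor
  · have hmem : R (svBasis (repLin g) 0) ∈ axesSpan 1 g := by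
      refine Submodule.mem_iSup_of_mem _ (Submodule.mem_iSup_of_mem le_rfl ?_)
      rw [Module.End.mem_eigenspace_iff]
      have := apply_adjoint_apply_svBasis (repLin g) 0
      rw [Fin.val_zero] at this
      rw [Nat.sub_self]
      rw [show R (svBasis (repLin g) 0) = repLin g (svBasis (repLin g) 0) by rw [e]; rfl]
      exact this
    intro hbot
    rw [hbot, Submodule.mem_bot] at hmem
    have h1 : B (R (svBasis (repLin g) 0)) = svBasis (repLin g) 0 := by
      rw [← mul_apply_eq_comp, hBR, one_apply_eq_self]
    rw [hmem, map_zero] at h1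
    have h2 := (svBasis (repLin g)).norm_eq_one 0
    rw [← h1, norm_zero] at h2
    exact zero_ne_one h2
  · have key : axesSpan 1 g ≤ Module.End.eigenspace
        ((R * ContinuousLinearMap.adjoint R : Euc d →L[ℝ] Euc d) : Euc d →ₗ[ℝ] Euc d)
          (‖R‖ ^ 2) := by
      refine iSup_le fun r => iSup_le fun hr => ?_
      rw [Nat.sub_self, h0] at hr
      intro x hx
      rw [Module.End.mem_eigenspace_iff, happ] at hx
      rw [Module.End.mem_eigenspace_iff]
      change R (ContinuousLinearMap.adjoint R x) = _
      by_cases hx0 : x = 0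
      · simp [hx0]
      have hle : ‖R (ContinuousLinearMap.adjoint R x)‖ ≤ ‖R‖ ^ 2 * ‖x‖ := by
        refine (R.le_opNorm _).trans ?_
        rw [pow_two, mul_assoc]
        gcongr
        refine (ContinuousLinearMap.le_opNorm _ _).trans ?_
        rw [LinearIsometryEquiv.norm_map]
      rw [hx, norm_smul, Real.norm_of_nonneg ((sq_nonneg _).trans hr)] at hle
      have := le_of_mul_le_mul_right hle (norm_pos_iff.2 hx0)
      rw [hx, le_antisymm this hr]
    intro x hx
    have h1 := Module.End.mem_eigenspace_iff.1 (key hx)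
    have h2 : (R * ContinuousLinearMap.adjoint R) x = ‖R‖ ^ 2 • x := h1
    rw [hR, smul_mul_adjoint_smul, norm_smul, mul_pow, smul_apply, Real.norm_eq_abs, sq_abs,
      mul_smul] at h2
    exact smul_right_injective _ (pow_ne_zero 2 hc) h2

/-- The witness is the eigenspace of `g g^*` for the smallest singular value squared; up to scale it
is the top eigenspace of the inverse operator, built from a lift of `g⁻¹`. If it is a line, the
remaining axes span its orthogonal complement. So limits of hyperplanes reduce to limits of lines.
-/
theorem axesSpan_pred_spec (hd : 2 ≤ d) {B : Euc d →L[ℝ] Euc d} {g : PGLR d}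
    (hB : IsLift B g⁻¹) : ∃ L : Submodule ℝ (Euc d), L ≠ ⊥ ∧
      (∀ x ∈ L, (ContinuousLinearMap.adjoint B * B) x = (‖B‖ ^ 2) • x) ∧
      ((∃ x₀ ∈ L, x₀ ≠ 0 ∧ L = ℝ ∙ x₀) → axesSpan (d - 1) g = Lᗮ) := by
  have : NeZero d := ⟨by omega⟩
  obtain ⟨R, hR, e⟩ := exists_repLin_eq g
  obtain ⟨B₀, hB₀, hRB, hBR⟩ := hR.exists_inv
  obtain ⟨c, hc, rfl⟩ := hB₀.eq_smul hB
  set T := repLin g ∘ₗ LinearMap.adjoint (repLin g) with hT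
  set σ := (repLin g).singularValues with hσ
  have hσl : (σ (d - 1))⁻¹ = ‖B₀‖ := by
    rw [hσ, e]; exact inv_singularValues_last hBR hRB
  have hσpos : ∀ i, i < d → 0 < σ i := fun i hi => by
    rw [hσ, e]; exact singularValues_pos hBR hi
  have happ : ∀ x, T x = R (ContinuousLinearMap.adjoint R x) := by
    intro x; rw [hT, e]; rfl
  have hsymm : ∀ x y, inner ℝ (T x) y = inner ℝ x (T y) := by
    intro x y
    rw [happ, happ, ← ContinuousLinearMap.adjoint_inner_right,
      ContinuousLinearMap.adjoint_inner_left]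
  have hl : d - 1 < d := by omega
  have hl2 : d - 2 < d := by omega
  set b := svBasis (repLin g) with hb
  have hu0 : ∀ i, R (b i) ≠ 0 := by
    intro i hi
    have h1 : B₀ (R (b i)) = b i := by
      rw [← mul_apply_eq_comp, hBR, one_apply_eq_self]
    rw [hi, map_zero] at h1
    have h2 := b.norm_eq_one i
    rw [← h1, norm_zero] at h2
    exact zero_ne_one h2
  have hTu : ∀ i : Fin d, T (R (b i)) = σ i ^ 2 • R (b i) := by
    intro i
    have := apply_adjoint_apply_svBasis (repLin g) i
    have e2 : R (b i) = repLin g (b i) := by rw [e]; rfl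
    rw [e2]
    exact this
  have hin : ∀ i : Fin d, ∀ y, inner ℝ (R (b i)) (R y) = σ i ^ 2 * inner ℝ (b i) y := by
    intro i y
    have := inner_apply_svBasis (repLin g) i y
    have e2 : ∀ y, R y = repLin g y := fun y => by rw [e]; rfl
    rw [e2, e2]
    exact this
  refine ⟨Module.End.eigenspace T (σ (d - 1) ^ 2), ?_, ?_, ?_⟩
  · intro hbot
    have : R (b ⟨d - 1, hl⟩) ∈ Module.End.eigenspace T (σ (d - 1) ^ 2) :=
      Module.End.mem_eigenspace_iff.2 (hTu ⟨d - 1, hl⟩)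
    rw [hbot, Submodule.mem_bot] at this
    exact hu0 _ this
  · intro x hx
    rw [Module.End.mem_eigenspace_iff, happ] at hx
    rw [adjoint_smul_mul_smul, norm_smul, mul_pow, smul_apply, Real.norm_eq_abs, sq_abs, mul_smul]
    congr 1
    rw [← hσl, inv_pow]
    have h1 : ContinuousLinearMap.adjoint B₀ (ContinuousLinearMap.adjoint R x) = x := by
      refine ext_inner_right ℝ fun y => ?_
      rw [ContinuousLinearMap.adjoint_inner_left, ContinuousLinearMap.adjoint_inner_left,
        ← mul_apply_eq_comp, hRB, one_apply_eq_self]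
    have h2 : B₀ (R (ContinuousLinearMap.adjoint R x)) = ContinuousLinearMap.adjoint R x := by
      rw [← mul_apply_eq_comp, hBR, one_apply_eq_self]
    rw [hx, map_smul] at h2
    rw [mul_apply_eq_comp, eq_inv_smul_iff₀ (pow_ne_zero 2 (hσpos _ hl).ne'), ← map_smul, h2, h1]
  · rintro ⟨x₀, hx₀, hx₀0, hL⟩
    have hlast : R (b ⟨d - 1, hl⟩) ∈ Module.End.eigenspace T (σ (d - 1) ^ 2) :=
      Module.End.mem_eigenspace_iff.2 (hTu ⟨d - 1, hl⟩)
    have horth : inner ℝ (R (b ⟨d - 1, hl⟩)) (R (b ⟨d - 2, hl2⟩)) = (0 : ℝ) := by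
      rw [hin, b.inner_eq_ite, if_neg, mul_zero]
      simp [Fin.ext_iff]
      omega
    -- Otherwise the images of the last two singular vectors, non-zero and orthogonal, would lie on
    -- one line.
    have hlt : σ (d - 1) < σ (d - 2) := by
      refine ((repLin g).singularValues_antitone (by omega)).lt_of_ne fun heq => ?_
      have h2 : R (b ⟨d - 2, hl2⟩) ∈ Module.End.eigenspace T (σ (d - 1) ^ 2) := by
        rw [Module.End.mem_eigenspace_iff, hσ, heq]
        exact hTu ⟨d - 2, hl2⟩
      rw [hL] at hlast h2
      obtain ⟨s, hs⟩ := Submodule.mem_span_singleton.1 hlast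
      obtain ⟨t, ht⟩ := Submodule.mem_span_singleton.1 h2
      rw [← hs, ← ht, real_inner_smul_left, real_inner_smul_right,
        real_inner_self_eq_norm_sq] at horth
      have h3 := hu0 ⟨d - 1, hl⟩
      have h4 := hu0 ⟨d - 2, hl2⟩
      rw [← hs] at h3
      rw [← ht] at h4
      have h5 : ‖x₀‖ ≠ 0 := norm_ne_zero_iff.2 hx₀0
      have : s ≠ 0 := fun h => h3 (by rw [h, zero_smul])
      have : t ≠ 0 := fun h => h4 (by rw [h, zero_smul])
      simp_all
    have hLspan : Module.End.eigenspace T (σ (d - 1) ^ 2) = ℝ ∙ R (b ⟨d - 1, hl⟩) := by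
      rw [hL] at hlast ⊢
      obtain ⟨s, hs⟩ := Submodule.mem_span_singleton.1 hlast
      have : s ≠ 0 := fun h => hu0 ⟨d - 1, hl⟩ (by rw [← hs, h, zero_smul])
      rw [← hs]
      exact (Submodule.span_singleton_smul_eq (IsUnit.mk0 s this) x₀).symm
    apply le_antisymm
    · refine iSup_le fun r => iSup_le fun hr => ?_
      intro x hx
      rw [Module.End.mem_eigenspace_iff] at hx
      rw [hLspan, Submodule.mem_orthogonal_singleton_iff_inner_right]
      have h1 := hsymm (R (b ⟨d - 1, hl⟩)) x
      rw [show T x = r • x from hx, hTu, real_inner_smul_left, real_inner_smul_right] at h1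
      have h2 : σ (d - 1) ^ 2 < r := by
        refine lt_of_lt_of_le ?_ hr
        exact pow_lt_pow_left₀ hlt (hσpos _ hl).le two_ne_zero
      have h3 : (r - σ (d - 1) ^ 2) * inner ℝ (R (b ⟨d - 1, hl⟩)) x = 0 := by
        linear_combination -h1
      exact (mul_eq_zero.1 h3).resolve_left (sub_ne_zero.2 h2.ne')
    · intro x hx
      rw [hLspan, Submodule.mem_orthogonal_singleton_iff_inner_right] at hx
      have hxR : R (B₀ x) = x := by rw [← mul_apply_eq_comp, hRB, one_apply_eq_self]
      have hsum : x = ∑ i : Fin d, inner ℝ (b i) (B₀ x) • R (b i) := by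
        conv_lhs => rw [← hxR, ← b.sum_repr' (B₀ x), map_sum]
        simp only [map_smul]
      have hz : inner ℝ (b ⟨d - 1, hl⟩) (B₀ x) = (0 : ℝ) := by
        rw [← hxR, hin] at hx
        exact (mul_eq_zero.1 hx).resolve_left (pow_ne_zero 2 (hσpos _ hl).ne')
      rw [hsum]
      refine Submodule.sum_mem _ fun i _ => ?_
      by_cases hi : (i : ℕ) = d - 1
      · have : i = ⟨d - 1, hl⟩ := Fin.ext hi
        rw [this, hz, zero_smul]
        exact Submodule.zero_mem _
      · refine Submodule.smul_mem _ _ (Submodule.mem_iSup_of_mem (σ i ^ 2)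
          (Submodule.mem_iSup_of_mem ?_ (Module.End.mem_eigenspace_iff.2 (hTu i))))
        have := i.isLt
        exact pow_le_pow_left₀ (hσpos _ (by omega)).le
          ((repLin g).singularValues_antitone (by omega)) 2

/-- Limits of the attracting axes of maps that converge to a map of rank one. -/
theorem tendsto_axesSpan_one [NeZero d] {A : ℕ → Euc d →L[ℝ] Euc d} {g : ℕ → PGLR d}
    (hA : ∀ n, IsLift (A n) (g n)) {φ : Euc d →L[ℝ] ℝ} {v : Euc d} (hφ : φ ≠ 0) (hv : v ≠ 0)
    (h : Tendsto A atTop (𝓝 (φ.smulRight v))) :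
    SubspaceTendsto (fun n => axesSpan 1 (g n)) (ℝ ∙ v) := by
  refine (tendsto_starProjection_of_eigen (μ := ‖φ‖ ^ 2 * ‖v‖ ^ 2)
    (S := fun n => A n * ContinuousLinearMap.adjoint (A n)) (ev := fun n => ‖A n‖ ^ 2)
    (by have := norm_pos_iff.2 hφ; have := norm_pos_iff.2 hv; positivity) ?_ ?_
    (fun n => (axesSpan_one_spec (hA n)).1) (fun n => (axesSpan_one_spec (hA n)).2)).2
  · rw [← smulRight_comp_adjoint φ hv]
    exact h.mul ((ContinuousLinearMap.adjoint.continuous.tendsto _).comp h)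
  · rw [← mul_pow, ← ContinuousLinearMap.norm_smulRight_apply]
    exact h.norm.pow 2

/-- Limits of the spans of all but the last axis, when the inverses converge to a map of rank
one. -/
theorem tendsto_axesSpan_pred (hd : 2 ≤ d) {B : ℕ → Euc d →L[ℝ] Euc d} {g : ℕ → PGLR d}
    (hB : ∀ n, IsLift (B n) (g n)⁻¹) {φ : Euc d →L[ℝ] ℝ} {v : Euc d} (hφ : φ ≠ 0) (hv : v ≠ 0)
    (h : Tendsto B atTop (𝓝 (φ.smulRight v))) :
    SubspaceTendsto (fun n => axesSpan (d - 1) (g n)) (LinearMap.ker (φ : Euc d →ₗ[ℝ] ℝ)) := by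
  choose L hL1 hL2 hL3 using fun n => axesSpan_pred_spec hd (hB n)
  have key := tendsto_starProjection_of_eigen (μ := ‖v‖ ^ 2 * ‖φ‖ ^ 2) (v := dualVec φ)
    (S := fun n => ContinuousLinearMap.adjoint (B n) * B n) (ev := fun n => ‖B n‖ ^ 2)
    (by have := norm_pos_iff.2 hφ; have := norm_pos_iff.2 hv; positivity) ?_ ?_ hL1 hL2
  · unfold SubspaceTendsto
    have e : (LinearMap.ker (φ : Euc d →ₗ[ℝ] ℝ)).starProjection =
        1 - (ℝ ∙ dualVec φ).starProjection := by
      rw [← Submodule.starProjection_orthogonal']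
      congr 1
      exact ker_eq_orthogonal φ
    rw [e]
    refine Tendsto.congr' ?_ (tendsto_const_nhds.sub key.2)
    filter_upwards [key.1] with n hn
    rw [← Submodule.starProjection_orthogonal']
    congr 1
    exact (hL3 n hn).symm
  · rw [← adjoint_comp_smulRight hφ v]
    exact ((ContinuousLinearMap.adjoint.continuous.tendsto _).comp h).mul h
  · rw [← mul_pow, mul_comm, ← ContinuousLinearMap.norm_smulRight_apply]
    exact h.norm.pow 2

end Axes

/-! ### Powers of proximal and of unipotent maps -/

section Proximal

open Polynomial

variable {d : ℕ}

/-- The linear map of a matrix on Euclidean space. -/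
abbrev eucCLM (M : Matrix (Fin d) (Fin d) ℝ) : Euc d →L[ℝ] Euc d :=
  Matrix.toEuclideanCLM (𝕜 := ℝ) (n := Fin d) M

/-- Gelfand's formula bounds all large powers by `t ^ n` for some `t` between the spectral radius
and 1; the constant takes care of the finitely many small exponents. -/
theorem exists_pow_norm_le {A : Type*} [NormedRing A] [NormedAlgebra ℂ A] [CompleteSpace A]
    [Nontrivial A] (a : A) (ha : ∀ z ∈ spectrum ℂ a, ‖z‖ < 1) :
    ∃ θ C : ℝ, 0 < θ ∧ θ < 1 ∧ 0 < C ∧ ∀ n : ℕ, ‖a ^ n‖ ≤ C * θ ^ n := by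
  have hr : spectralRadius ℂ a < (1 : NNReal) :=
    spectrum.spectralRadius_lt_of_forall_lt a fun z hz => ha z hz
  obtain ⟨t, ht1, ht2⟩ := ENNReal.lt_iff_exists_nnreal_btwn.1 hr
  have ht2' : t < 1 := by exact_mod_cast ht2
  have ht0 : 0 < t := by
    have h : (0 : ENNReal) < t := lt_of_le_of_lt bot_le ht1
    exact_mod_cast h
  have hev := (spectrum.pow_nnnorm_pow_one_div_tendsto_nhds_spectralRadius a).eventually_lt_const ht1
  obtain ⟨N, hN⟩ := eventually_atTop.1 hev
  have ht0' : (0 : ℝ) < t := ht0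
  have hbig : ∀ n, max N 1 ≤ n → ‖a ^ n‖ ≤ (t : ℝ) ^ n := by
    intro n hn
    have h1 := hN n ((le_max_left _ _).trans hn)
    have hn0 : (n : ℝ) ≠ 0 := by
      have := (le_max_right _ _).trans hn
      positivity
    have h2 := ENNReal.rpow_le_rpow h1.le (Nat.cast_nonneg n : (0 : ℝ) ≤ n)
    rw [← ENNReal.rpow_mul, one_div_mul_cancel hn0, ENNReal.rpow_one, ENNReal.rpow_natCast] at h2
    have h3 : ‖a ^ n‖₊ ≤ t ^ n := by exact_mod_cast h2
    exact_mod_cast h3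
  refine ⟨t, 1 + ∑ n ∈ Finset.range (max N 1), ‖a ^ n‖ / (t : ℝ) ^ n, ht0', by exact_mod_cast ht2',
    by positivity, fun n => ?_⟩
  have hp : (0 : ℝ) < (t : ℝ) ^ n := by positivity
  rw [← div_le_iff₀ hp]
  by_cases hn : max N 1 ≤ n
  · have h1 := hbig n hn
    have : ‖a ^ n‖ / (t : ℝ) ^ n ≤ 1 := by rw [div_le_one hp]; exact h1
    refine this.trans ?_
    have : 0 ≤ ∑ n ∈ Finset.range (max N 1), ‖a ^ n‖ / (t : ℝ) ^ n :=
      Finset.sum_nonneg fun _ _ => by positivity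
    linarith
  · have := Finset.single_le_sum (f := fun n => ‖a ^ n‖ / (t : ℝ) ^ n)
      (fun i _ => by positivity) (Finset.mem_range.2 (not_le.1 hn))
    linarith

theorem norm_eucCLM_le (X : Matrix (Fin d) (Fin d) ℝ) {t : ℝ} (h : ∀ i j, |X i j| ≤ t) :
    ‖eucCLM X‖ ≤ (∑ i, ∑ j, ‖eucCLM (Matrix.single i j (1 : ℝ) : Matrix (Fin d) (Fin d) ℝ)‖) * t := by
  have e : eucCLM X = ∑ i, ∑ j, X i j • eucCLM (Matrix.single i j (1 : ℝ)) := by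
    conv_lhs => rw [Matrix.matrix_eq_sum_single X]
    simp only [eucCLM, map_sum]
    refine Finset.sum_congr rfl fun i _ => Finset.sum_congr rfl fun j _ => ?_
    rw [← map_smul]
    congr 1
    rw [Matrix.smul_single, smul_eq_mul, mul_one]
  rw [e, Finset.sum_mul]
  refine (norm_sum_le _ _).trans (Finset.sum_le_sum fun i _ => ?_)
  rw [Finset.sum_mul]
  refine (norm_sum_le _ _).trans (Finset.sum_le_sum fun j _ => ?_)
  rw [norm_smul, mul_comm, Real.norm_eq_abs]
  gcongr
  exact h i j

/-- Gelfand's formula is applied to the complexification, and the bound returns to the real matrix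
through its entries. -/
theorem exists_pow_eucCLM_le [NeZero d] (B : Matrix (Fin d) (Fin d) ℝ)
    (hB : ∀ (z : ℂ) (x : Fin d → ℂ), x ≠ 0 → (B.map (algebraMap ℝ ℂ)).mulVec x = z • x → ‖z‖ < 1) :
    ∃ θ C : ℝ, 0 < θ ∧ θ < 1 ∧ 0 < C ∧ ∀ n : ℕ, ‖eucCLM (B ^ n)‖ ≤ C * θ ^ n := by
  set Bc := B.map (algebraMap ℝ ℂ) with hBc
  set a := Matrix.toEuclideanCLM (𝕜 := ℂ) (n := Fin d) Bc with ha
  have hsp : spectrum ℂ a = spectrum ℂ Bc :=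
    AlgEquiv.spectrum_eq (Matrix.toEuclideanCLM (𝕜 := ℂ) (n := Fin d)).toAlgEquiv Bc
  obtain ⟨θ, C, hθ, hθ1, hC, h⟩ := exists_pow_norm_le a (by
    intro z hz
    rw [hsp, ← Matrix.spectrum_toLin', ← Module.End.hasEigenvalue_iff_mem_spectrum] at hz
    obtain ⟨x, hx⟩ := hz.exists_hasEigenvector
    exact hB z x hx.2 (by simpa using hx.apply_eq_smul))
  set Q := ∑ i, ∑ j, ‖eucCLM (Matrix.single i j (1 : ℝ) : Matrix (Fin d) (Fin d) ℝ)‖ with hQ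
  have hQ0 : 0 ≤ Q := Finset.sum_nonneg fun _ _ => Finset.sum_nonneg fun _ _ => norm_nonneg _
  refine ⟨θ, (Q + 1) * C, hθ, hθ1, by positivity, fun n => ?_⟩
  refine (norm_eucCLM_le (t := C * θ ^ n) (B ^ n) fun i j => ?_).trans ?_
  · have e1 : (((B ^ n) i j : ℝ) : ℂ) = (Bc ^ n) i j := by
      rw [hBc, ← Matrix.map_pow]
      rfl
    have e2 : (Bc ^ n) i j = (a ^ n) (EuclideanSpace.single j 1) i := by
      rw [ha, ← map_pow, Matrix.ofLp_toEuclideanCLM]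
      simp
    rw [← Real.norm_eq_abs, ← Complex.norm_real, e1, e2]
    refine (PiLp.norm_apply_le _ i).trans (((a ^ n).le_opNorm _).trans ?_)
    simpa using h n
  · have : 0 < θ ^ n := by positivity
    nlinarith [mul_pos hC this]

/-- A matrix whose range is a line. -/
theorem exists_smulRight {x : Proj d} {Q : Matrix (Fin d) (Fin d) ℝ}
    (h : x.submodule = LinearMap.range (Matrix.toLin' Q)) :
    ∃ (v : Euc d) (φ : Euc d →L[ℝ] ℝ), v ≠ 0 ∧ φ ≠ 0 ∧ x.submodule = ℝ ∙ WithLp.ofLp v ∧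
      eucCLM Q = φ.smulRight v ∧ ∀ u : Euc d, φ u = 0 ↔ Q.mulVec (WithLp.ofLp u) = 0 := by
  set v : Euc d := WithLp.toLp 2 x.rep with hv
  have hv0 : v ≠ 0 := by
    rw [hv, Ne, WithLp.toLp_eq_zero]
    exact x.rep_nonzero
  have hn : ‖v‖ ^ 2 ≠ 0 := pow_ne_zero 2 (norm_ne_zero_iff.2 hv0)
  have hx : x.submodule = ℝ ∙ WithLp.ofLp v := x.submodule_eq
  set φ : Euc d →L[ℝ] ℝ := (‖v‖ ^ 2)⁻¹ • (innerSL ℝ v).comp (eucCLM Q) with hφ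
  have hQ : ∀ u, eucCLM Q u = φ u • v := by
    intro u
    have hmem : Q.mulVec (WithLp.ofLp u) ∈ x.submodule := by
      rw [h]; exact ⟨WithLp.ofLp u, rfl⟩
    rw [hx] at hmem
    obtain ⟨t, ht⟩ := Submodule.mem_span_singleton.1 hmem
    have e : eucCLM Q u = t • v := by
      apply (WithLp.equiv 2 (Fin d → ℝ)).injective
      change WithLp.ofLp (eucCLM Q u) = WithLp.ofLp (t • v)
      rw [Matrix.ofLp_toEuclideanCLM, ← ht]
      rfl
    have e2 : φ u = t := by
      simp only [hφ, smul_apply, ContinuousLinearMap.comp_apply, innerSL_apply_apply, e, smul_eq_mul]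
      rw [real_inner_smul_right, real_inner_self_eq_norm_sq]
      field_simp
    rw [e2, e]
  have hker : ∀ u : Euc d, φ u = 0 ↔ Q.mulVec (WithLp.ofLp u) = 0 := by
    intro u
    have e : WithLp.ofLp (eucCLM Q u) = 0 ↔ eucCLM Q u = 0 := WithLp.ofLp_eq_zero 2
    rw [← Matrix.ofLp_toEuclideanCLM, e, hQ u, smul_eq_zero, or_iff_left hv0]
  refine ⟨v, φ, hv0, ?_, hx, ContinuousLinearMap.ext fun u => ?_, hker⟩
  · intro h0
    have hmem : x.rep ∈ x.submodule := by
      rw [x.submodule_eq]; exact Submodule.mem_span_singleton_self _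
    rw [h] at hmem
    obtain ⟨u, hu⟩ := hmem
    have := (hker (WithLp.toLp 2 u)).1 (by rw [h0]; rfl)
    exact x.rep_nonzero (by rw [← hu]; exact this)
  · rw [hQ, ContinuousLinearMap.smulRight_apply]

/-- Write the characteristic polynomial as `(X - r) * q` with `q(r) ≠ 0`. Then `π = q(M) / q(r)` is
the spectral projection to the attracting line along the repelling hyperplane, and `M / r = π + B`
with `π * B = B * π = 0`. Hence the `n`-th power of `M / r` is `π + B ^ n`, and dominance makes the
spectral radius of `B` less than 1. -/
theorem IsProximalWith.exists_approx [NeZero d] {g : PGLR d} {x : Proj d}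
    {H : Submodule ℝ (Fin d → ℝ)} (h : IsProximalWith g x H) :
    ∃ (v : Euc d) (φ : Euc d →L[ℝ] ℝ) (C θ : ℝ), v ≠ 0 ∧ φ ≠ 0 ∧
      x.submodule = ℝ ∙ WithLp.ofLp v ∧ (∀ u : Euc d, φ u = 0 ↔ WithLp.ofLp u ∈ H) ∧
      0 < C ∧ 0 < θ ∧ θ < 1 ∧
      ∀ n : ℕ, 1 ≤ n → ∃ A, IsLift A (g ^ n) ∧ ‖A - φ.smulRight v‖ ≤ C * θ ^ n := by
  obtain ⟨G, r, rfl, ⟨hcount, hroots⟩, hx, rfl⟩ := h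
  set M : Matrix (Fin d) (Fin d) ℝ := (G : Matrix (Fin d) (Fin d) ℝ) with hM
  have hp0 : M.charpoly ≠ 0 := M.charpoly_monic.ne_zero
  have hinj : Function.Injective (algebraMap ℝ ℂ) := (algebraMap ℝ ℂ).injective
  have hmult : M.charpoly.rootMultiplicity r = 1 := by
    rw [count_roots] at hcount
    rw [Polynomial.eq_rootMultiplicity_map hinj]
    exact hcount
  set q := M.charpoly /ₘ (X - C r) with hq
  have hq0 : q.eval r ≠ 0 := by
    have := Polynomial.eval_divByMonic_pow_rootMultiplicity_ne_zero r hp0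
    rwa [hmult, pow_one] at this
  have hfac : M.charpoly = (X - C r) * q := by
    refine (Polynomial.mul_divByMonic_eq_iff_isRoot.2 ?_).symm
    rw [← Polynomial.rootMultiplicity_pos hp0, hmult]
    exact one_pos
  obtain ⟨s, hs⟩ : (X - C r) ∣ q - C (q.eval r) := by
    rw [Polynomial.dvd_iff_isRoot]; simp
  have hs' : q = C (q.eval r) + (X - C r) * s := by rw [← hs]; ring
  have haX : aeval M (X - C r) = M - r • 1 := by
    rw [map_sub, aeval_X, aeval_C, Algebra.algebraMap_eq_smul_one]
  have haC : aeval M (C (q.eval r)) = (q.eval r) • (1 : Matrix (Fin d) (Fin d) ℝ) := by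
    rw [aeval_C, Algebra.algebraMap_eq_smul_one]
  set π : Matrix (Fin d) (Fin d) ℝ := (q.eval r)⁻¹ • aeval M q with hπ
  have h1 : (M - r • 1) * π = 0 := by
    rw [hπ, mul_smul_comm, ← haX, ← map_mul, ← hfac, Matrix.aeval_self_charpoly, smul_zero]
  have h2 : π * (M - r • 1) = 0 := by
    rw [hπ, smul_mul_assoc, ← haX, ← map_mul, mul_comm q, ← hfac, Matrix.aeval_self_charpoly,
      smul_zero]
  have hMπ : M * π = r • π := by
    rw [sub_mul, smul_mul_assoc, one_mul, sub_eq_zero] at h1; exact h1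
  have hπM : π * M = r • π := by
    rw [mul_sub, mul_smul_comm, mul_one, sub_eq_zero] at h2; exact h2
  have hπs : π = 1 + (M - r • 1) * ((q.eval r)⁻¹ • aeval M s) := by
    conv_lhs => rw [hπ, hs', map_add, haC, map_mul, haX, smul_add, smul_smul, eval_add, eval_mul]
    simp [hq0]
  have hπs' : π = 1 + ((q.eval r)⁻¹ • aeval M s) * (M - r • 1) := by
    rw [hπs, ← haX, ← map_smul, ← map_mul, ← map_mul, mul_comm]
  have hππ : π * π = π := by
    conv_lhs => enter [2]; rw [hπs]
    rw [mul_add, mul_one, ← mul_assoc, h2, zero_mul, add_zero]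
  have hr0 : r ≠ 0 := by
    rintro rfl
    have hdet : M.det = 0 := by
      rw [Matrix.det_eq_sign_charpoly_coeff, Polynomial.coeff_zero_eq_eval_zero, hfac]
      simp
    have : IsUnit M.det := (Matrix.isUnit_iff_isUnit_det _).1 G.isUnit
    exact this.ne_zero hdet
  have hrange : x.submodule = LinearMap.range (Matrix.toLin' π) := by
    rw [hx]
    ext y
    rw [Module.End.mem_eigenspace_iff, Matrix.toLin'_apply]
    constructor
    · intro hy
      refine ⟨y, ?_⟩
      have : (M - r • 1).mulVec y = 0 := by
        rw [Matrix.sub_mulVec, hy, Matrix.smul_mulVec, Matrix.one_mulVec, sub_self]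
      rw [Matrix.toLin'_apply, hπs', Matrix.add_mulVec, Matrix.one_mulVec, ← Matrix.mulVec_mulVec,
        this, Matrix.mulVec_zero, add_zero]
    · rintro ⟨u, rfl⟩
      rw [Matrix.toLin'_apply, Matrix.mulVec_mulVec, hMπ, Matrix.smul_mulVec]
  obtain ⟨v, φ, hv0, hφ0, hxv, hQ, hker⟩ := exists_smulRight hrange
  -- the complementary part
  set B : Matrix (Fin d) (Fin d) ℝ := r⁻¹ • M - π with hB
  have hπB : π * B = 0 := by
    rw [hB, mul_sub, mul_smul_comm, hπM, smul_smul, inv_mul_cancel₀ hr0, one_smul, hππ, sub_self]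
  have hpow : ∀ n : ℕ, 1 ≤ n → r⁻¹ ^ n • M ^ n = π + B ^ n := by
    intro n hn
    induction n, hn using Nat.le_induction with
    | base => rw [pow_one, pow_one, pow_one, hB]; abel
    | succ n hn ih =>
      have e : r⁻¹ • M = π + B := by rw [hB]; abel
      have hBπ : B * π = 0 := by
        rw [hB, sub_mul, smul_mul_assoc, hMπ, smul_smul, inv_mul_cancel₀ hr0, one_smul, hππ,
          sub_self]
      have hBnπ : B ^ n * π = 0 := by
        obtain ⟨k, rfl⟩ : ∃ k, n = k + 1 := ⟨n - 1, by omega⟩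
        rw [pow_succ, mul_assoc, hBπ, mul_zero]
      rw [pow_succ, pow_succ, ← smul_mul_smul_comm, ih, e, add_mul, mul_add, mul_add, hππ, hπB,
        hBnπ, ← pow_succ]
      abel
  obtain ⟨θ, K, hθ, hθ1, hK, hBn⟩ := exists_pow_eucCLM_le B (by
    intro z y hy0 hy
    by_cases hz : z = 0
    · rw [hz, norm_zero]; exact one_pos
    set Mc := M.map (algebraMap ℝ ℂ) with hMc
    set πc := π.map (algebraMap ℝ ℂ) with hπc
    have hBc : B.map (algebraMap ℝ ℂ) = (r : ℂ)⁻¹ • Mc - πc := by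
      rw [hB, hMc, hπc]
      ext i j
      simp
    have hπy : πc.mulVec y = 0 := by
      have e1 : πc * B.map (algebraMap ℝ ℂ) = 0 := by
        rw [hπc, ← Matrix.map_mul, hπB]; simp
      have e2 : πc.mulVec (z • y) = 0 := by
        rw [← hy, Matrix.mulVec_mulVec, e1, Matrix.zero_mulVec]
      rw [Matrix.mulVec_smul] at e2
      exact (smul_eq_zero.1 e2).resolve_left hz
    have hrc : (r : ℂ) ≠ 0 := Complex.ofReal_ne_zero.2 hr0
    have hMy : Mc.mulVec y = ((r : ℂ) * z) • y := by
      rw [hBc, Matrix.sub_mulVec, hπy, sub_zero, Matrix.smul_mulVec] at hy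
      rw [mul_smul, ← hy, smul_smul, mul_inv_cancel₀ hrc, one_smul]
    have hev : Module.End.HasEigenvector (Matrix.toLin' Mc) ((r : ℂ) * z) y :=
      ⟨Module.End.mem_eigenspace_iff.2 (by rw [Matrix.toLin'_apply, hMy]), hy0⟩
    -- The polynomial `q` acts on an `r`-eigenvector by the non-zero scalar `q(r)`, yet `q(M)` is a
    -- multiple of `π`, which kills `y`.
    have hne : (r : ℂ) * z ≠ r := by
      intro heq
      have e1 := Module.End.aeval_apply_of_hasEigenvector (p := q.map (algebraMap ℝ ℂ)) hev
      have e2 : aeval (Matrix.toLin' Mc) (q.map (algebraMap ℝ ℂ)) y =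
          ((aeval M q).map (algebraMap ℝ ℂ)).mulVec y := by
        have e3 : aeval (Matrix.toLin' Mc) (q.map (algebraMap ℝ ℂ)) =
            Matrix.toLin' (aeval Mc (q.map (algebraMap ℝ ℂ))) := by
          exact Polynomial.aeval_algHom_apply (Matrix.toLinAlgEquiv' (R := ℂ) (n := Fin d)) Mc
            (q.map (algebraMap ℝ ℂ))
        have e4 : aeval Mc (q.map (algebraMap ℝ ℂ)) = (aeval M q).map (algebraMap ℝ ℂ) := by
          rw [Polynomial.aeval_map_algebraMap]
          exact Polynomial.aeval_algHom_apply
            ((Algebra.ofId ℝ ℂ).mapMatrix (m := Fin d)) M q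
        rw [e3, e4, Matrix.toLin'_apply]
      have e5 : (aeval M q).map (algebraMap ℝ ℂ) = ((q.eval r : ℝ) : ℂ) • πc := by
        have : aeval M q = (q.eval r) • π := by
          rw [hπ, smul_smul, mul_inv_cancel₀ hq0, one_smul]
        rw [this, hπc]
        ext i j
        simp
      rw [e2, e5, Matrix.smul_mulVec, hπy, smul_zero, heq] at e1
      have e6 : (q.map (algebraMap ℝ ℂ)).eval (r : ℂ) = ((q.eval r : ℝ) : ℂ) := by
        rw [Polynomial.eval_map]
        exact Polynomial.eval₂_at_apply (algebraMap ℝ ℂ) r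
      rw [e6] at e1
      rcases smul_eq_zero.1 e1.symm with h | h
      · exact hq0 (by exact_mod_cast h)
      · exact hy0 h
    have hroot : (r : ℂ) * z ∈ (M.charpoly.map (algebraMap ℝ ℂ)).roots := by
      rw [← Matrix.charpoly_map, Polynomial.mem_roots (Matrix.charpoly_monic _).ne_zero,
        ← Matrix.mem_spectrum_iff_isRoot_charpoly, ← Matrix.spectrum_toLin',
        ← Module.End.hasEigenvalue_iff_mem_spectrum]
      exact Module.End.hasEigenvalue_of_hasEigenvector hev
    have hlt := hroots _ hroot hne
    rw [norm_mul, Complex.norm_real, Real.norm_eq_abs] at hlt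
    have := abs_pos.2 hr0
    nlinarith)
  refine ⟨v, φ, K, θ, hv0, hφ0, hxv, fun u => ?_, hK, hθ, hθ1, fun n hn => ?_⟩
  · rw [hker]
    constructor
    · intro hu
      rw [hπs, Matrix.add_mulVec, Matrix.one_mulVec, ← Matrix.mulVec_mulVec] at hu
      refine ⟨-(((q.eval r)⁻¹ • aeval M s).mulVec (WithLp.ofLp u)), ?_⟩
      rw [map_neg, Matrix.toLin'_apply]
      exact (eq_neg_of_add_eq_zero_left hu).symm
    · rintro ⟨y, hy⟩
      rw [← hy, Matrix.toLin'_apply, Matrix.mulVec_mulVec, h2, Matrix.zero_mulVec]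
  · refine ⟨r⁻¹ ^ n • matCLM (G ^ n), ?_, ?_⟩
    · exact IsLift.smul ⟨G ^ n, map_pow _ _ _, rfl⟩ (pow_ne_zero _ (inv_ne_zero hr0))
    · have e : r⁻¹ ^ n • matCLM (G ^ n) = eucCLM (r⁻¹ ^ n • M ^ n) := by
        rw [eucCLM, map_smul, matCLM, hM, Units.val_pow_eq_pow_val]
      rw [e, hpow n hn, eucCLM, map_add, ← hQ, add_sub_cancel_left]
      exact hBn n

end Proximal

/-! ### Polynomial growth of unipotent powers -/

section Unipotent

variable {d : ℕ}

theorem unipotent_pow_eq {R : Type*} [Ring R] {M : R} {m : ℕ}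
    (h : (M - 1) ^ (m + 1) = 0) (n : ℕ) :
    M ^ n = ∑ i ∈ Finset.range (m + 1), (n.choose i) • (M - 1) ^ i := by
  have e1 : M ^ n = ∑ i ∈ Finset.range (n + 1), (n.choose i) • (M - 1) ^ i := by
    conv_lhs => rw [← sub_add_cancel M 1, (Commute.one_right (M - 1)).add_pow]
    refine Finset.sum_congr rfl fun i _ => ?_
    rw [one_pow, mul_one, nsmul_eq_mul, (Nat.cast_commute _ _).eq]
  have e2 : ∑ i ∈ Finset.range (n + 1), (n.choose i) • (M - 1) ^ i =
      ∑ i ∈ Finset.range (n + m + 1), (n.choose i) • (M - 1) ^ i := by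
    refine Finset.sum_subset (Finset.range_subset_range.2 (by omega)) fun i _ hi => ?_
    rw [Finset.mem_range] at hi
    rw [Nat.choose_eq_zero_of_lt (by omega), zero_smul]
  have e3 : ∑ i ∈ Finset.range (m + 1), (n.choose i) • (M - 1) ^ i =
      ∑ i ∈ Finset.range (n + m + 1), (n.choose i) • (M - 1) ^ i := by
    refine Finset.sum_subset (Finset.range_subset_range.2 (by omega)) fun i _ hi => ?_
    rw [Finset.mem_range] at hi
    rw [pow_eq_zero_of_le (by omega) h, smul_zero]
  rw [e1, e2, e3]

/-- The descending factorial lies between `(n - m) ^ m` and `n ^ m`, and Bernoulli's inequality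
handles the lower bound. For `n < m` the right side is at least 1 and the bound is trivial. -/
theorem abs_choose_div_sub_one_le (m : ℕ) {n : ℕ} (hn : 1 ≤ n) :
    |(m.factorial : ℝ) / (n : ℝ) ^ m * n.choose m - 1| ≤ (m : ℝ) ^ 2 / n := by
  have hn0 : (0 : ℝ) < n := by exact_mod_cast hn
  have hfac : (m.factorial : ℝ) * n.choose m = n.descFactorial m := by
    rw [Nat.descFactorial_eq_factorial_mul_choose]; push_cast; ring
  have e : (m.factorial : ℝ) / (n : ℝ) ^ m * n.choose m = n.descFactorial m / (n : ℝ) ^ m := by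
    rw [div_mul_eq_mul_div, hfac]
  have hup : (n.descFactorial m : ℝ) / (n : ℝ) ^ m ≤ 1 := by
    rw [div_le_one (by positivity)]
    exact_mod_cast Nat.descFactorial_le_pow n m
  have hlow : 1 - (m : ℝ) ^ 2 / n ≤ (n.descFactorial m : ℝ) / (n : ℝ) ^ m := by
    by_cases hmn : m ≤ n
    · have h1 : ((n : ℝ) - m) ^ m ≤ n.descFactorial m := by
        have h := Nat.pow_sub_le_descFactorial n m
        have h2 : (n - m) ^ m ≤ n.descFactorial m :=
          le_trans (Nat.pow_le_pow_left (by omega) m) h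
        rw [← Nat.cast_sub hmn]
        exact_mod_cast h2
      have h3 : -2 ≤ -((m : ℝ) / n) := by
        have : (m : ℝ) / n ≤ 1 := by
          rw [div_le_one hn0]; exact_mod_cast hmn
        linarith
      have h4 := one_add_mul_le_pow h3 m
      have h5 : (1 + -((m : ℝ) / n)) ^ m = ((n : ℝ) - m) ^ m / (n : ℝ) ^ m := by
        rw [← div_pow]
        congr 1
        field_simp
        ring
      rw [h5] at h4
      calc 1 - (m : ℝ) ^ 2 / n = 1 + m * -((m : ℝ) / n) := by ring
        _ ≤ _ := h4
        _ ≤ _ := by gcongr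
    · have h1 : (1 : ℝ) ≤ (m : ℝ) ^ 2 / n := by
        rw [one_le_div hn0]
        have h2 : (n : ℝ) ≤ m := by exact_mod_cast (by omega : n ≤ m)
        have h3 : (1 : ℝ) ≤ m := le_trans (by exact_mod_cast hn) h2
        nlinarith
      have h2 : (0 : ℝ) ≤ (n.descFactorial m : ℝ) / (n : ℝ) ^ m := by positivity
      linarith
  rw [e, abs_le]
  have : (0 : ℝ) ≤ (m : ℝ) ^ 2 / n := by positivity
  constructor <;> linarith

/-- In the binomial expansion, normalised by the growth of its top coefficient, all lower terms are
of order `1 / n` and the top coefficient is 1 up to order `1 / n`. -/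
theorem exists_unipotent_pow {M : Matrix (Fin d) (Fin d) ℝ} {m : ℕ} (h : (M - 1) ^ (m + 1) = 0) :
    ∃ C : ℝ, 0 < C ∧ ∀ n : ℕ, 1 ≤ n →
      ‖((m.factorial : ℝ) / (n : ℝ) ^ m) • eucCLM (M ^ n) - eucCLM ((M - 1) ^ m)‖ ≤ C / n := by
  set S := ∑ i ∈ Finset.range m, ‖eucCLM ((M - 1) ^ i)‖ with hS
  have hS0 : 0 ≤ S := Finset.sum_nonneg fun _ _ => norm_nonneg _
  refine ⟨1 + (m.factorial * S + (m : ℝ) ^ 2 * ‖eucCLM ((M - 1) ^ m)‖), by positivity,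
    fun n hn => ?_⟩
  have hn0 : (0 : ℝ) < n := by exact_mod_cast hn
  have hn1 : (1 : ℝ) ≤ n := by exact_mod_cast hn
  set t : ℝ := (m.factorial : ℝ) / (n : ℝ) ^ m with ht
  have ht0 : 0 ≤ t := by positivity
  have e : t • eucCLM (M ^ n) - eucCLM ((M - 1) ^ m) =
      (∑ i ∈ Finset.range m, (t * n.choose i) • eucCLM ((M - 1) ^ i)) +
        (t * n.choose m - 1) • eucCLM ((M - 1) ^ m) := by
    rw [unipotent_pow_eq h n, Finset.sum_range_succ]
    have e1 : ∀ (j : ℕ) (X : Matrix (Fin d) (Fin d) ℝ),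
        t • (j • eucCLM X) = (t * j) • eucCLM X := fun j X => by
      ext1 u
      exact (congrArg (t • ·) (Nat.cast_smul_eq_nsmul ℝ j (eucCLM X u))).symm.trans
        (mul_smul t (j : ℝ) (eucCLM X u)).symm
    simp only [map_add, map_sum, map_nsmul, smul_add, Finset.smul_sum]
    simp only [e1]
    have e2 : (t * n.choose m - 1) • eucCLM ((M - 1) ^ m) =
        (t * n.choose m) • eucCLM ((M - 1) ^ m) - eucCLM ((M - 1) ^ m) := by
      ext1 u
      exact (sub_smul _ _ _).trans (congrArg _ (one_smul ℝ _))
    rw [e2]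
    abel
  have hsmall : ∀ i ∈ Finset.range m, ‖(t * n.choose i) • eucCLM ((M - 1) ^ i)‖ ≤
      (m.factorial / n) * ‖eucCLM ((M - 1) ^ i)‖ := by
    intro i hi
    rw [Finset.mem_range] at hi
    rw [norm_smul, Real.norm_of_nonneg (by positivity)]
    gcongr
    have h1 : (n.choose i : ℝ) ≤ (n : ℝ) ^ (m - 1) := by
      have h2 : n.choose i ≤ n ^ i := Nat.choose_le_pow n i
      have h3 : n ^ i ≤ n ^ (m - 1) := Nat.pow_le_pow_right hn (by omega)
      exact_mod_cast h2.trans h3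
    calc t * n.choose i ≤ t * (n : ℝ) ^ (m - 1) := by gcongr
      _ = m.factorial / n := by
        obtain ⟨k, rfl⟩ : ∃ k, m = k + 1 := ⟨m - 1, by omega⟩
        rw [ht, Nat.add_sub_cancel, pow_succ]
        field_simp
  rw [e]
  calc _ ≤ (∑ i ∈ Finset.range m, ‖(t * n.choose i) • eucCLM ((M - 1) ^ i)‖) +
        ‖(t * n.choose m - 1) • eucCLM ((M - 1) ^ m)‖ :=
      (norm_add_le _ _).trans (add_le_add_left (norm_sum_le _ _) _)
    _ ≤ (∑ i ∈ Finset.range m, (m.factorial / n) * ‖eucCLM ((M - 1) ^ i)‖) +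
        ((m : ℝ) ^ 2 / n) * ‖eucCLM ((M - 1) ^ m)‖ := by
      refine add_le_add (Finset.sum_le_sum hsmall) ?_
      rw [norm_smul, Real.norm_eq_abs]
      gcongr
      exact abs_choose_div_sub_one_le m hn
    _ = (m.factorial * S + (m : ℝ) ^ 2 * ‖eucCLM ((M - 1) ^ m)‖) / n := by
      rw [← Finset.mul_sum]; ring
    _ ≤ _ := div_le_div_of_nonneg_right (by linarith) hn0.le

/-- Since `M' - 1 = -(M - 1) * M'` and `M'` acts trivially on the top power of `M - 1`, only a sign
changes. Thus positive and negative powers have the same projective limit. -/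
theorem unipotent_inv {R : Type*} [Ring R] {M M' : R} {m : ℕ} (h : (M - 1) ^ (m + 1) = 0)
    (h1 : M * M' = 1) (h2 : M' * M = 1) :
    (M' - 1) ^ (m + 1) = 0 ∧ (M' - 1) ^ m = (-1) ^ m * (M - 1) ^ m := by
  have hc : Commute (M - 1) M' := by
    unfold Commute SemiconjBy
    rw [sub_mul, mul_sub, h1, h2]; simp
  have e : M' - 1 = -1 * ((M - 1) * M') := by
    rw [sub_mul, h1]; simp
  have hpow : ∀ j, (M' - 1) ^ j = (-1) ^ j * ((M - 1) ^ j * M' ^ j) := fun j => by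
    rw [e, (Commute.neg_one_left _).mul_pow, hc.mul_pow]
  have h3 : (M - 1) ^ m * M' = (M - 1) ^ m := by
    have h4 : (M - 1) ^ m * M = (M - 1) ^ m := by
      have : (M - 1) ^ m * (M - 1) = 0 := by rw [← pow_succ]; exact h
      rwa [mul_sub, mul_one, sub_eq_zero] at this
    calc (M - 1) ^ m * M' = ((M - 1) ^ m * M) * M' := by rw [h4]
      _ = (M - 1) ^ m := by rw [mul_assoc, h1, mul_one]
  have h5 : ∀ j, (M - 1) ^ m * M' ^ j = (M - 1) ^ m := by
    intro j
    induction j with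
    | zero => rw [pow_zero, mul_one]
    | succ j ih => rw [pow_succ, ← mul_assoc, ih, h3]
  refine ⟨?_, ?_⟩
  · rw [hpow, h, zero_mul, mul_zero]
  · rw [hpow, h5]

/-- The common limit is the top power of `M - 1`. As `d ≥ 2` and its image is a line, `m ≥ 1`, so it
squares to zero and the line lies in the hyperplane. It is fixed by multiplication by `M` on either
side, so the unnormalised powers fix the vector and the functional. The powers and their inverses
have norm of order `|n| ^ m`, whence the exponent `2 * m` of the condition number. -/
theorem IsUnipotentWith.exists_approx (hd : 2 ≤ d) {g : PGLR d} {x : Proj d}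
    {H : Submodule ℝ (Fin d → ℝ)} (h : IsUnipotentWith g x H) :
    ∃ (v : Euc d) (φ : Euc d →L[ℝ] ℝ) (C : ℝ) (m : ℕ), v ≠ 0 ∧ φ ≠ 0 ∧
      x.submodule = ℝ ∙ WithLp.ofLp v ∧ (∀ u : Euc d, φ u = 0 ↔ WithLp.ofLp u ∈ H) ∧
      φ v = 0 ∧ 0 < C ∧
      ∀ n : ℤ, n ≠ 0 → (∃ A, IsLift A (g ^ n) ∧ ‖A - φ.smulRight v‖ ≤ C / |(n : ℝ)|) ∧
        svRatio 1 d (g ^ n) ≤ C * |(n : ℝ)| ^ m ∧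
        ∃ A, IsLift A (g ^ n) ∧ A v = v ∧ ∀ u, φ (A u) = φ u := by
  have : NeZero d := ⟨by omega⟩
  obtain ⟨G, m, rfl, hN, hx, rfl⟩ := h
  set M : Matrix (Fin d) (Fin d) ℝ := (G : Matrix (Fin d) (Fin d) ℝ) with hM
  set M' : Matrix (Fin d) (Fin d) ℝ := ((G⁻¹ : GL (Fin d) ℝ) : Matrix (Fin d) (Fin d) ℝ) with hM'
  obtain ⟨v, φ, hv0, hφ0, hxv, hQ, hker⟩ := exists_smulRight hx
  have hMM' : M * M' = 1 := G.mul_inv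
  have hM'M : M' * M = 1 := G.inv_mul
  obtain ⟨hN', hQ'⟩ := unipotent_inv hN hMM' hM'M
  obtain ⟨C₁, hC₁, h₁⟩ := exists_unipotent_pow hN
  obtain ⟨C₂, hC₂, h₂⟩ := exists_unipotent_pow hN'
  have hm : m ≠ 0 := by
    rintro rfl
    rw [pow_zero, Matrix.toLin'_one, LinearMap.range_id] at hx
    have h1 := x.finrank_submodule
    rw [hx, finrank_top, Module.finrank_fin_fun] at h1
    omega
  have hφv : φ v = 0 := by
    have e1 : eucCLM ((M - 1) ^ m) * eucCLM ((M - 1) ^ m) = 0 := by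
      rw [← map_mul, ← pow_add, pow_eq_zero_of_le (by omega) hN, map_zero]
    rw [hQ] at e1
    have e2 : ((φ.smulRight v) * (φ.smulRight v)) (dualVec φ) = 0 := by rw [e1]; rfl
    rw [mul_apply_eq_comp] at e2
    simp only [ContinuousLinearMap.smulRight_apply, map_smul, smul_eq_zero,
      or_iff_left hv0, ← inner_dualVec φ (dualVec φ), real_inner_self_eq_norm_sq] at e2
    refine e2.resolve_left (pow_ne_zero 2 ?_)
    rw [norm_dualVec]
    exact norm_ne_zero_iff.2 hφ0
  have hQn' : eucCLM ((M' - 1) ^ m) = (-1 : ℝ) ^ m • φ.smulRight v := by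
    rw [hQ', ← hQ, ← map_smul]
    congr 1
    rcases neg_one_pow_eq_or ℝ m with h | h <;>
      rcases neg_one_pow_eq_or (Matrix (Fin d) (Fin d) ℝ) m with h' | h' <;> rw [h, h']
    · simp
    · rcases Nat.even_or_odd m with he | ho
      · rw [he.neg_one_pow] at h'; rw [← h']; simp
      · rw [ho.neg_one_pow] at h; norm_num at h
    · rcases Nat.even_or_odd m with he | ho
      · rw [he.neg_one_pow] at h; norm_num at h
      · rw [ho.neg_one_pow] at h'; rw [← h']; simp
    · simp
  set q : ℝ := ‖φ.smulRight v‖ with hq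
  set F : ℝ := (m.factorial : ℝ) with hF
  have hF0 : 0 < F := by rw [hF]; exact_mod_cast m.factorial_pos
  have norms : ∀ n : ℕ, 1 ≤ n → ‖eucCLM (M ^ n)‖ ≤ (C₁ + C₂ + q) * (n : ℝ) ^ m / F ∧
      ‖eucCLM (M' ^ n)‖ ≤ (C₁ + C₂ + q) * (n : ℝ) ^ m / F := by
    intro n hn
    have hn0 : (0 : ℝ) < n := by exact_mod_cast hn
    have hn1 : (1 : ℝ) ≤ n := by exact_mod_cast hn
    have gen : ∀ (X Y : Euc d →L[ℝ] Euc d) (C : ℝ), 0 < C → ‖Y‖ ≤ q →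
        ‖(F / (n : ℝ) ^ m) • X - Y‖ ≤ C / n → C ≤ C₁ + C₂ →
        ‖X‖ ≤ (C₁ + C₂ + q) * (n : ℝ) ^ m / F := by
      intro X Y C hC hY hXY hCC
      have e1 : ‖(F / (n : ℝ) ^ m) • X‖ ≤ C + q := by
        have := norm_sub_norm_le ((F / (n : ℝ) ^ m) • X) Y
        have h2 : C / n ≤ C := div_le_self hC.le hn1
        linarith
      rw [norm_smul, Real.norm_of_nonneg (by positivity)] at e1
      rw [le_div_iff₀ hF0]
      have hp : (0 : ℝ) < (n : ℝ) ^ m := by positivity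
      calc ‖X‖ * F = (F / (n : ℝ) ^ m * ‖X‖) * (n : ℝ) ^ m := by field_simp
        _ ≤ (C₁ + C₂ + q) * (n : ℝ) ^ m := by gcongr; linarith
    refine ⟨gen _ _ C₁ hC₁ (by rw [hQ]) (h₁ n hn) (by linarith),
      gen _ _ C₂ hC₂ ?_ (h₂ n hn) (by linarith)⟩
    rw [hQn', norm_smul, norm_pow, norm_neg, norm_one, one_pow, one_mul]
  set K := (C₁ + C₂ + q) / F with hK
  have hK0 : 0 < K := by
    have : 0 ≤ q := norm_nonneg _
    positivity
  have hcond : ∀ n : ℕ, 1 ≤ n → ‖eucCLM (M ^ n)‖ * ‖eucCLM (M' ^ n)‖ ≤ K ^ 2 * (n : ℝ) ^ (2 * m) := by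
    intro n hn
    obtain ⟨e1, e2⟩ := norms n hn
    calc _ ≤ ((C₁ + C₂ + q) * (n : ℝ) ^ m / F) * ((C₁ + C₂ + q) * (n : ℝ) ^ m / F) := by gcongr
      _ = K ^ 2 * (n : ℝ) ^ (2 * m) := by rw [hK, pow_mul']; ring
  have hinv1 : ∀ n : ℕ, eucCLM (M ^ n) * eucCLM (M' ^ n) = 1 := fun n => by
    rw [← map_mul, ← (show Commute M M' from hMM'.trans hM'M.symm).mul_pow, hMM', one_pow, map_one]
  have hinv2 : ∀ n : ℕ, eucCLM (M' ^ n) * eucCLM (M ^ n) = 1 := fun n => by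
    rw [← map_mul, ← (show Commute M' M from hM'M.trans hMM'.symm).mul_pow, hM'M, one_pow, map_one]
  have hl1 : ∀ n : ℕ, IsLift (eucCLM (M ^ n)) (Matrix.ProjGenLinGroup.mk G ^ (n : ℤ)) := fun n =>
    ⟨G ^ n, by rw [map_pow, zpow_natCast], by rw [matCLM, Units.val_pow_eq_pow_val]⟩
  have hl2 : ∀ n : ℕ, IsLift (eucCLM (M' ^ n)) (Matrix.ProjGenLinGroup.mk G ^ (-(n : ℤ))) := fun n =>
    ⟨G⁻¹ ^ n, by rw [map_pow, map_inv, zpow_neg, zpow_natCast, inv_pow],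
      by rw [matCLM, Units.val_pow_eq_pow_val]⟩
  have hfix : ∀ X : Euc d →L[ℝ] Euc d, X * eucCLM ((M - 1) ^ m) = eucCLM ((M - 1) ^ m) →
      eucCLM ((M - 1) ^ m) * X = eucCLM ((M - 1) ^ m) → X v = v ∧ ∀ u, φ (X u) = φ u := by
    intro X h1 h2
    rw [hQ] at h1 h2
    obtain ⟨u₀, hu₀⟩ : ∃ u₀, φ u₀ ≠ 0 := by
      by_contra hcon
      push Not at hcon
      exact hφ0 (ContinuousLinearMap.ext hcon)
    constructor
    · have h3 := congrArg (fun F : Euc d →L[ℝ] Euc d => F u₀) h1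
      simp only [mul_apply_eq_comp, ContinuousLinearMap.smulRight_apply, map_smul] at h3
      exact smul_right_injective _ hu₀ h3
    · intro u
      have h3 := congrArg (fun F : Euc d →L[ℝ] Euc d => F u) h2
      simp only [mul_apply_eq_comp, ContinuousLinearMap.smulRight_apply] at h3
      exact smul_left_injective ℝ hv0 h3
  have hfixM : M * (M - 1) ^ m = (M - 1) ^ m ∧ (M - 1) ^ m * M = (M - 1) ^ m := by
    have h1 : (M - 1) * (M - 1) ^ m = 0 := by rw [← pow_succ']; exact hN
    have h2 : (M - 1) ^ m * (M - 1) = 0 := by rw [← pow_succ]; exact hN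
    constructor
    · rwa [sub_mul, one_mul, sub_eq_zero] at h1
    · rwa [mul_sub, mul_one, sub_eq_zero] at h2
  have hfixM' : M' * (M - 1) ^ m = (M - 1) ^ m ∧ (M - 1) ^ m * M' = (M - 1) ^ m := by
    constructor
    · conv_lhs => rw [← hfixM.1, ← mul_assoc, hM'M, one_mul]
    · conv_lhs => rw [← hfixM.2, mul_assoc, hMM', mul_one]
  have hfixpow : ∀ Y : Matrix (Fin d) (Fin d) ℝ, Y * (M - 1) ^ m = (M - 1) ^ m →
      (M - 1) ^ m * Y = (M - 1) ^ m → ∀ n : ℕ, eucCLM (Y ^ n) v = v ∧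
        ∀ u, φ (eucCLM (Y ^ n) u) = φ u := by
    intro Y h1 h2 n
    refine hfix _ ?_ ?_ <;> rw [← map_mul] <;> congr 1
    · induction n with
      | zero => rw [pow_zero, one_mul]
      | succ n ih => rw [pow_succ, mul_assoc, h1, ih]
    · induction n with
      | zero => rw [pow_zero, mul_one]
      | succ n ih => rw [pow_succ, ← mul_assoc, ih, h2]
  refine ⟨v, φ, C₁ + C₂ + K ^ 2, 2 * m, hv0, hφ0, hxv, fun u => ?_, hφv, by positivity,
    fun n hn => ?_⟩
  · rw [hker, LinearMap.mem_ker, Matrix.toLin'_apply]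
  · obtain ⟨k, rfl | rfl⟩ := n.eq_nat_or_neg
    · have hk : 1 ≤ k := by omega
      have hk0 : (0 : ℝ) < k := by exact_mod_cast hk
      rw [Int.cast_natCast, Nat.abs_cast]
      refine ⟨⟨_, (hl1 k).smul (c := F / (k : ℝ) ^ m) (by positivity), ?_⟩, ?_,
        ⟨_, hl1 k, hfixpow M hfixM.1 hfixM.2 k⟩⟩
      · rw [← hQ]
        refine (h₁ k hk).trans ?_
        gcongr
        have := sq_nonneg K
        linarith
      · rw [svRatio_one_eq (hl1 k) (hinv1 k) (hinv2 k)]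
        refine (hcond k hk).trans ?_
        gcongr
        linarith
    · have hk : 1 ≤ k := by omega
      have hk0 : (0 : ℝ) < k := by exact_mod_cast hk
      rw [Int.cast_neg, abs_neg, Int.cast_natCast, Nat.abs_cast]
      have hs : ((-1 : ℝ) ^ m) ≠ 0 := pow_ne_zero _ (by norm_num)
      have hs1 : ((-1 : ℝ) ^ m) * (-1) ^ m = 1 := by rw [← mul_pow]; norm_num
      refine ⟨⟨_, ((hl2 k).smul (c := F / (k : ℝ) ^ m) (by positivity)).smul hs, ?_⟩, ?_,
        ⟨_, hl2 k, hfixpow M' hfixM'.1 hfixM'.2 k⟩⟩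
      · have e : (-1 : ℝ) ^ m • (F / (k : ℝ) ^ m) • eucCLM (M' ^ k) - φ.smulRight v =
            (-1 : ℝ) ^ m • ((F / (k : ℝ) ^ m) • eucCLM (M' ^ k) - eucCLM ((M' - 1) ^ m)) := by
          rw [hQn', smul_sub, smul_smul ((-1 : ℝ) ^ m) ((-1) ^ m), hs1, one_smul]
        rw [e, norm_smul, norm_pow, norm_neg, norm_one, one_pow, one_mul]
        refine (h₂ k hk).trans ?_
        gcongr
        have := sq_nonneg K
        linarith
      · rw [svRatio_one_eq (hl2 k) (hinv2 k) (hinv1 k), mul_comm ‖eucCLM (M' ^ k)‖]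
        refine (hcond k hk).trans ?_
        gcongr
        linarith

end Unipotent

/-! ### Representations with ping-pong dynamics -/

/-- The first syllables of two words are transverse. -/
def TransHeads {k l : ℕ} (x y : CyclicProd (Fin k ⊕ Fin l)) : Prop :=
  ∀ a ∈ (letters x).head?, ∀ b ∈ (letters y).head?,
    a.1 ≠ b.1 ∨ ∃ i, a.1 = Sum.inl i ∧ b.1 = Sum.inl i ∧ expSign a.2 = expSign (-b.2)

/-- A representation of a free product of cyclic groups, all of whose reduced words are close to
maps of rank one, with transverse ranges and kernels. -/
structure GoodRep {k l d : ℕ} (ρ : CyclicProd (Fin k ⊕ Fin l) →* PGLR d)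
    (v : Fin k ⊕ Fin l → ℤˣ → Euc d) (φ : Fin k ⊕ Fin l → ℤˣ → Euc d →L[ℝ] ℝ)
    (v₀ : Euc d) (φ₀ : Euc d →L[ℝ] ℝ) (B c μ η : ℝ) : Prop where
  two_le_d : 2 ≤ d
  two_le : 2 ≤ k + l
  data : TransverseData d v φ B c
  μ_pos : 0 < μ
  η_pos : 0 < η
  c_le : c ≤ 1
  η_le : η ≤ 1
  η_le' : 2 * B * η ≤ c
  η_lt : 32 * B ^ 2 * η ≤ c ^ 2
  norm_v₀ : ‖v₀‖ ≤ B
  norm_φ₀ : ‖φ₀‖ ≤ B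
  generic_v₀ : ∀ i ε, c ≤ |φ i ε v₀|
  generic_φ₀ : ∀ i ε, c ≤ |φ₀ (v i ε)|
  generic : c ≤ |φ₀ v₀|
  same_sign : ∀ i ε, c ≤ |φ (Sum.inl i) ε (v (Sum.inl i) ε)|
  cusp_v : ∀ j ε, v (Sum.inr j) ε = v (Sum.inr j) 1
  cusp_φ : ∀ j ε, φ (Sum.inr j) ε = φ (Sum.inr j) 1
  cusp_zero : ∀ j, φ (Sum.inr j) 1 (v (Sum.inr j) 1) = 0
  cusp_fix : ∀ j p, ∃ A, IsLift A (ρ (syl (Sum.inr j) p)) ∧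
    A (v (Sum.inr j) 1) = v (Sum.inr j) 1 ∧ ∀ u, φ (Sum.inr j) 1 (A u) = φ (Sum.inr j) 1 u
  approx : IsApprox ρ v φ (wt k l) μ 1
  word : ∀ x, x ≠ 1 → IsWordApprox ρ v φ (wt k l) μ η x
  cond : ∃ C : ℝ, 0 ≤ C ∧ ∀ i p, p ≠ 0 → svRatio 1 d (ρ (syl i p)) ≤ Real.exp (C * wt k l i p)

namespace GoodRep

variable {k l d : ℕ} {ρ : CyclicProd (Fin k ⊕ Fin l) →* PGLR d}
  {v : Fin k ⊕ Fin l → ℤˣ → Euc d} {φ : Fin k ⊕ Fin l → ℤˣ → Euc d →L[ℝ] ℝ}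
  {v₀ : Euc d} {φ₀ : Euc d →L[ℝ] ℝ} {B c μ η : ℝ}

theorem B_pos (h : GoodRep ρ v φ v₀ φ₀ B c μ η) : 0 < B := one_pos.trans_le h.data.one_le

theorem le_norm_v (h : GoodRep ρ v φ v₀ φ₀ B c μ η) (i ε) : c ≤ B * ‖v i ε‖ := by
  refine (h.generic_φ₀ i ε).trans ?_
  rw [← Real.norm_eq_abs]
  exact (φ₀.le_opNorm _).trans (mul_le_mul_of_nonneg_right h.norm_φ₀ (norm_nonneg _))

theorem le_norm_φ (h : GoodRep ρ v φ v₀ φ₀ B c μ η) (i ε) : c ≤ B * ‖φ i ε‖ := by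
  refine (h.generic_v₀ i ε).trans ?_
  rw [← Real.norm_eq_abs, mul_comm]
  exact ((φ i ε).le_opNorm _).trans (mul_le_mul_of_nonneg_left h.norm_v₀ (norm_nonneg _))

theorem v_ne_zero (h : GoodRep ρ v φ v₀ φ₀ B c μ η) (i ε) : v i ε ≠ 0 := by
  intro h0
  have := h.le_norm_v i ε
  rw [h0, norm_zero, mul_zero] at this
  exact absurd h.data.pos (not_lt.2 this)

theorem φ_ne_zero (h : GoodRep ρ v φ v₀ φ₀ B c μ η) (i ε) : φ i ε ≠ 0 := by
  intro h0
  have := h.le_norm_φ i ε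
  rw [h0, norm_zero, mul_zero] at this
  exact absurd h.data.pos (not_lt.2 this)

theorem abs_apply_sub_le (h : GoodRep ρ v φ v₀ φ₀ B c μ η) {χ : Euc d →L[ℝ] ℝ} {w w' : Euc d}
    (hχ : ‖χ‖ ≤ B) (hw : ‖w - w'‖ ≤ η) (hc : c ≤ |χ w'|) : c / 2 ≤ |χ w| := by
  have h1 : |χ (w - w')| ≤ B * η := by
    rw [← Real.norm_eq_abs]
    exact (χ.le_opNorm _).trans (mul_le_mul hχ hw (norm_nonneg _) h.B_pos.le)
  rw [map_sub] at h1
  have h2 := abs_sub_abs_le_abs_sub (χ w') (χ w)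
  rw [abs_sub_comm] at h2
  have := h.η_le'
  linarith

theorem abs_sub_apply_le (h : GoodRep ρ v φ v₀ φ₀ B c μ η) {χ χ' : Euc d →L[ℝ] ℝ} {w : Euc d}
    (hw : ‖w‖ ≤ B) (hχ : ‖χ - χ'‖ ≤ η) (hc : c ≤ |χ' w|) : c / 2 ≤ |χ w| := by
  have h1 : |(χ - χ') w| ≤ η * B := by
    rw [← Real.norm_eq_abs]
    exact ((χ - χ').le_opNorm _).trans (mul_le_mul hχ hw (norm_nonneg _) h.η_pos.le)
  rw [sub_apply] at h1
  have h2 := abs_sub_abs_le_abs_sub (χ' w) (χ w)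
  rw [abs_sub_comm] at h2
  have := h.η_le'
  linarith

/-- The normal form of a lift of a word. -/
theorem exists_word (h : GoodRep ρ v φ v₀ φ₀ B c μ η) {x : CyclicProd (Fin k ⊕ Fin l)}
    (hx : x ≠ 1) : ∃ (w : Euc d) (ψ : Euc d →L[ℝ] ℝ) (D : Euc d →L[ℝ] Euc d)
    (a b : (Fin k ⊕ Fin l) × ℤ),
    IsLift (ψ.smulRight w + D) (ρ x) ∧ a ∈ (letters x).head? ∧ b ∈ (letters x).getLast? ∧
    ‖w - v a.1 (expSign a.2)‖ ≤ η ∧ ‖ψ - φ b.1 (expSign b.2)‖ ≤ η ∧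
    ‖D‖ ≤ η * Real.exp (-(μ * len (wt k l) x)) ∧ ‖D‖ ≤ η ∧ ‖w‖ ≤ 2 * B ∧ ‖ψ‖ ≤ 2 * B ∧
    c ≤ 2 * B * ‖w‖ ∧ c ≤ 2 * B * ‖ψ‖ := by
  obtain ⟨w, ψ, D, a, b, hl, ha, hb, hw, hψ, hD⟩ := h.word x hx
  have hB := h.B_pos
  refine ⟨w, ψ, D, a, b, hl, ha, hb, hw, hψ, hD, hD.trans ?_, ?_, ?_, ?_, ?_⟩
  · have h1 : Real.exp (-(μ * len (wt k l) x)) ≤ 1 := by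
      rw [Real.exp_le_one_iff]
      have := mul_nonneg h.μ_pos.le (len_nonneg (isWeight_wt k l) x)
      linarith
    have := h.η_pos
    nlinarith
  · have := norm_le_norm_add_norm_sub' w (v a.1 (expSign a.2))
    linarith [h.data.norm_v a.1 (expSign a.2), h.η_le, h.data.one_le]
  · have := norm_le_norm_add_norm_sub' ψ (φ b.1 (expSign b.2))
    linarith [h.data.norm_φ b.1 (expSign b.2), h.η_le, h.data.one_le]
  · have h1 := h.abs_apply_sub_le h.norm_φ₀ hw (h.generic_φ₀ _ _)
    have h2 := φ₀.le_opNorm w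
    rw [Real.norm_eq_abs] at h2
    have := mul_le_mul_of_nonneg_right h.norm_φ₀ (norm_nonneg w)
    linarith
  · have h1 := h.abs_sub_apply_le h.norm_v₀ hψ (h.generic_v₀ _ _)
    have h2 := ψ.le_opNorm v₀
    rw [Real.norm_eq_abs] at h2
    have := mul_le_mul_of_nonneg_left h.norm_v₀ (norm_nonneg ψ)
    linarith

theorem le_norm_mul_norm (h : GoodRep ρ v φ v₀ φ₀ B c μ η) {w : Euc d} {ψ : Euc d →L[ℝ] ℝ}
    (hw : c ≤ 2 * B * ‖w‖) (hψ : c ≤ 2 * B * ‖ψ‖) : 4 * η ≤ ‖ψ‖ * ‖w‖ := by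
  have hB := h.B_pos
  have hc := h.data.pos
  have h1 : c ^ 2 ≤ (2 * B * ‖w‖) * (2 * B * ‖ψ‖) := by
    rw [pow_two]; exact mul_le_mul hw hψ hc.le (hc.le.trans hw)
  have h2 := h.η_lt
  have h3 : B ^ 2 * (4 * η) ≤ B ^ 2 * (‖ψ‖ * ‖w‖) := by nlinarith
  exact le_of_mul_le_mul_left h3 (by positivity)

/-- The rank-one part has norm at least `4 * η`, and the error is at most `η` times the exponential.
The factors `η` cancel. -/
theorem le_svRatio (h : GoodRep ρ v φ v₀ φ₀ B c μ η) (x : CyclicProd (Fin k ⊕ Fin l)) :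
    Real.exp (μ * len (wt k l) x) ≤ svRatio 1 2 (ρ x) := by
  by_cases hx : x = 1
  · rw [hx, len_one, mul_zero, Real.exp_zero]
    obtain ⟨R, hR, e⟩ := exists_repLin_eq (ρ (1 : CyclicProd (Fin k ⊕ Fin l)))
    obtain ⟨A, -, -, hA⟩ := hR.exists_inv
    unfold svRatio
    rw [e]
    have := singularValues_pos hA (i := 1) (by have := h.two_le_d; omega)
    rw [le_div_iff₀ this, one_mul]
    exact (R : Euc d →ₗ[ℝ] Euc d).singularValues_antitone (Nat.zero_le _)
  · obtain ⟨w, ψ, D, a, b, hl, -, -, -, -, hD, hDη, -, -, hw, hψ⟩ := h.exists_word hx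
    have h1 := h.le_norm_mul_norm hw hψ
    have hη := h.η_pos
    have := le_svRatio_one_two h.two_le_d hl (X := η) hη
      (Y := η * Real.exp (-(μ * len (wt k l) x))) (by positivity) (by linarith) hD
    refine le_trans (le_of_eq ?_) this
    rw [Real.exp_neg]
    field_simp

/-- If a non-trivial word acted as a scalar, evaluation on the kernel of `ψ` would bound the scalar
by `η`; the rank-one part would then have norm at most `2 * η`, but its norm is at least `4 * η`. -/
theorem injective (h : GoodRep ρ v φ v₀ φ₀ B c μ η) : Function.Injective ρ := by
  rw [injective_iff_map_eq_one]
  intro x hx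
  by_contra hne
  obtain ⟨w, ψ, D, a, b, hl, -, -, -, -, -, hDη, -, -, hw, hψ⟩ := h.exists_word hne
  rw [hx] at hl
  obtain ⟨t, -, ht⟩ := isLift_one.eq_smul hl
  have h1 := h.le_norm_mul_norm hw hψ
  have hη := h.η_pos
  have hd := h.two_le_d
  have : NeZero d := ⟨by omega⟩
  have happ : ∀ u, ψ u • w + D u = t • u := fun u => by
    have := congrArg (fun F : Euc d →L[ℝ] Euc d => F u) ht
    simpa using this
  obtain ⟨u, hu0, hu⟩ : ∃ u : Euc d, u ≠ 0 ∧ ψ u = 0 := by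
    have hlt : Module.finrank ℝ ℝ < Module.finrank ℝ (Euc d) := by
      rw [Module.finrank_self, finrank_euc]; omega
    have := LinearMap.ker_ne_bot_of_finrank_lt (f := (ψ : Euc d →ₗ[ℝ] ℝ)) hlt
    obtain ⟨u, hu, hu0⟩ := Submodule.exists_mem_ne_zero_of_ne_bot this
    exact ⟨u, hu0, hu⟩
  have ht2 : |t| ≤ η := by
    have h2 := happ u
    rw [hu, zero_smul, zero_add] at h2
    have h3 := D.le_opNorm u
    rw [h2, norm_smul, Real.norm_eq_abs] at h3
    exact (le_of_mul_le_mul_right h3 (norm_pos_iff.2 hu0)).trans hDη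
  have h4 : ‖ψ.smulRight w‖ ≤ 2 * η := by
    refine ContinuousLinearMap.opNorm_le_bound _ (by positivity) fun u => ?_
    have : ψ.smulRight w u = t • u - D u := by
      rw [ContinuousLinearMap.smulRight_apply, ← happ u]; abel
    rw [this]
    refine (norm_sub_le _ _).trans ?_
    rw [norm_smul, Real.norm_eq_abs]
    have h5 := (D.le_opNorm u).trans (mul_le_mul_of_nonneg_right hDη (norm_nonneg u))
    have h6 := mul_le_mul_of_nonneg_right ht2 (norm_nonneg u)
    linarith
  rw [ContinuousLinearMap.norm_smulRight_apply] at h4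
  linarith

theorem svRatio_one_le (h : GoodRep ρ v φ v₀ φ₀ B c μ η) : ∃ C : ℝ, 0 ≤ C ∧
    ∀ x, svRatio 1 d (ρ x) ≤ Real.exp (C * len (wt k l) x) := by
  have : NeZero d := ⟨by have := h.two_le_d; omega⟩
  obtain ⟨C, hC0, hC⟩ := h.cond
  refine ⟨C, hC0, fun x => ?_⟩
  induction x using syl_induction with
  | one =>
    rw [map_one, svRatio_one_eq isLift_one (one_mul 1) (one_mul 1), len_one, mul_zero, Real.exp_zero]
    have := ContinuousLinearMap.norm_id_le (𝕜 := ℝ) (E := Euc d)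
    exact mul_le_one₀ this (norm_nonneg _) this
  | mul i p y hp hy ih =>
    obtain ⟨A, A', hA, hA', h1, h2⟩ := exists_isLift (ρ (syl i p))
    obtain ⟨D, D', hD, hD', h3, h4⟩ := exists_isLift (ρ y)
    have h5 := hC i p hp
    rw [svRatio_one_eq hA h1 h2] at h5
    rw [svRatio_one_eq hD h3 h4] at ih
    have e1 : (A * D) * (D' * A') = 1 := by
      rw [mul_assoc, ← mul_assoc D, h3, one_mul, h1]
    have e2 : (D' * A') * (A * D) = 1 := by
      rw [mul_assoc, ← mul_assoc A', h2, one_mul, h4]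
    rw [map_mul, svRatio_one_eq (hA.mul hD) e1 e2, len_syl_mul (isWeight_wt k l) p hy, mul_add,
      Real.exp_add]
    calc ‖A * D‖ * ‖D' * A'‖ ≤ (‖A‖ * ‖D‖) * (‖D'‖ * ‖A'‖) :=
          mul_le_mul (norm_mul_le _ _) (norm_mul_le _ _) (norm_nonneg _) (by positivity)
      _ = (‖A‖ * ‖A'‖) * (‖D‖ * ‖D'‖) := by ring
      _ ≤ _ := mul_le_mul h5 ih (by positivity) (Real.exp_pos _).le

end GoodRep

/-- Words without syllables of given indices at their ends. -/
theorem exists_core {ι : Type*} [DecidableEq ι] (i j : ι) (x : CyclicProd ι) :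
    ∃ (p q : ℤ) (y : CyclicProd ι), x = syl i p * y * syl j q ∧ NoHead i y ∧ NoHead j y⁻¹ := by
  obtain ⟨p, y, hy, rfl⟩ := exists_head i x
  obtain ⟨q, z, hz, hyz⟩ := exists_head j y⁻¹
  have e : y = z⁻¹ * syl j (-q) := by
    rw [← inv_inv y, hyz, mul_inv_rev, syl_neg]
  refine ⟨p, -q, z⁻¹, by rw [e]; group, ?_, by rwa [inv_inv]⟩
  by_cases hq : q = 0
  · rw [hq, neg_zero, syl_zero, mul_one] at e
    rwa [← e]
  · intro a ha
    refine hy a ?_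
    have h1 : letters y = invList ((j, q) :: letters z) := by
      rw [← letters_syl_mul hq hz, ← hyz, letters_inv, ← letters_inv, ← letters_inv, inv_inv]
    have h2 : invList ((j, q) :: letters z) = letters z⁻¹ ++ [(j, -q)] := by
      rw [letters_inv]; simp [invList]
    rw [h1, h2, List.head?_append]
    rw [Option.mem_def] at ha
    rw [ha]
    rfl

namespace GoodRep

variable {k l d : ℕ} {ρ : CyclicProd (Fin k ⊕ Fin l) →* PGLR d}
  {v : Fin k ⊕ Fin l → ℤˣ → Euc d} {φ : Fin k ⊕ Fin l → ℤˣ → Euc d →L[ℝ] ℝ}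
  {v₀ : Euc d} {φ₀ : Euc d →L[ℝ] ℝ} {B c μ η : ℝ}

theorem cusp_lift (h : GoodRep ρ v φ v₀ φ₀ B c μ η) {j : Fin l} {p : ℤ} {A : Euc d →L[ℝ] Euc d}
    (hA : IsLift A (ρ (syl (Sum.inr j) p))) : ∃ t : ℝ, t ≠ 0 ∧
      A (v (Sum.inr j) 1) = t • v (Sum.inr j) 1 ∧
      ∀ u, φ (Sum.inr j) 1 (A u) = t * φ (Sum.inr j) 1 u := by
  obtain ⟨A', hA', h1, h2⟩ := h.cusp_fix j p
  obtain ⟨t, ht, rfl⟩ := hA'.eq_smul hA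
  refine ⟨t, ht, by rw [smul_apply, h1], fun u => ?_⟩
  rw [smul_apply, map_smul, h2, smul_eq_mul]

/-- A lift that is not the power of a cusp generator moves the fixed lines of the cusps off the
fixed hyperplanes. -/
theorem eq_syl_of_apply_eq_zero (h : GoodRep ρ v φ v₀ φ₀ B c μ η) {j j' : Fin l}
    {x : CyclicProd (Fin k ⊕ Fin l)} {A : Euc d →L[ℝ] Euc d} (hA : IsLift A (ρ x))
    (h0 : φ (Sum.inr j') 1 (A (v (Sum.inr j) 1)) = 0) :
    j' = j ∧ ∃ p, x = syl (Sum.inr j) p := by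
  obtain ⟨p, q, y, rfl, hy, hy'⟩ := exists_core (Sum.inr j' : Fin k ⊕ Fin l) (Sum.inr j) x
  have hc := h.data.pos
  have hB := h.B_pos
  obtain ⟨Ap, hAp, -, -⟩ := h.cusp_fix j' p
  obtain ⟨Aq, hAq, -, -⟩ := h.cusp_fix j q
  obtain ⟨t, ht, -, htφ⟩ := h.cusp_lift hAp
  obtain ⟨s, hs, hsv, -⟩ := h.cusp_lift hAq
  -- Cusp powers at either end only rescale the fixed functional and the fixed vector, so they can
  -- be stripped.
  have reduce : ∀ Y, IsLift Y (ρ y) → φ (Sum.inr j') 1 (Y (v (Sum.inr j) 1)) = 0 := by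
    intro Y hY
    have h1 : IsLift (Ap * Y * Aq) (ρ (syl (Sum.inr j') p * y * syl (Sum.inr j) q)) := by
      rw [map_mul, map_mul]
      exact (hAp.mul hY).mul hAq
    obtain ⟨r, hr, rfl⟩ := h1.eq_smul hA
    simp only [smul_apply, mul_apply_eq_comp, map_smul, hsv, htφ, smul_eq_mul,
      mul_eq_zero, hr, hs, ht, false_or] at h0
    exact h0
  by_cases hy1 : y = 1
  · subst hy1
    have h1 := reduce 1 (by rw [map_one]; exact isLift_one)
    rw [one_apply_eq_self] at h1
    have hjj : j' = j := by
      by_contra hne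
      have h2 := h.data.transverse (Sum.inr j') 1 (Sum.inr j) 1 (by simpa using hne)
      rw [h1, abs_zero] at h2
      linarith
    subst hjj
    exact ⟨rfl, p + q, by rw [mul_one, syl_add]⟩
  · exfalso
    obtain ⟨w, ψ, D, a, b, hl, ha, hb, hw, hψ, -, hDη, -, -, -, -⟩ := h.exists_word hy1
    have h1 := reduce _ hl
    have hja : Sum.inr j' ≠ a.1 := (hy a ha).symm
    have hjb : b.1 ≠ Sum.inr j := by
      have : (b.1, -b.2) ∈ (letters y⁻¹).head? := by
        rw [letters_inv, head?_invList]
        simpa using hb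
      exact hy' (b.1, -b.2) this
    -- Neither end of the core `y` matches the adjacent cusp, so the rank-one term is at least `c ^
    -- 2 / 4` in absolute value, more than the error `B ^ 2 * η`.
    have e1 := h.abs_apply_sub_le (h.data.norm_φ (Sum.inr j') 1) hw
      (h.data.transverse _ _ _ _ hja)
    have e2 := h.abs_sub_apply_le (h.data.norm_v (Sum.inr j) 1) hψ
      (h.data.transverse _ _ _ _ hjb)
    simp only [add_apply, ContinuousLinearMap.smulRight_apply, map_add, map_smul,
      smul_eq_mul] at h1
    have e3 : |φ (Sum.inr j') 1 (D (v (Sum.inr j) 1))| ≤ B * (η * B) := by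
      rw [← Real.norm_eq_abs]
      refine (ContinuousLinearMap.le_opNorm _ _).trans (mul_le_mul (h.data.norm_φ _ _) ?_
        (norm_nonneg _) hB.le)
      exact (D.le_opNorm _).trans (mul_le_mul hDη (h.data.norm_v _ _) (norm_nonneg _) h.η_pos.le)
    have e4 : c / 2 * (c / 2) ≤ |ψ (v (Sum.inr j) 1)| * |φ (Sum.inr j') 1 w| :=
      mul_le_mul e2 e1 (by linarith) (abs_nonneg _)
    rw [← abs_mul, eq_neg_of_add_eq_zero_left h1, abs_neg] at e4
    have := h.η_lt
    nlinarith

end GoodRep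

theorem tendsto_logWeight : Tendsto logWeight cofinite atTop := by
  rw [tendsto_atTop]
  intro R
  have hfin : (Set.Icc (-⌈(2 : ℝ) ^ (R / 2)⌉) ⌈(2 : ℝ) ^ (R / 2)⌉ : Set ℤ).Finite := Set.finite_Icc _ _
  filter_upwards [hfin.compl_mem_cofinite] with q hq
  by_contra hlt
  apply hq
  have h1 : 1 + |(q : ℝ)| < 2 ^ (R / 2) := by
    by_contra hge
    have := le_logWeight (p := q) (t := R / 2) (not_lt.1 hge)
    linarith
  have h2 := Int.le_ceil ((2 : ℝ) ^ (R / 2))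
  rw [Set.mem_Icc, ← abs_le]
  have h3 : ((|q| : ℤ) : ℝ) ≤ ((⌈(2 : ℝ) ^ (R / 2)⌉ : ℤ) : ℝ) := by
    rw [Int.cast_abs]; linarith
  exact_mod_cast h3

namespace GoodRep

variable {k l d : ℕ} {ρ : CyclicProd (Fin k ⊕ Fin l) →* PGLR d}
  {v : Fin k ⊕ Fin l → ℤˣ → Euc d} {φ : Fin k ⊕ Fin l → ℤˣ → Euc d →L[ℝ] ℝ}
  {v₀ : Euc d} {φ₀ : Euc d →L[ℝ] ℝ} {B c μ η : ℝ}

/-- Powers of a cusp generator converge to a map of rank one. -/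
theorem exists_tendsto_lift (h : GoodRep ρ v φ v₀ φ₀ B c μ η) (j : Fin l) {q : ℕ → ℤ}
    (hq : Tendsto (fun n => logWeight (q n)) atTop atTop) : ∃ A : ℕ → Euc d →L[ℝ] Euc d,
      (∀ n, IsLift (A n) (ρ (syl (Sum.inr j) (q n)))) ∧
      Tendsto A atTop (𝓝 ((φ (Sum.inr j) 1).smulRight (v (Sum.inr j) 1))) := by
  have hex : ∀ p : ℤ, ∃ A, IsLift A (ρ (syl (Sum.inr j) p)) ∧ (p ≠ 0 →
      ‖A - (φ (Sum.inr j) 1).smulRight (v (Sum.inr j) 1)‖ ≤ Real.exp (-(μ * logWeight p))) := by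
    intro p
    by_cases hp : p = 0
    · obtain ⟨A, -, hA, -⟩ := exists_isLift (ρ (syl (Sum.inr j : Fin k ⊕ Fin l) p))
      exact ⟨A, hA, fun h => absurd hp h⟩
    · obtain ⟨A, hA, hb⟩ := h.approx (Sum.inr j) p hp
      rw [h.cusp_φ, h.cusp_v, div_one] at hb
      exact ⟨A, hA, fun _ => hb⟩
  choose A hA hb using hex
  refine ⟨fun n => A (q n), fun n => hA _, ?_⟩
  rw [tendsto_iff_norm_sub_tendsto_zero]
  refine squeeze_zero' (Eventually.of_forall fun _ => norm_nonneg _) (g := fun n =>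
    Real.exp (-(μ * logWeight (q n)))) ?_ ?_
  · filter_upwards [hq.eventually_gt_atTop 0] with n hn
    refine hb _ fun h0 => ?_
    rw [h0] at hn
    simp [logWeight] at hn
  · exact Real.tendsto_exp_neg_atTop_nhds_zero.comp (hq.const_mul_atTop h.μ_pos)

end GoodRep

/-! ### Domination, limit lines and limit hyperplanes -/

section Limits

variable {k l d : ℕ} {Γ : Type*} [Group Γ] {e : Γ ≃* CyclicProd (Fin k ⊕ Fin l)}
  {P : Fin l → Subgroup Γ} {ρ : CyclicProd (Fin k ⊕ Fin l) →* PGLR d}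
  {v : Fin k ⊕ Fin l → ℤˣ → Euc d} {φ : Fin k ⊕ Fin l → ℤˣ → Euc d →L[ℝ] ℝ}
  {v₀ : Euc d} {φ₀ : Euc d →L[ℝ] ℝ} {B c μ η : ℝ} {r : Γ →* PGLR d}

theorem dMinus_of_goodRep (h : GoodRep ρ v φ v₀ φ₀ B c μ η) (hr : ∀ g, r g = ρ (e g))
    (hP : IsStdPeripheral e P) {G : Set Γ} (hG : IsCompatible P G) : DMinus P G r := by
  obtain ⟨u, hu0, hu⟩ := cuspedLength_le hP hG
  refine ⟨1, one_pos, μ / u, div_pos h.μ_pos hu0, fun g => ?_⟩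
  rw [one_mul, hr]
  refine le_trans (Real.exp_le_exp.2 ?_) (h.le_svRatio (e g))
  have := hu g
  rw [div_mul_eq_mul_div, div_le_iff₀ hu0]
  have := mul_le_mul_of_nonneg_left this h.μ_pos.le
  linarith

theorem dPlus_of_goodRep (h : GoodRep ρ v φ v₀ φ₀ B c μ η) (hr : ∀ g, r g = ρ (e g))
    (hP : IsStdPeripheral e P) {G : Set Γ} (hG : IsCompatible P G) : DPlus P G r := by
  obtain ⟨U, hU0, hU⟩ := len_le_cuspedLength hP hG
  obtain ⟨C, hC0, hC⟩ := h.svRatio_one_le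
  refine ⟨Real.exp (C * U), Real.exp_pos _, C * U + 1, by positivity, fun g => ?_⟩
  rw [← Real.exp_add, hr]
  refine (hC (e g)).trans (Real.exp_le_exp.2 ?_)
  have h1 := mul_le_mul_of_nonneg_left (hU g) hC0
  have h2 : (0 : ℝ) ≤ cuspedLength P G g := Nat.cast_nonneg _
  linarith

/-- A lift of a projective transformation. -/
def liftOf (g : PGLR d) : Euc d →L[ℝ] Euc d := (exists_isLift g).choose

theorem isLift_liftOf (g : PGLR d) : IsLift (liftOf g) g :=
  (exists_isLift g).choose_spec.choose_spec.1

theorem IsLift.injective {A : Euc d →L[ℝ] Euc d} {g : PGLR d} (hA : IsLift A g) :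
    Function.Injective A := by
  obtain ⟨B, -, -, hB⟩ := hA.exists_inv
  intro x y hxy
  have h1 : ∀ z, B (A z) = z := fun z => by rw [← mul_apply_eq_comp, hB, one_apply_eq_self]
  rw [← h1 x, ← h1 y, hxy]

theorem IsLift.surjective {A : Euc d →L[ℝ] Euc d} {g : PGLR d} (hA : IsLift A g) :
    Function.Surjective A := by
  obtain ⟨B, -, hB, -⟩ := hA.exists_inv
  exact fun z => ⟨B z, by rw [← mul_apply_eq_comp, hB, one_apply_eq_self]⟩

theorem comp_liftOf_ne_zero {χ : Euc d →L[ℝ] ℝ} (hχ : χ ≠ 0) (g : PGLR d) :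
    χ.comp (liftOf g) ≠ 0 := by
  intro h0
  refine hχ (ContinuousLinearMap.ext fun z => ?_)
  obtain ⟨y, rfl⟩ := (isLift_liftOf g).surjective z
  have := congrArg (fun F : Euc d →L[ℝ] ℝ => F y) h0
  simpa using this

/-- Leaving every finite set means that the exponents leave every finite set, so lifts of the
conjugated cusp powers converge to the conjugated rank-one map. For the hyperplane the inverses are
used; they are again cusp powers and have the same limit. -/
theorem tendsto_axes_of_conj (h : GoodRep ρ v φ v₀ φ₀ B c μ η) (hr : ∀ g, r g = ρ (e g))
    (hP : IsStdPeripheral e P) (j : Fin l) (g : Γ) {x : ℕ → Γ}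
    (hx : ∀ n, x n ∈ (P j).map (MulAut.conj g).toMonoidHom) (hx' : Tendsto x atTop cofinite) :
    SubspaceTendsto (fun n => axesSpan 1 (r (x n))) (ℝ ∙ liftOf (r g) (v (Sum.inr j) 1)) ∧
    SubspaceTendsto (fun n => axesSpan (d - 1) (r (x n)))
      (LinearMap.ker ((φ (Sum.inr j) 1).comp (liftOf (r g⁻¹)) : Euc d →ₗ[ℝ] ℝ)) := by
  have hd := h.two_le_d
  have : NeZero d := ⟨by omega⟩
  have hex : ∀ n, ∃ q : ℤ, x n = g * e.symm (syl (Sum.inr j) q) * g⁻¹ := by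
    intro n
    obtain ⟨y, hy, hyx⟩ := hx n
    obtain ⟨q, hq⟩ := (hP j y).1 hy
    refine ⟨q, ?_⟩
    rw [← hyx, ← hq, e.symm_apply_apply]
    rfl
  choose q hq using hex
  have hqt : Tendsto q atTop cofinite := by
    intro s hs
    rw [mem_cofinite] at hs
    have hfin := hs.image fun p : ℤ => g * e.symm (syl (Sum.inr j) p) * g⁻¹
    rw [mem_map]
    filter_upwards [mem_map.1 (hx' hfin.compl_mem_cofinite)] with n hn
    by_contra hmem
    exact hn ⟨q n, hmem, (hq n).symm⟩
  have hq1 : Tendsto (fun n => logWeight (q n)) atTop atTop := tendsto_logWeight.comp hqt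
  have hq2 : Tendsto (fun n => logWeight (-q n)) atTop atTop := by
    simpa only [logWeight_neg] using hq1
  obtain ⟨A, hA, hAt⟩ := h.exists_tendsto_lift j hq1
  obtain ⟨A', hA', hAt'⟩ := h.exists_tendsto_lift j hq2
  have hv := h.v_ne_zero (Sum.inr j) 1
  have hφ := h.φ_ne_zero (Sum.inr j) 1
  set L := liftOf (r g) with hL
  set L' := liftOf (r g⁻¹) with hL'
  have hLl : IsLift L (r g) := isLift_liftOf _
  have hLl' : IsLift L' (r g⁻¹) := isLift_liftOf _
  have hlim : L * (φ (Sum.inr j) 1).smulRight (v (Sum.inr j) 1) * L' =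
      ((φ (Sum.inr j) 1).comp L').smulRight (L (v (Sum.inr j) 1)) := by
    ext1 u
    simp [mul_apply_eq_comp]
  have hcont : Continuous fun X : Euc d →L[ℝ] Euc d => L * X * L' := by fun_prop
  have hne1 : (φ (Sum.inr j) 1).comp L' ≠ 0 := comp_liftOf_ne_zero hφ _
  have hne2 : L (v (Sum.inr j) 1) ≠ 0 := fun h0 => hv (hLl.injective (h0.trans (map_zero L).symm))
  constructor
  · refine tendsto_axesSpan_one (A := fun n => L * A n * L') (fun n => ?_) hne1 hne2 ?_
    · rw [hq n, map_mul, map_mul, hr (e.symm _), e.apply_symm_apply]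
      exact (hLl.mul (hA n)).mul hLl'
    · rw [← hlim]
      exact (hcont.tendsto _).comp hAt
  · refine tendsto_axesSpan_pred hd (B := fun n => L * A' n * L') (fun n => ?_) hne1 hne2 ?_
    · have e1 : (r (x n))⁻¹ = r g * ρ (syl (Sum.inr j) (-q n)) * r g⁻¹ := by
        rw [hq n, map_mul, map_mul, hr (e.symm _), e.apply_symm_apply, syl_neg, map_inv, map_inv]
        group
      rw [e1]
      exact (hLl.mul (hA' n)).mul hLl'
    · rw [← hlim]
      exact (hcont.tendsto _).comp hAt'

/-- The limit line of a peripheral subgroup. -/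
def limitLine (P : Fin l → Subgroup Γ) (v : Fin k ⊕ Fin l → ℤˣ → Euc d) (r : Γ →* PGLR d)
    (Q : Subgroup Γ) : Submodule ℝ (Euc d) :=
  open Classical in
  if h : Q ∈ peripherals P then
    ℝ ∙ liftOf (r h.choose_spec.choose) (v (Sum.inr h.choose) 1) else ⊥

/-- The limit hyperplane of a peripheral subgroup. -/
def limitHyperplane (P : Fin l → Subgroup Γ) (φ : Fin k ⊕ Fin l → ℤˣ → Euc d →L[ℝ] ℝ)
    (r : Γ →* PGLR d) (Q : Subgroup Γ) : Submodule ℝ (Euc d) :=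
  open Classical in
  if h : Q ∈ peripherals P then
    LinearMap.ker ((φ (Sum.inr h.choose) 1).comp (liftOf (r h.choose_spec.choose⁻¹)) :
      Euc d →ₗ[ℝ] ℝ) else ⊥

theorem exists_limit_eq {Q : Subgroup Γ} (hQ : Q ∈ peripherals P) :
    ∃ (j : Fin l) (g : Γ), Q = (P j).map (MulAut.conj g).toMonoidHom ∧
      limitLine P v r Q = ℝ ∙ liftOf (r g) (v (Sum.inr j) 1) ∧
      limitHyperplane P φ r Q =
        LinearMap.ker ((φ (Sum.inr j) 1).comp (liftOf (r g⁻¹)) : Euc d →ₗ[ℝ] ℝ) :=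
  ⟨hQ.choose, hQ.choose_spec.choose, hQ.choose_spec.choose_spec, by
    unfold limitLine; rw [dif_pos hQ], by unfold limitHyperplane; rw [dif_pos hQ]⟩

theorem uniqueLimits_of_goodRep (h : GoodRep ρ v φ v₀ φ₀ B c μ η) (hr : ∀ g, r g = ρ (e g))
    (hP : IsStdPeripheral e P) : UniqueLimits P r (limitLine P v r) (limitHyperplane P φ r) := by
  intro Q hQ
  obtain ⟨j, g, rfl, h1, h2⟩ := exists_limit_eq (v := v) (φ := φ) (r := r) hQ
  rw [h1, h2]
  refine ⟨?_, ?_, fun x hx hx' => tendsto_axes_of_conj h hr hP j g hx hx'⟩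
  · refine finrank_span_singleton fun h0 => h.v_ne_zero (Sum.inr j) 1 ?_
    exact (isLift_liftOf (r g)).injective (h0.trans (map_zero _).symm)
  · set χ := (φ (Sum.inr j) 1).comp (liftOf (r g⁻¹)) with hχ
    have hne : χ ≠ 0 := comp_liftOf_ne_zero (h.φ_ne_zero (Sum.inr j) 1) _
    have e1 : Module.finrank ℝ (ℝ ∙ dualVec χ) = 1 := by
      refine finrank_span_singleton ?_
      rw [← norm_ne_zero_iff, norm_dualVec]
      exact norm_ne_zero_iff.2 hne
    have e2 := (ℝ ∙ dualVec χ).finrank_add_finrank_orthogonal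
    rw [e1, finrank_euc] at e2
    have e3 : Module.finrank ℝ (LinearMap.ker (χ : Euc d →ₗ[ℝ] ℝ)) =
        Module.finrank ℝ (ℝ ∙ dualVec χ)ᗮ := by rw [ker_eq_orthogonal]
    exact e3.trans (by omega)

/-- The limits at the subgroups `P j` themselves. -/
theorem limit_eq (h : GoodRep ρ v φ v₀ φ₀ B c μ η) (hr : ∀ g, r g = ρ (e g))
    (hP : IsStdPeripheral e P) (j : Fin l) :
    limitLine P v r (P j) = ℝ ∙ v (Sum.inr j) 1 ∧
      limitHyperplane P φ r (P j) = LinearMap.ker (φ (Sum.inr j) 1 : Euc d →ₗ[ℝ] ℝ) := by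
  -- The chosen presentation of `P j` as a conjugate need not be the trivial one, so the values are
  -- identified through uniqueness of limits along the powers of the generator.
  have hQ : P j = (P j).map (MulAut.conj 1).toMonoidHom := by
    ext x; simp
  have hmem : P j ∈ peripherals P := ⟨j, 1, hQ⟩
  set x : ℕ → Γ := fun n => e.symm (syl (Sum.inr j) (n : ℤ)) with hx
  have hxP : ∀ n, x n ∈ P j := fun n => (hP j _).2 ⟨n, e.apply_symm_apply _⟩
  have hinj : Function.Injective x := by
    intro m n hmn
    have h1 : syl (Sum.inr j : Fin k ⊕ Fin l) (m : ℤ) = syl (Sum.inr j) (n : ℤ) :=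
      e.symm.injective hmn
    have h2 := congrArg (len (wt k l)) (congrArg₂ (· * ·) h1 (rfl : syl (Sum.inr j) (-(n : ℤ)) = _))
    have h3 : (m : ℤ) - n = 0 := by
      by_contra hne
      simp only [← syl_add] at h2
      rw [len_syl (isWeight_wt k l), len_syl (isWeight_wt k l), add_neg_cancel,
        (isWeight_wt k l).zero, ← sub_eq_add_neg] at h2
      linarith [(isWeight_wt k l).one_le (Sum.inr j) _ hne]
    omega
  have hxt : Tendsto x atTop cofinite := by
    rw [← Nat.cofinite_eq_atTop]; exact hinj.tendsto_cofinite
  obtain ⟨-, -, h1⟩ := uniqueLimits_of_goodRep (v := v) (φ := φ) h hr hP (P j) hmem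
  obtain ⟨h2, h3⟩ := h1 x hxP hxt
  obtain ⟨h4, h5⟩ := tendsto_axes_of_conj h hr hP j 1 (fun n => hQ ▸ hxP n) hxt
  have e1 := Submodule.starProjection_inj.1 (tendsto_nhds_unique h2 h4)
  have e2 := Submodule.starProjection_inj.1 (tendsto_nhds_unique h3 h5)
  rw [e1, e2, inv_one, map_one]
  obtain ⟨t, ht, hL⟩ := isLift_one.eq_smul (isLift_liftOf (1 : PGLR d))
  rw [hL]
  constructor
  · rw [smul_apply, one_apply_eq_self]
    exact Submodule.span_singleton_smul_eq (IsUnit.mk0 t ht) _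
  · ext u
    simp [ht]

/-- If the lines agree, `g'⁻¹ * g` carries the fixed line of one cusp to that of the other, which
lies in its own fixed hyperplane. By `eq_syl_of_apply_eq_zero` the element is a cusp power, and the
two conjugates coincide. -/
theorem distinctLimits_of_goodRep (h : GoodRep ρ v φ v₀ φ₀ B c μ η) (hr : ∀ g, r g = ρ (e g))
    (hP : IsStdPeripheral e P) : DistinctLimits P (limitLine P v r) := by
  intro Q hQ Q' hQ' hne heq
  obtain ⟨j, g, rfl, h1, -⟩ := exists_limit_eq (v := v) (φ := φ) (r := r) hQ
  obtain ⟨j', g', rfl, h2, -⟩ := exists_limit_eq (v := v) (φ := φ) (r := r) hQ'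
  rw [h1, h2] at heq
  apply hne
  obtain ⟨t, ht⟩ := Submodule.mem_span_singleton.1
    (heq ▸ Submodule.mem_span_singleton_self (liftOf (r g) (v (Sum.inr j) 1)))
  obtain ⟨L', hL', -, hinv⟩ := (isLift_liftOf (r g')).exists_inv
  have hA : IsLift (L' * liftOf (r g)) (ρ (e (g'⁻¹ * g))) := by
    rw [← hr, map_mul, map_inv]
    exact hL'.mul (isLift_liftOf _)
  have h0 : φ (Sum.inr j') 1 ((L' * liftOf (r g)) (v (Sum.inr j) 1)) = 0 := by
    rw [mul_apply_eq_comp, ← ht, map_smul, ← mul_apply_eq_comp, hinv, one_apply_eq_self, map_smul,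
      h.cusp_zero, smul_zero]
  obtain ⟨rfl, p, hp⟩ := h.eq_syl_of_apply_eq_zero hA h0
  have hmem : g'⁻¹ * g ∈ P j' := (hP j' _).2 ⟨p, hp⟩
  ext x
  simp only [Subgroup.mem_map_equiv, MulAut.conj_symm_apply]
  have e1 : g⁻¹ * x * g = (g'⁻¹ * g)⁻¹ * (g'⁻¹ * x * g') * (g'⁻¹ * g) := by group
  rw [e1]
  constructor
  · intro hx
    have := (P j').mul_mem ((P j').mul_mem hmem hx) ((P j').inv_mem hmem)
    convert! this using 1
    group
  · intro hx
    exact (P j').mul_mem ((P j').mul_mem ((P j').inv_mem hmem) hx) hmem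

end Limits

/-! ### Uniform transversality -/

theorem expSign_neg {p : ℤ} (hp : p ≠ 0) : expSign (-p) = -expSign p := by
  unfold expSign
  rcases lt_or_gt_of_ne hp with h | h
  · rw [if_pos (by omega), if_neg (by omega), neg_neg]
  · rw [if_neg (by omega), if_pos h]

theorem expSign_eq_of_ne {p q : ℤ} (hq : q ≠ 0) (h : expSign p ≠ expSign q) :
    expSign p = expSign (-q) := by
  rw [expSign_neg hq]
  rcases Int.units_eq_one_or (expSign p) with e1 | e1 <;>
    rcases Int.units_eq_one_or (expSign q) with e2 | e2 <;> simp_all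

/-! ### Common prefixes and Gromov products of words -/

section Prefix

variable {k l : ℕ}

/-- For exponents of equal sign, `|p| + |q| - |p - q|` is twice the minimum; for logarithmic weights
the near-ultrametric inequality plays this part. Opposite powers of a proximal generator are
excluded, being already transverse. -/
theorem min_wt_le {i : Fin k ⊕ Fin l} {p q : ℤ} {R : ℝ} (hR : 0 ≤ R)
    (h : wt k l i p + wt k l i q - wt k l i (p - q) ≤ R)
    (hs : ¬ ∃ i₀, i = Sum.inl i₀ ∧ expSign p ≠ expSign q) :
    min (wt k l i p) (wt k l i q) ≤ R + 4 := by
  cases i with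
  | inl i =>
    have hs' : expSign p = expSign q := by
      by_contra hne
      exact hs ⟨i, rfl, hne⟩
    simp only [wt, Sum.elim_inl, Int.cast_sub] at h ⊢
    have hsgn : (0 < p ↔ 0 < q) := by
      unfold expSign at hs'
      split_ifs at hs' with h1 h2 h2
      · exact ⟨fun _ => h2, fun _ => h1⟩
      · exact absurd hs' (by decide)
      · exact absurd hs' (by decide)
      · exact ⟨fun h => absurd h h1, fun h => absurd h h2⟩
    have key : (0 ≤ (p : ℝ) ∧ 0 ≤ (q : ℝ)) ∨ ((p : ℝ) ≤ 0 ∧ (q : ℝ) ≤ 0) := by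
      by_cases hp : 0 < p
      · have hq := hsgn.1 hp
        exact Or.inl ⟨by exact_mod_cast hp.le, by exact_mod_cast hq.le⟩
      · have hq : ¬ 0 < q := fun hq => hp (hsgn.2 hq)
        exact Or.inr ⟨by exact_mod_cast not_lt.1 hp, by exact_mod_cast not_lt.1 hq⟩
    rw [min_le_iff]
    by_contra hcon
    push Not at hcon
    obtain ⟨h1, h2⟩ := hcon
    rcases key with ⟨k1, k2⟩ | ⟨k1, k2⟩
    · rw [abs_of_nonneg k1] at h h1
      rw [abs_of_nonneg k2] at h h2
      rcases abs_cases ((p : ℝ) - q) with ⟨e, _⟩ | ⟨e, _⟩ <;> rw [e] at h <;> linarith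
    · rw [abs_of_nonpos k1] at h h1
      rw [abs_of_nonpos k2] at h h2
      rcases abs_cases ((p : ℝ) - q) with ⟨e, _⟩ | ⟨e, _⟩ <;> rw [e] at h <;> linarith
  | inr j =>
    simp only [wt, Sum.elim_inr] at h ⊢
    have h1 := logWeight_ultra p (-q)
    rw [logWeight_neg, ← sub_eq_add_neg] at h1
    have h2 := min_add_max (logWeight p) (logWeight q)
    linarith

/-- Two words with bounded Gromov product have a short common prefix with transverse
remainders. -/
theorem exists_prefix (x : CyclicProd (Fin k ⊕ Fin l)) : ∀ (y : CyclicProd (Fin k ⊕ Fin l)) (R : ℝ),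
    len (wt k l) x + len (wt k l) y - wdist (wt k l) x y ≤ R →
    ∃ z x' y', x = z * x' ∧ y = z * y' ∧ len (wt k l) z ≤ R + 4 ∧ TransHeads x' y' := by
  have hw := isWeight_wt k l
  have hpos : ∀ (x y : CyclicProd (Fin k ⊕ Fin l)) (R : ℝ),
      len (wt k l) x + len (wt k l) y - wdist (wt k l) x y ≤ R → 0 ≤ R := by
    intro x y R h
    have := len_mul_le hw x⁻¹ y
    rw [len_inv hw] at this
    unfold wdist at h
    linarith
  induction x using syl_induction with
  | one =>
    intro y R h
    exact ⟨1, 1, y, by simp, by simp, by rw [len_one]; linarith [hpos _ _ _ h],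
      fun a ha => by simp at ha⟩
  | mul i p x hp hx ih =>
    intro y R h
    have hR := hpos _ _ _ h
    obtain ⟨q, y, hy, rfl⟩ := exists_head i y
    have hhead := head?_syl_mul hp hx
    by_cases hq : q = 0
    · subst hq
      rw [syl_zero, one_mul]
      refine ⟨1, syl i p * x, y, by simp, by simp, by rw [len_one]; linarith, fun a ha b hb => ?_⟩
      rw [hhead, Option.mem_some_iff] at ha
      subst ha
      exact Or.inl (hy b hb).symm
    rw [len_syl_mul hw p hx, len_syl_mul hw q hy] at h
    by_cases hpq : p = q
    · subst hpq
      rw [wdist_mul_left] at h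
      obtain ⟨z, x', y', rfl, rfl, hz, ht⟩ := ih y (R - 2 * wt k l i p) (by linarith)
      refine ⟨syl i p * z, x', y', by rw [mul_assoc], by rw [mul_assoc], ?_, ht⟩
      have := len_mul_le hw (syl i p) z
      rw [len_syl hw] at this
      linarith [hw.nonneg i p]
    · have hd : wdist (wt k l) (syl i p * x) (syl i q * y) =
          len (wt k l) x + len (wt k l) y + wt k l i (p - q) := len_inv_mul_eq hw hpq hx hy
      rw [hd] at h
      have hheadq := head?_syl_mul hq hy
      -- With opposite signs the attracting line of one power and the repelling hyperplane of the
      -- inverse of the other belong to the same sign of a proximal generator, so they are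
      -- transverse and the empty prefix serves.
      by_cases hs : ∃ i₀, i = Sum.inl i₀ ∧ expSign p ≠ expSign q
      · obtain ⟨i₀, rfl, hne⟩ := hs
        refine ⟨1, _, _, (one_mul _).symm, (one_mul _).symm, by rw [len_one]; linarith,
          fun a ha b hb => ?_⟩
        rw [hhead, Option.mem_some_iff] at ha
        rw [hheadq, Option.mem_some_iff] at hb
        subst ha hb
        exact Or.inr ⟨i₀, rfl, rfl, expSign_eq_of_ne hq hne⟩
      -- The cheaper of the two first syllables becomes the prefix; the other word keeps the
      -- non-trivial difference of exponents, and its new head has index `i` while the first word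
      -- has lost its own.
      · have hmin := min_wt_le hR (by linarith) hs
        rw [min_le_iff] at hmin
        rcases hmin with hmin | hmin
        · refine ⟨syl i p, x, syl i (q - p) * y, rfl, ?_, by rwa [len_syl hw], fun a ha b hb => ?_⟩
          · rw [← mul_assoc, ← syl_add, add_sub_cancel]
          · rw [head?_syl_mul (sub_ne_zero.2 (Ne.symm hpq)) hy, Option.mem_some_iff] at hb
            subst hb
            exact Or.inl (hx a ha)
        · refine ⟨syl i q, syl i (p - q) * x, y, ?_, rfl, by rwa [len_syl hw], fun a ha b hb => ?_⟩
          · rw [← mul_assoc, ← syl_add, add_sub_cancel]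
          · rw [head?_syl_mul (sub_ne_zero.2 hpq) hx, Option.mem_some_iff] at ha
            subst ha
            exact Or.inl (hy b hb).symm

end Prefix

namespace GoodRep

variable {k l d : ℕ} {ρ : CyclicProd (Fin k ⊕ Fin l) →* PGLR d}
  {v : Fin k ⊕ Fin l → ℤˣ → Euc d} {φ : Fin k ⊕ Fin l → ℤˣ → Euc d →L[ℝ] ℝ}
  {v₀ : Euc d} {φ₀ : Euc d →L[ℝ] ℝ} {B c μ η : ℝ}

theorem eta_bound (h : GoodRep ρ v φ v₀ φ₀ B c μ η) :
    6 * B * (η * (1 + 2 * B / c)) ≤ c ∧ η * (1 + 2 * B / c) ≤ 1 := by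
  have hc := h.data.pos
  have hB := h.data.one_le
  have h1 : 6 * B * (η * (1 + 2 * B / c)) ≤ c := by
    have e : 6 * B * (η * (1 + 2 * B / c)) = (6 * B * η * (c + 2 * B)) / c := by field_simp
    rw [e, div_le_iff₀ hc]
    have h2 := h.η_lt
    have h3 := h.η_pos
    have h4 := h.c_le
    have h5 : 6 * B * η * (c + 2 * B) ≤ 6 * B * η * (3 * B) :=
      mul_le_mul_of_nonneg_left (by linarith) (by positivity)
    nlinarith [mul_pos (mul_pos h3 h.B_pos) h.B_pos]
  refine ⟨h1, ?_⟩
  have h2 : 0 ≤ η * (1 + 2 * B / c) := by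
    have := h.η_pos
    have := h.B_pos
    positivity
  have := h.c_le
  nlinarith

/-- Images of the base vector are close to the attracting vector of the first syllable. -/
theorem exists_lift_apply (h : GoodRep ρ v φ v₀ φ₀ B c μ η) (x : CyclicProd (Fin k ⊕ Fin l)) :
    ∃ (A : Euc d →L[ℝ] Euc d) (v' : Euc d), IsLift A (ρ x) ∧
      ‖A v₀ - v'‖ ≤ η * (1 + 2 * B / c) ∧
      ((x = 1 ∧ v' = v₀) ∨ ∃ a ∈ (letters x).head?, v' = v a.1 (expSign a.2)) := by
  have hc := h.data.pos
  have hB := h.B_pos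
  have hη := h.η_pos
  by_cases hx : x = 1
  · refine ⟨1, v₀, by rw [hx, map_one]; exact isLift_one, ?_, Or.inl ⟨hx, rfl⟩⟩
    rw [one_apply_eq_self, sub_self, norm_zero]
    positivity
  · obtain ⟨w, ψ, D, a, b, hl, ha, hb, hw, hψ, -, hDη, -, -, -, -⟩ := h.exists_word hx
    have h1 := h.abs_sub_apply_le h.norm_v₀ hψ (h.generic_v₀ _ _)
    have hne : ψ v₀ ≠ 0 := by
      intro h0
      rw [h0, abs_zero] at h1
      linarith
    refine ⟨(ψ v₀)⁻¹ • (ψ.smulRight w + D), _, hl.smul (inv_ne_zero hne), ?_, Or.inr ⟨a, ha, rfl⟩⟩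
    have e : ((ψ v₀)⁻¹ • (ψ.smulRight w + D)) v₀ - v a.1 (expSign a.2) =
        (w - v a.1 (expSign a.2)) + (ψ v₀)⁻¹ • D v₀ := by
      rw [smul_apply, add_apply, ContinuousLinearMap.smulRight_apply, smul_add, smul_smul,
        inv_mul_cancel₀ hne, one_smul]
      abel
    rw [e]
    refine (norm_add_le _ _).trans ?_
    have h2 : ‖(ψ v₀)⁻¹ • D v₀‖ ≤ 2 / c * (η * B) := by
      rw [norm_smul, norm_inv, Real.norm_eq_abs]
      refine mul_le_mul ?_ ((D.le_opNorm _).trans (mul_le_mul hDη h.norm_v₀ (norm_nonneg _) hη.le))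
        (norm_nonneg _) (by positivity)
      rw [inv_le_comm₀ (abs_pos.2 hne) (by positivity), inv_div]
      exact h1
    have e2 : η * (1 + 2 * B / c) = η + 2 / c * (η * B) := by ring
    linarith

/-- Pull-backs of the base functional are close to the repelling functional of the first
syllable of the inverse. -/
theorem exists_lift_comp (h : GoodRep ρ v φ v₀ φ₀ B c μ η) (x : CyclicProd (Fin k ⊕ Fin l)) :
    ∃ (Y : Euc d →L[ℝ] Euc d) (φ' : Euc d →L[ℝ] ℝ), IsLift Y (ρ x⁻¹) ∧
      ‖φ₀.comp Y - φ'‖ ≤ η * (1 + 2 * B / c) ∧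
      ((x = 1 ∧ φ' = φ₀) ∨ ∃ a ∈ (letters x).head?, φ' = φ a.1 (expSign (-a.2))) := by
  have hc := h.data.pos
  have hB := h.B_pos
  have hη := h.η_pos
  by_cases hx : x = 1
  · refine ⟨1, φ₀, by rw [hx, inv_one, map_one]; exact isLift_one, ?_, Or.inl ⟨hx, rfl⟩⟩
    have : φ₀.comp (1 : Euc d →L[ℝ] Euc d) = φ₀ := rfl
    rw [this, sub_self, norm_zero]
    positivity
  · obtain ⟨w, ψ, D, a, b, hl, ha, hb, hw, hψ, -, hDη, -, -, -, -⟩ :=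
      h.exists_word (x := x⁻¹) (inv_ne_one.2 hx)
    have h1 := h.abs_apply_sub_le h.norm_φ₀ hw (h.generic_φ₀ _ _)
    have hne : φ₀ w ≠ 0 := by
      intro h0
      rw [h0, abs_zero] at h1
      linarith
    have hb' : (b.1, -b.2) ∈ (letters x).head? := by
      rw [letters_inv, getLast?_invList] at hb
      exact hb
    refine ⟨(φ₀ w)⁻¹ • (ψ.smulRight w + D), φ b.1 (expSign b.2), hl.smul (inv_ne_zero hne), ?_,
      Or.inr ⟨_, hb', by simp⟩⟩
    have e : φ₀.comp ((φ₀ w)⁻¹ • (ψ.smulRight w + D)) - φ b.1 (expSign b.2) =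
        (ψ - φ b.1 (expSign b.2)) + (φ₀ w)⁻¹ • φ₀.comp D := by
      ext1 u
      simp only [sub_apply, add_apply, smul_apply, ContinuousLinearMap.comp_apply,
        ContinuousLinearMap.smulRight_apply, map_add, map_smul, smul_eq_mul]
      field_simp
      ring
    rw [e]
    refine (norm_add_le _ _).trans ?_
    have h2 : ‖(φ₀ w)⁻¹ • φ₀.comp D‖ ≤ 2 / c * (B * η) := by
      rw [norm_smul, norm_inv, Real.norm_eq_abs]
      refine mul_le_mul ?_ ((φ₀.opNorm_comp_le D).trans
        (mul_le_mul h.norm_φ₀ hDη (norm_nonneg _) hB.le)) (norm_nonneg _) (by positivity)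
      rw [inv_le_comm₀ (abs_pos.2 hne) (by positivity), inv_div]
      exact h1
    have e2 : η * (1 + 2 * B / c) = η + 2 / c * (B * η) := by ring
    linarith

theorem abs_apply_ge (h : GoodRep ρ v φ v₀ φ₀ B c μ η) {χ φ' : Euc d →L[ℝ] ℝ} {y v' : Euc d}
    (hχ : ‖χ - φ'‖ ≤ η * (1 + 2 * B / c)) (hy : ‖y - v'‖ ≤ η * (1 + 2 * B / c))
    (hφ' : ‖φ'‖ ≤ B) (hv' : ‖v'‖ ≤ B) (hc : c ≤ |φ' v'|) : c / 2 ≤ |χ y| := by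
  obtain ⟨h1, h2⟩ := h.eta_bound
  set η' := η * (1 + 2 * B / c)
  have hη' : 0 ≤ η' := (norm_nonneg _).trans hy
  have hB := h.data.one_le
  have hyn : ‖y‖ ≤ B + η' := by
    have := norm_le_norm_add_norm_sub' y v'
    linarith
  have e : χ y - φ' v' = (χ - φ') y + φ' (y - v') := by
    rw [sub_apply, map_sub]; ring
  have h3 : |χ y - φ' v'| ≤ η' * (B + η') + B * η' := by
    rw [e, ← Real.norm_eq_abs]
    refine (norm_add_le _ _).trans (add_le_add ?_ ?_)
    · exact ((χ - φ').le_opNorm y).trans (mul_le_mul hχ hyn (norm_nonneg _) hη')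
    · exact (φ'.le_opNorm _).trans (mul_le_mul hφ' hy (norm_nonneg _) (by linarith))
  have h4 := abs_sub_abs_le_abs_sub (φ' v') (χ y)
  rw [abs_sub_comm] at h4
  nlinarith

/-- The generic pair `v₀, φ₀` stands in for a missing first syllable; this is why it must be
transverse to all attracting and repelling data and to itself. -/
theorem transHeads_le (h : GoodRep ρ v φ v₀ φ₀ B c μ η) {x y : CyclicProd (Fin k ⊕ Fin l)}
    (ht : TransHeads x y) {v' : Euc d} {φ' : Euc d →L[ℝ] ℝ}
    (hv' : (x = 1 ∧ v' = v₀) ∨ ∃ a ∈ (letters x).head?, v' = v a.1 (expSign a.2))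
    (hφ' : (y = 1 ∧ φ' = φ₀) ∨ ∃ a ∈ (letters y).head?, φ' = φ a.1 (expSign (-a.2))) :
    c ≤ |φ' v'| ∧ ‖φ'‖ ≤ B ∧ ‖v'‖ ≤ B := by
  rcases hv' with ⟨-, rfl⟩ | ⟨a, ha, rfl⟩ <;> rcases hφ' with ⟨-, rfl⟩ | ⟨b, hb, rfl⟩
  · exact ⟨h.generic, h.norm_φ₀, h.norm_v₀⟩
  · exact ⟨h.generic_v₀ _ _, h.data.norm_φ _ _, h.norm_v₀⟩
  · exact ⟨h.generic_φ₀ _ _, h.norm_φ₀, h.data.norm_v _ _⟩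
  · refine ⟨?_, h.data.norm_φ _ _, h.data.norm_v _ _⟩
    rcases ht a ha b hb with hne | ⟨i, h1, h2, h3⟩
    · exact h.data.transverse _ _ _ _ hne.symm
    · rw [h1, h2, h3]
      exact h.same_sign _ _

/-- Words with bounded Gromov product act transversely on the base vector and functional. -/
theorem exists_transverse (h : GoodRep ρ v φ v₀ φ₀ B c μ η) (R : ℝ) : ∃ δ > 0,
    ∀ x y : CyclicProd (Fin k ⊕ Fin l),
      len (wt k l) x + len (wt k l) y - wdist (wt k l) x y ≤ R →
      ∀ A Y : Euc d →L[ℝ] Euc d, IsLift A (ρ x) → IsLift Y (ρ y⁻¹) →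
        δ * (‖φ₀.comp Y‖ * ‖A v₀‖) ≤ |φ₀ (Y (A v₀))| := by
  obtain ⟨C, hC0, hC⟩ := h.svRatio_one_le
  have hc := h.data.pos
  have hB := h.B_pos
  have : NeZero d := ⟨by have := h.two_le_d; omega⟩
  set κ := Real.exp (C * (R + 4)) with hκ
  have hκ0 : 0 < κ := Real.exp_pos _
  refine ⟨c / 2 / ((B + 1) ^ 2 * κ), by positivity, fun x y hxy A Y hA hY => ?_⟩
  -- The common prefix `z` cancels in the pairing and distorts the two norms by at most its
  -- condition number, which is bounded since its length is. The remainders are transverse.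
  obtain ⟨z, x', y', rfl, rfl, hz, ht⟩ := exists_prefix x y R hxy
  obtain ⟨A', v', hA', hAv, hv'⟩ := h.exists_lift_apply x'
  obtain ⟨Y', φ', hY', hYφ, hφ'⟩ := h.exists_lift_comp y'
  obtain ⟨Z, Z', hZ, hZ', hZZ', hZ'Z⟩ := exists_isLift (ρ z)
  obtain ⟨hcc, hφB, hvB⟩ := h.transHeads_le ht hv' hφ'
  have hmain := h.abs_apply_ge hYφ hAv hφB hvB hcc
  obtain ⟨-, hη1⟩ := h.eta_bound
  have hA1 : IsLift (Z * A') (ρ (z * x')) := by rw [map_mul]; exact hZ.mul hA'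
  have hY1 : IsLift (Y' * Z') (ρ (z * y')⁻¹) := by
    rw [mul_inv_rev, map_mul, map_inv ρ z]; exact hY'.mul hZ'
  obtain ⟨s, hs, rfl⟩ := hA1.eq_smul hA
  obtain ⟨t, ht0, rfl⟩ := hY1.eq_smul hY
  have hcond : ‖Z‖ * ‖Z'‖ ≤ κ := by
    rw [← svRatio_one_eq hZ hZZ' hZ'Z]
    exact (hC z).trans (Real.exp_le_exp.2 (mul_le_mul_of_nonneg_left hz hC0))
  have hn1 : ‖A' v₀‖ ≤ B + 1 := by
    have := norm_le_norm_add_norm_sub' (A' v₀) v'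
    linarith
  have hn2 : ‖φ₀.comp Y'‖ ≤ B + 1 := by
    have := norm_le_norm_add_norm_sub' (φ₀.comp Y') φ'
    linarith
  have e1 : φ₀.comp (t • (Y' * Z')) = t • (φ₀.comp Y').comp Z' := by
    ext1 u; simp [mul_apply_eq_comp]
  have e2 : φ₀ ((t • (Y' * Z')) ((s • (Z * A')) v₀)) = t * s * (φ₀.comp Y') (A' v₀) := by
    have e3 : ∀ u, Z' (Z u) = u := fun u => by
      rw [← mul_apply_eq_comp, hZ'Z, one_apply_eq_self]
    simp only [smul_apply, mul_apply_eq_comp, map_smul, e3, smul_eq_mul,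
      ContinuousLinearMap.comp_apply]
    ring
  have e4 : (s • (Z * A')) v₀ = s • Z (A' v₀) := rfl
  rw [e2, e1, e4, norm_smul, norm_smul, abs_mul, abs_mul, Real.norm_eq_abs, Real.norm_eq_abs]
  have h5 : ‖(φ₀.comp Y').comp Z'‖ * ‖Z (A' v₀)‖ ≤ (B + 1) ^ 2 * κ := by
    calc _ ≤ ((B + 1) * ‖Z'‖) * (‖Z‖ * (B + 1)) := by
          refine mul_le_mul ?_ ?_ (norm_nonneg _) (by positivity)
          · exact (ContinuousLinearMap.opNorm_comp_le _ _).trans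
              (mul_le_mul_of_nonneg_right hn2 (norm_nonneg _))
          · exact (Z.le_opNorm _).trans (mul_le_mul_of_nonneg_left hn1 (norm_nonneg _))
      _ = (B + 1) ^ 2 * (‖Z‖ * ‖Z'‖) := by ring
      _ ≤ _ := mul_le_mul_of_nonneg_left hcond (by positivity)
  calc c / 2 / ((B + 1) ^ 2 * κ) * (|t| * ‖(φ₀.comp Y').comp Z'‖ * (|s| * ‖Z (A' v₀)‖))
      = c / 2 / ((B + 1) ^ 2 * κ) * (‖(φ₀.comp Y').comp Z'‖ * ‖Z (A' v₀)‖) * (|t| * |s|) := by ring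
    _ ≤ c / 2 / ((B + 1) ^ 2 * κ) * ((B + 1) ^ 2 * κ) * (|t| * |s|) := by gcongr
    _ = |t| * |s| * (c / 2) := by field_simp
    _ ≤ _ := mul_le_mul_of_nonneg_left hmain (by positivity)

theorem head_other_cusp {j : Fin l} {τ : CyclicProd (Fin k ⊕ Fin l)}
    (hτ : τ = 1 ∨ ∃ j', j' ≠ j ∧ ∃ t, τ = syl (Sum.inr j') t) (q : ℤ) :
    TransHeads τ (syl (Sum.inr j) q) := by
  intro a ha b hb
  left
  by_cases hq : q = 0
  · rw [hq, syl_zero, letters_one] at hb; simp at hb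
  rw [letters_syl hq] at hb
  rcases hτ with rfl | ⟨j', hj', t, rfl⟩
  · simp at ha
  · by_cases ht : t = 0
    · rw [ht, syl_zero, letters_one] at ha; simp at ha
    rw [letters_syl ht] at ha
    simp only [List.head?_cons, Option.mem_some_iff] at ha hb
    subst ha hb
    simpa using hj'

theorem mem_head?_letters_syl (i : Fin k ⊕ Fin l) {p : ℤ} (hp : p ≠ 0) :
    (i, p) ∈ (letters (syl i p)).head? := by
  rw [letters_syl hp]; exact Option.mem_some_self _

theorem cusp_φ_apply_ge (h : GoodRep ρ v φ v₀ φ₀ B c μ η) {j : Fin l}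
    {τ : CyclicProd (Fin k ⊕ Fin l)}
    (hτ : τ = 1 ∨ ∃ j', j' ≠ j ∧ ∃ t, τ = syl (Sum.inr j') t) {v' : Euc d}
    (hv' : (τ = 1 ∧ v' = v₀) ∨ ∃ a ∈ (letters τ).head?, v' = v a.1 (expSign a.2)) :
    c ≤ |φ (Sum.inr j) 1 v'| ∧ ‖φ (Sum.inr j) 1‖ ≤ B ∧ ‖v'‖ ≤ B :=
  h.transHeads_le (head_other_cusp hτ 1) hv'
    (Or.inr ⟨_, mem_head?_letters_syl (Sum.inr j) one_ne_zero, (h.cusp_φ j _).symm⟩)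

theorem apply_cusp_v_ge (h : GoodRep ρ v φ v₀ φ₀ B c μ η) {j : Fin l}
    {τ : CyclicProd (Fin k ⊕ Fin l)}
    (hτ : τ = 1 ∨ ∃ j', j' ≠ j ∧ ∃ t, τ = syl (Sum.inr j') t) {φ' : Euc d →L[ℝ] ℝ}
    (hφ' : (τ = 1 ∧ φ' = φ₀) ∨ ∃ a ∈ (letters τ).head?, φ' = φ a.1 (expSign (-a.2))) :
    c ≤ |φ' (v (Sum.inr j) 1)| ∧ ‖φ'‖ ≤ B ∧ ‖v (Sum.inr j) 1‖ ≤ B := by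
  refine h.transHeads_le (x := syl (Sum.inr j) 1) ?_
    (Or.inr ⟨_, mem_head?_letters_syl (Sum.inr j) one_ne_zero, (h.cusp_v j _).symm⟩) hφ'
  intro a ha b hb
  rcases head_other_cusp hτ 1 b hb a ha with h1 | ⟨i, -, h2, -⟩
  · exact Or.inl h1.symm
  · rw [letters_syl one_ne_zero] at ha
    simp only [List.head?_cons, Option.mem_some_iff] at ha
    rw [← ha] at h2
    simp at h2

set_option maxHeartbeats 400000 in
/-- Points and hyperplanes at infinity of a peripheral coset, as limits. -/
theorem exists_limit_lifts (h : GoodRep ρ v φ v₀ φ₀ B c μ η) (j : Fin l)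
    (E : CyclicProd (Fin k ⊕ Fin l)) {q : ℕ → ℤ} {τ : ℕ → CyclicProd (Fin k ⊕ Fin l)}
    (hq : Tendsto (fun n => logWeight (q n)) atTop atTop)
    (hτ : ∀ n, τ n = 1 ∨ ∃ j', j' ≠ j ∧ ∃ t, τ n = syl (Sum.inr j') t)
    {L L' : Euc d →L[ℝ] Euc d} (hL : IsLift L (ρ E)) (hL' : IsLift L' (ρ E⁻¹)) :
    (∃ A : ℕ → Euc d →L[ℝ] Euc d, (∀ n, IsLift (A n) (ρ (E * syl (Sum.inr j) (q n) * τ n))) ∧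
      Tendsto (fun n => A n v₀) atTop (𝓝 (L (v (Sum.inr j) 1)))) ∧
    (∃ Y : ℕ → Euc d →L[ℝ] Euc d, (∀ n, IsLift (Y n) (ρ (E * syl (Sum.inr j) (q n) * τ n)⁻¹)) ∧
      Tendsto (fun n => φ₀.comp (Y n)) atTop (𝓝 ((φ (Sum.inr j) 1).comp L'))) := by
  have hc := h.data.pos
  have hB := h.B_pos
  obtain ⟨-, hη1⟩ := h.eta_bound
  set vj := v (Sum.inr j) 1 with hvj
  set φj := φ (Sum.inr j) 1 with hφj
  set Q := φj.smulRight vj with hQ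
  have hq2 : Tendsto (fun n => logWeight (-q n)) atTop atTop := by
    simpa only [logWeight_neg] using hq
  obtain ⟨S, hS, hSt⟩ := h.exists_tendsto_lift j hq
  obtain ⟨S', hS', hSt'⟩ := h.exists_tendsto_lift j hq2
  rw [tendsto_iff_norm_sub_tendsto_zero] at hSt hSt'
  have hz : ∀ χ : ℝ, c / 2 ≤ |χ| → χ ≠ 0 ∧ |χ|⁻¹ ≤ 2 / c := by
    intro χ hχ
    have hne : χ ≠ 0 := by
      rintro rfl
      rw [abs_zero] at hχ
      linarith
    refine ⟨hne, ?_⟩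
    rw [inv_le_comm₀ (abs_pos.2 hne) (by positivity), inv_div]
    exact hχ
  have hη0 : 0 ≤ η * (1 + 2 * B / c) := by have := h.η_pos; positivity
  constructor
  -- The tails `τ n` need not converge. It is enough that their images of `v₀` stay bounded and
  -- uniformly off the hyperplane of cusp `j`, for the cusp powers then push them to its line.
  · choose W v' hW hWv hv' using fun n => h.exists_lift_apply (τ n)
    have hb : ∀ n, c / 2 ≤ |φj (W n v₀)| ∧ ‖W n v₀‖ ≤ B + 1 := by
      intro n
      obtain ⟨h1, h2, h3⟩ := h.cusp_φ_apply_ge (hτ n) (hv' n)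
      refine ⟨h.abs_apply_ge (by rw [sub_self, norm_zero]; exact hη0) (hWv n) h2 h3 h1, ?_⟩
      have := norm_le_norm_add_norm_sub' (W n v₀) (v' n)
      linarith [hWv n]
    refine ⟨fun n => (φj (W n v₀))⁻¹ • (L * S n * W n), fun n => ?_, ?_⟩
    · refine IsLift.smul ?_ (inv_ne_zero (hz _ (hb n).1).1)
      rw [map_mul, map_mul]
      exact (hL.mul (hS n)).mul (hW n)
    · have e : ∀ n, ((φj (W n v₀))⁻¹ • (L * S n * W n)) v₀ =
          L (vj + (φj (W n v₀))⁻¹ • (S n - Q) (W n v₀)) := by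
        intro n
        have hne := (hz _ (hb n).1).1
        simp only [smul_apply, mul_apply_eq_comp, map_add, map_smul, sub_apply, hQ,
          ContinuousLinearMap.smulRight_apply, smul_sub, map_sub]
        rw [smul_smul, inv_mul_cancel₀ hne, one_smul]
        abel
      simp only [e]
      have hlim : Tendsto (fun n => vj + (φj (W n v₀))⁻¹ • (S n - Q) (W n v₀)) atTop (𝓝 vj) := by
        have : Tendsto (fun n => (φj (W n v₀))⁻¹ • (S n - Q) (W n v₀)) atTop (𝓝 0) := by
          refine squeeze_zero_norm (a := fun n => 2 / c * (‖S n - Q‖ * (B + 1))) (fun n => ?_) ?_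
          · rw [norm_smul, norm_inv, Real.norm_eq_abs]
            refine mul_le_mul (hz _ (hb n).1).2 ?_ (norm_nonneg _) (by positivity)
            exact ((S n - Q).le_opNorm _).trans
              (mul_le_mul_of_nonneg_left (hb n).2 (norm_nonneg _))
          · simpa using (hSt.mul_const (B + 1)).const_mul (2 / c)
        simpa using tendsto_const_nhds.add this
      exact (L.continuous.tendsto _).comp hlim
  · choose W φ' hW hWφ hφ' using fun n => h.exists_lift_comp (τ n)
    have hb : ∀ n, c / 2 ≤ |φ₀ (W n vj)| ∧ ‖φ₀.comp (W n)‖ ≤ B + 1 := by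
      intro n
      obtain ⟨h1, h2, h3⟩ := h.apply_cusp_v_ge (hτ n) (hφ' n)
      have h4 := h.abs_apply_ge (y := vj) (hWφ n) (by rw [sub_self, norm_zero]; exact hη0) h2 h3 h1
      rw [ContinuousLinearMap.comp_apply] at h4
      refine ⟨h4, ?_⟩
      have := norm_le_norm_add_norm_sub' (φ₀.comp (W n)) (φ' n)
      linarith [hWφ n]
    refine ⟨fun n => (φ₀ (W n vj))⁻¹ • (W n * S' n * L'), fun n => ?_, ?_⟩
    · refine IsLift.smul ?_ (inv_ne_zero (hz _ (hb n).1).1)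
      rw [mul_inv_rev, mul_inv_rev, map_mul, map_mul, ← mul_assoc, ← syl_neg]
      exact ((hW n).mul (hS' n)).mul hL'
    · have e : ∀ n, φ₀.comp ((φ₀ (W n vj))⁻¹ • (W n * S' n * L')) =
          (φj + (φ₀ (W n vj))⁻¹ • (φ₀.comp (W n)).comp (S' n - Q)).comp L' := by
        intro n
        have hne := (hz _ (hb n).1).1
        ext1 u
        simp only [smul_apply, mul_apply_eq_comp, add_apply, map_smul, sub_apply, hQ,
          ContinuousLinearMap.smulRight_apply, map_sub, ContinuousLinearMap.comp_apply, smul_eq_mul]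
        field_simp
        ring
      simp only [e]
      have hlim : Tendsto (fun n => φj + (φ₀ (W n vj))⁻¹ • (φ₀.comp (W n)).comp (S' n - Q)) atTop
          (𝓝 φj) := by
        have : Tendsto (fun n => (φ₀ (W n vj))⁻¹ • (φ₀.comp (W n)).comp (S' n - Q)) atTop
            (𝓝 0) := by
          refine squeeze_zero_norm (a := fun n => 2 / c * ((B + 1) * ‖S' n - Q‖)) (fun n => ?_) ?_
          · rw [norm_smul, norm_inv, Real.norm_eq_abs]
            refine mul_le_mul (hz _ (hb n).1).2 ?_ (norm_nonneg _) (by positivity)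
            exact (ContinuousLinearMap.opNorm_comp_le _ _).trans
              (mul_le_mul_of_nonneg_right (hb n).2 (norm_nonneg _))
          · simpa using (hSt'.const_mul (B + 1)).const_mul (2 / c)
        simpa using tendsto_const_nhds.add this
      have hcont : Continuous fun χ : Euc d →L[ℝ] ℝ => χ.comp L' := by fun_prop
      exact (hcont.tendsto _).comp hlim

end GoodRep

/-! ### Transversality along quasigeodesics of the cusped space -/

section Transversality

variable {k l d : ℕ} {Γ : Type*} [Group Γ] {e : Γ ≃* CyclicProd (Fin k ⊕ Fin l)}
  {P : Fin l → Subgroup Γ} {G : Set Γ}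

/-- The ends of a vertex over a peripheral coset. -/
theorem cuspEnds_form (hP : IsStdPeripheral e P) (w : CuspedVertex Γ l) (b : Bool) (g : Γ)
    (j : Fin l) (hw : g⁻¹ * w.proj ∈ P j) : ∃ (q : ℤ) (τ : CyclicProd (Fin k ⊕ Fin l)),
      cuspEnds e w b = e g * syl (Sum.inr j) q * τ ∧
      (τ = 1 ∨ ∃ j', j' ≠ j ∧ ∃ t, τ = syl (Sum.inr j') t) ∧
      min (len (wt k l) (e w.proj)) (len (wt k l) (cuspEnds e w b)) ≤
        len (wt k l) (e g) + logWeight q := by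
  obtain ⟨q, hq⟩ := (hP j _).1 hw
  have hproj : e w.proj = e g * syl (Sum.inr j) q := by
    rw [← hq, ← map_mul, mul_inv_cancel_left]
  have hlen : ∀ p, len (wt k l) (e g * syl (Sum.inr j) p) ≤ len (wt k l) (e g) + logWeight p := by
    intro p
    have := len_mul_le (isWeight_wt k l) (e g) (syl (Sum.inr j) p)
    rwa [len_syl (isWeight_wt k l)] at this
  cases w with
  | base x =>
    refine ⟨q, 1, by rw [mul_one]; exact hproj, Or.inl rfl, (min_le_left _ _).trans ?_⟩
    rw [hproj]
    exact hlen q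
  | horo j' x n =>
    by_cases hj : j' = j
    · subst hj
      have hE : cuspEnds e (.horo j' x n) b =
          e g * syl (Sum.inr j') (q + endSign b * 2 ^ n) := by
        rw [syl_add, ← mul_assoc, ← hproj]
        rfl
      refine ⟨q + endSign b * 2 ^ n, 1, by rw [mul_one]; exact hE, Or.inl rfl,
        (min_le_right _ _).trans ?_⟩
      rw [hE]
      exact hlen _
    -- A vertex over the coset may lie in a horoball of another type, based on another coset through
    -- the same element. Its ends then leave the coset by one syllable, recorded as `τ`.
    · refine ⟨q, syl (Sum.inr j') (endSign b * 2 ^ n), ?_, Or.inr ⟨j', hj, _, rfl⟩,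
        (min_le_left _ _).trans ?_⟩
      · rw [← hproj]; rfl
      · rw [hproj]; exact hlen q

/-- The ends of a quasigeodesic of the cusped space have bounded Gromov product, and escape. -/
theorem exists_ends_of_lift (hP : IsStdPeripheral e P) (hG : IsCompatible P G) {u U : ℝ}
    (hu : 0 < u) (hU : 0 < U) : ∃ R W : ℝ, 0 < W ∧ ∀ (γ : ℤ → Γ) (c : ℤ → CuspedVertex Γ l),
      IsQuasigeodesicLift P G u U γ c → ∀ n : ℕ, ∃ b b' : Bool,
        len (wt k l) (cuspEnds e (c (-n)) b) + len (wt k l) (cuspEnds e (c n) b') -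
          wdist (wt k l) (cuspEnds e (c (-n)) b) (cuspEnds e (c n) b') ≤ R ∧
        (n : ℝ) ≤ W * (len (wt k l) (cuspEnds e (c (-n)) b) + W) ∧
        (n : ℝ) ≤ W * (len (wt k l) (cuspEnds e (c n) b') + W) := by
  have hw := isWeight_wt k l
  have hk := isHypKernel_cuspKernel e (l := l)
  obtain ⟨U₂, hU₂0, hU₂⟩ := cuspKernel_le (e := e) hP hG
  obtain ⟨u₁, hu₁0, hu₁⟩ := cuspedDist_le (e := e) hP hG
  set w := (1 + u) * (1 + u₁) with hwdef
  have hw0 : 0 < w := by positivity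
  set U' := U₂ * (U * 1 + U) + U₂ + 4 with hU'
  have hU'4 : 4 ≤ U' := by rw [hU']; have : 0 < U₂ * (U * 1 + U) + U₂ := by positivity
                           linarith
  obtain ⟨R, hR0, hR⟩ := hk.morse hw0 hU'4
  refine ⟨R, w + R, by positivity, fun γ c hc n => ?_⟩
  set m := cuspKernel e (l := l) with hm
  have hlow : ∀ p q : ℤ, p ≤ q → (q : ℝ) - p ≤ w * (m (c p) (c q) + w) := by
    intro p q hpq
    have h1 := hc.lower q p
    have h2 := hu₁ (c p) (c q)
    have h3 : (0 : ℝ) ≤ (q : ℝ) - p := by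
      have : (p : ℝ) ≤ q := by exact_mod_cast hpq
      linarith
    rw [abs_of_nonneg h3] at h1
    have h4 : (q : ℝ) - p ≤ u * (u₁ * (m (c p) (c q) + u₁) + u) := by
      have h5 : u⁻¹ * ((q : ℝ) - p) ≤ u₁ * (m (c p) (c q) + u₁) + u := by
        have := h1.trans h2
        linarith
      rwa [inv_mul_le_iff₀ hu] at h5
    have h6 : 0 ≤ m (c p) (c q) := hk.nonneg _ _
    have h7 : u * u₁ ≤ w := by rw [hwdef]; nlinarith
    have h8 : u * u₁ ^ 2 + u ^ 2 ≤ w ^ 2 := by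
      have e1 : w ^ 2 - (u * u₁ ^ 2 + u ^ 2) = 1 + 2 * u + 2 * u₁ + 4 * u * u₁ + 2 * u ^ 2 * u₁ +
          u₁ ^ 2 + u * u₁ ^ 2 + u ^ 2 * u₁ ^ 2 := by rw [hwdef]; ring
      have e2 : 0 ≤ 1 + 2 * u + 2 * u₁ + 4 * u * u₁ + 2 * u ^ 2 * u₁ +
          u₁ ^ 2 + u * u₁ ^ 2 + u ^ 2 * u₁ ^ 2 := by positivity
      linarith
    have h9 := mul_le_mul_of_nonneg_right h7 h6
    nlinarith
  -- The segment from time `-n` to time `n` is indexed by `0, …, 2 * n`, so the identity is at index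
  -- `n`.
  have hqg : IsQuasiGeod m w U' (fun t : ℕ => c ((t : ℤ) - n)) (2 * n) := by
    constructor
    · intro p q hpq _
      have := hlow ((p : ℤ) - n) ((q : ℤ) - n) (by omega)
      push_cast at this
      linarith
    · intro t _
      have h1 := hU₂ (c ((t : ℤ) - n)) (c (((t + 1 : ℕ) : ℤ) - n))
      have h2 := hc.upper (((t + 1 : ℕ) : ℤ) - n) ((t : ℤ) - n)
      have h3 : |((((t + 1 : ℕ) : ℤ) - n : ℤ) : ℝ) - (((t : ℤ) - n : ℤ) : ℝ)| = 1 := by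
        push_cast
        rw [show (t : ℝ) + 1 - n - (t - n) = 1 by ring, abs_one]
      rw [h3] at h2
      have h4 := mul_le_mul_of_nonneg_left h2 hU₂0.le
      rw [hU']
      linarith
  have hmorse := hR _ _ hqg n (by omega)
  simp only [Nat.cast_zero, zero_sub, sub_self] at hmorse
  rw [show ((2 * n : ℕ) : ℤ) - n = n by push_cast; ring] at hmorse
  -- The ends attaining the kernel. The vertex at time 0 is the identity, of height 0, so when the
  -- stability inequality is written out the other two heights cancel and a bound on the Gromov
  -- product of these ends remains.
  obtain ⟨b, b', hb⟩ := exists_endsKernel (wdist (wt k l)) (cuspEnds e) height 4 (c (-n)) (c n)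
  have hb' : m (c (-n)) (c n) = wdist (wt k l) (cuspEnds e (c (-n)) b) (cuspEnds e (c n) b') -
      height (c (-n)) - height (c n) + 4 / 2 := hb
  have hht : ∀ x : CuspedVertex Γ l, 0 ≤ height x := by
    intro x
    cases x with
    | base g => exact le_rfl
    | horo j g n => simp only [height]; positivity
  have hone : wdist (wt k l) (cuspEnds e (c (-n)) b) 1 = len (wt k l) (cuspEnds e (c (-n)) b) := by
    unfold wdist; rw [mul_one, len_inv hw]
  have hone' : wdist (wt k l) 1 (cuspEnds e (c n) b') = len (wt k l) (cuspEnds e (c n) b') := by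
    unfold wdist; rw [inv_one, one_mul]
  have hc0 : cuspEnds e (c 0) true = 1 := by rw [hc.zero_eq]; exact map_one e
  have hh0 : height (c 0) = 0 := by rw [hc.zero_eq]; rfl
  have h1 : wdist (wt k l) (cuspEnds e (c (-n)) b) (cuspEnds e (c 0) true) - height (c (-n)) -
      height (c 0) + 4 / 2 ≤ m (c (-n)) (c 0) :=
    le_endsKernel (wdist (wt k l)) (cuspEnds e) height 4 _ _ _ _
  have h2 : wdist (wt k l) (cuspEnds e (c 0) true) (cuspEnds e (c n) b') - height (c 0) -
      height (c n) + 4 / 2 ≤ m (c 0) (c n) :=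
    le_endsKernel (wdist (wt k l)) (cuspEnds e) height 4 _ _ _ _
  rw [hc0, hone, hh0] at h1
  rw [hc0, hone', hh0] at h2
  have htri := wdist_triangle hw (cuspEnds e (c (-n)) b) 1 (cuspEnds e (c n) b')
  rw [hone, hone'] at htri
  have h3 := hlow (-n) 0 (by omega)
  have h4 := hlow 0 n (by omega)
  push_cast at h3 h4
  have ha := hht (c (-n))
  have ha' := hht (c n)
  have hl1 := len_nonneg hw (cuspEnds e (c (-n)) b)
  have hl2 := len_nonneg hw (cuspEnds e (c n) b')
  refine ⟨b, b', by linarith, ?_, ?_⟩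
  · have h5 : m (c (-n)) (c 0) ≤ len (wt k l) (cuspEnds e (c (-n)) b) + R := by linarith
    have h6 : w * (m (c (-n)) (c 0) + w) ≤ w * (len (wt k l) (cuspEnds e (c (-n)) b) + R + w) :=
      mul_le_mul_of_nonneg_left (by linarith) hw0.le
    nlinarith
  · have h5 : m (c 0) (c n) ≤ len (wt k l) (cuspEnds e (c n) b') + R := by linarith
    have h6 : w * (m (c 0) (c n) + w) ≤ w * (len (wt k l) (cuspEnds e (c n) b') + R + w) :=
      mul_le_mul_of_nonneg_left (by linarith) hw0.le
    nlinarith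

variable {ρ : CyclicProd (Fin k ⊕ Fin l) →* PGLR d}
  {v : Fin k ⊕ Fin l → ℤˣ → Euc d} {φ : Fin k ⊕ Fin l → ℤˣ → Euc d →L[ℝ] ℝ}
  {v₀ : Euc d} {φ₀ : Euc d →L[ℝ] ℝ} {B c μ η : ℝ} {r : Γ →* PGLR d}

theorem tendsto_atTop_of_min_le {a b f : ℕ → ℝ} {C W : ℝ} (hW : 0 < W)
    (ha : ∀ n : ℕ, (n : ℝ) ≤ W * (a n + W)) (hb : ∀ n : ℕ, (n : ℝ) ≤ W * (b n + W))
    {N : ℕ} (h : ∀ n, min (a (n + N)) (b (n + N)) ≤ C + f n) : Tendsto f atTop atTop := by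
  have hlow : ∀ n : ℕ, (n : ℝ) / W + (-W - C) ≤ f n := by
    intro n
    have e1 : ((n : ℕ) : ℝ) ≤ ((n + N : ℕ) : ℝ) := by push_cast; linarith [(Nat.cast_nonneg N : (0:ℝ) ≤ N)]
    have h1 : (n : ℝ) / W - W ≤ a (n + N) := by
      rw [sub_le_iff_le_add, div_le_iff₀ hW, mul_comm]
      exact e1.trans (ha _)
    have h2 : (n : ℝ) / W - W ≤ b (n + N) := by
      rw [sub_le_iff_le_add, div_le_iff₀ hW, mul_comm]
      exact e1.trans (hb _)
    have := (le_min h1 h2).trans (h n)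
    linarith
  refine tendsto_atTop_mono hlow (tendsto_atTop_add_const_right _ _ ?_)
  exact tendsto_natCast_atTop_atTop.atTop_div_const hW

theorem tendsto_clm_apply {F : ℕ → Euc d →L[ℝ] ℝ} {x : ℕ → Euc d} {F₀ : Euc d →L[ℝ] ℝ} {x₀ : Euc d}
    (hF : Tendsto F atTop (𝓝 F₀)) (hx : Tendsto x atTop (𝓝 x₀)) :
    Tendsto (fun n => F n (x n)) atTop (𝓝 (F₀ x₀)) := by
  have hc : Continuous fun p : (Euc d →L[ℝ] ℝ) × Euc d => p.1 p.2 :=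
    isBoundedBilinearMap_apply.continuous
  exact (hc.tendsto (F₀, x₀)).comp (hF.prodMk_nhds hx)

-- The limit line and the limit hyperplane are limits of images of `v₀` and pull-backs of `φ₀` by
-- the words at the ends of the quasigeodesic. Those words have bounded Gromov product, so
-- `exists_transverse` applies uniformly and passes to the limit. The pairing of a vector with a
-- functional is then read as a distance to its kernel.
set_option maxHeartbeats 800000 in
theorem uniformTransversality_of_goodRep (h : GoodRep ρ v φ v₀ φ₀ B c μ η)
    (hr : ∀ g, r g = ρ (e g)) (hP : IsStdPeripheral e P) (hG : IsCompatible P G) :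
    UniformTransversality P G r (limitLine P v r) (limitHyperplane P φ r) := by
  intro u hu U hU
  obtain ⟨R, W, hW, hends⟩ := exists_ends_of_lift (e := e) hP hG hu hU
  obtain ⟨δ, hδ, htrans⟩ := h.exists_transverse R
  obtain ⟨u₁, hu₁0, hu₁⟩ := cuspedLength_le (e := e) hP hG
  -- Halved because the limit inequality is only weak, whereas a strict one is required.
  refine ⟨δ / 2, by positivity, ?_⟩
  rintro i j g g' ⟨γ, cc, hγ, hcc, hγ0, a, b, -, -, hga, hgb⟩ x hx hx0
  choose s s' hgrom hs hs' using hends γ cc hcc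
  set W' := W + u * u₁ + u * u + u with hW'
  have hW'0 : 0 < W' := by positivity
  have hWW' : ∀ (n : ℕ) (t : ℝ), 0 ≤ t → (n : ℝ) ≤ W * (t + W) → (n : ℝ) ≤ W' * (t + W') := by
    intro n t ht hn
    have h1 : W ≤ W' := by
      have : 0 < u * u₁ + u * u + u := by positivity
      linarith
    exact hn.trans (mul_le_mul h1 (by linarith) (by positivity) hW'0.le)
  have hnn := fun y => len_nonneg (isWeight_wt k l) (y : CyclicProd (Fin k ⊕ Fin l))
  have hγlen : ∀ n : ℤ, |(n : ℝ)| ≤ W' * (len (wt k l) (e (γ n)) + W') := by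
    intro n
    have h1 := hγ.lower n 0
    rw [hγ0, inv_one, one_mul, Int.cast_zero, sub_zero] at h1
    have h2 := h1.trans (hu₁ (γ n))
    have h3 : |(n : ℝ)| ≤ u * (u₁ * len (wt k l) (e (γ n)) + u) := by
      rw [← inv_mul_le_iff₀ hu]; linarith
    refine h3.trans ?_
    have h4 : u * u₁ ≤ W' := by
      have : 0 < W + u * u + u := by positivity
      linarith
    have h5 : u * u ≤ W' * W' := by
      have : u ≤ W' := by
        have : 0 < W + u * u₁ + u * u := by positivity
        linarith
      exact mul_le_mul this this hu.le hW'0.le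
    have h6 := mul_le_mul_of_nonneg_right h4 (hnn (e (γ n)))
    linarith
  -- the forward end
  choose q τ hq hτ hmin using fun n : ℕ => cuspEnds_form hP (cc ((n + b : ℕ) : ℤ)) (s' (n + b)) g' j
    (by rw [hcc.proj_eq]; exact hgb _ (by omega))
  have hqt : Tendsto (fun n => logWeight (q n)) atTop atTop := by
    refine tendsto_atTop_of_min_le (C := len (wt k l) (e g')) (N := b)
      (a := fun n => len (wt k l) (e (cc ((n : ℕ) : ℤ)).proj))
      (b := fun n => len (wt k l) (cuspEnds e (cc ((n : ℕ) : ℤ)) (s' n))) hW'0 ?_ ?_ hmin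
    · intro n
      rw [hcc.proj_eq]
      have := hγlen n
      rwa [Int.cast_natCast, Nat.abs_cast] at this
    · exact fun n => hWW' n _ (hnn _) (hs' n)
  -- the backward end
  choose q' τ' hq' hτ' hmin' using fun n : ℕ => cuspEnds_form hP (cc (-((n + a : ℕ) : ℤ)))
    (s (n + a)) g⁻¹ i (by rw [inv_inv, hcc.proj_eq]; exact hga _ (by omega))
  have hqt' : Tendsto (fun n => logWeight (q' n)) atTop atTop := by
    refine tendsto_atTop_of_min_le (C := len (wt k l) (e g⁻¹)) (N := a)
      (a := fun n => len (wt k l) (e (cc (-((n : ℕ) : ℤ))).proj))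
      (b := fun n => len (wt k l) (cuspEnds e (cc (-((n : ℕ) : ℤ))) (s n))) hW'0 ?_ ?_ hmin'
    · intro n
      rw [hcc.proj_eq]
      have := hγlen (-n)
      rwa [Int.cast_neg, Int.cast_natCast, abs_neg, Nat.abs_cast] at this
    · exact fun n => hWW' n _ (hnn _) (hs n)
  obtain ⟨L, hL, eL⟩ := exists_repLin_eq (r g⁻¹)
  obtain ⟨M, hM, eM⟩ := exists_repLin_eq (r g')
  obtain ⟨M', hM', hMM', hM'M⟩ := hM.exists_inv
  rw [hr] at hL
  rw [hr, ← map_inv] at hM'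
  rw [hr] at hM
  obtain ⟨_, L', -, hL', -, -⟩ := exists_isLift (ρ (e g⁻¹))
  rw [← map_inv] at hL'
  obtain ⟨⟨A, hA, hAt⟩, -⟩ := h.exists_limit_lifts i (e g⁻¹) hqt' hτ' hL hL'
  obtain ⟨-, ⟨Y, hY, hYt⟩⟩ := h.exists_limit_lifts j (e g') hqt hτ hM hM'
  set ψ := (φ (Sum.inr j) 1).comp M' with hψ
  set y := L (v (Sum.inr i) 1) with hy
  have hineq : δ * (‖ψ‖ * ‖y‖) ≤ |ψ y| := by
    -- The backward words start at time `a` and the forward ones at time `b`. The crossed shifts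
    -- bring both to the common time `n + a + b`, where the Gromov product is controlled.
    have hAs : Tendsto (fun n => A (n + b) v₀) atTop (𝓝 y) := hAt.comp (tendsto_add_atTop_nat b)
    have hYs : Tendsto (fun n => φ₀.comp (Y (n + a))) atTop (𝓝 ψ) :=
      hYt.comp (tendsto_add_atTop_nat a)
    have hev : Tendsto (fun n => (φ₀.comp (Y (n + a))) (A (n + b) v₀)) atTop (𝓝 (ψ y)) :=
      tendsto_clm_apply hYs hAs
    refine le_of_tendsto_of_tendsto ((hYs.norm.mul hAs.norm).const_mul δ) hev.abs
      (Eventually.of_forall fun n => ?_)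
    have h1 := hgrom (n + a + b)
    have e1 : cuspEnds e (cc (-((n + a + b : ℕ) : ℤ))) (s (n + a + b)) =
        e g⁻¹ * syl (Sum.inr i) (q' (n + b)) * τ' (n + b) := by
      have := hq' (n + b)
      rw [show n + b + a = n + a + b by omega] at this
      exact this
    have e2 : cuspEnds e (cc ((n + a + b : ℕ) : ℤ)) (s' (n + a + b)) =
        e g' * syl (Sum.inr j) (q (n + a)) * τ (n + a) := hq (n + a)
    rw [e1, e2] at h1
    exact htrans _ _ h1 _ _ (hA (n + b)) (hY (n + a))
  have hlim := limit_eq (v := v) (φ := φ) h hr hP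
  rw [(hlim i).1, eL, Submodule.map_span, Set.image_singleton] at hx
  obtain ⟨t, rfl⟩ := Submodule.mem_span_singleton.1 hx
  have hψ0 : ψ ≠ 0 := by
    intro h0
    refine h.φ_ne_zero (Sum.inr j) 1 (ContinuousLinearMap.ext fun z => ?_)
    have h1 := congrArg (fun F : Euc d →L[ℝ] ℝ => F (M z)) h0
    simp only [hψ, ContinuousLinearMap.comp_apply] at h1
    rw [← mul_apply_eq_comp, hM'M, one_apply_eq_self] at h1
    simpa using h1
  have hψn := norm_pos_iff.2 hψ0
  have hxn := norm_pos_iff.2 hx0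
  rw [(hlim j).2, eM, lt_div_iff₀ hxn]
  have hge : δ * ‖t • y‖ ≤ Metric.infDist (t • y)
      (((LinearMap.ker (φ (Sum.inr j) 1 : Euc d →ₗ[ℝ] ℝ)).map (M : Euc d →ₗ[ℝ] Euc d) :
        Submodule ℝ (Euc d)) : Set (Euc d)) := by
    rw [Metric.le_infDist ⟨0, Submodule.zero_mem _⟩]
    rintro z ⟨z', hz', rfl⟩
    have hz0 : ψ (M z') = 0 := by
      rw [hψ, ContinuousLinearMap.comp_apply, ← mul_apply_eq_comp, hM'M, one_apply_eq_self]
      exact hz'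
    have h1 : |ψ (t • y)| ≤ ‖ψ‖ * dist (t • y) (M z') := by
      have h2 := ψ.le_opNorm (t • y - M z')
      rwa [map_sub, hz0, sub_zero, ← dist_eq_norm, Real.norm_eq_abs] at h2
    have h3 : δ * (‖ψ‖ * ‖t • y‖) ≤ |ψ (t • y)| := by
      rw [map_smul, smul_eq_mul, abs_mul, norm_smul, Real.norm_eq_abs]
      have := mul_le_mul_of_nonneg_left hineq (abs_nonneg t)
      linarith
    have h4 : ‖ψ‖ * (δ * ‖t • y‖) ≤ ‖ψ‖ * dist (t • y) (M z') := by linarith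
    exact le_of_mul_le_mul_left h4 hψn
  refine lt_of_lt_of_le ?_ hge
  have hxn' : 0 < ‖t • y‖ := hxn
  have : δ / 2 * ‖t • y‖ < δ * ‖t • y‖ := by nlinarith
  exact this

end Transversality

/-! ### Constants for transverse data -/

section Generic

theorem exists_forall_le {α : Type*} [Finite α] (f : α → ℝ) : ∃ B, 1 ≤ B ∧ ∀ a, f a ≤ B := by
  obtain ⟨B, hB⟩ := (Set.finite_range f).bddAbove
  exact ⟨max 1 B, le_max_left _ _, fun a => (hB ⟨a, rfl⟩).trans (le_max_right _ _)⟩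

theorem exists_pos_forall_le {α : Type*} [Finite α] (f : α → ℝ) (hf : ∀ a, 0 < f a) :
    ∃ c, 0 < c ∧ c ≤ 1 ∧ ∀ a, c ≤ f a := by
  obtain ⟨B, hB, h⟩ := exists_forall_le fun a => (f a)⁻¹
  have hB0 : 0 < B := by linarith
  exact ⟨B⁻¹, by positivity, inv_le_one_of_one_le₀ hB, fun a => inv_le_of_inv_le₀ (hf a) (h a)⟩

/-- Finitely many vectors and functionals have a transverse functional and a transverse vector,
with uniform constants. -/
theorem exists_generic {d : ℕ} {κ : Type*} [Finite κ] [Nonempty κ] (v : κ → Euc d)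
    (φ : κ → Euc d →L[ℝ] ℝ) (hv : ∀ a, v a ≠ 0) (hφ : ∀ a, φ a ≠ 0) :
    ∃ (v₀ : Euc d) (φ₀ : Euc d →L[ℝ] ℝ) (B c : ℝ), 1 ≤ B ∧ 0 < c ∧ c ≤ 1 ∧ (∀ a, ‖v a‖ ≤ B) ∧
      (∀ a, ‖φ a‖ ≤ B) ∧ ‖v₀‖ ≤ B ∧ ‖φ₀‖ ≤ B ∧ (∀ a, c ≤ |φ a v₀|) ∧ (∀ a, c ≤ |φ₀ (v a)|) ∧
      c ≤ |φ₀ v₀| ∧ ∀ a b, φ a (v b) ≠ 0 → c ≤ |φ a (v b)| := by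
  obtain ⟨v₀, hv₀⟩ := Module.Dual.exists_forall_ne_zero_of_forall_exists
    (fun a => (φ a : Euc d →ₗ[ℝ] ℝ)) fun a => by
      by_contra! hcon
      exact hφ a (ContinuousLinearMap.ext hcon)
  have hv₀0 : v₀ ≠ 0 := by
    rintro rfl
    exact hv₀ (Classical.arbitrary κ) (map_zero _)
  obtain ⟨f, hf⟩ := Module.exists_dual_forall_apply_ne_zero (K := ℝ)
    (fun a : Option κ => a.elim v₀ v) (by rintro (_ | a); exacts [hv₀0, hv a])
  set φ₀ : Euc d →L[ℝ] ℝ := LinearMap.toContinuousLinearMap f with hφ₀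
  have hφ₀v : ∀ x, φ₀ x = f x := fun x => rfl
  obtain ⟨B₁, hB₁, h1⟩ := exists_forall_le fun a => ‖v a‖
  obtain ⟨B₂, hB₂, h2⟩ := exists_forall_le fun a => ‖φ a‖
  obtain ⟨c₁, hc₁, -, h3⟩ := exists_pos_forall_le (fun a => |φ a v₀|) fun a => abs_pos.2 (hv₀ a)
  obtain ⟨c₂, hc₂, -, h4⟩ := exists_pos_forall_le (fun a : Option κ => |φ₀ (a.elim v₀ v)|)
    fun a => abs_pos.2 (hf a)
  obtain ⟨c₃, hc₃, hc₃1, h5⟩ := exists_pos_forall_le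
    (fun a : {a : κ × κ // φ a.1 (v a.2) ≠ 0} => |φ a.1.1 (v a.1.2)|) fun a => abs_pos.2 a.2
  refine ⟨v₀, φ₀, B₁ + B₂ + ‖v₀‖ + ‖φ₀‖, min c₁ (min c₂ c₃), ?_, by positivity,
    (min_le_right _ _).trans ((min_le_right _ _).trans hc₃1), fun a => (h1 a).trans ?_,
    fun a => (h2 a).trans ?_, ?_, ?_, fun a => (min_le_left _ _).trans (h3 a),
    fun a => ((min_le_right _ _).trans (min_le_left _ _)).trans (h4 (some a)),
    ((min_le_right _ _).trans (min_le_left _ _)).trans (h4 none), fun a b hab =>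
    ((min_le_right _ _).trans (min_le_right _ _)).trans (h5 ⟨(a, b), hab⟩)⟩
  all_goals linarith [norm_nonneg v₀, norm_nonneg φ₀]

end Generic

/-! ### The representation of a free product given by its generators -/

section GenRep

variable {ι G : Type*} [Group G]

/-- The homomorphism from a free product of cyclic groups with given values on the generators. -/
def genRep (g : ι → G) : CyclicProd ι →* G := Monoid.CoprodI.lift fun i => zpowersHom G (g i)

theorem genRep_syl (g : ι → G) (i : ι) (p : ℤ) : genRep g (syl i p) = g i ^ p := by
  unfold genRep syl
  rw [Monoid.CoprodI.lift_of, zpowersHom_apply, toAdd_ofAdd]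

end GenRep

/-! ### Growth of condition numbers -/

section Growth

variable {d : ℕ}

theorem IsLift.pow {A : Euc d →L[ℝ] Euc d} {g : PGLR d} (hA : IsLift A g) (n : ℕ) :
    IsLift (A ^ n) (g ^ n) := by
  induction n with
  | zero => rw [pow_zero, pow_zero]; exact isLift_one
  | succ n ih => rw [pow_succ, pow_succ]; exact ih.mul hA

theorem exists_svRatio_zpow_le [NeZero d] (g : PGLR d) :
    ∃ C : ℝ, ∀ p : ℤ, p ≠ 0 → svRatio 1 d (g ^ p) ≤ Real.exp (C * |(p : ℝ)|) := by
  obtain ⟨A, B, hA, hB, h, h'⟩ := exists_isLift g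
  have hc : Commute A B := h.trans h'.symm
  have hn : ∀ n : ℕ, n ≠ 0 → ‖A ^ n‖ * ‖B ^ n‖ ≤ (‖A‖ * ‖B‖) ^ n := by
    intro n hn
    rw [mul_pow]
    exact mul_le_mul (norm_pow_le' A (Nat.pos_of_ne_zero hn)) (norm_pow_le' B (Nat.pos_of_ne_zero hn))
      (norm_nonneg _) (by positivity)
  refine ⟨‖A‖ * ‖B‖, fun p hp => ?_⟩
  have hpow : ∀ n : ℕ, A ^ n * B ^ n = 1 ∧ B ^ n * A ^ n = 1 := fun n =>
    ⟨by rw [← hc.mul_pow, h, one_pow], by rw [← hc.symm.mul_pow, h', one_pow]⟩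
  have hexp : ∀ n : ℕ, (‖A‖ * ‖B‖) ^ n ≤ Real.exp (‖A‖ * ‖B‖ * n) := by
    intro n
    rw [mul_comm (‖A‖ * ‖B‖) (n : ℝ), Real.exp_nat_mul]
    exact pow_le_pow_left₀ (by positivity) (by linarith [Real.add_one_le_exp (‖A‖ * ‖B‖)]) n
  have habs : |(p : ℝ)| = (p.natAbs : ℝ) := by rw [Nat.cast_natAbs, Int.cast_abs]
  have hn0 : p.natAbs ≠ 0 := Int.natAbs_ne_zero.2 hp
  rw [habs]
  refine le_trans ?_ ((hn _ hn0).trans (hexp _))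
  rcases Int.natAbs_eq p with e | e
  · have hA' : IsLift (A ^ p.natAbs) (g ^ p) := by
      have := hA.pow p.natAbs
      rwa [← zpow_natCast, ← e] at this
    rw [svRatio_one_eq hA' (hpow _).1 (hpow _).2]
  · have hB' : IsLift (B ^ p.natAbs) (g ^ p) := by
      have := hB.pow p.natAbs
      rwa [← zpow_natCast, inv_zpow, ← zpow_neg, ← e] at this
    rw [svRatio_one_eq hB' (hpow _).2 (hpow _).1, mul_comm]

theorem one_add_abs_eq_exp (p : ℤ) :
    1 + |(p : ℝ)| = Real.exp (Real.log 2 / 2 * logWeight p) := by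
  have h0 : (0 : ℝ) < 1 + |(p : ℝ)| := by positivity
  have h2 : Real.log 2 ≠ 0 := (Real.log_pos one_lt_two).ne'
  unfold logWeight Real.logb
  rw [show Real.log 2 / 2 * (2 * (Real.log (1 + |(p : ℝ)|) / Real.log 2)) =
    Real.log (1 + |(p : ℝ)|) by field_simp, Real.exp_log h0]

/-- Polynomial growth is exponential in the logarithmic weight. -/
theorem mul_abs_pow_le_exp_logWeight {C : ℝ} (hC : 0 ≤ C) (t : ℕ) {p : ℤ} (hp : p ≠ 0) :
    C * |(p : ℝ)| ^ t ≤ Real.exp ((C + t * (Real.log 2 / 2)) * logWeight p) := by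
  have h1 : C ≤ Real.exp (C * logWeight p) := by
    have h2 := two_le_logWeight hp
    have h3 := Real.add_one_le_exp (C * logWeight p)
    nlinarith
  have h2 : |(p : ℝ)| ^ t ≤ Real.exp (t * (Real.log 2 / 2 * logWeight p)) := by
    rw [Real.exp_nat_mul, ← one_add_abs_eq_exp]
    exact pow_le_pow_left₀ (abs_nonneg _) (by linarith) t
  rw [add_mul, Real.exp_add, mul_assoc]
  exact mul_le_mul h1 h2 (by positivity) (Real.exp_pos _).le

end Growth

/-! ### Ping-pong gives a representation close to rank one -/

section PingPong

variable {d k l : ℕ}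

theorem apply_ne_zero_of_notMem {x : Proj d} {H : Submodule ℝ (Fin d → ℝ)} {v : Euc d}
    {φ : Euc d →L[ℝ] ℝ} (hx : x.submodule = ℝ ∙ WithLp.ofLp v)
    (hφ : ∀ u : Euc d, φ u = 0 ↔ WithLp.ofLp u ∈ H) (h : x ∉ projSet H) : φ v ≠ 0 := by
  intro h0
  refine h ?_
  change x.submodule ≤ H
  rw [hx, Submodule.span_singleton_le_iff_mem]
  exact (hφ v).1 h0

/-- Attracting points lie in attracting sets or their closures, hyperplanes in repelling sets or
their closures, and these are disjoint. Closures are needed as soon as a cusp is involved. -/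
theorem WeakPingPong.notMem_projSet {T : Fin k → PGLR d} {S : Fin l → PGLR d}
    {a : Fin k → ℤˣ → Proj d} {H : Fin k → ℤˣ → Submodule ℝ (Fin d → ℝ)}
    {s : Fin l → Proj d} {K : Fin l → Submodule ℝ (Fin d → ℝ)}
    {A B : Fin k → ℤˣ → Set (Proj d)} {C D : Fin l → ℤˣ → Set (Proj d)}
    (h : WeakPingPong T S a H s K A B C D) :
    (∀ i ε i' ε', (i, ε) ≠ (i', -ε') → a i' ε' ∉ projSet (H i ε)) ∧
    (∀ i ε j, a i ε ∉ projSet (K j)) ∧ (∀ i ε j, s j ∉ projSet (H i ε)) ∧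
    ∀ j j', j ≠ j' → s j ∉ projSet (K j') :=
  ⟨fun i ε i' ε' hne hmem => Set.disjoint_left.1 (h.disjoint_A_B i' ε' i ε hne) (h.mem_A i' ε')
      (h.subset_B i ε hmem),
    fun i ε j hmem => Set.disjoint_left.1 (h.disjoint_closure_A_D i ε j 1)
      (subset_closure (h.mem_A i ε)) (h.subset_closure_D j 1 hmem),
    fun i ε j hmem => Set.disjoint_left.1 (h.disjoint_closure_B_C i ε j 1)
      (subset_closure (h.subset_B i ε hmem)) (h.mem_closure_C j 1),
    fun j j' hne hmem => Set.disjoint_left.1 (h.disjoint_closure_C_D j 1 j' 1 hne)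
      (h.mem_closure_C j 1) (h.subset_closure_D j' 1 hmem)⟩

/-- Because `n * q ≥ (n - 1) + q`, the decay splits: the part with `n - 1` pays for the constants
`C₀` and `K`, the part with `q` gives the exponential in the weight. -/
theorem mul_pow_le_exp_div {C C₀ θ K r μ : ℝ} {n q : ℕ} (hC : 0 < C) (hCC : C ≤ C₀) (hθ : 0 < θ)
    (hr : 0 < r) (hθr : r ≤ -Real.log θ) (hK : 1 ≤ K) (hμ : μ ≤ r) (hn : C₀ * K / r + 1 ≤ n)
    (hq : 1 ≤ q) : C * θ ^ (n * q) ≤ Real.exp (-(μ * q)) / K := by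
  have hK0 : 0 < K := by linarith
  have hq' : (1 : ℝ) ≤ q := by exact_mod_cast hq
  have hC₀ : 0 < C₀ := hC.trans_le hCC
  have hn1 : 0 ≤ (n : ℝ) - 1 := by
    have : 0 < C₀ * K / r := by positivity
    linarith
  have h1 : θ ^ (n * q) ≤ Real.exp (-(r * (n - 1))) * Real.exp (-(μ * q)) := by
    have h2 : θ ≤ Real.exp (-r) := by
      rw [← Real.log_le_iff_le_exp hθ]; linarith
    refine (pow_le_pow_left₀ hθ.le h2 _).trans ?_
    rw [← Real.exp_nat_mul, ← Real.exp_add, Real.exp_le_exp]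
    push_cast
    have h3 : 0 ≤ r * ((n - 1) * ((q : ℝ) - 1)) := by
      have : 0 ≤ (q : ℝ) - 1 := by linarith
      positivity
    have h4 : μ * q ≤ r * q := by gcongr
    nlinarith
  have h5 : C₀ * K ≤ Real.exp (r * (n - 1)) := by
    have h6 : C₀ * K ≤ r * (n - 1) := by
      rw [← div_le_iff₀' hr]; linarith
    linarith [Real.add_one_le_exp (r * ((n : ℝ) - 1))]
  have h7 : C * Real.exp (-(r * (n - 1))) ≤ 1 / K := by
    rw [Real.exp_neg, ← div_eq_mul_inv, div_le_div_iff₀ (Real.exp_pos _) hK0, one_mul]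
    exact (mul_le_mul_of_nonneg_right hCC hK0.le).trans h5
  calc C * θ ^ (n * q) ≤ C * (Real.exp (-(r * (n - 1))) * Real.exp (-(μ * q))) := by gcongr
    _ = (C * Real.exp (-(r * (n - 1)))) * Real.exp (-(μ * q)) := by ring
    _ ≤ 1 / K * Real.exp (-(μ * q)) := by gcongr
    _ = _ := by ring

/-- Decay like `1 / |p|` is exponential decay in `logWeight p` with rate `log 2 / 2`, which limits
`μ`. The large factor `m` pays for the constants. -/
theorem div_abs_le_exp_div {C C₀ K μ : ℝ} {m : ℕ} {p : ℤ} (hC : 0 < C) (hCC : C ≤ C₀)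
    (hK : 1 ≤ K) (hμ : μ ≤ Real.log 2 / 2) (hm : 2 * C₀ * K ≤ m) (hp : p ≠ 0) :
    C / |((m * p : ℤ) : ℝ)| ≤ Real.exp (-(μ * logWeight p)) / K := by
  have hK0 : 0 < K := by linarith
  have hp1 : (1 : ℝ) ≤ |(p : ℝ)| := by exact_mod_cast Int.one_le_abs hp
  have hC₀ : 0 < C₀ := hC.trans_le hCC
  have hm0 : (0 : ℝ) < m := lt_of_lt_of_le (by positivity) hm
  have h1 : (2 * |(p : ℝ)|)⁻¹ ≤ Real.exp (-(μ * logWeight p)) := by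
    have h2 : Real.exp (-(Real.log 2 / 2 * logWeight p)) ≤ Real.exp (-(μ * logWeight p)) := by
      rw [Real.exp_le_exp, neg_le_neg_iff]
      exact mul_le_mul_of_nonneg_right hμ (logWeight_nonneg p)
    refine le_trans ?_ h2
    rw [Real.exp_neg, ← one_add_abs_eq_exp]
    exact inv_anti₀ (by positivity) (by linarith)
  push_cast
  rw [abs_mul, Nat.abs_cast]
  refine le_trans ?_ (div_le_div_of_nonneg_right h1 hK0.le)
  rw [inv_eq_one_div, div_div, div_le_div_iff₀ (by positivity) (by positivity)]
  have h3 : 2 * C * K ≤ m := le_trans (by gcongr) hm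
  nlinarith

/-- The power of `g` with a given exponent, in terms of the powers of `g` or `g⁻¹`. -/
theorem pow_zpow_eq_expSign {G : Type*} [Group G] (g : G) (n : ℕ) (p : ℤ) :
    (g ^ n) ^ p = (g ^ (expSign p : ℤ)) ^ (n * p.natAbs) := by
  rw [← zpow_natCast, ← zpow_mul, ← zpow_natCast, ← zpow_mul]
  congr 1
  unfold expSign
  split_ifs with h
  · push_cast
    rw [abs_of_pos h, one_mul]
  · push_cast
    rw [abs_of_nonpos (not_lt.1 h)]
    ring

-- The order of choices matters. The vectors, functionals, `b`, `c`, `η` and `μ` depend only on the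
-- given maps and their attracting and repelling data; `κ` is the accuracy that
-- `exists_isWordApprox` demands for them; `N` is chosen last, so that all powers of all generators
-- attain this accuracy.
set_option maxHeartbeats 1000000 in
theorem exists_goodRep (hd : 2 ≤ d) (hkl : 2 ≤ k + l)
    {T : Fin k → PGLR d} {S : Fin l → PGLR d}
    {a : Fin k → ℤˣ → Proj d} {H : Fin k → ℤˣ → Submodule ℝ (Fin d → ℝ)}
    {s : Fin l → Proj d} {K : Fin l → Submodule ℝ (Fin d → ℝ)}
    (hT : ∀ (i : Fin k) (ε : ℤˣ), IsProximalWith (T i ^ (ε : ℤ)) (a i ε) (H i ε))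
    (hS : ∀ j : Fin l, IsUnipotentWith (S j) (s j) (K j))
    {T' : Fin k → PGLR d} {S' : Fin l → PGLR d}
    {A B : Fin k → ℤˣ → Set (Proj d)} {C D : Fin l → ℤˣ → Set (Proj d)}
    (hpp : WeakPingPong T' S' a H s K A B C D) :
    ∃ (v : Fin k ⊕ Fin l → ℤˣ → Euc d) (φ : Fin k ⊕ Fin l → ℤˣ → Euc d →L[ℝ] ℝ)
      (v₀ : Euc d) (φ₀ : Euc d →L[ℝ] ℝ) (b c μ η : ℝ) (N : ℕ),
      (∀ j, (s j).submodule = ℝ ∙ WithLp.ofLp (v (Sum.inr j) 1)) ∧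
      ∀ (n : Fin k → ℕ) (m : Fin l → ℕ), (∀ i, N ≤ n i) → (∀ j, N ≤ m j) →
        GoodRep (genRep (powerGens T S n m)) v φ v₀ φ₀ b c μ η := by
  have : NeZero d := ⟨by omega⟩
  obtain ⟨t1, t2, t3, t4⟩ := hpp.notMem_projSet
  choose vT φT CT θ hvT hφT haT hHT hCT hθ0 hθ1 hTa using fun i ε => (hT i ε).exists_approx
  choose vS φS CS t hvS hφS hsS hKS hS0 hCS hSa using fun j => (hS j).exists_approx hd
  obtain ⟨v, hv⟩ : ∃ v : Fin k ⊕ Fin l → ℤˣ → Euc d, v = Sum.elim vT (fun j _ => vS j) := ⟨_, rfl⟩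
  obtain ⟨φ, hφ⟩ : ∃ φ : Fin k ⊕ Fin l → ℤˣ → Euc d →L[ℝ] ℝ, φ = Sum.elim φT (fun j _ => φS j) :=
    ⟨_, rfl⟩
  have hvl : ∀ i ε, v (Sum.inl i) ε = vT i ε := fun i ε => by rw [hv]; rfl
  have hvr : ∀ j ε, v (Sum.inr j) ε = vS j := fun j ε => by rw [hv]; rfl
  have hφl : ∀ i ε, φ (Sum.inl i) ε = φT i ε := fun i ε => by rw [hφ]; rfl
  have hφr : ∀ j ε, φ (Sum.inr j) ε = φS j := fun j ε => by rw [hφ]; rfl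
  clear hv hφ
  have hsame : ∀ i ε, φ (Sum.inl i) ε (v (Sum.inl i) ε) ≠ 0 := by
    intro i ε
    rw [hvl, hφl]
    refine apply_ne_zero_of_notMem (haT i ε) (hHT i ε) (t1 i ε i ε fun h => ?_)
    exact units_ne_neg_self ε (Prod.ext_iff.1 h).2
  have hdiff : ∀ i ε i' ε', i ≠ i' → φ i ε (v i' ε') ≠ 0 := by
    rintro (i | j) ε (i' | j') ε' hne
    · rw [hvl, hφl]
      refine apply_ne_zero_of_notMem (haT _ _) (hHT _ _) (t1 i ε i' ε' fun h => hne ?_)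
      exact congrArg Sum.inl (Prod.ext_iff.1 h).1
    · rw [hvr, hφl]
      exact apply_ne_zero_of_notMem (hsS _) (hHT _ _) (t3 _ _ _)
    · rw [hvl, hφr]
      exact apply_ne_zero_of_notMem (haT _ _) (hKS _) (t2 _ _ _)
    · rw [hvr, hφr]
      exact apply_ne_zero_of_notMem (hsS _) (hKS _) (t4 _ _ fun h => hne (by rw [h]))
  have hne : Nonempty (Fin k ⊕ Fin l) := by
    rw [← Fintype.card_pos_iff, Fintype.card_sum, Fintype.card_fin, Fintype.card_fin]; omega
  obtain ⟨v₀, φ₀, b, c, hb, hc, hc1, g1, g2, g3, g4, g5, g6, g7, g8⟩ := exists_generic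
    (fun x : (Fin k ⊕ Fin l) × ℤˣ => v x.1 x.2) (fun x => φ x.1 x.2)
    (by rintro ⟨i | j, ε⟩; exacts [by simpa only [hvl] using hvT i ε, by simpa only [hvr] using hvS j])
    (by rintro ⟨i | j, ε⟩; exacts [by simpa only [hφl] using hφT i ε, by simpa only [hφr] using hφS j])
  have hdata : TransverseData d v φ b c := ⟨hb, hc, fun i ε => g1 (i, ε), fun i ε => g2 (i, ε),
    fun i ε i' ε' h => g8 (i, ε) (i', ε') (hdiff i ε i' ε' h)⟩
  obtain ⟨η, hη0, hη1, hη2, hη3⟩ : ∃ η : ℝ, 0 < η ∧ η ≤ 1 ∧ 2 * b * η ≤ c ∧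
      32 * b ^ 2 * η ≤ c ^ 2 := by
    refine ⟨min 1 (min (c / (2 * b)) (c ^ 2 / (32 * b ^ 2))), by positivity, min_le_left _ _, ?_, ?_⟩
    · rw [← le_div_iff₀' (by positivity)]
      exact (min_le_right _ _).trans (min_le_left _ _)
    · rw [← le_div_iff₀' (by positivity)]
      exact (min_le_right _ _).trans (min_le_right _ _)
  obtain ⟨r, hr, -, hrθ⟩ := exists_pos_forall_le (fun x : Fin k × ℤˣ => -Real.log (θ x.1 x.2))
    fun x => neg_pos.2 (Real.log_neg (hθ0 _ _) (hθ1 _ _))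
  obtain ⟨C₁, hC₁, hCT'⟩ := exists_forall_le fun x : Fin k × ℤˣ => CT x.1 x.2
  obtain ⟨C₂, hC₂, hCS'⟩ := exists_forall_le CS
  obtain ⟨μ, hμ0, hμr, hμ2⟩ : ∃ μ : ℝ, 0 < μ ∧ μ ≤ r ∧ μ ≤ Real.log 2 / 2 :=
    ⟨min r (Real.log 2 / 2), lt_min hr (by have := Real.log_pos one_lt_two; positivity),
      min_le_left _ _, min_le_right _ _⟩
  obtain ⟨κ₀, hκ₀, hword⟩ := exists_isWordApprox hdata (isWeight_wt k l) hμ0.le hη0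
  obtain ⟨κ, hκ1, hκ2⟩ : ∃ κ : ℝ, 1 ≤ κ ∧ κ₀ ≤ κ := ⟨max 1 κ₀, le_max_left _ _, le_max_right _ _⟩
  obtain ⟨N, hN⟩ := exists_nat_ge (C₁ * κ / r + 1 + 2 * C₂ * κ)
  have hN1 : C₁ * κ / r + 1 ≤ N := by
    have : 0 ≤ 2 * C₂ * κ := by positivity
    linarith
  have hN2 : 2 * C₂ * κ ≤ N := by
    have : 0 ≤ C₁ * κ / r := by positivity
    linarith
  have hN0 : 1 ≤ N := by
    have h1 : 0 ≤ C₁ * κ / r := by positivity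
    have h2 : (1 : ℝ) ≤ N := by linarith
    exact_mod_cast h2
  refine ⟨v, φ, v₀, φ₀, b, c, μ, η, N, fun j => by rw [hvr]; exact hsS j, fun n m hn hm => ?_⟩
  have happrox : IsApprox (genRep (powerGens T S n m)) v φ (wt k l) μ κ := by
    rintro (i | j) p hp
    · obtain ⟨A, hA, hAe⟩ := hTa i (expSign p) (n i * p.natAbs)
        (Nat.one_le_iff_ne_zero.2 (mul_ne_zero (by have := hn i; omega) (Int.natAbs_ne_zero.2 hp)))
      refine ⟨A, ?_, ?_⟩
      · rw [genRep_syl]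
        change IsLift A ((T i ^ n i) ^ p)
        rw [pow_zpow_eq_expSign]
        exact hA
      · rw [hφl, hvl]
        refine hAe.trans ?_
        have h1 := mul_pow_le_exp_div (hCT i (expSign p)) (hCT' (i, expSign p)) (hθ0 i (expSign p))
          hr (hrθ (i, expSign p)) hκ1 hμr (hN1.trans (by exact_mod_cast hn i))
          (Nat.one_le_iff_ne_zero.2 (Int.natAbs_ne_zero.2 hp))
        rwa [Nat.cast_natAbs, Int.cast_abs] at h1
    · obtain ⟨⟨A, hA, hAe⟩, -, -⟩ := hSa j (m j * p)
        (mul_ne_zero (by have := hm j; omega) hp)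
      refine ⟨A, ?_, ?_⟩
      · rw [genRep_syl]
        change IsLift A ((S j ^ m j) ^ p)
        rw [← zpow_natCast, ← zpow_mul]
        exact hA
      · rw [hφr, hvr]
        exact hAe.trans (div_abs_le_exp_div (hCS j) (hCS' j) hκ1 hμ2
          (hN2.trans (by exact_mod_cast hm j)) hp)
  refine
    { two_le_d := hd
      two_le := hkl
      data := hdata
      μ_pos := hμ0
      η_pos := hη0
      c_le := hc1
      η_le := hη1
      η_le' := hη2
      η_lt := hη3
      norm_v₀ := g3
      norm_φ₀ := g4
      generic_v₀ := fun i ε => g5 (i, ε)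
      generic_φ₀ := fun i ε => g6 (i, ε)
      generic := g7
      same_sign := fun i ε => g8 (Sum.inl i, ε) (Sum.inl i, ε) (hsame i ε)
      cusp_v := fun j ε => by rw [hvr, hvr]
      cusp_φ := fun j ε => by rw [hφr, hφr]
      cusp_zero := fun j => by rw [hvr, hφr]; exact hS0 j
      cusp_fix := fun j p => ?_
      approx := fun i p hp => ?_
      word := hword κ hκ2 _ happrox
      cond := ?_ }
  · rw [hvr, hφr, genRep_syl]
    by_cases hp : p = 0
    · exact ⟨1, by rw [hp, zpow_zero]; exact isLift_one, rfl, fun _ => rfl⟩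
    · obtain ⟨-, -, A, hA, h1, h2⟩ := hSa j (m j * p) (mul_ne_zero (by have := hm j; omega) hp)
      refine ⟨A, ?_, h1, h2⟩
      change IsLift A ((S j ^ m j) ^ p)
      rw [← zpow_natCast, ← zpow_mul]
      exact hA
  · obtain ⟨A, hA, hAe⟩ := happrox i p hp
    refine ⟨A, hA, hAe.trans ?_⟩
    exact div_le_div_of_nonneg_left (Real.exp_pos _).le one_pos hκ1
  -- These growth constants may depend on the exponents `n` and `m`, which are fixed here.
  · choose E hE using fun i => exists_svRatio_zpow_le (T i ^ n i)
    obtain ⟨E₁, hE₁, hE'⟩ := exists_forall_le E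
    obtain ⟨E₂, hE₂, hE''⟩ := exists_forall_le fun j =>
      CS j * (m j : ℝ) ^ t j + t j * (Real.log 2 / 2)
    refine ⟨E₁ + E₂, by linarith, ?_⟩
    rintro (i | j) p hp
    · rw [genRep_syl]
      refine (hE i p hp).trans (Real.exp_le_exp.2 ?_)
      change E i * |(p : ℝ)| ≤ (E₁ + E₂) * |(p : ℝ)|
      have := hE' i
      exact mul_le_mul_of_nonneg_right (by linarith) (abs_nonneg _)
    · obtain ⟨-, h1, -⟩ := hSa j (m j * p) (mul_ne_zero (by have := hm j; omega) hp)
      rw [genRep_syl]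
      change svRatio 1 d ((S j ^ m j) ^ p) ≤ Real.exp ((E₁ + E₂) * logWeight p)
      rw [← zpow_natCast, ← zpow_mul]
      refine h1.trans ?_
      push_cast
      rw [abs_mul, Nat.abs_cast, mul_pow, ← mul_assoc]
      refine (mul_abs_pow_le_exp_logWeight (by have := hCS j; positivity) (t j) hp).trans
        (Real.exp_le_exp.2 (mul_le_mul_of_nonneg_right ?_ (logWeight_nonneg p)))
      have := hE'' j
      linarith

end PingPong

/-! ### Groups with a faithful representation of a free product -/

section FreeGens

variable {ι G : Type*} [Group G]

theorem range_genRep [DecidableEq ι] (g : ι → G) : (genRep g).range = Subgroup.closure (Set.range g) := by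
  apply le_antisymm
  · rintro _ ⟨x, rfl⟩
    induction x using syl_induction with
    | one => rw [map_one]; exact one_mem _
    | mul i p x _ _ ih =>
      rw [map_mul, genRep_syl]
      exact mul_mem (zpow_mem (Subgroup.subset_closure (Set.mem_range_self i)) p) ih
  · rw [Subgroup.closure_le]
    rintro _ ⟨i, rfl⟩
    exact ⟨syl i 1, by rw [genRep_syl, zpow_one]⟩

/-- The map from the free group to the free product of infinite cyclic groups has `genRep
FreeGroup.of` as a left inverse. -/
theorem injective_freeGroup_lift {g : ι → G} (hg : Function.Injective (genRep g)) :
    Function.Injective (FreeGroup.lift g) := by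
  have h1 : FreeGroup.lift g = (genRep g).comp (FreeGroup.lift fun i => syl i 1) := by
    ext i; simp [genRep_syl]
  have h2 : ((genRep FreeGroup.of).comp (FreeGroup.lift fun i : ι => syl i 1)) =
      MonoidHom.id (FreeGroup ι) := by
    ext i; simp [genRep_syl]
  rw [h1, MonoidHom.coe_comp]
  refine hg.comp (Function.LeftInverse.injective (g := genRep FreeGroup.of) fun x => ?_)
  exact DFunLike.congr_fun h2 x

/-- The free product, when represented faithfully. -/
def genEquiv [DecidableEq ι] {g : ι → G} (hg : Function.Injective (genRep g)) :
    Subgroup.closure (Set.range g) ≃* CyclicProd ι :=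
  (MulEquiv.subgroupCongr (range_genRep g).symm).trans (MonoidHom.ofInjective hg).symm

theorem genRep_genEquiv [DecidableEq ι] {g : ι → G} (hg : Function.Injective (genRep g))
    (x : Subgroup.closure (Set.range g)) : genRep g (genEquiv hg x) = x :=
  congrArg Subtype.val ((MonoidHom.ofInjective hg).apply_symm_apply _)

theorem not_isOfFinOrder_of_injective {g : ι → G} (hg : Function.Injective (genRep g))
    (x : Subgroup.closure (Set.range g)) (hx : x ≠ 1) : ¬ IsOfFinOrder x := by
  intro hfin
  have hinj := injective_freeGroup_lift hg
  obtain ⟨y, hy⟩ : (x : G) ∈ (FreeGroup.lift g).range := by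
    rw [FreeGroup.range_lift_eq_closure]; exact x.2
  have h1 : IsOfFinOrder (FreeGroup.lift g y) := by
    rw [hy]; exact (Subgroup.subtype _).isOfFinOrder hfin
  have h2 : IsOfFinOrder y := (hinj.isOfFinOrder_iff).1 h1
  rw [isOfFinOrder_iff_eq_one] at h2
  rw [h2, map_one] at hy
  exact hx (Subtype.ext hy.symm)

end FreeGens

/-! ### Peripheral subgroups are proper and infinite -/

section StdPeripheral

variable {Γ : Type*} [Group Γ] {k l : ℕ} {e : Γ ≃* CyclicProd (Fin k ⊕ Fin l)}
  {P : Fin l → Subgroup Γ}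

theorem syl_injective (i : Fin k ⊕ Fin l) :
    Function.Injective (syl i : ℤ → CyclicProd (Fin k ⊕ Fin l)) := by
  intro p q h
  have h1 : syl i (p - q) = 1 := by rw [sub_eq_add_neg, syl_add, syl_neg, h, mul_inv_cancel]
  by_contra hne
  have h2 := letters_syl (i := i) (sub_ne_zero.2 hne)
  rw [h1, letters_one] at h2
  simp at h2

theorem IsStdPeripheral.ne_top (hP : IsStdPeripheral e P) (hkl : 2 ≤ k + l) (j : Fin l) :
    P j ≠ ⊤ := by
  intro htop
  have hcard : 1 < Fintype.card (Fin k ⊕ Fin l) := by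
    rw [Fintype.card_sum, Fintype.card_fin, Fintype.card_fin]; omega
  have := Fintype.one_lt_card_iff_nontrivial.1 hcard
  obtain ⟨i, hi⟩ := exists_ne (Sum.inr j : Fin k ⊕ Fin l)
  obtain ⟨q, hq⟩ := (hP j (e.symm (syl i 1))).1 (by rw [htop]; trivial)
  rw [e.apply_symm_apply] at hq
  have h1 := letters_syl (i := i) one_ne_zero
  rw [hq] at h1
  by_cases hq0 : q = 0
  · rw [hq0, syl_zero, letters_one] at h1
    simp at h1
  · rw [letters_syl hq0] at h1
    simp only [List.cons.injEq, Prod.mk.injEq] at h1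
    exact hi h1.1.1.symm

theorem IsStdPeripheral.infinite (hP : IsStdPeripheral e P) (j : Fin l) : Infinite (P j) := by
  refine Infinite.of_injective (fun q : ℤ => (⟨e.symm (syl (Sum.inr j) q), (hP j _).2
    ⟨q, e.apply_symm_apply _⟩⟩ : P j)) fun p q h => ?_
  exact syl_injective _ (e.symm.injective (congrArg Subtype.val h))

end StdPeripheral

/-! ### Fixed points in projective space -/

theorem IsLift.smul_eq_iff {d : ℕ} {A : Euc d →L[ℝ] Euc d} {g : PGLR d} (hA : IsLift A g)
    {x : Proj d} {v : Euc d} (hv : v ≠ 0) (hx : x.submodule = ℝ ∙ WithLp.ofLp v) :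
    g • x = x ↔ ∃ c : ℝ, A v = c • v := by
  obtain ⟨M, rfl, rfl⟩ := hA
  have hv' : WithLp.ofLp v ≠ 0 := fun h => hv ((WithLp.ofLp_eq_zero 2).1 h)
  have e : x = Projectivization.mk ℝ (WithLp.ofLp v) hv' := by
    apply Projectivization.submodule_injective
    rw [hx, Projectivization.submodule_mk]
  rw [e, Projectivization.PGL.mk_smul_mk, Projectivization.mk_eq_mk_iff']
  refine exists_congr fun c => ?_
  have h1 : WithLp.ofLp (matCLM M v) = M • WithLp.ofLp v := rfl
  rw [← h1, ← WithLp.ofLp_smul, (WithLp.ofLp_injective 2).eq_iff, eq_comm]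

/-! ### Stabilisers of the cusp points and relative domination -/

section Conclusion

variable {d k l : ℕ} {T : Fin k → PGLR d} {S : Fin l → PGLR d} {n : Fin k → ℕ} {m : Fin l → ℕ}
  {v : Fin k ⊕ Fin l → ℤˣ → Euc d} {φ : Fin k ⊕ Fin l → ℤˣ → Euc d →L[ℝ] ℝ}
  {v₀ : Euc d} {φ₀ : Euc d →L[ℝ] ℝ} {B c μ η : ℝ}

theorem isStdPeripheral_cuspGroup (hg : Function.Injective (genRep (powerGens T S n m))) :
    IsStdPeripheral (Γ := powerGroup T S n m) (genEquiv hg) (cuspGroup T S n m) := by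
  intro j x
  unfold cuspGroup
  rw [Subgroup.mem_subgroupOf, Subgroup.mem_zpowers_iff]
  refine exists_congr fun q => ?_
  have h1 : (S j ^ m j) ^ q = genRep (powerGens T S n m) (syl (Sum.inr j) q) :=
    (genRep_syl _ _ _).symm
  have h2 := genRep_genEquiv hg x
  rw [h1]
  constructor
  · intro h
    exact hg (h2.trans h.symm)
  · intro h
    rw [← h]
    exact h2

/-- An element that fixes the line of a cusp keeps it inside the fixed hyperplane of the same cusp,
because the line lies there; only cusp powers do this. -/
theorem GoodRep.smul_eq_iff (h : GoodRep (genRep (powerGens T S n m)) v φ v₀ φ₀ B c μ η)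
    {j : Fin l} {x : Proj d} (hx : x.submodule = ℝ ∙ WithLp.ofLp (v (Sum.inr j) 1))
    {g : PGLR d} (hg : g ∈ powerGroup T S n m) :
    g • x = x ↔ g ∈ Subgroup.zpowers (S j ^ m j) := by
  unfold powerGroup at hg
  rw [← range_genRep] at hg
  obtain ⟨y, rfl⟩ := hg
  rw [Subgroup.mem_zpowers_iff]
  constructor
  · obtain ⟨A, -, hA, -⟩ := exists_isLift (genRep (powerGens T S n m) y)
    rw [hA.smul_eq_iff (h.v_ne_zero _ _) hx]
    rintro ⟨t, ht⟩
    obtain ⟨-, p, rfl⟩ := h.eq_syl_of_apply_eq_zero (j := j) (j' := j) hA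
      (by rw [ht, map_smul, h.cusp_zero, smul_zero])
    exact ⟨p, (genRep_syl _ _ _).symm⟩
  · rintro ⟨p, hp⟩
    obtain ⟨A, hA, h1, -⟩ := h.cusp_fix j p
    have e : genRep (powerGens T S n m) (syl (Sum.inr j) p) = genRep (powerGens T S n m) y := by
      rw [← hp]; exact genRep_syl _ _ _
    rw [e] at hA
    exact (hA.smul_eq_iff (h.v_ne_zero _ _) hx).2 ⟨1, by rw [h1, one_smul]⟩

theorem GoodRep.isP1DominatedRel (h : GoodRep (genRep (powerGens T S n m)) v φ v₀ φ₀ B c μ η) :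
    IsP1DominatedRel (cuspGroup T S n m) (powerGroup T S n m).subtype := by
  have hg := h.injective
  have hP := isStdPeripheral_cuspGroup hg
  have hr : ∀ x, (powerGroup T S n m).subtype x =
      genRep (powerGens T S n m) (genEquiv hg x) := fun x => (genRep_genEquiv hg x).symm
  exact ⟨Group.closure_finite_fg _, not_isOfFinOrder_of_injective hg,
    fun j => ⟨hP.ne_top h.two_le j, hP.infinite j⟩, isRelHyperbolic_of_std hP,
    fun G hG => ⟨dMinus_of_goodRep h hr hP hG, dPlus_of_goodRep h hr hP hG⟩,
    _, _, uniqueLimits_of_goodRep h hr hP, distinctLimits_of_goodRep h hr hP,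
    fun G hG => uniformTransversality_of_goodRep h hr hP hG⟩

end Conclusion

end RelDom

end

theorem mainTheorem7 {d k l : ℕ} (hd : 2 ≤ d) (hkl : 2 ≤ k + l)
    (T : Fin k → RelDom.PGLR d) (S : Fin l → RelDom.PGLR d)
    (a : Fin k → ℤˣ → RelDom.Proj d) (H : Fin k → ℤˣ → Submodule ℝ (Fin d → ℝ))
    (s : Fin l → RelDom.Proj d) (K : Fin l → Submodule ℝ (Fin d → ℝ))
    (hT : ∀ (i : Fin k) (ε : ℤˣ), RelDom.IsProximalWith (T i ^ (ε : ℤ)) (a i ε) (H i ε))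
    (hS : ∀ j : Fin l, RelDom.IsUnipotentWith (S j) (s j) (K j))
    (hpp : ∃ (p : Fin k → ℕ) (q : Fin l → ℕ), (∀ i, 0 < p i) ∧ (∀ j, 0 < q j) ∧
      ∃ (A B : Fin k → ℤˣ → Set (RelDom.Proj d)) (C D : Fin l → ℤˣ → Set (RelDom.Proj d)),
        RelDom.WeakPingPong (fun i => T i ^ p i) (fun j => S j ^ q j) a H s K A B C D) :
    ∃ N : ℕ, ∀ (n : Fin k → ℕ) (m : Fin l → ℕ), (∀ i, N ≤ n i) → (∀ j, N ≤ m j) →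
      Function.Injective (FreeGroup.lift (RelDom.powerGens T S n m)) ∧
      (∀ j, ∀ g ∈ RelDom.powerGroup T S n m,
        g • s j = s j ↔ g ∈ Subgroup.zpowers (S j ^ m j)) ∧
      RelDom.IsP1DominatedRel (RelDom.cuspGroup T S n m)
        (RelDom.powerGroup T S n m).subtype := by
  obtain ⟨p, q, -, -, A, B, C, D, hpp⟩ := hpp
  obtain ⟨v, φ, v₀, φ₀, b, c, μ, η, N, hs, h⟩ := RelDom.exists_goodRep hd hkl hT hS hpp
  refine ⟨N, fun n m hn hm => ?_⟩
  have hg := h n m hn hm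
  exact ⟨RelDom.injective_freeGroup_lift hg.injective, fun j g hmem => hg.smul_eq_iff (hs j) hmem,
    hg.isP1DominatedRel⟩
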